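/- Let $k$ be an algebraically closed field, $V$ a finite dimensional $k$-vector space, $R\subset V\otimes V$ a subspace, and let $A=TV/(R)$ be a Koszul Artin–Schelter regular algebra of global dimension $d$. (Koszul: the trivial module $k$ has a linear free resolution $\cdots\to A(-2)^{(I_2)}\to A(-1)^{(I_1)}\to A\to k\to 0$. Artin–Schelter regular of dimension $d$: $A$ has global dimension $d$, $\operatorname{Ext}^i_A(k,A)=0$ for $i\ne d$, and $\operatorname{Ext}^d_A(k,A)\cong k(l)$ for some $l\in\mathbb Z$.) Put $R_0=k$, $R_1=V$ and $R_a=\bigcap_{i+j+2=a}V^{\otimes i}\otimes R\otimes V^{\otimes j}$ for $a\ge 2$. *Universal coactions.* $\operatorname{\underline{end}}(A)$ denotes the universal algebra $E$ with an algebra morphism $\delta:A\to E\otimes A$ such that $\delta(A_n)\subset E\otimes A_n$ for all $n$: for every algebra $B$ and algebra morphism $f:A\to B\otimes A$ with $f(A_n)\subset B\otimes A_n$ there is a unique algebra morphism $g:E\to B$ with $(g\otimes 1)\delta=f$. It is a bialgebra, in the way that makes $A$ a left comodule through $\delta$. $\operatorname{\underline{aut}}(A)$ denotes its Hopf envelope: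 a Hopf algebra $H$ with a bialgebra morphism $\operatorname{\underline{end}}(A)\to H$ through which every bialgebra morphism from $\operatorname{\underline{end}}(A)$ to a Hopf algebra factors uniquely. *Categories.* Let $\Lambda^+=\langle r_1,\dots,r_d\rangle$ be the free monoid, let $\Lambda=\langle r_1,\dots,r_{d-1},r_d^{\pm1}\rangle$ be obtained from it by adjoining an inverse of $r_d$, and put $r_0=1$. Let $\mathcal U_\uparrow^+$ be the strict monoidal category with monoid of objects $\Lambda^+$, generated by morphisms $\phi_{a,b}:r_{a+b}\to r_ar_b$ ($a,b\ge0$, $a+b\le d$), subject to $\phi_{a,0}=\phi_{0,a}=\mathrm{id}_{r_a}$ and $$(\phi_{a,b}r_c)\,\phi_{a+b,c}=(r_a\phi_{b,c})\,\phi_{a,b+c}.\qquad(1)$$ Let $\mathcal U$ be the strict monoidal category with monoid of objects $\Lambda$, generated by morphisms $\phi_{a,b}$ as above and $\theta_{a,b}:r_ar_d^{-1}r_b\to r_{a+b-d}$ ($0\le a,b\le d$, $a+b\ge d$), subject to $\phi_{a,0}=\phi_{0,a}=\mathrm{id}_{r_a}$, $\theta_{a,d}=\theta_{d,a}=\mathrm{id}_{r_a}$,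 to (1), and to $$\theta_{a+b-d,c}\,(\theta_{a,b}r_d^{-1}r_c)=\theta_{a,b+c-d}\,(r_ar_d^{-1}\theta_{b,c}),$$ $$(r_a\theta_{b,c})(\phi_{a,b}r_d^{-1}r_c)=\phi_{a,b+c-d}\,\theta_{a+b,c},$$ $$(\theta_{a,b}r_c)(r_ar_d^{-1}\phi_{b,c})=\phi_{a+b-d,c}\,\theta_{a,b+c},$$ whenever all the morphisms in the relation are defined. There is an evident monoidal functor $\mathcal U_\uparrow^+\to\mathcal U$. *Fiber functors.* Let $M^+$ be the monoidal functor from $\mathcal U_\uparrow^+$ to finite dimensional vector spaces with $r_a\mapsto R_a$ and $\phi_{a,b}\mapsto(R_{a+b}\hookrightarrow R_a\otimes R_b)$. For a monoidal functor $F$ from a monoidal category $\mathcal C$ to finite dimensional vector spaces let $\operatorname{coend}_{\mathcal C}(F)$ be the continuous dual of $\operatorname{End}(F)$, that is, the space spanned by the coefficients $c_{\xi,v}:\eta\mapsto\xi(\eta_Xv)$ ($X\in\mathcal C$, $\xi\in(FX)^*$, $v\in FX$); it is a bialgebra with product $c_{\xi,v}c_{\zeta,w}=c_{\xi\otimes\zeta,v\otimes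 w}$ and with the coproduct $\Delta c_{\xi,v}=\sum_i c_{e^i,v}\otimes c_{\xi,e_i}$ (with $e_i$, $e^i$ dual bases of $FX$) for which $FX$ is a left comodule. **Theorem.** $\operatorname{\underline{end}}(A)$ and $\operatorname{\underline{aut}}(A)$ exist, and $M^+$ extends (up to monoidal isomorphism) to a monoidal functor $M$ from $\mathcal U$ to finite dimensional vector spaces. For $\operatorname{\underline{end}}(A)$, $\operatorname{\underline{aut}}(A)$ and for every such extension $M$, there are isomorphisms of bialgebras $$\operatorname{\underline{end}}(A)\cong\operatorname{coend}_{\mathcal U_\uparrow^+}(M^+),\qquad \operatorname{\underline{aut}}(A)\cong\operatorname{coend}_{\mathcal U}(M).$$ Moreover $\operatorname{coend}_{\mathcal U}(M)$ is a Hopf algebra, and the second isomorphism is one of Hopf algebras. -/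

import Mathlib

open CategoryTheory MonoidalCategory

universe w v u

/-! ## Strict monoidal categories given by generators and relations -/

namespace StrictPres

/-- Formal morphisms built from the generators `G` by identities, composition (in diagrammatic
order: `comp f g` is first `f`, then `g`) and tensor product. The objects are the elements of a
monoid, and the tensor product of objects is the multiplication of that monoid. -/
inductive PreHom {S : Type} [Monoid S] (G : S → S → Type) : S → S → Type
  | gen {x y : S} (g : G x y) : PreHom G x y
  | ident (x : S) : PreHom G x x
  | comp {x y z : S} (f : PreHom G x y) (g : PreHom G y z) : PreHom G x z
  | tensor {x y x' y' : S} (f : PreHom G x y) (g : PreHom G x' y') : PreHom G (x * x') (y * y')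

/-- The identity, seen as a morphism between two equal objects. -/
def PreHom.eqTo {S : Type} [Monoid S] (G : S → S → Type) {x y : S} (h : x = y) : PreHom G x y :=
  h ▸ PreHom.ident x

end StrictPres

/-- A presentation of a strict monoidal category with monoid of objects `S`, by generating
morphisms and by relations between parallel formal morphisms. -/
structure StrictPres (S : Type) [Monoid S] where
  gen : S → S → Type
  rel : ∀ {x y : S}, StrictPres.PreHom gen x y → StrictPres.PreHom gen x y → Prop

namespace StrictPres

variable {S : Type} [Monoid S] (P : StrictPres S)

/-- The smallest congruence on formal morphisms that contains the given relations and makes them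
the morphisms of a strict monoidal category. -/
inductive HomRel : ∀ {x y : S}, PreHom P.gen x y → PreHom P.gen x y → Prop
  | rel {x y : S} {f g : PreHom P.gen x y} (h : P.rel f g) : HomRel f g
  | refl {x y : S} (f : PreHom P.gen x y) : HomRel f f
  | symm {x y : S} {f g : PreHom P.gen x y} (h : HomRel f g) : HomRel g f
  | trans {x y : S} {f g h : PreHom P.gen x y} (h₁ : HomRel f g) (h₂ : HomRel g h) : HomRel f h
  | comp_congr {x y z : S} {f f' : PreHom P.gen x y} {g g' : PreHom P.gen y z}
      (h₁ : HomRel f f') (h₂ : HomRel g g') : HomRel (f.comp g) (f'.comp g')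
  | tensor_congr {x y x' y' : S} {f f' : PreHom P.gen x y} {g g' : PreHom P.gen x' y'}
      (h₁ : HomRel f f') (h₂ : HomRel g g') : HomRel (f.tensor g) (f'.tensor g')
  | id_comp {x y : S} (f : PreHom P.gen x y) : HomRel ((PreHom.ident x).comp f) f
  | comp_id {x y : S} (f : PreHom P.gen x y) : HomRel (f.comp (PreHom.ident y)) f
  | assoc {x y z t : S} (f : PreHom P.gen x y) (g : PreHom P.gen y z) (h : PreHom P.gen z t) :
      HomRel ((f.comp g).comp h) (f.comp (g.comp h))
  | tensor_id (x y : S) : HomRel ((PreHom.ident x).tensor (PreHom.ident y)) (PreHom.ident (x * y))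
  | tensor_comp {x y z x' y' z' : S} (f : PreHom P.gen x y) (g : PreHom P.gen y z)
      (f' : PreHom P.gen x' y') (g' : PreHom P.gen y' z') :
      HomRel ((f.comp g).tensor (f'.comp g')) ((f.tensor f').comp (g.tensor g'))
  | one_tensor {x y : S} (f : PreHom P.gen x y) :
      HomRel (((PreHom.ident 1).tensor f).comp (PreHom.eqTo P.gen (one_mul y)))
        ((PreHom.eqTo P.gen (one_mul x)).comp f)
  | tensor_one {x y : S} (f : PreHom P.gen x y) :
      HomRel ((f.tensor (PreHom.ident 1)).comp (PreHom.eqTo P.gen (mul_one y)))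
        ((PreHom.eqTo P.gen (mul_one x)).comp f)
  | tensor_assoc {x y x' y' x'' y'' : S} (f : PreHom P.gen x y) (g : PreHom P.gen x' y')
      (h : PreHom P.gen x'' y'') :
      HomRel (((f.tensor g).tensor h).comp (PreHom.eqTo P.gen (mul_assoc y y' y'')))
        ((PreHom.eqTo P.gen (mul_assoc x x' x'')).comp (f.tensor (g.tensor h)))

/-- The congruence `HomRel` on formal morphisms between two objects, as a setoid. -/
def homSetoid (x y : S) : Setoid (PreHom P.gen x y) where
  r := P.HomRel
  iseqv := ⟨HomRel.refl, HomRel.symm, HomRel.trans⟩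

/-- The strict monoidal category with presentation `P`. -/
structure Cat (P : StrictPres S) : Type where
  of : S

instance : Category P.Cat where
  Hom X Y := Quotient (P.homSetoid X.of Y.of)
  id X := Quotient.mk _ (PreHom.ident X.of)
  comp f g := Quotient.map₂ PreHom.comp (fun _ _ h₁ _ _ h₂ => HomRel.comp_congr h₁ h₂) f g
  id_comp f := by
    induction f using Quotient.ind with | _ f => exact Quotient.sound (HomRel.id_comp f)
  comp_id f := by
    induction f using Quotient.ind with | _ f => exact Quotient.sound (HomRel.comp_id f)
  assoc f g h := by
    induction f using Quotient.ind with | _ f =>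
    induction g using Quotient.ind with | _ g =>
    induction h using Quotient.ind with | _ h => exact Quotient.sound (HomRel.assoc f g h)

/-- The morphism represented by a formal morphism. -/
def homMk {x y : S} (f : PreHom P.gen x y) : (⟨x⟩ : P.Cat) ⟶ ⟨y⟩ :=
  Quotient.mk (P.homSetoid x y) f

/-- The tensor product of morphisms. -/
def tensorHom' {X Y X' Y' : P.Cat} (f : X ⟶ Y) (g : X' ⟶ Y') :
    (⟨X.of * X'.of⟩ : P.Cat) ⟶ ⟨Y.of * Y'.of⟩ :=
  Quotient.map₂ PreHom.tensor (fun _ _ h₁ _ _ h₂ => HomRel.tensor_congr h₁ h₂) f g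

lemma homMk_eqTo {x y : S} (h : x = y) :
    P.homMk (PreHom.eqTo P.gen h) = eqToHom (congrArg Cat.mk h) := by
  subst h; rfl

lemma homMk_surjective {X Y : P.Cat} (f : X ⟶ Y) :
    ∃ f' : PreHom P.gen X.of Y.of, P.homMk f' = f :=
  Quotient.exists_rep f

lemma tensorHom'_eqToHom {x y x' y' : S} (h : x = y) (h' : x' = y') :
    P.tensorHom' (eqToHom (congrArg Cat.mk h)) (eqToHom (congrArg Cat.mk h')) =
      eqToHom (congrArg Cat.mk (by rw [h, h'])) := by
  subst h; subst h'
  exact Quotient.sound (HomRel.tensor_id _ _)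

lemma tensorHom'_id (X Y : P.Cat) : P.tensorHom' (𝟙 X) (𝟙 Y) = 𝟙 _ :=
  Quotient.sound (HomRel.tensor_id _ _)

lemma tensorHom'_comp {X Y Z X' Y' Z' : P.Cat} (f : X ⟶ Y) (g : Y ⟶ Z) (f' : X' ⟶ Y')
    (g' : Y' ⟶ Z') :
    P.tensorHom' (f ≫ g) (f' ≫ g') = P.tensorHom' f f' ≫ P.tensorHom' g g' := by
  induction f using Quotient.ind with | _ f =>
  induction g using Quotient.ind with | _ g =>
  induction f' using Quotient.ind with | _ f' =>
  induction g' using Quotient.ind with | _ g' =>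
  exact Quotient.sound (HomRel.tensor_comp f g f' g')

lemma tensorHom'_assoc {X Y X' Y' X'' Y'' : P.Cat} (f : X ⟶ Y) (g : X' ⟶ Y') (h : X'' ⟶ Y'') :
    P.tensorHom' (P.tensorHom' f g) h ≫ eqToHom (congrArg Cat.mk (mul_assoc Y.of Y'.of Y''.of)) =
      eqToHom (congrArg Cat.mk (mul_assoc X.of X'.of X''.of)) ≫
        P.tensorHom' f (P.tensorHom' g h) := by
  induction f using Quotient.ind with | _ f =>
  induction g using Quotient.ind with | _ g =>
  induction h using Quotient.ind with | _ h =>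
  have h1 := P.homMk_eqTo (mul_assoc Y.of Y'.of Y''.of)
  have h2 := P.homMk_eqTo (mul_assoc X.of X'.of X''.of)
  refine (congrArg (_ ≫ ·) h1.symm).trans (Eq.trans ?_ (congrArg (· ≫ _) h2))
  exact Quotient.sound (s := P.homSetoid _ _) (HomRel.tensor_assoc f g h)

lemma one_tensorHom' {X Y : P.Cat} (f : X ⟶ Y) :
    P.tensorHom' (𝟙 ⟨1⟩) f ≫ eqToHom (congrArg Cat.mk (one_mul Y.of)) =
      eqToHom (congrArg Cat.mk (one_mul X.of)) ≫ f := by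
  induction f using Quotient.ind with | _ f =>
  have h1 := P.homMk_eqTo (one_mul Y.of)
  have h2 := P.homMk_eqTo (one_mul X.of)
  refine (congrArg (_ ≫ ·) h1.symm).trans (Eq.trans ?_ (congrArg (· ≫ _) h2))
  exact Quotient.sound (s := P.homSetoid _ _) (HomRel.one_tensor f)

lemma tensorHom'_one {X Y : P.Cat} (f : X ⟶ Y) :
    P.tensorHom' f (𝟙 ⟨1⟩) ≫ eqToHom (congrArg Cat.mk (mul_one Y.of)) =
      eqToHom (congrArg Cat.mk (mul_one X.of)) ≫ f := by
  induction f using Quotient.ind with | _ f =>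
  have h1 := P.homMk_eqTo (mul_one Y.of)
  have h2 := P.homMk_eqTo (mul_one X.of)
  refine (congrArg (_ ≫ ·) h1.symm).trans (Eq.trans ?_ (congrArg (· ≫ _) h2))
  exact Quotient.sound (s := P.homSetoid _ _) (HomRel.tensor_one f)

instance : MonoidalCategory P.Cat where
  tensorObj X Y := ⟨X.of * Y.of⟩
  whiskerLeft X _ _ f := P.tensorHom' (𝟙 X) f
  whiskerRight f Y := P.tensorHom' f (𝟙 Y)
  tensorHom f g := P.tensorHom' f g
  tensorUnit := ⟨1⟩
  associator X Y Z := eqToIso (congrArg Cat.mk (mul_assoc X.of Y.of Z.of))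
  leftUnitor X := eqToIso (congrArg Cat.mk (one_mul X.of))
  rightUnitor X := eqToIso (congrArg Cat.mk (mul_one X.of))
  tensorHom_def f g := by
    rw [← P.tensorHom'_comp, Category.comp_id, Category.id_comp]
  id_tensorHom_id X Y := P.tensorHom'_id X Y
  tensorHom_comp_tensorHom f g f' g' := (P.tensorHom'_comp f f' g g').symm
  whiskerLeft_id X Y := P.tensorHom'_id X Y
  id_whiskerRight X Y := P.tensorHom'_id X Y
  associator_naturality f g h := P.tensorHom'_assoc f g h
  leftUnitor_naturality f := P.one_tensorHom' f
  rightUnitor_naturality f := P.tensorHom'_one f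
  pentagon W X Y Z := by
    have h1 := P.tensorHom'_eqToHom (mul_assoc W.of X.of Y.of) (rfl : Z.of = Z.of)
    have h2 := P.tensorHom'_eqToHom (rfl : W.of = W.of) (mul_assoc X.of Y.of Z.of)
    simp only [eqToHom_refl] at h1 h2
    simp only [eqToIso.hom]
    erw [h1, h2]
    simp only [eqToHom_trans]
  triangle X Y := by
    have h1 := P.tensorHom'_eqToHom (mul_one X.of) (rfl : Y.of = Y.of)
    have h2 := P.tensorHom'_eqToHom (rfl : X.of = X.of) (one_mul Y.of)
    simp only [eqToHom_refl] at h1 h2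
    simp only [eqToIso.hom]
    erw [h1, h2]
    simp only [eqToHom_trans]


variable {D : Type u} [Category.{v} D] [MonoidalCategory D]

/-- Values of a monoidal functor to `D` on objects and on generating morphisms, together with its
structure isomorphisms `ε`, `μ`. -/
structure LiftData (D : Type u) [Category.{v} D] [MonoidalCategory D] where
  obj : S → D
  ε : 𝟙_ D ≅ obj 1
  μ (x y : S) : obj x ⊗ obj y ≅ obj (x * y)
  assoc (x y z : S) : (μ x y).hom ▷ obj z ≫ (μ (x * y) z).hom ≫
      eqToHom (congrArg obj (mul_assoc x y z)) =
    (α_ (obj x) (obj y) (obj z)).hom ≫ obj x ◁ (μ y z).hom ≫ (μ x (y * z)).hom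
  left_unit (x : S) : ε.hom ▷ obj x ≫ (μ 1 x).hom ≫ eqToHom (congrArg obj (one_mul x)) =
    (λ_ (obj x)).hom
  right_unit (x : S) : obj x ◁ ε.hom ≫ (μ x 1).hom ≫ eqToHom (congrArg obj (mul_one x)) =
    (ρ_ (obj x)).hom
  map {x y : S} (g : P.gen x y) : obj x ⟶ obj y

namespace LiftData

variable {P} (L : P.LiftData D)

/-- The value on a formal morphism. -/
def eval : {x y : S} → PreHom P.gen x y → (L.obj x ⟶ L.obj y)
  | _, _, .gen g => L.map g
  | _, _, .ident x => 𝟙 (L.obj x)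
  | _, _, .comp f g => eval f ≫ eval g
  | _, _, .tensor f g => (L.μ _ _).inv ≫ (eval f ⊗ₘ eval g) ≫ (L.μ _ _).hom

lemma eval_eqTo {x y : S} (h : x = y) :
    L.eval (PreHom.eqTo P.gen h) = eqToHom (congrArg L.obj h) := by
  subst h; rfl

/-- The defining relations hold in `D`. -/
def Respects : Prop :=
  ∀ ⦃x y : S⦄ ⦃f g : PreHom P.gen x y⦄, P.rel f g → L.eval f = L.eval g

lemma eval_homRel (hL : L.Respects)
    {x y : S} {f g : PreHom P.gen x y} (h : P.HomRel f g) : L.eval f = L.eval g := by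
  induction h with
  | rel h => exact hL h
  | refl f => rfl
  | symm _ ih => exact ih.symm
  | trans _ _ ih₁ ih₂ => exact ih₁.trans ih₂
  | comp_congr _ _ ih₁ ih₂ => simp only [eval, ih₁, ih₂]
  | tensor_congr _ _ ih₁ ih₂ => simp only [eval, ih₁, ih₂]
  | id_comp f => simp only [eval, Category.id_comp]
  | comp_id f => simp only [eval, Category.comp_id]
  | assoc f g h => simp only [eval, Category.assoc]
  | tensor_id x y => simp [eval]
  | tensor_comp f g f' g' => simp [eval]
  | @one_tensor x y f =>
      simp only [eval, eval_eqTo]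
      rw [← cancel_epi (L.μ 1 x).hom, ← cancel_epi (L.ε.hom ▷ L.obj x)]
      have e1 := L.left_unit x
      have e2 := L.left_unit y
      simp only [Category.assoc, Iso.hom_inv_id_assoc, id_tensorHom]
      rw [← whisker_exchange_assoc, e2, reassoc_of% e1, leftUnitor_naturality]
  | @tensor_one x y f =>
      simp only [eval, eval_eqTo]
      rw [← cancel_epi (L.μ x 1).hom, ← cancel_epi (L.obj x ◁ L.ε.hom)]
      have e1 := L.right_unit x
      have e2 := L.right_unit y
      simp only [Category.assoc, Iso.hom_inv_id_assoc, tensorHom_id]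
      rw [whisker_exchange_assoc, e2, reassoc_of% e1, rightUnitor_naturality]
  | @tensor_assoc x y x' y' x'' y'' f g h =>
      simp only [eval, eval_eqTo]
      rw [← cancel_epi (L.μ (x * x') x'').hom, ← cancel_epi ((L.μ x x').hom ▷ L.obj x'')]
      have e1 := L.assoc x x' x''
      have e2 := L.assoc y y' y''
      simp only [Category.assoc, Iso.hom_inv_id_assoc]
      rw [reassoc_of% e1]
      simp only [Iso.hom_inv_id_assoc, ← id_tensorHom, ← tensorHom_id]
      simp only [tensorHom_comp_tensorHom_assoc, Category.id_comp,
        Iso.hom_inv_id_assoc]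
      have e3 : ((L.eval f ⊗ₘ L.eval g) ≫ (L.μ y y').hom) ⊗ₘ L.eval h =
          ((L.eval f ⊗ₘ L.eval g) ⊗ₘ L.eval h) ≫ ((L.μ y y').hom ▷ L.obj y'') := by
        rw [← tensorHom_id, tensorHom_comp_tensorHom, Category.comp_id]
      have e4 : L.eval f ⊗ₘ ((L.eval g ⊗ₘ L.eval h) ≫ (L.μ y' y'').hom) =
          (L.eval f ⊗ₘ (L.eval g ⊗ₘ L.eval h)) ≫ (L.obj y ◁ (L.μ y' y'').hom) := by
        rw [← id_tensorHom, tensorHom_comp_tensorHom, Category.comp_id]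
      rw [e3, e4]
      simp only [Category.assoc]
      rw [e2, associator_naturality_assoc]

variable (hL : L.Respects)

/-- The functor determined by its values on generators. -/
def lift : P.Cat ⥤ D where
  obj X := L.obj X.of
  map f := Quotient.lift L.eval (fun _ _ h => L.eval_homRel hL h) f
  map_id _ := rfl
  map_comp f g := by
    induction f using Quotient.ind with | _ f =>
    induction g using Quotient.ind with | _ g => rfl

lemma lift_map_homMk {x y : S} (f : PreHom P.gen x y) :
    (L.lift hL).map (P.homMk f) = L.eval f := rfl

lemma lift_map_eqToHom {x y : S} (h : x = y) :
    (L.lift hL).map (eqToHom (congrArg Cat.mk h)) = eqToHom (congrArg L.obj h) := by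
  subst h; rfl

/-- The monoidal structure on `lift`. -/
def coreMonoidal : (L.lift hL).CoreMonoidal where
  εIso := L.ε
  μIso X Y := L.μ X.of Y.of
  μIso_hom_natural_left {X Y} f Z := by
    induction f using Quotient.ind with | _ f =>
    have h : L.eval f ▷ L.obj Z.of ≫ (L.μ Y.of Z.of).hom = (L.μ X.of Z.of).hom ≫
        L.eval (f.tensor (PreHom.ident Z.of)) := by
      simp only [eval, Iso.hom_inv_id_assoc, tensorHom_id]
    exact h
  μIso_hom_natural_right {X Y} Z f := by
    induction f using Quotient.ind with | _ f =>
    have h : L.obj Z.of ◁ L.eval f ≫ (L.μ Z.of Y.of).hom = (L.μ Z.of X.of).hom ≫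
        L.eval ((PreHom.ident Z.of).tensor f) := by
      simp only [eval, Iso.hom_inv_id_assoc, id_tensorHom]
    exact h
  associativity X Y Z := by
    exact (congrArg (fun t => _ ≫ _ ≫ t) (L.lift_map_eqToHom hL (mul_assoc X.of Y.of Z.of))).trans
      (L.assoc X.of Y.of Z.of)
  left_unitality X := by
    exact ((congrArg (fun t => _ ≫ _ ≫ t) (L.lift_map_eqToHom hL (one_mul X.of))).trans
      (L.left_unit X.of)).symm
  right_unitality X := by
    exact ((congrArg (fun t => _ ≫ _ ≫ t) (L.lift_map_eqToHom hL (mul_one X.of))).trans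
      (L.right_unit X.of)).symm

instance : (L.lift hL).Monoidal := (L.coreMonoidal hL).toMonoidal

end LiftData

end StrictPres

/-! ## The categories `U↑⁺` and `U` -/

/-- The letters `r_1, …, r_d`. -/
abbrev Letter (d : ℕ) : Type := {a : ℕ // 1 ≤ a ∧ a ≤ d}

/-- The free monoid `Λ⁺ = ⟨r_1, …, r_d⟩`. -/
abbrev LambdaPlus (d : ℕ) : Type := FreeMonoid (Letter d)

namespace LambdaPlus

/-- The generator `r_a` for `1 ≤ a ≤ d`, with the convention `r_0 = 1`. (For `a > d` the value is
irrelevant: no such `r_a` is ever used.) -/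
def r (d a : ℕ) : LambdaPlus d :=
  if h : 1 ≤ a ∧ a ≤ d then FreeMonoid.of ⟨a, h⟩ else 1

lemma r_zero (d : ℕ) : r d 0 = 1 := by simp [r]

end LambdaPlus

/-- The relations `r_d r_d⁻¹ = 1 = r_d⁻¹ r_d`, the extra generator being `r_d⁻¹`. -/
inductive LambdaRel (d : ℕ) :
    FreeMonoid (Letter d ⊕ Unit) → FreeMonoid (Letter d ⊕ Unit) → Prop
  | mul_inv : LambdaRel d
      (FreeMonoid.map Sum.inl (LambdaPlus.r d d) * FreeMonoid.of (Sum.inr ())) 1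
  | inv_mul : LambdaRel d
      (FreeMonoid.of (Sum.inr ()) * FreeMonoid.map Sum.inl (LambdaPlus.r d d)) 1

/-- The monoid `Λ = ⟨r_1, …, r_{d-1}, r_d^{±1}⟩`, obtained from `Λ⁺` by adjoining an inverse of
`r_d`. -/
abbrev Lambda (d : ℕ) : Type := PresentedMonoid (LambdaRel d)

namespace Lambda

/-- The canonical map `Λ⁺ → Λ`. -/
def incl (d : ℕ) : LambdaPlus d →* Lambda d :=
  (PresentedMonoid.mk (LambdaRel d)).comp (FreeMonoid.map Sum.inl)

/-- The element `r_a` of `Λ`. -/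
def r (d a : ℕ) : Lambda d := incl d (LambdaPlus.r d a)

/-- The element `r_d⁻¹` of `Λ`. -/
def rInv (d : ℕ) : Lambda d := PresentedMonoid.of (LambdaRel d) (Sum.inr ())

lemma r_zero (d : ℕ) : r d 0 = 1 := by rw [r, LambdaPlus.r_zero, map_one]

lemma r_mul_rInv (d : ℕ) : r d d * rInv d = 1 :=
  (Con.eq _).mpr (ConGen.Rel.of _ _ LambdaRel.mul_inv)

lemma rInv_mul_r (d : ℕ) : rInv d * r d d = 1 :=
  (Con.eq _).mpr (ConGen.Rel.of _ _ LambdaRel.inv_mul)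

end Lambda

namespace UpPlus

/-- The generators `φ_{a,b} : r_{a+b} → r_a r_b`. -/
inductive Gen (d : ℕ) : LambdaPlus d → LambdaPlus d → Type
  | phi (a b c : ℕ) (h : a + b = c) (hc : c ≤ d) :
      Gen d (LambdaPlus.r d c) (LambdaPlus.r d a * LambdaPlus.r d b)

open LambdaPlus StrictPres StrictPres.PreHom

/-- The formal morphism `φ_{a,b}`, with `c = a + b`. -/
abbrev phi {d : ℕ} (a b c : ℕ) (h : a + b = c) (hc : c ≤ d) :
    PreHom (Gen d) (r d c) (r d a * r d b) := gen (Gen.phi a b c h hc)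

/-- The relations of `U↑⁺`: `φ_{0,a}` and `φ_{a,0}` are identities, and
`(φ_{a,b} r_c) φ_{a+b,c} = (r_a φ_{b,c}) φ_{a,b+c}`. -/
inductive Rel (d : ℕ) : ∀ {x y : LambdaPlus d}, PreHom (Gen d) x y → PreHom (Gen d) x y → Prop
  | phi_zero_left (a : ℕ) (ha : a ≤ d) :
      Rel d (phi 0 a a (zero_add a) ha) (eqTo (Gen d) (by rw [r_zero, one_mul]))
  | phi_zero_right (a : ℕ) (ha : a ≤ d) :
      Rel d (phi a 0 a (add_zero a) ha) (eqTo (Gen d) (by rw [r_zero, mul_one]))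
  | phi_phi (a b c ab bc abc : ℕ) (h₁ : a + b = ab) (h₂ : b + c = bc) (h₃ : ab + c = abc)
      (h₄ : a + bc = abc) (hd : abc ≤ d) :
      Rel d
        (((phi ab c abc h₃ hd).comp ((phi a b ab h₁ (by omega)).tensor (ident (r d c)))).comp
          (eqTo (Gen d) (mul_assoc (r d a) (r d b) (r d c))))
        ((phi a bc abc h₄ hd).comp ((ident (r d a)).tensor (phi b c bc h₂ (by omega))))

end UpPlus

/-- The presentation of `U↑⁺`. -/
abbrev UpPlusPres (d : ℕ) : StrictPres (LambdaPlus d) where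
  gen := UpPlus.Gen d
  rel := UpPlus.Rel d

/-- The strict monoidal category `U↑⁺`. -/
abbrev UpPlus (d : ℕ) : Type := (UpPlusPres d).Cat

namespace U

/-- The generators `φ_{a,b} : r_{a+b} → r_a r_b` and `θ_{a,b} : r_a r_d⁻¹ r_b → r_{a+b-d}`. -/
inductive Gen (d : ℕ) : Lambda d → Lambda d → Type
  | phi (a b c : ℕ) (h : a + b = c) (hc : c ≤ d) :
      Gen d (Lambda.r d c) (Lambda.r d a * Lambda.r d b)
  | theta (a b c : ℕ) (h : a + b = c + d) (ha : a ≤ d) (hb : b ≤ d) :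
      Gen d (Lambda.r d a * Lambda.rInv d * Lambda.r d b) (Lambda.r d c)

open Lambda StrictPres StrictPres.PreHom

/-- The formal morphism `φ_{a,b}`, with `c = a + b`. -/
abbrev phi {d : ℕ} (a b c : ℕ) (h : a + b = c) (hc : c ≤ d) :
    PreHom (Gen d) (r d c) (r d a * r d b) := gen (Gen.phi a b c h hc)

/-- The formal morphism `θ_{a,b}`, with `c = a + b - d`. -/
abbrev theta {d : ℕ} (a b c : ℕ) (h : a + b = c + d) (ha : a ≤ d) (hb : b ≤ d) :
    PreHom (Gen d) (r d a * rInv d * r d b) (r d c) := gen (Gen.theta a b c h ha hb)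

/-- The relations of `U`: the morphisms `φ_{0,a}`, `φ_{a,0}`, `θ_{d,a}`, `θ_{a,d}` are identities,
and, suppressing indices, the two ways of composing `φ` with `φ`, `θ` with `θ`, and `φ` with `θ`
(on either side) agree. -/
inductive Rel (d : ℕ) : ∀ {x y : Lambda d}, PreHom (Gen d) x y → PreHom (Gen d) x y → Prop
  | phi_zero_left (a : ℕ) (ha : a ≤ d) :
      Rel d (phi 0 a a (zero_add a) ha) (eqTo (Gen d) (by rw [r_zero, one_mul]))
  | phi_zero_right (a : ℕ) (ha : a ≤ d) :
      Rel d (phi a 0 a (add_zero a) ha) (eqTo (Gen d) (by rw [r_zero, mul_one]))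
  | theta_top_left (a : ℕ) (ha : a ≤ d) :
      Rel d (theta d a a (add_comm d a) le_rfl ha)
        (eqTo (Gen d) (by rw [r_mul_rInv, one_mul]))
  | theta_top_right (a : ℕ) (ha : a ≤ d) :
      Rel d (theta a d a rfl ha le_rfl)
        (eqTo (Gen d) (by rw [mul_assoc, rInv_mul_r, mul_one]))
  | phi_phi (a b c ab bc abc : ℕ) (h₁ : a + b = ab) (h₂ : b + c = bc) (h₃ : ab + c = abc)
      (h₄ : a + bc = abc) (hd : abc ≤ d) :
      Rel d
        (((phi ab c abc h₃ hd).comp ((phi a b ab h₁ (by omega)).tensor (ident (r d c)))).comp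
          (eqTo (Gen d) (mul_assoc (r d a) (r d b) (r d c))))
        ((phi a bc abc h₄ hd).comp ((ident (r d a)).tensor (phi b c bc h₂ (by omega))))
  | theta_theta (a b c ab bc abc : ℕ) (h₁ : a + b = ab + d) (h₂ : b + c = bc + d)
      (h₃ : ab + c = abc + d) (h₄ : a + bc = abc + d) (ha : a ≤ d) (hb : b ≤ d) (hc : c ≤ d) :
      Rel d
        ((((theta a b ab h₁ ha hb).tensor (ident (rInv d * r d c))).comp
          (eqTo (Gen d) (mul_assoc (r d ab) (rInv d) (r d c)).symm)).comp
            (theta ab c abc h₃ (by omega) hc))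
        (((eqTo (Gen d) (y := r d a * rInv d * (r d b * rInv d * r d c))
            (by simp only [mul_assoc])).comp ((ident (r d a * rInv d)).tensor (theta b c bc h₂ hb hc))).comp
            (theta a bc abc h₄ ha (by omega)))
  | phi_theta (a b c ab bc abc : ℕ) (h₁ : a + b = ab) (h₂ : b + c = bc + d)
      (h₃ : ab + c = abc + d) (h₄ : a + bc = abc) (hab : ab ≤ d) (hc : c ≤ d) :
      Rel d
        ((((eqTo (Gen d) (mul_assoc (r d ab) (rInv d) (r d c))).comp
          ((phi a b ab h₁ hab).tensor (ident (rInv d * r d c)))).comp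
            (eqTo (Gen d) (y := r d a * (r d b * rInv d * r d c)) (by simp only [mul_assoc]))).comp
              ((ident (r d a)).tensor (theta b c bc h₂ (by omega) hc)))
        ((theta ab c abc h₃ hab hc).comp (phi a bc abc h₄ (by omega)))
  | theta_phi (a b c ab bc abc : ℕ) (h₁ : a + b = ab + d) (h₂ : b + c = bc)
      (h₃ : ab + c = abc) (h₄ : a + bc = abc + d) (ha : a ≤ d) (hbc : bc ≤ d) :
      Rel d
        ((((ident (r d a * rInv d)).tensor (phi b c bc h₂ hbc)).comp
          (eqTo (Gen d) (mul_assoc (r d a * rInv d) (r d b) (r d c)).symm)).comp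
            ((theta a b ab h₁ ha (by omega)).tensor (ident (r d c))))
        ((theta a bc abc h₄ ha hbc).comp (phi ab c abc h₃ (by omega)))

end U

/-- The presentation of `U`. -/
abbrev UPres (d : ℕ) : StrictPres (Lambda d) where
  gen := U.Gen d
  rel := U.Rel d

/-- The strict monoidal category `U`. -/
abbrev U (d : ℕ) : Type := (UPres d).Cat

namespace UpPlus

open StrictPres

lemma tensor_eqToHom {S : Type} [Monoid S] (P : StrictPres S) {X Y X' Y' : P.Cat}
    (h : X = Y) (h' : X' = Y') :
    (eqToHom h ⊗ₘ eqToHom h') = eqToHom (by rw [h, h']) := by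
  subst h; subst h'; simp

lemma associator_hom_eq {S : Type} [Monoid S] (P : StrictPres S) (X Y Z : P.Cat) :
    (α_ X Y Z).hom = eqToHom (congrArg Cat.mk (mul_assoc X.of Y.of Z.of)) := rfl

lemma leftUnitor_hom_eq {S : Type} [Monoid S] (P : StrictPres S) (X : P.Cat) :
    (λ_ X).hom = eqToHom (congrArg Cat.mk (one_mul X.of)) := rfl

lemma rightUnitor_hom_eq {S : Type} [Monoid S] (P : StrictPres S) (X : P.Cat) :
    (ρ_ X).hom = eqToHom (congrArg Cat.mk (mul_one X.of)) := rfl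

/-- The values of the canonical functor `U↑⁺ → U` on generators. -/
def toULift (d : ℕ) : (UpPlusPres d).LiftData (U d) where
  obj x := ⟨Lambda.incl d x⟩
  ε := eqToIso (congrArg Cat.mk (map_one (Lambda.incl d)).symm)
  μ x y := eqToIso (congrArg Cat.mk (map_mul (Lambda.incl d) x y).symm)
  assoc x y z := by
    simp only [eqToIso.hom, ← tensorHom_id, ← id_tensorHom, ← eqToHom_refl _ rfl, tensor_eqToHom,
      associator_hom_eq]
    simp only [eqToHom_trans]
  left_unit x := by
    simp only [eqToIso.hom, ← tensorHom_id, ← eqToHom_refl _ rfl, tensor_eqToHom,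
      leftUnitor_hom_eq]
    simp only [eqToHom_trans]
  right_unit x := by
    simp only [eqToIso.hom, ← id_tensorHom, ← eqToHom_refl _ rfl, tensor_eqToHom,
      rightUnitor_hom_eq]
    simp only [eqToHom_trans]
  map := fun
    | .phi a b c h hc => (UPres d).homMk (U.phi a b c h hc) ≫
        eqToHom (congrArg Cat.mk (map_mul (Lambda.incl d) _ _).symm)

lemma homMk_eq_of_rel {S : Type} [Monoid S] (P : StrictPres S) {x y : S}
    {f g : PreHom P.gen x y} (h : P.rel f g) : P.homMk f = P.homMk g :=
  Quotient.sound (s := P.homSetoid x y) (HomRel.rel h)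

lemma homMk_comp {S : Type} [Monoid S] (P : StrictPres S) {x y z : S}
    (f : PreHom P.gen x y) (g : PreHom P.gen y z) :
    P.homMk (f.comp g) = P.homMk f ≫ P.homMk g := rfl

lemma homMk_tensor {S : Type} [Monoid S] (P : StrictPres S) {x y x' y' : S}
    (f : PreHom P.gen x y) (g : PreHom P.gen x' y') :
    P.homMk (f.tensor g) = P.homMk f ⊗ₘ P.homMk g := rfl

lemma homMk_ident {S : Type} [Monoid S] (P : StrictPres S) (x : S) :
    P.homMk (PreHom.ident x) = 𝟙 (⟨x⟩ : P.Cat) := rfl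

lemma strict_aux {T : Type} [Monoid T] (Q : StrictPres T) {A B C AB BC ABC Y₁ Y₂ Y₃ Y₄ Z : Q.Cat}
    (f : ABC ⟶ AB ⊗ C) (g : AB ⟶ A ⊗ B) (f' : ABC ⟶ A ⊗ BC) (g' : BC ⟶ B ⊗ C)
    (h₁ : AB ⊗ C = Y₁) (h₂ : A ⊗ B = Y₂) (h₃ : A ⊗ BC = Y₃) (h₄ : B ⊗ C = Y₄)
    (p : (A ⊗ B) ⊗ C = A ⊗ (B ⊗ C))
    (h : (f ≫ (g ⊗ₘ 𝟙 C)) ≫ eqToHom p = f' ≫ (𝟙 A ⊗ₘ g'))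
    {Y₅ : Q.Cat} (q₁ : Y₂ ⊗ C = Y₅) (q₂ : Y₅ = Z) (q₃ : A ⊗ Y₄ = Z) (k₁ : Y₁ = AB ⊗ C)
    (k₃ : Y₃ = A ⊗ BC) :
    ((f ≫ eqToHom h₁) ≫ eqToHom k₁ ≫ ((g ≫ eqToHom h₂) ⊗ₘ 𝟙 C) ≫ eqToHom q₁) ≫ eqToHom q₂ =
      (f' ≫ eqToHom h₃) ≫ eqToHom k₃ ≫ (𝟙 A ⊗ₘ (g' ≫ eqToHom h₄)) ≫ eqToHom q₃ := by
  subst h₁ h₂ h₃ h₄ q₁ q₃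
  simp only [eqToHom_refl, Category.comp_id, Category.id_comp]
  exact h

lemma toULift_respects (d : ℕ) : (toULift d).Respects := by
  intro x y f g h
  cases h with
  | phi_zero_left a ha =>
    have h1 := homMk_eq_of_rel (UPres d) (U.Rel.phi_zero_left a ha)
    refine Eq.trans (congrArg (· ≫ _) (h1.trans (homMk_eqTo (UPres d) _))) ?_
    exact (eqToHom_trans _ _).trans ((toULift d).eval_eqTo _).symm
  | phi_zero_right a ha =>
    have h1 := homMk_eq_of_rel (UPres d) (U.Rel.phi_zero_right a ha)
    refine Eq.trans (congrArg (· ≫ _) (h1.trans (homMk_eqTo (UPres d) _))) ?_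
    exact (eqToHom_trans _ _).trans ((toULift d).eval_eqTo _).symm
  | phi_phi a b c ab bc abc h₁ h₂ h₃ h₄ hd =>
    have h1 := homMk_eq_of_rel (UPres d) (U.Rel.phi_phi a b c ab bc abc h₁ h₂ h₃ h₄ hd)
    have h2 := (congrArg (fun t => (UPres d).homMk ((U.phi ab c abc h₃ hd).comp
      ((U.phi a b ab h₁ (by omega)).tensor (PreHom.ident (Lambda.r d c)))) ≫ t)
      (homMk_eqTo (UPres d)
        (mul_assoc (Lambda.r d a) (Lambda.r d b) (Lambda.r d c)))).symm.trans h1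
    refine Eq.trans (congrArg (fun t => (toULift d).eval ((phi ab c abc h₃ hd).comp
      ((phi a b ab h₁ (by omega)).tensor (PreHom.ident (LambdaPlus.r d c)))) ≫ t)
      ((toULift d).eval_eqTo (mul_assoc _ _ _))) ?_
    exact strict_aux (UPres d) _ _ _ _ _ _ _ _ _ h2
      (congrArg Cat.mk (map_mul (Lambda.incl d) _ _).symm) _
      (congrArg Cat.mk (map_mul (Lambda.incl d) _ _).symm)
      (congrArg Cat.mk (map_mul (Lambda.incl d) _ _))
      (congrArg Cat.mk (map_mul (Lambda.incl d) _ _))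

end UpPlus

/-- The canonical monoidal functor `U↑⁺ → U`, which sends `r_a` to `r_a` and `φ_{a,b}` to
`φ_{a,b}`. -/
def UpPlus.toU (d : ℕ) : UpPlus d ⥤ U d := (UpPlus.toULift d).lift (UpPlus.toULift_respects d)

instance (d : ℕ) : (UpPlus.toU d).Monoidal :=
  inferInstanceAs ((UpPlus.toULift d).lift (UpPlus.toULift_respects d)).Monoidal

/-! ## The coend of a fiber functor -/

namespace FiberFunctor

open TensorProduct

variable {k : Type u} [Field k] {C : Type w} [Category.{v} C]

section Coend

variable (F : C ⥤ FGModuleCat.{u} k)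

/-- The linear map `F(f)`. -/
abbrev mapL {X Y : C} (f : X ⟶ Y) : F.obj X →ₗ[k] F.obj Y := (F.map f).hom.hom

/-- Symbols for the generators `c_{ξ,v}` of the coend. -/
abbrev Symbol : Type (max u w) := Σ X : C, Module.Dual k (F.obj X) × F.obj X

/-- The symbol `c_{ξ,v}`, for `ξ ∈ (FX)^*` and `v ∈ FX`. -/
noncomputable def symb (X : C) (ξ : Module.Dual k (F.obj X)) (v : F.obj X) : Symbol F →₀ k :=
  Finsupp.single ⟨X, ξ, v⟩ 1

/-- The relations of the coend: bilinearity and `c_{ξ ∘ F(f), v} = c_{ξ, F(f) v}`. -/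
inductive IsRelator : (Symbol F →₀ k) → Prop
  | add_left (X : C) (ξ ξ' : Module.Dual k (F.obj X)) (v : F.obj X) :
      IsRelator (symb F X (ξ + ξ') v - (symb F X ξ v + symb F X ξ' v))
  | add_right (X : C) (ξ : Module.Dual k (F.obj X)) (v v' : F.obj X) :
      IsRelator (symb F X ξ (v + v') - (symb F X ξ v + symb F X ξ v'))
  | smul_left (X : C) (c : k) (ξ : Module.Dual k (F.obj X)) (v : F.obj X) :
      IsRelator (symb F X (c • ξ) v - c • symb F X ξ v)
  | smul_right (X : C) (c : k) (ξ : Module.Dual k (F.obj X)) (v : F.obj X) :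
      IsRelator (symb F X ξ (c • v) - c • symb F X ξ v)
  | naturality (X Y : C) (f : X ⟶ Y) (ξ : Module.Dual k (F.obj Y)) (v : F.obj X) :
      IsRelator (symb F X (ξ ∘ₗ mapL F f) v - symb F Y ξ (mapL F f v))

/-- The subspace spanned by the relations. -/
noncomputable def coendRel : Submodule k (Symbol F →₀ k) := Submodule.span k {t | IsRelator F t}

/-- The coend `∫^X (FX)^* ⊗ FX` of `F`. It is identified below, by `pairing_injective` and
`mem_range_pairing_iff`, with the continuous dual of the algebra of natural endomorphisms of
`F`. -/
def Coend : Type (max u w) := (Symbol F →₀ k) ⧸ coendRel F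

variable {F} in
lemma mapL_id (X : C) : mapL F (𝟙 X) = LinearMap.id := by simp [mapL]

namespace Coend

noncomputable instance : AddCommGroup (Coend F) :=
  inferInstanceAs (AddCommGroup ((Symbol F →₀ k) ⧸ coendRel F))

noncomputable instance : Module k (Coend F) :=
  inferInstanceAs (Module k ((Symbol F →₀ k) ⧸ coendRel F))

/-- The quotient map onto the coend. -/
noncomputable def proj : (Symbol F →₀ k) →ₗ[k] Coend F := (coendRel F).mkQ

/-- The class `c_{ξ,v}` of `ξ ⊗ v` in the coend. -/
noncomputable def coef (X : C) (ξ : Module.Dual k (F.obj X)) (v : F.obj X) : Coend F :=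
  proj F (symb F X ξ v)

variable {F}

lemma proj_eq_of_isRelator {s t : Symbol F →₀ k} (h : IsRelator F (s - t)) :
    proj F s = proj F t :=
  (Submodule.Quotient.eq (coendRel F)).mpr (Submodule.subset_span h)

lemma coef_add_left {X : C} (ξ ξ' : Module.Dual k (F.obj X)) (v : F.obj X) :
    coef F X (ξ + ξ') v = coef F X ξ v + coef F X ξ' v :=
  (proj_eq_of_isRelator (.add_left X ξ ξ' v)).trans (map_add _ _ _)

lemma coef_add_right {X : C} (ξ : Module.Dual k (F.obj X)) (v v' : F.obj X) :
    coef F X ξ (v + v') = coef F X ξ v + coef F X ξ v' :=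
  (proj_eq_of_isRelator (.add_right X ξ v v')).trans (map_add _ _ _)

lemma coef_smul_left {X : C} (c : k) (ξ : Module.Dual k (F.obj X)) (v : F.obj X) :
    coef F X (c • ξ) v = c • coef F X ξ v :=
  (proj_eq_of_isRelator (.smul_left X c ξ v)).trans (map_smul _ _ _)

lemma coef_smul_right {X : C} (c : k) (ξ : Module.Dual k (F.obj X)) (v : F.obj X) :
    coef F X ξ (c • v) = c • coef F X ξ v :=
  (proj_eq_of_isRelator (.smul_right X c ξ v)).trans (map_smul _ _ _)

lemma coef_comp {X Y : C} (f : X ⟶ Y) (ξ : Module.Dual k (F.obj Y)) (v : F.obj X) :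
    coef F X (ξ ∘ₗ mapL F f) v = coef F Y ξ (mapL F f v) :=
  proj_eq_of_isRelator (.naturality X Y f ξ v)

variable (F) in
/-- The class `c_{ξ,v}` as a bilinear function of `ξ` and `v`. -/
noncomputable def coefL (X : C) : Module.Dual k (F.obj X) →ₗ[k] F.obj X →ₗ[k] Coend F :=
  LinearMap.mk₂ k (coef F X) coef_add_left coef_smul_left coef_add_right coef_smul_right

lemma coef_sum_left {X : C} {ι : Type*} (s : Finset ι) (ξ : ι → Module.Dual k (F.obj X))
    (v : F.obj X) : coef F X (∑ i ∈ s, ξ i) v = ∑ i ∈ s, coef F X (ξ i) v :=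
  map_sum ((coefL F X).flip v) ξ s

lemma coef_sum_right {X : C} {ι : Type*} (s : Finset ι) (ξ : Module.Dual k (F.obj X))
    (v : ι → F.obj X) : coef F X ξ (∑ i ∈ s, v i) = ∑ i ∈ s, coef F X ξ (v i) :=
  map_sum (coefL F X ξ) v s

lemma induction_on {p : Coend F → Prop} (t : Coend F) (zero : p 0)
    (coef : ∀ (X : C) (ξ : Module.Dual k (F.obj X)) (v : F.obj X), p (coef F X ξ v))
    (add : ∀ a b, p a → p b → p (a + b)) : p t := by
  obtain ⟨t, rfl⟩ : ∃ s, proj F s = t := Submodule.mkQ_surjective (coendRel F) t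
  induction t using Finsupp.induction_linear with
  | zero => rw [map_zero]; exact zero
  | add a b ha hb => rw [map_add]; exact add _ _ ha hb
  | single s c =>
    obtain ⟨X, ξ, v⟩ := s
    have h : proj F (Finsupp.single ⟨X, ξ, v⟩ c) = Coend.coef F X (c • ξ) v := by
      rw [coef_smul_left, Coend.coef, ← map_smul, symb, Finsupp.smul_single, smul_eq_mul, mul_one]
    rw [h]
    exact coef X _ v

variable {W : Type*} [AddCommGroup W] [Module k W]

lemma hom_ext {g h : Coend F →ₗ[k] W}
    (H : ∀ (X : C) (ξ : Module.Dual k (F.obj X)) (v : F.obj X),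
      g (coef F X ξ v) = h (coef F X ξ v)) : g = h := by
  ext t
  induction t using induction_on with
  | zero => simp
  | coef X ξ v => exact H X ξ v
  | add a b ha hb => rw [map_add, map_add, ha, hb]

/-- Compatibility of a family of bilinear maps with the relations of the coend. -/
def IsNatural (g : ∀ X : C, Module.Dual k (F.obj X) →ₗ[k] F.obj X →ₗ[k] W) : Prop :=
  ∀ ⦃X Y : C⦄ (f : X ⟶ Y) (ξ : Module.Dual k (F.obj Y)) (v : F.obj X),
    g X (ξ ∘ₗ mapL F f) v = g Y ξ (mapL F f v)

/-- The universal property of the coend. -/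
noncomputable def desc (g : ∀ X : C, Module.Dual k (F.obj X) →ₗ[k] F.obj X →ₗ[k] W)
    (hg : IsNatural g) : Coend F →ₗ[k] W :=
  (coendRel F).liftQ (Finsupp.linearCombination k fun s : Symbol F => g s.1 s.2.1 s.2.2) (by
    rw [coendRel, Submodule.span_le]
    intro t ht
    simp only [SetLike.mem_coe, LinearMap.mem_ker]
    cases ht with
    | naturality X Y f ξ v =>
      simp only [symb, map_sub, Finsupp.linearCombination_single, one_smul]
      rw [hg f ξ v, sub_self]
    | _ => simp [symb])

@[simp]
lemma desc_coef (g : ∀ X : C, Module.Dual k (F.obj X) →ₗ[k] F.obj X →ₗ[k] W)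
    (hg : IsNatural g) (X : C) (ξ : Module.Dual k (F.obj X))
    (v : F.obj X) : desc g hg (coef F X ξ v) = g X ξ v := by
  have : desc g hg (coef F X ξ v) = Finsupp.linearCombination k
    (fun s : Symbol F => g s.1 s.2.1 s.2.2) (symb F X ξ v) := rfl
  rw [this, symb, Finsupp.linearCombination_single, one_smul]

/-- A basis of `FX`. -/
noncomputable abbrev bas (X : C) : Module.Basis (Fin (Module.finrank k (F.obj X))) k (F.obj X) :=
  Module.finBasis k (F.obj X)

/-- The comultiplication on coefficients. -/
noncomputable def comulAux (X : C) :
    Module.Dual k (F.obj X) →ₗ[k] F.obj X →ₗ[k] Coend F ⊗[k] Coend F :=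
  LinearMap.mk₂ k
    (fun ξ v => ∑ i, coef F X ((bas X).coord i) v ⊗ₜ[k] coef F X ξ (bas X i))
    (fun ξ ξ' v => by simp only [coef_add_left, tmul_add, Finset.sum_add_distrib])
    (fun c ξ v => by simp only [coef_smul_left, tmul_smul, Finset.smul_sum])
    (fun ξ v v' => by simp only [coef_add_right, add_tmul, Finset.sum_add_distrib])
    (fun c ξ v => by simp only [coef_smul_right, smul_tmul', Finset.smul_sum])

lemma sum_coord_tmul {X Y : C} {ι κ : Type*} [Fintype ι] [Fintype κ]
    (b : Module.Basis ι k (F.obj X)) (b' : Module.Basis κ k (F.obj Y)) (f : X ⟶ Y)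
    (ξ : Module.Dual k (F.obj Y)) (v : F.obj X) :
    ∑ i, coef F X (b.coord i) v ⊗ₜ[k] coef F X (ξ ∘ₗ mapL F f) (b i) =
      ∑ j, coef F Y (b'.coord j) (mapL F f v) ⊗ₜ[k] coef F Y ξ (b' j) := by
  have h1 : ∀ i, coef F X (ξ ∘ₗ mapL F f) (b i) =
      ∑ j, b'.coord j (mapL F f (b i)) • coef F Y ξ (b' j) := by
    intro i
    rw [coef_comp]
    conv_lhs => rw [← b'.sum_repr (mapL F f (b i))]
    simp only [coef_sum_right, coef_smul_right, Module.Basis.coord_apply]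
  have h2 : ∀ j, coef F Y (b'.coord j) (mapL F f v) =
      ∑ i, b'.coord j (mapL F f (b i)) • coef F X (b.coord i) v := by
    intro j
    have : b'.coord j ∘ₗ mapL F f = ∑ i, b'.coord j (mapL F f (b i)) • b.coord i := by
      classical
      refine b.ext fun i => ?_
      simp [LinearMap.sum_apply, Finsupp.single_apply]
    rw [← coef_comp, this, coef_sum_left]
    simp only [coef_smul_left]
  simp only [h1, h2, tmul_sum, sum_tmul, tmul_smul, smul_tmul']
  exact Finset.sum_comm

lemma isNatural_comulAux : IsNatural (comulAux (F := F)) :=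
  fun X Y f ξ v => sum_coord_tmul (bas X) (bas Y) f ξ v

lemma isNatural_id : IsNatural (F := F) (fun _ => LinearMap.id) := fun _ _ _ _ _ => rfl

/-- The comultiplication `Δ c_{ξ,v} = ∑ i, c_{e^i,v} ⊗ c_{ξ,e_i}`, for dual bases `e_i`, `e^i`
of `FX`. With this convention `FX` is a left comodule, through `v ↦ ∑ i, c_{e^i,v} ⊗ e_i`. -/
noncomputable def comulL : Coend F →ₗ[k] Coend F ⊗[k] Coend F :=
  desc comulAux isNatural_comulAux

/-- The counit `c_{ξ,v} ↦ ξ(v)`. -/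
noncomputable def counitL : Coend F →ₗ[k] k :=
  desc (fun _ => LinearMap.id) isNatural_id

@[simp] lemma counitL_coef (X : C) (ξ : Module.Dual k (F.obj X)) (v : F.obj X) :
    counitL (coef F X ξ v) = ξ v := by simp [counitL]

lemma comulL_coef {X : C} {ι : Type*} [Fintype ι] (b : Module.Basis ι k (F.obj X))
    (ξ : Module.Dual k (F.obj X)) (v : F.obj X) :
    comulL (coef F X ξ v) = ∑ i, coef F X (b.coord i) v ⊗ₜ[k] coef F X ξ (b i) := by
  rw [comulL, desc_coef]
  have := sum_coord_tmul (bas X) b (𝟙 X) ξ v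
  simp only [mapL_id, LinearMap.comp_id, LinearMap.id_apply] at this
  exact this

noncomputable instance : Coalgebra k (Coend F) where
  comul := comulL
  counit := counitL
  coassoc := by
    refine hom_ext fun X ξ v => ?_
    simp only [LinearMap.comp_apply, comulL_coef (bas X), map_sum, LinearMap.rTensor_tmul,
      LinearMap.lTensor_tmul, LinearEquiv.coe_coe, sum_tmul, tmul_sum, TensorProduct.assoc_tmul]
    exact Finset.sum_comm
  rTensor_counit_comp_comul := by
    refine hom_ext fun X ξ v => ?_
    simp only [LinearMap.comp_apply, comulL_coef (bas X), map_sum, LinearMap.rTensor_tmul,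
      counitL_coef, TensorProduct.mk_apply]
    conv_rhs => rw [← (bas X).sum_repr v]
    simp only [coef_sum_right, coef_smul_right, tmul_sum, Module.Basis.coord_apply]
    refine Finset.sum_congr rfl fun i _ => ?_
    rw [← smul_tmul, smul_eq_mul, mul_one]
  lTensor_counit_comp_comul := by
    refine hom_ext fun X ξ v => ?_
    simp only [LinearMap.comp_apply, comulL_coef (bas X), map_sum, LinearMap.lTensor_tmul,
      counitL_coef, TensorProduct.mk_apply, LinearMap.flip_apply]
    have : ξ = ∑ i, ξ (bas X i) • (bas X).coord i := by
      refine (bas X).ext fun i => ?_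
      simp
    conv_rhs => rw [this]
    simp only [coef_sum_left, coef_smul_left, sum_tmul]
    refine Finset.sum_congr rfl fun i _ => ?_
    rw [smul_tmul, smul_eq_mul, mul_one]

end Coend

end Coend

section Monoidal

variable [MonoidalCategory C] (F : C ⥤ FGModuleCat.{u} k) [F.Monoidal]

/-- The structure isomorphism `FX ⊗ FY ≅ F(X ⊗ Y)`. -/
noncomputable def muL (X Y : C) : (F.obj X ⊗[k] F.obj Y) ≃ₗ[k] F.obj (X ⊗ Y) :=
  FGModuleCat.isoToLinearEquiv (Functor.Monoidal.μIso F X Y)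

/-- The structure isomorphism `k ≅ F(1)`. -/
noncomputable def epsL : k ≃ₗ[k] F.obj (𝟙_ C) :=
  FGModuleCat.isoToLinearEquiv (Functor.Monoidal.εIso F)

lemma mapL_muL {X Y X' Y' : C} (f : X ⟶ Y) (g : X' ⟶ Y') (v : F.obj X) (w : F.obj X') :
    mapL F (f ⊗ₘ g) (muL F X X' (v ⊗ₜ w)) = muL F Y Y' (mapL F f v ⊗ₜ mapL F g w) := by
  have h := Functor.LaxMonoidal.μ_natural F f g
  have := congrArg (fun t => t.hom.hom (v ⊗ₜ[k] w)) h
  exact this.symm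

lemma mapL_associator {X Y Z : C} (x : F.obj X) (y : F.obj Y) (z : F.obj Z) :
    mapL F (α_ X Y Z).hom (muL F (X ⊗ Y) Z (muL F X Y (x ⊗ₜ y) ⊗ₜ z)) =
      muL F X (Y ⊗ Z) (x ⊗ₜ muL F Y Z (y ⊗ₜ z)) := by
  have h := Functor.LaxMonoidal.associativity F X Y Z
  have := congrArg (fun t => t.hom.hom ((x ⊗ₜ[k] y) ⊗ₜ[k] z)) h
  exact this

lemma mapL_leftUnitor {X : C} (x : F.obj X) :
    mapL F (λ_ X).hom (muL F (𝟙_ C) X (epsL F 1 ⊗ₜ x)) = x := by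
  have h := Functor.LaxMonoidal.left_unitality F X
  have := congrArg (fun t => t.hom.hom ((1 : k) ⊗ₜ[k] x)) h
  exact this.symm.trans (one_smul k x)

lemma mapL_rightUnitor {X : C} (x : F.obj X) :
    mapL F (ρ_ X).hom (muL F X (𝟙_ C) (x ⊗ₜ epsL F 1)) = x := by
  have h := Functor.LaxMonoidal.right_unitality F X
  have := congrArg (fun t => t.hom.hom (x ⊗ₜ[k] (1 : k))) h
  exact this.symm.trans (one_smul k x)

/-- The functional `ξ ⊗ ζ` on `F(X ⊗ Y) ≅ FX ⊗ FY`. -/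
noncomputable def tens {X Y : C} (ξ : Module.Dual k (F.obj X)) (ζ : Module.Dual k (F.obj Y)) :
    Module.Dual k (F.obj (X ⊗ Y)) :=
  LinearMap.mul' k k ∘ₗ TensorProduct.map ξ ζ ∘ₗ (muL F X Y).symm.toLinearMap

variable {F}

@[simp]
lemma tens_muL {X Y : C} (ξ : Module.Dual k (F.obj X)) (ζ : Module.Dual k (F.obj Y))
    (v : F.obj X) (w : F.obj Y) : tens F ξ ζ (muL F X Y (v ⊗ₜ w)) = ξ v * ζ w := by
  simp [tens]

lemma dual_ext {X Y : C} {W : Type*} [AddCommGroup W] [Module k W] {ω ω' : F.obj (X ⊗ Y) →ₗ[k] W}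
    (h : ∀ v w, ω (muL F X Y (v ⊗ₜ w)) = ω' (muL F X Y (v ⊗ₜ w))) : ω = ω' := by
  have : ω ∘ₗ (muL F X Y).toLinearMap = ω' ∘ₗ (muL F X Y).toLinearMap :=
    TensorProduct.ext' h
  ext t
  obtain ⟨t, rfl⟩ := (muL F X Y).surjective t
  exact LinearMap.congr_fun this t

lemma tens_comp {X Y X' Y' : C} (f : X ⟶ Y) (g : X' ⟶ Y') (ξ : Module.Dual k (F.obj Y))
    (ζ : Module.Dual k (F.obj Y')) :
    tens F (ξ ∘ₗ mapL F f) (ζ ∘ₗ mapL F g) = tens F ξ ζ ∘ₗ mapL F (f ⊗ₘ g) :=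
  dual_ext fun v w => by
    rw [LinearMap.comp_apply (tens F ξ ζ), mapL_muL, tens_muL, tens_muL, LinearMap.comp_apply,
      LinearMap.comp_apply]

namespace Coend

/-- The product of `c_{ξ,v}` with a coefficient. -/
noncomputable def mulAux (X Y : C) (ξ : Module.Dual k (F.obj X)) (v : F.obj X) :
    Module.Dual k (F.obj Y) →ₗ[k] F.obj Y →ₗ[k] Coend F :=
  LinearMap.mk₂ k (fun ζ w => coef F (X ⊗ Y) (tens F ξ ζ) (muL F X Y (v ⊗ₜ w)))
    (fun ζ ζ' w => by
      rw [← coef_add_left]; congr 1; exact dual_ext fun a b => by simp [mul_add])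
    (fun c ζ w => by
      rw [← coef_smul_left]; congr 1; exact dual_ext fun a b => by simp [mul_left_comm])
    (fun ζ w w' => by rw [tmul_add, map_add, coef_add_right])
    (fun c ζ w => by rw [tmul_smul, map_smul, coef_smul_right])

lemma mulAux_apply (X Y : C) (ξ : Module.Dual k (F.obj X)) (v : F.obj X)
    (ζ : Module.Dual k (F.obj Y)) (w : F.obj Y) :
    mulAux X Y ξ v ζ w = coef F (X ⊗ Y) (tens F ξ ζ) (muL F X Y (v ⊗ₜ w)) := rfl

lemma isNatural_mulAux (X : C) (ξ : Module.Dual k (F.obj X)) (v : F.obj X) :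
    IsNatural (fun Y => mulAux X Y ξ v) := by
  intro Y Y' f ζ w
  have h := tens_comp (F := F) (𝟙 X) f ξ ζ
  rw [mapL_id, LinearMap.comp_id] at h
  rw [mulAux_apply, mulAux_apply, h, coef_comp, mapL_muL, mapL_id, LinearMap.id_apply]

/-- The product of `c_{ξ,v}` with an element of the coend. -/
noncomputable def mulLeft (X : C) :
    Module.Dual k (F.obj X) →ₗ[k] F.obj X →ₗ[k] Coend F →ₗ[k] Coend F :=
  LinearMap.mk₂ k (fun ξ v => desc (fun Y => mulAux X Y ξ v) (isNatural_mulAux X ξ v))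
    (fun ξ ξ' v => hom_ext fun Y ζ w => by
      simp only [LinearMap.add_apply, desc_coef, mulAux_apply]
      rw [← coef_add_left]; congr 1; exact dual_ext fun a b => by simp [add_mul])
    (fun c ξ v => hom_ext fun Y ζ w => by
      simp only [LinearMap.smul_apply, desc_coef, mulAux_apply]
      rw [← coef_smul_left]; congr 1; exact dual_ext fun a b => by simp [mul_assoc])
    (fun ξ v v' => hom_ext fun Y ζ w => by
      simp only [LinearMap.add_apply, desc_coef, mulAux_apply]
      rw [add_tmul, map_add, coef_add_right])
    (fun c ξ v => hom_ext fun Y ζ w => by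
      simp only [LinearMap.smul_apply, desc_coef, mulAux_apply]
      rw [← smul_tmul', map_smul, coef_smul_right])

lemma mulLeft_coef (X Y : C) (ξ : Module.Dual k (F.obj X)) (v : F.obj X)
    (ζ : Module.Dual k (F.obj Y)) (w : F.obj Y) :
    mulLeft X ξ v (coef F Y ζ w) = coef F (X ⊗ Y) (tens F ξ ζ) (muL F X Y (v ⊗ₜ w)) :=
  (desc_coef _ (isNatural_mulAux X ξ v) Y ζ w)

lemma isNatural_mulLeft : IsNatural (F := F) mulLeft := by
  intro X X' f ξ v
  refine hom_ext fun Y ζ w => ?_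
  have h := tens_comp (F := F) f (𝟙 Y) ξ ζ
  rw [mapL_id, LinearMap.comp_id] at h
  rw [mulLeft_coef, mulLeft_coef, h, coef_comp, mapL_muL, mapL_id, LinearMap.id_apply]

/-- The multiplication `c_{ξ,v} c_{ζ,w} = c_{ξ ⊗ ζ, v ⊗ w}` of the coend of a monoidal functor. -/
noncomputable def mulL : Coend F →ₗ[k] Coend F →ₗ[k] Coend F := desc mulLeft isNatural_mulLeft

noncomputable instance : Mul (Coend F) := ⟨fun a b => mulL a b⟩

noncomputable instance : One (Coend F) :=
  ⟨coef F (𝟙_ C) (epsL F).symm.toLinearMap (epsL F 1)⟩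

lemma mul_def (a b : Coend F) : a * b = mulL a b := rfl

lemma one_def : (1 : Coend F) = coef F (𝟙_ C) (epsL F).symm.toLinearMap (epsL F 1) := rfl

lemma coef_mul_coef (X Y : C) (ξ : Module.Dual k (F.obj X)) (v : F.obj X)
    (ζ : Module.Dual k (F.obj Y)) (w : F.obj Y) :
    coef F X ξ v * coef F Y ζ w = coef F (X ⊗ Y) (tens F ξ ζ) (muL F X Y (v ⊗ₜ w)) := by
  rw [mul_def, mulL, desc_coef, mulLeft_coef]

protected lemma add_mul' (a b c : Coend F) : (a + b) * c = a * c + b * c := by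
  simp only [mul_def, map_add, LinearMap.add_apply]

protected lemma mul_add' (a b c : Coend F) : a * (b + c) = a * b + a * c := by
  simp only [mul_def, map_add]

protected lemma zero_mul' (a : Coend F) : 0 * a = 0 := by
  simp only [mul_def, map_zero, LinearMap.zero_apply]

protected lemma mul_zero' (a : Coend F) : a * 0 = 0 := by
  simp only [mul_def, map_zero]

protected lemma mul_assoc' (a b c : Coend F) : a * b * c = a * (b * c) := by
  induction a using induction_on with
  | zero => simp only [Coend.zero_mul']
  | add a a' h h' => simp only [Coend.add_mul', h, h']
  | coef X ξ x =>
  induction b using induction_on with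
  | zero => simp only [Coend.zero_mul', Coend.mul_zero']
  | add b b' h h' => simp only [Coend.add_mul', Coend.mul_add', h, h']
  | coef Y ζ y =>
  induction c using induction_on with
  | zero => simp only [Coend.mul_zero']
  | add c c' h h' => simp only [Coend.mul_add', h, h']
  | coef Z τ z =>
    simp only [coef_mul_coef]
    have h : tens F (tens F ξ ζ) τ = tens F ξ (tens F ζ τ) ∘ₗ mapL F (α_ X Y Z).hom := by
      refine dual_ext fun t c => ?_
      obtain ⟨t, rfl⟩ := (muL F X Y).surjective t
      induction t using TensorProduct.induction_on with
      | zero => simp only [map_zero, zero_tmul]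
      | add t t' h h' => simp only [map_add, add_tmul, h, h']
      | tmul a b =>
        rw [LinearMap.comp_apply, mapL_associator, tens_muL, tens_muL, tens_muL, tens_muL,
          mul_assoc]
    rw [h, coef_comp, mapL_associator]

protected lemma one_mul' (a : Coend F) : 1 * a = a := by
  induction a using induction_on with
  | zero => exact Coend.mul_zero' _
  | add a a' h h' => rw [Coend.mul_add', h, h']
  | coef X ξ x =>
    rw [one_def, coef_mul_coef]
    have h : tens F (epsL F).symm.toLinearMap ξ = ξ ∘ₗ mapL F (λ_ X).hom := by
      refine dual_ext fun t c => ?_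
      obtain ⟨t, rfl⟩ := (epsL F).surjective t
      have e : epsL F t = t • epsL F 1 := by rw [← map_smul, smul_eq_mul, mul_one]
      rw [tens_muL, LinearMap.comp_apply, e, ← smul_tmul', map_smul, map_smul, map_smul, mapL_leftUnitor]
      simp
    rw [h, coef_comp, mapL_leftUnitor]

protected lemma mul_one' (a : Coend F) : a * 1 = a := by
  induction a using induction_on with
  | zero => exact Coend.zero_mul' _
  | add a a' h h' => rw [Coend.add_mul', h, h']
  | coef X ξ x =>
    rw [one_def, coef_mul_coef]
    have h : tens F ξ (epsL F).symm.toLinearMap = ξ ∘ₗ mapL F (ρ_ X).hom := by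
      refine dual_ext fun c t => ?_
      obtain ⟨t, rfl⟩ := (epsL F).surjective t
      have e : epsL F t = t • epsL F 1 := by rw [← map_smul, smul_eq_mul, mul_one]
      rw [tens_muL, LinearMap.comp_apply, e, tmul_smul, map_smul, map_smul, map_smul, mapL_rightUnitor]
      simp [mul_comm]
    rw [h, coef_comp, mapL_rightUnitor]

noncomputable instance : Ring (Coend F) :=
  { (inferInstance : AddCommGroup (Coend F)), (inferInstance : Mul (Coend F)),
    (inferInstance : One (Coend F)) with
    left_distrib := Coend.mul_add'
    right_distrib := Coend.add_mul'
    zero_mul := Coend.zero_mul'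
    mul_zero := Coend.mul_zero'
    mul_assoc := Coend.mul_assoc'
    one_mul := Coend.one_mul'
    mul_one := Coend.mul_one' }

noncomputable instance : Algebra k (Coend F) :=
  Algebra.ofModule (fun c a b => by simp only [mul_def, map_smul, LinearMap.smul_apply])
    (fun c a b => by simp only [mul_def, map_smul])

/-- The bialgebra structure on the coend of a monoidal functor. -/
noncomputable instance instBialgebra : Bialgebra k (Coend F) :=
  Bialgebra.mk' k (Coend F)
    (by
      change counitL (1 : Coend F) = 1
      rw [one_def, counitL_coef]; simp)
    (fun {a b} => by
      change counitL (a * b) = counitL a * counitL b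
      induction a using induction_on with
      | zero => simp
      | add a a' h h' => simp only [add_mul, map_add, h, h']
      | coef X ξ x =>
      induction b using induction_on with
      | zero => simp
      | add b b' h h' => simp only [mul_add, map_add, h, h']
      | coef Y ζ y => rw [coef_mul_coef, counitL_coef, counitL_coef, counitL_coef, tens_muL])
    (by
      change comulL (1 : Coend F) = 1
      rw [one_def, comulL_coef ((Module.Basis.singleton Unit k).map (epsL F)),
        Algebra.TensorProduct.one_def, one_def]
      simp only [Finset.univ_unique, Finset.sum_singleton]
      congr 2
      · ext t
        simp
      · simp)
    (fun {a b} => by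
      change comulL (a * b) = comulL a * comulL b
      induction a using induction_on with
      | zero => simp
      | add a a' h h' => simp only [add_mul, map_add, h, h']
      | coef X ξ x =>
      induction b using induction_on with
      | zero => simp
      | add b b' h h' => simp only [mul_add, map_add, h, h']
      | coef Y ζ y =>
        rw [coef_mul_coef, comulL_coef (bas X), comulL_coef (bas Y),
          comulL_coef (((bas X).tensorProduct (bas Y)).map (muL F X Y)), Finset.sum_mul_sum,
          Fintype.sum_prod_type]
        refine Finset.sum_congr rfl fun i _ => Finset.sum_congr rfl fun j _ => ?_
        rw [Algebra.TensorProduct.tmul_mul_tmul, coef_mul_coef, coef_mul_coef]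
        congr 2
        · exact dual_ext fun v w => by simp [mul_comm]
        · simp)

end Coend

end Monoidal

end FiberFunctor

namespace FiberFunctor

namespace Coend

open TensorProduct

section Pairing

variable {k : Type u} [Field k] {C : Type w} [Category.{v} C] (F : C ⥤ FGModuleCat.{u} k)

/-- The component at `X` of a natural endomorphism of `F`, as a linear map. -/
abbrev appL (X : C) (η : F ⟶ F) : F.obj X →ₗ[k] F.obj X := (η.app X).hom.hom

/-- A coefficient `c_{ξ,v}` as a function `η ↦ ξ(η v)` on natural endomorphisms of `F`. -/
noncomputable def pairing : Coend F →ₗ[k] Module.Dual k (F ⟶ F) :=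
  desc (fun X => LinearMap.mk₂ k
      (fun ξ v =>
        { toFun := fun η => ξ (appL F X η v)
          map_add' := fun η η' => map_add ξ _ _
          map_smul' := fun c η => map_smul ξ c _ })
      (fun ξ ξ' v => rfl) (fun c ξ v => rfl)
      (fun ξ v v' => LinearMap.ext fun η => (congrArg ξ (map_add _ v v')).trans (map_add ξ _ _))
      (fun c ξ v => LinearMap.ext fun η => (congrArg ξ (map_smul _ c v)).trans (map_smul ξ _ _)))
    (fun X Y f ξ v => by
      ext η
      have h := congrArg (fun t => ξ (t.hom.hom v)) (η.naturality f)
      exact h.symm)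

lemma pairing_coef (X : C) (ξ : Module.Dual k (F.obj X)) (v : F.obj X) (η : F ⟶ F) :
    pairing F (coef F X ξ v) η = ξ (appL F X η v) := by
  exact LinearMap.congr_fun (desc_coef _ _ X ξ v) η

/-- A functional on the natural endomorphisms of `F` is continuous if it vanishes on the
endomorphisms with zero components at the objects of some finite set. -/
def IsContinuous (l : Module.Dual k (F ⟶ F)) : Prop :=
  ∃ s : Finset C, ∀ η : F ⟶ F, (∀ X ∈ s, η.app X = 0) → l η = 0

/-- The natural endomorphism of `F` given by a functional on the coend. -/
lemma exists_endo (l : Module.Dual k (Coend F)) : ∃ η : F ⟶ F, ∀ t, pairing F t η = l t := by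
  have h : ∀ X (v : F.obj X), ∃ v' : F.obj X, ∀ ξ : Module.Dual k (F.obj X),
      ξ v' = l (coef F X ξ v) := by
    intro X v
    obtain ⟨v', hv'⟩ := (Module.evalEquiv k (F.obj X)).surjective (l ∘ₗ (coefL F X).flip v)
    exact ⟨v', fun ξ => LinearMap.congr_fun hv' ξ⟩
  choose g hg using h
  have ext' : ∀ X (v v' : F.obj X), (∀ ξ : Module.Dual k (F.obj X), ξ v = ξ v') → v = v' :=
    fun X v v' h => sub_eq_zero.mp ((Module.forall_dual_apply_eq_zero_iff k (v - v')).mp fun ξ => by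
      rw [map_sub, h ξ, sub_self])
  refine ⟨{ app := fun X => FGModuleCat.ofHom
              { toFun := g X
                map_add' := fun v v' => ext' X _ _ fun ξ => by
                  rw [map_add, hg, hg, hg, coef_add_right, map_add]
                map_smul' := fun c v => ext' X _ _ fun ξ => by
                  rw [RingHom.id_apply, map_smul, hg, hg, coef_smul_right, map_smul] }
            naturality := fun X Y f => ?_ }, fun t => ?_⟩
  · refine FGModuleCat.hom_ext (LinearMap.ext fun v => ext' Y _ _ fun ξ => ?_)
    exact (hg Y _ ξ).trans ((congrArg l (coef_comp f ξ v)).symm.trans (hg X v _).symm)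
  · induction t using induction_on with
    | zero => simp
    | coef X ξ v => rw [pairing_coef]; exact hg X v ξ
    | add a b ha hb => rw [map_add, map_add, LinearMap.add_apply, ha, hb]

/-- The coend is a space of functionals on the natural endomorphisms of `F`. -/
theorem pairing_injective : Function.Injective (pairing F) := by
  rw [injective_iff_map_eq_zero]
  intro t ht
  rw [← Module.forall_dual_apply_eq_zero_iff k]
  intro l
  obtain ⟨η, hη⟩ := exists_endo F l
  rw [← hη, ht, LinearMap.zero_apply]

/-- The coend is the continuous dual of the algebra of natural endomorphisms of `F`. -/
theorem mem_range_pairing_iff (l : Module.Dual k (F ⟶ F)) :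
    l ∈ LinearMap.range (pairing F) ↔ IsContinuous F l := by
  classical
  constructor
  · rintro ⟨t, rfl⟩
    induction t using induction_on with
    | zero => exact ⟨∅, fun _ _ => by simp⟩
    | coef X ξ v =>
      refine ⟨{X}, fun η h => ?_⟩
      have : appL F X η = 0 := by simp [appL, h X (by simp)]
      rw [pairing_coef, this, LinearMap.zero_apply, map_zero]
    | add a b ha hb =>
      obtain ⟨s, hs⟩ := ha
      obtain ⟨s', hs'⟩ := hb
      refine ⟨s ∪ s', fun η h => ?_⟩
      rw [map_add, LinearMap.add_apply, hs η fun X hX => h X (Finset.mem_union_left _ hX),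
        hs' η fun X hX => h X (Finset.mem_union_right _ hX), add_zero]
  · rintro ⟨s, hs⟩
    let ev : (F ⟶ F) →ₗ[k] ∀ X : s, (F.obj X.1 →ₗ[k] F.obj X.1) :=
      { toFun := fun η X => appL F X.1 η
        map_add' := fun _ _ => rfl
        map_smul' := fun _ _ => rfl }
    have hker : LinearMap.ker ev ≤ LinearMap.ker l := by
      intro η hη
      refine hs η fun X hX => ?_
      have : appL F X η = 0 := congrFun (LinearMap.mem_ker.mp hη) ⟨X, hX⟩
      exact FGModuleCat.hom_ext this
    obtain ⟨m, hm⟩ : ∃ m : Module.Dual k (∀ X : s, (F.obj X.1 →ₗ[k] F.obj X.1)),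
        m ∘ₗ ev = l := by
      have : l ∈ LinearMap.range ev.dualMap := by
        rw [LinearMap.range_dualMap_eq_dualAnnihilator_ker, Submodule.mem_dualAnnihilator]
        exact fun η hη => hker hη
      exact this
    let E : ∀ (X : s) (i j : Fin (Module.finrank k (F.obj X.1))), F.obj X.1 →ₗ[k] F.obj X.1 :=
      fun X i j => ((bas X.1).coord j).smulRight (bas X.1 i)
    refine ⟨∑ X : s, ∑ i, ∑ j, m (Pi.single X (E X i j)) •
      coef F X.1 ((bas X.1).coord i) (bas X.1 j), ?_⟩
    ext η
    have hη : ∀ X : s, ev η X =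
        ∑ i, ∑ j, (bas X.1).coord i (appL F X.1 η (bas X.1 j)) • E X i j := by
      intro X
      refine (bas X.1).ext fun j => ?_
      simp only [LinearMap.sum_apply, LinearMap.smul_apply, E, LinearMap.smulRight_apply,
        Module.Basis.coord_apply, Module.Basis.repr_self, Finsupp.single_apply, ite_smul, one_smul,
        zero_smul, smul_ite, smul_zero, Finset.sum_ite_eq, Finset.mem_univ, if_true]
      exact ((bas X.1).sum_repr _).symm
    have hs' : ev η = ∑ X : s, Pi.single X (ev η X) := (Finset.univ_sum_single _).symm
    rw [← hm, LinearMap.comp_apply, hs', map_sum, map_sum, LinearMap.sum_apply]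
    refine Finset.sum_congr rfl fun X _ => ?_
    have h2 : m (Pi.single X (ev η X)) =
        ∑ i, ∑ j, (bas X.1).coord i (appL F X.1 η (bas X.1 j)) * m (Pi.single X (E X i j)) := by
      have := congrArg (m ∘ₗ LinearMap.single k _ X) (hη X)
      simp only [map_sum, map_smul, LinearMap.comp_apply, LinearMap.single_apply,
        smul_eq_mul] at this
      exact this
    rw [h2]
    simp only [map_sum, map_smul, LinearMap.sum_apply, LinearMap.smul_apply, pairing_coef,
      smul_eq_mul]
    exact Finset.sum_congr rfl fun i _ => Finset.sum_congr rfl fun j _ => mul_comm _ _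

/-- The comultiplication is dual to the composition of natural endomorphisms. -/
theorem pairing_comp (t : Coend F) (η η' : F ⟶ F) :
    pairing F t (η ≫ η') = LinearMap.mul' k k (TensorProduct.map ((pairing F).flip η)
      ((pairing F).flip η') (Coalgebra.comul t)) := by
  induction t using induction_on with
  | zero => simp
  | add a b ha hb => simp only [map_add, LinearMap.add_apply, ha, hb]
  | coef X ξ v =>
    have : Coalgebra.comul (R := k) (coef F X ξ v) = _ := comulL_coef (bas X) ξ v
    rw [this, map_sum, map_sum]
    simp only [TensorProduct.map_tmul, LinearMap.mul'_apply, LinearMap.flip_apply, pairing_coef]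
    have h : appL F X (η ≫ η') v = appL F X η' (appL F X η v) := rfl
    rw [h]
    conv_lhs => rw [← (bas X).sum_repr (appL F X η v), map_sum, map_sum]
    refine Finset.sum_congr rfl fun i _ => ?_
    rw [map_smul, map_smul, smul_eq_mul]; rfl

/-- The counit is the evaluation at the identity of `F`. -/
theorem pairing_id (t : Coend F) : pairing F t (𝟙 F) = Coalgebra.counit (R := k) t := by
  induction t using induction_on with
  | zero => simp
  | add a b ha hb => simp only [map_add, LinearMap.add_apply, ha, hb]
  | coef X ξ v => rw [pairing_coef]; exact (counitL_coef X ξ v).symm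

end Pairing

end Coend

end FiberFunctor

/-! ## The subspaces `R_a` and the functor `M⁺` -/

namespace QuadAlg

open TensorProduct

section Contraction

variable {k T : Type u} [Field k] [Ring T] [Algebra k T] {M N : Submodule k T}

/-- The contraction `M N → N` along a functional on `M`, for linearly disjoint `M` and `N`. -/
noncomputable def contrL (H : M.LinearDisjoint N) (φ : Module.Dual k M) : ↥(M * N) →ₗ[k] N :=
  (TensorProduct.lid k N).toLinearMap ∘ₗ LinearMap.rTensor N φ ∘ₗ H.mulMap.symm.toLinearMap

/-- The contraction `M N → M` along a functional on `N`, for linearly disjoint `M` and `N`. -/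
noncomputable def contrR (H : M.LinearDisjoint N) (φ : Module.Dual k N) : ↥(M * N) →ₗ[k] M :=
  (TensorProduct.rid k M).toLinearMap ∘ₗ LinearMap.lTensor M φ ∘ₗ H.mulMap.symm.toLinearMap

lemma mulMap_symm_mul (H : M.LinearDisjoint N) (m : M) (n : N) :
    H.mulMap.symm ⟨m.1 * n.1, Submodule.mul_mem_mul m.2 n.2⟩ = m ⊗ₜ n := by
  rw [LinearEquiv.symm_apply_eq]
  exact Subtype.ext (H.val_mulMap_tmul m n).symm

lemma contrL_comp (H : M.LinearDisjoint N) (φ : Module.Dual k M) {M' N' : Submodule k T}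
    (hM : M' ≤ M) (hN : N' ≤ N) (y : M' ⊗[k] N')
    (hy : Submodule.mulMap M' N' y ∈ M * N) :
    contrL H φ ⟨Submodule.mulMap M' N' y, hy⟩ =
      Submodule.inclusion hN (TensorProduct.lid k N'
        (LinearMap.rTensor N' (φ ∘ₗ Submodule.inclusion hM) y)) := by
  have h1 : ∀ y : M' ⊗[k] N', Submodule.mulMap M' N' y ∈ M * N := fun y =>
    mul_le_mul' hM hN ((Submodule.mulMap_range M' N').le ⟨y, rfl⟩)
  have h2 : contrL H φ ∘ₗ LinearMap.codRestrict (M * N) (Submodule.mulMap M' N') h1 =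
      Submodule.inclusion hN ∘ₗ (TensorProduct.lid k N').toLinearMap ∘ₗ
        LinearMap.rTensor N' (φ ∘ₗ Submodule.inclusion hM) := by
    refine TensorProduct.ext' fun m n => ?_
    have := mulMap_symm_mul H (Submodule.inclusion hM m) (Submodule.inclusion hN n)
    have e : LinearMap.codRestrict (M * N) (Submodule.mulMap M' N') h1 (m ⊗ₜ n) =
      ⟨_, Submodule.mul_mem_mul (Submodule.inclusion hM m).2 (Submodule.inclusion hN n).2⟩ := rfl
    simp only [LinearMap.comp_apply, contrL, e, LinearEquiv.coe_coe, this]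
    simp
  exact LinearMap.congr_fun h2 y

lemma contrR_comp (H : M.LinearDisjoint N) (φ : Module.Dual k N) {M' N' : Submodule k T}
    (hM : M' ≤ M) (hN : N' ≤ N) (y : M' ⊗[k] N')
    (hy : Submodule.mulMap M' N' y ∈ M * N) :
    contrR H φ ⟨Submodule.mulMap M' N' y, hy⟩ =
      Submodule.inclusion hM (TensorProduct.rid k M'
        (LinearMap.lTensor M' (φ ∘ₗ Submodule.inclusion hN) y)) := by
  have h1 : ∀ y : M' ⊗[k] N', Submodule.mulMap M' N' y ∈ M * N := fun y =>
    mul_le_mul' hM hN ((Submodule.mulMap_range M' N').le ⟨y, rfl⟩)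
  have h2 : contrR H φ ∘ₗ LinearMap.codRestrict (M * N) (Submodule.mulMap M' N') h1 =
      Submodule.inclusion hM ∘ₗ (TensorProduct.rid k M').toLinearMap ∘ₗ
        LinearMap.lTensor M' (φ ∘ₗ Submodule.inclusion hN) := by
    refine TensorProduct.ext' fun m n => ?_
    have := mulMap_symm_mul H (Submodule.inclusion hM m) (Submodule.inclusion hN n)
    have e : LinearMap.codRestrict (M * N) (Submodule.mulMap M' N') h1 (m ⊗ₜ n) =
      ⟨_, Submodule.mul_mem_mul (Submodule.inclusion hM m).2 (Submodule.inclusion hN n).2⟩ := rfl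
    simp only [LinearMap.comp_apply, contrR, e, LinearEquiv.coe_coe, this]
    simp
  exact LinearMap.congr_fun h2 y

lemma exists_mulMap_eq {M' N' : Submodule k T} {x : T} (hx : x ∈ M' * N') :
    ∃ y, Submodule.mulMap M' N' y = x := by
  rwa [← Submodule.mulMap_range] at hx

lemma contrL_mem (H : M.LinearDisjoint N) (φ : Module.Dual k M) {P : Submodule k T} (hP : P ≤ N)
    {x : T} (hx : x ∈ M * P) (hx' : x ∈ M * N) : (contrL H φ ⟨x, hx'⟩ : T) ∈ P := by
  obtain ⟨y, rfl⟩ := exists_mulMap_eq hx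
  rw [contrL_comp H φ le_rfl hP y hx']
  exact (TensorProduct.lid k P _).2

lemma contrR_mem (H : M.LinearDisjoint N) (φ : Module.Dual k N) {P : Submodule k T} (hP : P ≤ M)
    {x : T} (hx : x ∈ P * N) (hx' : x ∈ M * N) : (contrR H φ ⟨x, hx'⟩ : T) ∈ P := by
  obtain ⟨y, rfl⟩ := exists_mulMap_eq hx
  rw [contrR_comp H φ hP le_rfl y hx']
  exact (TensorProduct.rid k P _).2

lemma mem_mul_of_contrL (H : M.LinearDisjoint N) {P : Submodule k T}
    {x : T} (hx : x ∈ M * N) (h : ∀ φ, (contrL H φ ⟨x, hx⟩ : T) ∈ P) : x ∈ M * P := by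
  have key : ∀ t : M ⊗[k] N, (∀ φ : Module.Dual k M,
      (TensorProduct.lid k N (LinearMap.rTensor N φ t) : T) ∈ P) →
      Submodule.mulMap M N t ∈ M * P := by
    classical
    intro t ht
    let b := Module.Basis.ofVectorSpace k M
    obtain ⟨f, rfl⟩ := (TensorProduct.equivFinsuppOfBasisLeft b).symm.surjective t
    rw [TensorProduct.equivFinsuppOfBasisLeft_symm_apply, Finsupp.sum, map_sum]
    refine Submodule.sum_mem _ fun i hi => ?_
    have := ht (b.coord i)
    rw [TensorProduct.equivFinsuppOfBasisLeft_symm_apply, Finsupp.sum, map_sum, map_sum] at this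
    rw [Finset.sum_eq_single i] at this
    · refine Submodule.mul_mem_mul (b i).2 ?_
      simpa using this
    · intro j _ hj
      simp [hj]
    · intro hi'
      exact absurd hi hi'
  have e := key (H.mulMap.symm ⟨x, hx⟩) h
  have : ((H.mulMap (H.mulMap.symm ⟨x, hx⟩) : ↥(M * N)) : T) = x := by
    rw [LinearEquiv.apply_symm_apply]
  rw [← this]
  exact e

lemma mem_mul_of_contrR (H : M.LinearDisjoint N) {P : Submodule k T}
    {x : T} (hx : x ∈ M * N) (h : ∀ φ, (contrR H φ ⟨x, hx⟩ : T) ∈ P) : x ∈ P * N := by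
  have key : ∀ t : M ⊗[k] N, (∀ φ : Module.Dual k N,
      (TensorProduct.rid k M (LinearMap.lTensor M φ t) : T) ∈ P) →
      Submodule.mulMap M N t ∈ P * N := by
    classical
    intro t ht
    let b := Module.Basis.ofVectorSpace k N
    obtain ⟨f, rfl⟩ := (TensorProduct.equivFinsuppOfBasisRight b).symm.surjective t
    rw [TensorProduct.equivFinsuppOfBasisRight_symm_apply, Finsupp.sum, map_sum]
    refine Submodule.sum_mem _ fun i hi => ?_
    have := ht (b.coord i)
    rw [TensorProduct.equivFinsuppOfBasisRight_symm_apply, Finsupp.sum, map_sum, map_sum] at this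
    rw [Finset.sum_eq_single i] at this
    · refine Submodule.mul_mem_mul ?_ (b i).2
      simpa using this
    · intro j _ hj
      simp [hj]
    · intro hi'
      exact absurd hi hi'
  have e := key (H.mulMap.symm ⟨x, hx⟩) h
  have : ((H.mulMap (H.mulMap.symm ⟨x, hx⟩) : ↥(M * N)) : T) = x := by
    rw [LinearEquiv.apply_symm_apply]
  rw [← this]
  exact e

lemma mem_mul_of_mem (H : M.LinearDisjoint N) {P Q : Submodule k T} (hP : P ≤ M) (hQ : Q ≤ N)
    {x : T} (h₁ : x ∈ P * N) (h₂ : x ∈ M * Q) : x ∈ P * Q := by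
  have H' : P.LinearDisjoint N := H.of_le_left_of_flat hP
  refine mem_mul_of_contrL H' h₁ fun φ => ?_
  obtain ⟨l, hl⟩ := (Submodule.inclusion hP).exists_leftInverse_of_injective
    (LinearMap.ker_eq_bot.mpr (Submodule.inclusion_injective hP))
  have h3 : contrL H' φ ⟨x, h₁⟩ = contrL H (φ ∘ₗ l) ⟨x, mul_le_mul' le_rfl hQ h₂⟩ := by
    obtain ⟨y, rfl⟩ := exists_mulMap_eq h₁
    rw [contrL_comp H' φ le_rfl le_rfl y h₁, contrL_comp H (φ ∘ₗ l) hP le_rfl y,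
      LinearMap.comp_assoc, hl]
    rfl
  rw [h3]
  exact contrL_mem H _ hQ h₂ _

end Contraction
end QuadAlg

namespace QuadAlg

open TensorProduct

section Subspaces

variable {k V : Type u} [Field k] [AddCommGroup V] [Module k V]

variable (k V) in
/-- The image of `V` in its tensor algebra; its powers are the homogeneous components. -/
noncomputable def V1 : Submodule k (TensorAlgebra k V) := LinearMap.range (TensorAlgebra.ι k)

/-- The image in the tensor algebra of a space `R ⊆ V ⊗ V` of quadratic relations. -/
noncomputable def RT (R : Submodule k (V ⊗[k] V)) : Submodule k (TensorAlgebra k V) :=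
  R.map (LinearMap.mul' k (TensorAlgebra k V) ∘ₗ
    TensorProduct.map (TensorAlgebra.ι k) (TensorAlgebra.ι k))

/-- The subspace `R_a = ⋂_{i+j+2=a} V^{⊗ i} ⊗ R ⊗ V^{⊗ j}` of `V^{⊗ a}`, realised inside the
tensor algebra of `V`. In particular `R_0 = k`, `R_1 = V` and `R_2 = R`. -/
noncomputable def Rsub (R : Submodule k (V ⊗[k] V)) (a : ℕ) : Submodule k (TensorAlgebra k V) :=
  V1 k V ^ a ⊓ ⨅ (i : ℕ) (j : ℕ) (_ : i + j + 2 = a), V1 k V ^ i * RT R * V1 k V ^ j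

lemma Rsub_zero (R : Submodule k (V ⊗[k] V)) : Rsub R 0 = 1 := by
  simp [Rsub]

lemma Rsub_one (R : Submodule k (V ⊗[k] V)) : Rsub R 1 = V1 k V := by
  have : ∀ i j : ℕ, i + j + 2 ≠ 1 := by omega
  simp [Rsub, this]

lemma RT_le (R : Submodule k (V ⊗[k] V)) : RT R ≤ V1 k V ^ 2 := by
  rw [pow_two, ← Submodule.mulMap_range]
  have h : Submodule.mulMap (V1 k V) (V1 k V) ∘ₗ
      TensorProduct.map (TensorAlgebra.ι k).rangeRestrict (TensorAlgebra.ι k).rangeRestrict =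
      LinearMap.mul' k (TensorAlgebra k V) ∘ₗ
        TensorProduct.map (TensorAlgebra.ι k) (TensorAlgebra.ι k) :=
    TensorProduct.ext' fun _ _ => rfl
  rw [RT, ← h, Submodule.map_comp]
  exact LinearMap.map_le_range

lemma Rsub_two (R : Submodule k (V ⊗[k] V)) : Rsub R 2 = RT R := by
  have : ∀ i j : ℕ, i + j + 2 = 2 ↔ i = 0 ∧ j = 0 := by omega
  refine le_antisymm ?_ (le_inf (RT_le R) ?_)
  · intro x hx
    have h := hx.2
    simp only [SetLike.mem_coe, Submodule.mem_iInf] at h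
    simpa only [pow_zero, one_mul, mul_one] using h 0 0 (by norm_num)
  · refine le_iInf fun i => le_iInf fun j => le_iInf fun h => ?_
    obtain ⟨rfl, rfl⟩ := (this i j).1 h
    simp

lemma Rsub_le (R : Submodule k (V ⊗[k] V)) (a : ℕ) : Rsub R a ≤ V1 k V ^ a := inf_le_left

lemma list_prod_mem {n : ℕ} (f : Fin n → V) :
    (List.ofFn fun i => TensorAlgebra.ι k (f i)).prod ∈ V1 k V ^ n := by
  induction n with
  | zero => simp [Submodule.mem_one]
  | succ n ih =>
    rw [List.ofFn_succ, List.prod_cons, pow_succ']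
    exact Submodule.mul_mem_mul ⟨f 0, rfl⟩ (ih fun i => f i.succ)

lemma range_toTensorAlgebra (n : ℕ) :
    LinearMap.range (TensorPower.toTensorAlgebra (R := k) (M := V) (n := n)) = V1 k V ^ n := by
  refine le_antisymm ?_ ?_
  · rintro _ ⟨x, rfl⟩
    induction x using PiTensorProduct.induction_on with
    | smul_tprod r f =>
      rw [map_smul, TensorPower.toTensorAlgebra_tprod, TensorAlgebra.tprod_apply]
      refine Submodule.smul_mem _ _ ?_
      exact list_prod_mem f
    | add a b ha hb => rw [map_add]; exact add_mem ha hb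
  · induction n with
    | zero =>
      rw [pow_zero]
      intro x h
      obtain ⟨r, rfl⟩ := Submodule.mem_one.mp h
      refine ⟨r • GradedMonoid.GOne.one (A := fun n => ⨂[k]^n V), ?_⟩
      rw [map_smul, TensorPower.toTensorAlgebra_gOne, Algebra.algebraMap_eq_smul_one]
    | succ n ih =>
      rw [pow_succ, Submodule.mul_le]
      intro a ha b hb
      obtain ⟨a, rfl⟩ := ih ha
      obtain ⟨b, rfl⟩ := hb
      refine ⟨GradedMonoid.GMul.mul (A := fun n => ⨂[k]^n V) a
        (PiTensorProduct.tprod k (fun _ : Fin 1 => b)), ?_⟩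
      rw [TensorPower.toTensorAlgebra_gMul, TensorPower.toTensorAlgebra_tprod]
      simp

lemma toTensorAlgebra_injective (n : ℕ) :
    Function.Injective (TensorPower.toTensorAlgebra (R := k) (M := V) (n := n)) := by
  have h : ∀ x : ⨂[k]^n V, TensorAlgebra.ofDirectSum (DirectSum.of (fun n => ⨂[k]^n V) n x) =
      TensorPower.toTensorAlgebra x := fun x => DirectSum.toAddMonoid_of _ _ _
  intro x y hxy
  rw [← h, ← h] at hxy
  exact DirectSum.of_injective n (TensorAlgebra.equivDirectSum.symm.injective hxy)

lemma linearDisjoint_V1 (m n : ℕ) : (V1 k V ^ m).LinearDisjoint (V1 k V ^ n) := by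
  rw [Submodule.linearDisjoint_iff]
  let em := LinearEquiv.ofInjective _ (toTensorAlgebra_injective (k := k) (V := V) m)
  let en := LinearEquiv.ofInjective _ (toTensorAlgebra_injective (k := k) (V := V) n)
  rw [← range_toTensorAlgebra, ← range_toTensorAlgebra]
  have : Submodule.mulMap _ _ ∘ₗ (TensorProduct.congr em en).toLinearMap =
      TensorPower.toTensorAlgebra ∘ₗ
        (TensorPower.mulEquiv (R := k) (M := V) (n := m) (m := n)).toLinearMap := by
    refine TensorProduct.ext' fun a b => ?_
    exact (TensorPower.toTensorAlgebra_gMul a b).symm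
  have h2 : Function.Injective (Submodule.mulMap _ _ ∘ₗ (TensorProduct.congr em en).toLinearMap) := by
    rw [this]
    exact (toTensorAlgebra_injective _).comp (LinearEquiv.injective _)
  have h3 := h2.comp (TensorProduct.congr em en).symm.injective
  have h4 : ∀ t, (TensorProduct.congr em en).toLinearMap ((TensorProduct.congr em en).symm t) = t :=
    (TensorProduct.congr em en).apply_symm_apply
  intro s t hst
  refine h3 ?_
  simp only [Function.comp_apply, LinearMap.comp_apply, h4]
  exact hst

lemma linearDisjoint {m n : ℕ} {P Q : Submodule k (TensorAlgebra k V)} (hP : P ≤ V1 k V ^ m)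
    (hQ : Q ≤ V1 k V ^ n) : P.LinearDisjoint Q :=
  (linearDisjoint_V1 m n).of_le_of_flat_left hP hQ

lemma Rsub_add_le (R : Submodule k (V ⊗[k] V)) (a b : ℕ) :
    Rsub R (a + b) ≤ Rsub R a * Rsub R b := by
  intro x hx
  have H := linearDisjoint_V1 (k := k) (V := V) a b
  have hx0 : x ∈ V1 k V ^ a * V1 k V ^ b := by rw [← pow_add]; exact hx.1
  have hx' : ∀ i j, i + j + 2 = a + b → x ∈ V1 k V ^ i * RT R * V1 k V ^ j := by
    have := hx.2
    simp only [SetLike.mem_coe, Submodule.mem_iInf] at this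
    exact this
  refine mem_mul_of_mem H (Rsub_le R a) (Rsub_le R b) ?_ ?_
  · refine mem_mul_of_contrR H hx0 fun φ => ?_
    refine ⟨Subtype.prop _, ?_⟩
    simp only [SetLike.mem_coe, Submodule.mem_iInf]
    intro i j hij
    refine contrR_mem H φ (P := V1 k V ^ i * RT R * V1 k V ^ j) ?_ ?_ hx0
    · rw [← hij, show i + j + 2 = i + 2 + j by ring, pow_add, pow_add]
      exact mul_le_mul' (mul_le_mul' le_rfl (RT_le R)) le_rfl
    · rw [mul_assoc, ← pow_add]
      exact hx' i (j + b) (by omega)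
  · refine mem_mul_of_contrL H hx0 fun φ => ?_
    refine ⟨Subtype.prop _, ?_⟩
    simp only [SetLike.mem_coe, Submodule.mem_iInf]
    intro i j hij
    refine contrL_mem H φ (P := V1 k V ^ i * RT R * V1 k V ^ j) ?_ ?_ hx0
    · rw [← hij, show i + j + 2 = i + 2 + j by ring, pow_add, pow_add]
      exact mul_le_mul' (mul_le_mul' le_rfl (RT_le R)) le_rfl
    · rw [← mul_assoc, ← mul_assoc, ← pow_add]
      exact hx' (a + i) j (by omega)

/-- `R_{a₁} ⊗ ⋯ ⊗ R_{aₙ}`, realised as a subspace of the tensor algebra. -/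
noncomputable def word (R : Submodule k (V ⊗[k] V)) (d : ℕ) :
    LambdaPlus d →* Submodule k (TensorAlgebra k V) :=
  FreeMonoid.lift fun a => Rsub R a.1

lemma word_r (R : Submodule k (V ⊗[k] V)) {d a : ℕ} (ha : a ≤ d) :
    word R d (LambdaPlus.r d a) = Rsub R a := by
  unfold LambdaPlus.r
  split_ifs with h
  · simp [word]
  · obtain rfl : a = 0 := by omega
    rw [map_one, Rsub_zero]

lemma exists_word_le (R : Submodule k (V ⊗[k] V)) (d : ℕ) (w : LambdaPlus d) :
    ∃ n, word R d w ≤ V1 k V ^ n := by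
  induction w using FreeMonoid.inductionOn with
  | one => exact ⟨0, by rw [map_one, pow_zero]⟩
  | of a => exact ⟨a.1, by simpa [word] using Rsub_le R a.1⟩
  | mul x y hx hy =>
    obtain ⟨m, hm⟩ := hx
    obtain ⟨n, hn⟩ := hy
    exact ⟨m + n, by rw [map_mul, pow_add]; exact mul_le_mul' hm hn⟩

lemma word_linearDisjoint (R : Submodule k (V ⊗[k] V)) (d : ℕ) (x y : LambdaPlus d) :
    (word R d x).LinearDisjoint (word R d y) := by
  obtain ⟨m, hm⟩ := exists_word_le R d x
  obtain ⟨n, hn⟩ := exists_word_le R d y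
  exact linearDisjoint hm hn

variable [FiniteDimensional k V]

instance word_finite (R : Submodule k (V ⊗[k] V)) (d : ℕ) (w : LambdaPlus d) :
    Module.Finite k (word R d w) := by
  obtain ⟨n, hn⟩ := exists_word_le R d w
  have h1 : (V1 k V).FG := by
    rw [V1, LinearMap.range_eq_map]
    exact (Module.Finite.fg_top).map _
  have h2 : Module.Finite k ↥(V1 k V ^ n) := Module.Finite.iff_fg.mpr (h1.pow n)
  exact Submodule.finiteDimensional_of_le hn

end Subspaces
end QuadAlg

namespace QuadAlg

open TensorProduct

section MPlus

variable {k V : Type u} [Field k] [AddCommGroup V] [Module k V] [FiniteDimensional k V]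
variable (R : Submodule k (V ⊗[k] V)) (d : ℕ)

/-- The value of `M⁺` on an object. -/
noncomputable abbrev wordObj (w : LambdaPlus d) : FGModuleCat.{u} k := FGModuleCat.of k (word R d w)

lemma wordObj_eqToHom {w w' : LambdaPlus d} (h : w = w') (x : word R d w) :
    (((eqToHom (congrArg (wordObj R d) h)).hom.hom x : word R d w') : TensorAlgebra k V) = x := by
  subst h; rfl

/-- The structure isomorphism `k ≅ M⁺(1)`. -/
noncomputable def unitEquiv : k ≃ₗ[k] word R d 1 :=
  LinearEquiv.ofBijective
    ((Algebra.linearMap k (TensorAlgebra k V)).codRestrict (word R d 1) fun c => by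
      rw [map_one]; exact Submodule.mem_one.mpr ⟨c, rfl⟩)
    ⟨fun a b h => (TensorAlgebra.algebraMap_leftInverse V).injective (congrArg Subtype.val h), by
      rintro ⟨x, hx⟩
      have hx' := hx
      rw [map_one] at hx'
      obtain ⟨c, rfl⟩ := Submodule.mem_one.mp hx'
      exact ⟨c, rfl⟩⟩

/-- The structure isomorphism `M⁺(x) ⊗ M⁺(y) ≅ M⁺(xy)`, given by multiplication in the tensor
algebra. -/
noncomputable def mulEquiv (x y : LambdaPlus d) :
    (word R d x ⊗[k] word R d y) ≃ₗ[k] word R d (x * y) :=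
  (word_linearDisjoint R d x y).mulMap ≪≫ₗ LinearEquiv.ofEq _ _ (map_mul (word R d) x y).symm

lemma mulEquiv_tmul (x y : LambdaPlus d) (a : word R d x) (b : word R d y) :
    (mulEquiv R d x y (a ⊗ₜ b) : TensorAlgebra k V) = a * b := rfl

lemma word_r_le {a b c : ℕ} (h : a + b = c) (hc : c ≤ d) :
    word R d (LambdaPlus.r d c) ≤ word R d (LambdaPlus.r d a * LambdaPlus.r d b) := by
  rw [map_mul, word_r R hc, word_r R (by omega : a ≤ d), word_r R (by omega : b ≤ d), ← h]
  exact Rsub_add_le R a b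

/-- The values of `M⁺`: `r_a` goes to `R_a`, and `φ_{a,b}` to the inclusion
`R_{a+b} ⊆ R_a R_b`. -/
noncomputable def liftData : (UpPlusPres d).LiftData (FGModuleCat.{u} k) where
  obj := wordObj R d
  ε := (unitEquiv R d).toFGModuleCatIso
  μ x y := (mulEquiv R d x y).toFGModuleCatIso
  assoc x y z := by
    refine FGModuleCat.hom_ext (TensorProduct.ext_threefold fun a b c => Subtype.ext ?_)
    refine (wordObj_eqToHom R d (mul_assoc x y z) _).trans ?_
    exact mul_assoc (a : TensorAlgebra k V) b c
  left_unit x := by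
    refine FGModuleCat.hom_ext (TensorProduct.ext' fun a b => Subtype.ext ?_)
    refine (wordObj_eqToHom R d (one_mul x) _).trans ?_
    exact (Algebra.smul_def a (b : TensorAlgebra k V)).symm
  right_unit x := by
    refine FGModuleCat.hom_ext (TensorProduct.ext' fun b a => Subtype.ext ?_)
    refine (wordObj_eqToHom R d (mul_one x) _).trans ?_
    exact (Algebra.commutes a (b : TensorAlgebra k V)).symm.trans
      (Algebra.smul_def a (b : TensorAlgebra k V)).symm
  map := fun
    | .phi _ _ _ h hc => FGModuleCat.ofHom (Submodule.inclusion (word_r_le R d h hc))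

lemma mulEquiv_map_apply {x y x' y' : LambdaPlus d} (f : word R d x →ₗ[k] word R d y)
    (g : word R d x' →ₗ[k] word R d y') (hf : ∀ v, (f v : TensorAlgebra k V) = v)
    (hg : ∀ v, (g v : TensorAlgebra k V) = v) (v : word R d (x * x')) :
    (mulEquiv R d y y' (TensorProduct.map f g ((mulEquiv R d x x').symm v)) :
      TensorAlgebra k V) = v := by
  obtain ⟨t, rfl⟩ := (mulEquiv R d x x').surjective v
  rw [LinearEquiv.symm_apply_apply]
  induction t using TensorProduct.induction_on with
  | zero => simp
  | add s t hs ht =>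
    rw [map_add, map_add, map_add, Submodule.coe_add, Submodule.coe_add, hs, ht]
  | tmul a b =>
    rw [TensorProduct.map_tmul, mulEquiv_tmul, mulEquiv_tmul, hf, hg]

lemma eval_apply {x y : LambdaPlus d} (f : StrictPres.PreHom (UpPlusPres d).gen x y)
    (v : word R d x) :
    Subtype.val (p := (· ∈ word R d y)) (((liftData R d).eval f).hom.hom v) = v := by
  induction f with
  | gen g => cases g; rfl
  | ident x => rfl
  | comp f g hf hg => exact (hg (((liftData R d).eval f).hom.hom v)).trans (hf v)
  | @tensor x y x' y' f g hf hg =>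
    exact mulEquiv_map_apply R d _ _ hf hg v

lemma liftData_respects : (liftData R d).Respects := fun _ _ f g _ =>
  FGModuleCat.hom_ext (LinearMap.ext fun v => Subtype.ext
    ((eval_apply R d f v).trans (eval_apply R d g v).symm))

/-- The monoidal functor `M⁺` from `U↑⁺` to finite dimensional vector spaces, with `r_a ↦ R_a`
and `φ_{a,b}` sent to the inclusion `R_{a+b} ⊆ R_a ⊗ R_b`. -/
noncomputable def MPlus : UpPlus d ⥤ FGModuleCat.{u} k :=
  (liftData R d).lift (liftData_respects R d)

noncomputable instance : (MPlus R d).Monoidal :=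
  inferInstanceAs ((liftData R d).lift (liftData_respects R d)).Monoidal

end MPlus
end QuadAlg

/-! ## Quadratic algebras, regularity, and universal coactions -/

namespace QuadAlg

open TensorProduct

section Algebra

variable {k V : Type u} [Field k] [AddCommGroup V] [Module k V] (R : Submodule k (V ⊗[k] V))

/-- The relations `t = 0` for `t ∈ R`. -/
def QuadRel (s t : TensorAlgebra k V) : Prop := s ∈ RT R ∧ t = 0

/-- The quadratic algebra `TV/(R)`. -/
abbrev Alg : Type u := RingQuot (QuadRel R)

/-- The canonical map `V → TV/(R)`. -/
noncomputable def gen : V →ₗ[k] Alg R :=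
  (RingQuot.mkAlgHom k (QuadRel R)).toLinearMap ∘ₗ TensorAlgebra.ι k

/-- The homogeneous component of degree `n` of `TV/(R)`. -/
noncomputable def gr (n : ℕ) : Submodule k (Alg R) := LinearMap.range (gen R) ^ n

lemma algebraMapInv_RT {s : TensorAlgebra k V} (hs : s ∈ RT R) :
    TensorAlgebra.algebraMapInv (R := k) (M := V) s = 0 := by
  have h : (TensorAlgebra.algebraMapInv (R := k) (M := V)).toLinearMap ∘ₗ
      (LinearMap.mul' k (TensorAlgebra k V) ∘ₗ
        TensorProduct.map (TensorAlgebra.ι k) (TensorAlgebra.ι k)) = 0 :=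
    TensorProduct.ext' fun a b => by simp [TensorAlgebra.algebraMapInv]
  obtain ⟨t, -, rfl⟩ := hs
  exact LinearMap.congr_fun h t

/-- The augmentation `TV/(R) → k`, which kills `V`. -/
noncomputable def aug : Alg R →ₐ[k] k :=
  RingQuot.liftAlgHom k ⟨TensorAlgebra.algebraMapInv, fun s t h => by
    rw [h.2, map_zero]; exact algebraMapInv_RT R h.1⟩

/-- `TV/(R)` is Koszul: the trivial module `k` has a linear free resolution
`⋯ → A(-2)^{(I₁)} → A(-1)^{(I₀)} → A → k → 0` by left modules, that is, a resolution in which the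
entries of the matrices of all the differentials have degree one. -/
def IsKoszul : Prop :=
  ∃ (I : ℕ → Type u) (p : (I 0 →₀ Alg R) →ₗ[Alg R] Alg R)
    (D : ∀ n, (I (n + 1) →₀ Alg R) →ₗ[Alg R] (I n →₀ Alg R)),
    (∀ i, p (Finsupp.single i 1) ∈ gr R 1) ∧
    (∀ n i j, D n (Finsupp.single i 1) j ∈ gr R 1) ∧
    Function.Exact p (aug R) ∧ Function.Exact (D 0) p ∧
    ∀ n, Function.Exact (D (n + 1)) (D n)

/-- The trivial left module `k` over `TV/(R)`. -/
noncomputable def trivialModule : ModuleCat.{u} (Alg R) :=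
  (ModuleCat.restrictScalars (aug R).toRingHom).obj (ModuleCat.of k k)

/-- Right multiplication by `a`, as an endomorphism of the left regular module. -/
noncomputable def rightMul (a : Alg R) :
    ModuleCat.of (Alg R) (Alg R) ⟶ ModuleCat.of (Alg R) (Alg R) :=
  ModuleCat.ofHom (LinearMap.toSpanSingleton (Alg R) (Alg R) a)

/-- `TV/(R)` is Artin-Schelter regular of dimension `d`: its global dimension is `d`, the groups
`Ext^i(k, A)` vanish for `i ≠ d`, and `Ext^d(k, A)` with the right `A`-module structure coming from
right multiplication on `A` is isomorphic to the trivial module `k` (a shift of the grading on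
`k` leaves the module unchanged). -/
structure IsASRegular (d : ℕ) : Prop where
  projectiveDimension_le : ∀ N : ModuleCat.{u} (Alg R), HasProjectiveDimensionLE N d
  exists_projectiveDimension_eq : ∃ N : ModuleCat.{u} (Alg R), ¬ HasProjectiveDimensionLT N d
  ext_eq_zero : ∀ i ≠ d, Subsingleton
    (Abelian.Ext (trivialModule R) (ModuleCat.of (Alg R) (Alg R)) i)
  ext_top : ∃ e : Abelian.Ext (trivialModule R) (ModuleCat.of (Alg R) (Alg R)) d ≃+ k,
    ∀ x a, e (x.comp (Abelian.Ext.mk₀ (rightMul R a)) (add_zero d)) = e x * aug R a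

/-- A map `f : A → B ⊗ A` with `f(A_n) ⊆ B ⊗ A_n`. -/
def IsGraded {B : Type u} [Ring B] [Algebra k B] (f : Alg R →ₐ[k] B ⊗[k] Alg R) : Prop :=
  ∀ n, ∀ a ∈ gr R n, f a ∈ LinearMap.range ((gr R n).subtype.lTensor B)

/-- The bialgebra `E` with the coaction `δ` is the universal coacting bialgebra `uend(A)` of
`A = TV/(R)`. -/
structure IsUEnd (E : Type u) [Ring E] [Bialgebra k E] (δ : Alg R →ₐ[k] E ⊗[k] Alg R) : Prop where
  graded : IsGraded R δ
  coassoc : ∀ a, TensorProduct.assoc k E E (Alg R)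
    ((Coalgebra.comul (R := k) (A := E)).rTensor (Alg R) (δ a)) = δ.toLinearMap.lTensor E (δ a)
  counit : ∀ a, (Coalgebra.counit (R := k) (A := E)).rTensor (Alg R) (δ a) = 1 ⊗ₜ a
  universal : ∀ (B : Type u) [Ring B] [Algebra k B] (f : Alg R →ₐ[k] B ⊗[k] Alg R),
    IsGraded R f →
      ∃! g : E →ₐ[k] B, (Algebra.TensorProduct.map g (AlgHom.id k (Alg R))).comp δ = f

end Algebra

/-- `i : B → H` is the Hopf envelope of the bialgebra `B`. -/
def IsHopfEnvelope {k : Type u} [Field k] {B H : Type u} [Ring B] [Bialgebra k B] [Ring H]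
    [HopfAlgebra k H] (i : B →ₐc[k] H) : Prop :=
  ∀ (K : Type u) [Ring K] [HopfAlgebra k K] (f : B →ₐc[k] K), ∃! g : H →ₐc[k] K, g.comp i = f

/-- The Hopf algebra `H` is `uaut(A)`, the Hopf envelope of `uend(A)`, for `A = TV/(R)`. -/
def IsUAut {k V : Type u} [Field k] [AddCommGroup V] [Module k V] (R : Submodule k (V ⊗[k] V))
    (H : Type u) [Ring H] [HopfAlgebra k H] : Prop :=
  ∃ (E : Type u) (_ : Ring E) (_ : Bialgebra k E) (δ : Alg R →ₐ[k] E ⊗[k] Alg R)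
    (i : E →ₐc[k] H), IsUEnd R E δ ∧ IsHopfEnvelope i

/-- The monoidal functor `M` on `U` extends the monoidal functor `M⁺` on `U↑⁺`. -/
def Extends {k V : Type u} [Field k] [AddCommGroup V] [Module k V] [FiniteDimensional k V]
    (R : Submodule k (V ⊗[k] V)) (d : ℕ) (M : U d ⥤ FGModuleCat.{u} k) [M.Monoidal] : Prop :=
  ∃ e : UpPlus.toU d ⋙ M ≅ MPlus R d, NatTrans.IsMonoidal e.hom

end QuadAlg

open TensorProduct QuadAlg FiberFunctor

/-! The proof is linear algebra with the subspaces `R_a` of the tensor algebra `T` of `V`, together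
with a dictionary between algebra morphisms out of a coend and coactions on the fiber functor.

From homological algebra to contractions. Normalise the linear resolution so that it starts with
`A`. Its differentials are matrices over `V`, the only relations of `A` in degree two are those in
`R`, and `R_{n+2} = V R_{n+1} ∩ R V^n`; so exactness identifies the generators in degree `n` with
`R_n` (`LinRes.toTensor_spec`). Since the matrices have entries of positive degree, a nonzero
constant cochain is never a coboundary. The hypotheses on `Ext` therefore become statements about
the spaces `R_a` (`isFrobenius`): `R_{d+1} = 0`, `dim R_d = 1`, and for `i < d` no nonzero
functional on `R_i` contracts `R_{i+1} ⊆ V R_i` to zero. Iterating the last property, contraction of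
a generator `t` of `R_d`, from either end, is an isomorphism `R_b^* ≅ R_{d-b}` (`rcTop_bijective`,
`lcTop_bijective`).

Existence of `M`. Use `t` to replace `R_d` by `k`, send `r_d⁻¹` to `k`, and let `θ_{a,b}` be the
product `R_a × R_b → R_{a+b-d}` that contracts `u` from the right along the functional which turns
`t` into `y`. The same product contracts `y` from the left along the functional attached to `u`,
because contractions at opposite ends commute (`TopForm.pair_eq`). Each relation of `U` is evident
in one of these two descriptions.

The coend of `M⁺`. A monoidal natural transformation `F → B ⊗ F` is the same as an algebra morphism
from the coend of `F` to `B`. For `M⁺` it is determined by `V → B ⊗ V`, and such a map is admissible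
exactly when its extension to `T` preserves `R`, since every `R_a` arises from `V` and `R` by
products and intersections. This is also what a graded coaction on `A` amounts to, so the coend has
the universal property of `uend(A)` (`IsFrobenius.exists_isUEnd`).

The antipode. In `U` the object `r_b` has the dual `r_d⁻¹ r_{d-b}`, with copairing `φ_{d-b,b}` and
pairing `θ_{b,d-b}`; the zigzag identities are instances of the mixed relations between `φ` and `θ`.
The dual of `r_d⁻¹` is `r_d`. A coaction on an object with a dual is invertible, and the inverses of
the universal coaction define an antipode (`Coend.exists_hopfAlgebra`).

The envelope. A bialgebra morphism from the coend over `U↑⁺` to a Hopf algebra `K` is a coaction of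
`K` on the words in `Λ⁺`. On the line `M(r_d)` it is an invertible element `g`, so `r_d⁻¹` has to
carry `g⁻¹`. The copairings are built from `φ`, hence colinear; since the antipode of `K` inverts
coactions, the pairings are colinear as well; and every `θ` is composed of a pairing and a `φ`. So
the coaction extends to `U`, in only one way (`existsUnique_extension`). Uniqueness of universal
objects, and the fact that bialgebra morphisms respect antipodes, give the isomorphisms. -/

namespace QuadAlg

open TensorProduct

/-! ### The quadratic algebra in degrees zero, one and two -/

section LowDegree

variable {k V : Type u} [Field k] [AddCommGroup V] [Module k V] (R : Submodule k (V ⊗[k] V))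

/-- The quotient map from the tensor algebra onto `TV/(R)`. -/
noncomputable abbrev quot : TensorAlgebra k V →ₐ[k] Alg R := RingQuot.mkAlgHom k (QuadRel R)

lemma gen_apply (v : V) : gen R v = quot R (TensorAlgebra.ι k v) := rfl

lemma quot_eq_zero_of_mem {x : TensorAlgebra k V} (hx : x ∈ RT R) : quot R x = 0 := by
  have h : QuadRel R x 0 := ⟨hx, rfl⟩
  rw [RingQuot.mkAlgHom_rel k h, map_zero]

@[simp] lemma aug_quot (x : TensorAlgebra k V) :
    aug R (quot R x) = TensorAlgebra.algebraMapInv x := by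
  rw [aug, RingQuot.liftAlgHom_mkAlgHom_apply]

@[simp] lemma aug_gen (v : V) : aug R (gen R v) = 0 := by
  rw [gen_apply, aug_quot]; simp [TensorAlgebra.algebraMapInv]

lemma gr_one : gr R 1 = LinearMap.range (gen R) := pow_one _

lemma mem_V1 (v : V) : TensorAlgebra.ι k v ∈ V1 k V := ⟨v, rfl⟩

/-- An algebra map out of the tensor algebra kills `RT R` if the induced map on `V ⊗ V`
kills `R`. -/
lemma lift_eq_zero_of_mem_RT {B : Type*} [Ring B] [Algebra k B] (f : V →ₗ[k] B)
    (h : ∀ t ∈ R, LinearMap.mul' k B (TensorProduct.map f f t) = 0) {x : TensorAlgebra k V}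
    (hx : x ∈ RT R) : TensorAlgebra.lift k f x = 0 := by
  obtain ⟨t, ht, rfl⟩ := hx
  have e : (TensorAlgebra.lift k f).toLinearMap ∘ₗ (LinearMap.mul' k (TensorAlgebra k V) ∘ₗ
      TensorProduct.map (TensorAlgebra.ι k) (TensorAlgebra.ι k)) =
      LinearMap.mul' k B ∘ₗ TensorProduct.map f f :=
    TensorProduct.ext' fun a b => by simp
  exact (LinearMap.congr_fun e t).trans (h t ht)

/-- The square-zero extension `k ⊕ V` receives an algebra map from the quadratic algebra that is the
identity on `V`: products of two elements of `V` vanish there, so `R` is killed. Its second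
component is the required map, and the product rule is the multiplication of the extension. -/
lemma exists_linPart : ∃ L : Alg R →ₗ[k] V, (∀ v, L (gen R v) = v) ∧
    ∀ a b, L (a * b) = aug R a • L b + aug R b • L a := by
  -- The square-zero extension is formed from a bimodule, so `V` also needs a right action of `k`;
  -- it is taken equal to the left one.
  let _ : Module kᵐᵒᵖ V := Module.compHom _ ((RingHom.id k).fromOpposite mul_comm)
  have : IsCentralScalar k V := ⟨fun r m => rfl⟩
  let Ψ : Alg R →ₐ[k] TrivSqZeroExt k V := RingQuot.liftAlgHom k
    ⟨TensorAlgebra.lift k (TrivSqZeroExt.inrHom k V), fun s t h => by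
      rw [h.2, map_zero]
      refine lift_eq_zero_of_mem_RT R _ (fun t _ => ?_) h.1
      have e : LinearMap.mul' k (TrivSqZeroExt k V) ∘ₗ TensorProduct.map
        (TrivSqZeroExt.inrHom k V) (TrivSqZeroExt.inrHom k V) = 0 :=
        TensorProduct.ext' fun a b => by simp
      exact LinearMap.congr_fun e t⟩
  have hg : ∀ v, Ψ (gen R v) = TrivSqZeroExt.inr v := fun v => by
    rw [gen_apply, RingQuot.liftAlgHom_mkAlgHom_apply, TensorAlgebra.lift_ι_apply]; rfl
  have hf : (TrivSqZeroExt.fstHom k k V).comp Ψ = aug R := by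
    refine RingQuot.ringQuot_ext' _ _ _ (TensorAlgebra.hom_ext (LinearMap.ext fun v => ?_))
    have h1 := hg v
    have h2 := aug_gen R v
    rw [gen_apply] at h1 h2
    simp only [LinearMap.comp_apply, AlgHom.toLinearMap_apply, AlgHom.comp_apply]
    rw [h1, h2]; simp
  refine ⟨(TrivSqZeroExt.sndHom k V) ∘ₗ Ψ.toLinearMap, fun v => ?_, fun a b => ?_⟩
  · simp [hg]
  · have h : ∀ a, (Ψ a).fst = aug R a := fun a => AlgHom.congr_fun hf a
    simp only [LinearMap.comp_apply, AlgHom.toLinearMap_apply, map_mul, TrivSqZeroExt.sndHom_apply,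
      TrivSqZeroExt.snd_mul, h]
    rfl

/-- The component of degree one of an element of `TV/(R)`. -/
noncomputable def linPart : Alg R →ₗ[k] V := (exists_linPart R).choose

@[simp] lemma linPart_gen (v : V) : linPart R (gen R v) = v := (exists_linPart R).choose_spec.1 v

lemma linPart_mul (a b : Alg R) :
    linPart R (a * b) = aug R a • linPart R b + aug R b • linPart R a :=
  (exists_linPart R).choose_spec.2 a b

lemma gen_injective : Function.Injective (gen R) := Function.LeftInverse.injective (linPart_gen R)

lemma gen_linPart {a : Alg R} (ha : a ∈ gr R 1) : gen R (linPart R a) = a := by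
  rw [gr_one] at ha
  obtain ⟨v, rfl⟩ := ha
  rw [linPart_gen]

/-- The part of degree at least `n` of the tensor algebra. -/
noncomputable def highDeg (k V : Type u) [Field k] [AddCommGroup V] [Module k V] (n : ℕ) :
    Submodule k (TensorAlgebra k V) := ⨆ (m : ℕ) (_ : n ≤ m), V1 k V ^ m

lemma V1_pow_le_highDeg {n m : ℕ} (h : n ≤ m) : V1 k V ^ m ≤ highDeg k V n :=
  le_iSup₂_of_le m h le_rfl

lemma V1_mul_highDeg (n : ℕ) : V1 k V * highDeg k V n ≤ highDeg k V n := by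
  simp only [highDeg, Submodule.mul_iSup]
  refine iSup₂_le fun m hm => ?_
  rw [← pow_succ']
  exact V1_pow_le_highDeg (by omega)

lemma highDeg_mul_V1 (n : ℕ) : highDeg k V n * V1 k V ≤ highDeg k V n := by
  simp only [highDeg, Submodule.iSup_mul]
  refine iSup₂_le fun m hm => ?_
  rw [← pow_succ]
  exact V1_pow_le_highDeg (by omega)

lemma iSupIndep_V1_pow : iSupIndep fun n : ℕ => V1 k V ^ n := by
  classical
  exact (DirectSum.Decomposition.isInternal
    (fun n : ℕ => LinearMap.range (TensorAlgebra.ι k : V →ₗ[k] _) ^ n)).submodule_iSupIndep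

lemma disjoint_highDeg {m n : ℕ} (h : m < n) : Disjoint (V1 k V ^ m) (highDeg k V n) :=
  (iSupIndep_V1_pow m).mono_right (iSup₂_le fun l hl =>
    le_iSup₂_of_le (f := fun j (_ : j ≠ m) => V1 k V ^ j) l (by omega) le_rfl)

/-- The sum of `RT R` and the part of degree at least three. -/
noncomputable def relHull : Submodule k (TensorAlgebra k V) := RT R ⊔ highDeg k V 3

lemma V1_mul_relHull : V1 k V * relHull R ≤ relHull R := by
  rw [relHull, Submodule.mul_sup]
  refine sup_le (le_sup_of_le_right ?_) (le_sup_of_le_right (V1_mul_highDeg 3))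
  refine (mul_le_mul' le_rfl (RT_le R)).trans ?_
  rw [← pow_succ']
  exact V1_pow_le_highDeg le_rfl

lemma relHull_mul_V1 : relHull R * V1 k V ≤ relHull R := by
  rw [relHull, Submodule.sup_mul]
  refine sup_le (le_sup_of_le_right ?_) (le_sup_of_le_right (highDeg_mul_V1 3))
  refine (mul_le_mul' (RT_le R) le_rfl).trans ?_
  rw [← pow_succ]
  exact V1_pow_le_highDeg le_rfl

/-- Multiplying `RT R`, which sits in degree two, by `V` lands in degree three. So the hull is
stable under the generators of the tensor algebra on both sides, and is a two-sided ideal. -/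
lemma mul_mem_relHull (a : TensorAlgebra k V) :
    ∀ {x}, x ∈ relHull R → a * x ∈ relHull R ∧ x * a ∈ relHull R := by
  induction a using TensorAlgebra.induction with
  | algebraMap r =>
    intro x hx
    rw [← Algebra.commutes, ← Algebra.smul_def]
    exact ⟨Submodule.smul_mem _ _ hx, Submodule.smul_mem _ _ hx⟩
  | ι v =>
    exact fun hx => ⟨V1_mul_relHull R (Submodule.mul_mem_mul (mem_V1 v) hx),
      relHull_mul_V1 R (Submodule.mul_mem_mul hx (mem_V1 v))⟩
  | mul a b ha hb =>
    intro x hx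
    rw [mul_assoc, ← mul_assoc x]
    exact ⟨(ha (hb hx).1).1, (hb (ha hx).2).2⟩
  | add a b ha hb =>
    intro x hx
    rw [add_mul, mul_add]
    exact ⟨add_mem (ha hx).1 (hb hx).1, add_mem (ha hx).2 (hb hx).2⟩

lemma sub_mem_relHull_of_rel {x y : TensorAlgebra k V} (h : RingQuot.Rel (QuadRel R) x y) :
    x - y ∈ relHull R := by
  induction h with
  | of h => rw [h.2, sub_zero]; exact Submodule.mem_sup_left h.1
  | add_left _ ih => simpa using ih
  | mul_left _ ih => rw [← sub_mul]; exact (mul_mem_relHull R _ ih).2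
  | mul_right _ ih => rw [← mul_sub]; exact (mul_mem_relHull R _ ih).1

/-- Equality in the quotient means a chain of elementary steps, each changing an element by
something in the ideal generated by `R`. As `relHull R` is an ideal that contains the relators, the
total difference stays in it. -/
lemma mem_relHull_of_quot_eq_zero {x : TensorAlgebra k V} (h : quot R x = 0) :
    x ∈ relHull R := by
  have h1 : RingQuot.mkRingHom (QuadRel R) x = RingQuot.mkRingHom (QuadRel R) 0 := by
    rw [← RingQuot.mkAlgHom_coe k]; exact h.trans (map_zero _).symm
  simp only [RingQuot.mkRingHom_def] at h1
  have h2 := Quot.eqvGen_exact (congrArg RingQuot.toQuot h1)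
  have h3 : ∀ {x y}, Relation.EqvGen (RingQuot.Rel (QuadRel R)) x y → x - y ∈ relHull R := by
    intro x y h
    induction h with
    | rel x y h => exact sub_mem_relHull_of_rel R h
    | refl x => simp
    | symm x y _ ih => rw [← neg_sub]; exact neg_mem ih
    | trans x y z _ _ ih ih' => rw [← sub_add_sub_cancel x y z]; exact add_mem ih ih'
  simpa using h3 h2

/-- The relations of degree two of `TV/(R)` are exactly those in `R`. -/
lemma mem_RT_of_quot_eq_zero {x : TensorAlgebra k V} (hx : x ∈ V1 k V ^ 2) (h : quot R x = 0) :
    x ∈ RT R := by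
  obtain ⟨r, hr, s, hs, rfl⟩ := Submodule.mem_sup.mp (mem_relHull_of_quot_eq_zero R h)
  have : s ∈ V1 k V ^ 2 := by
    have := sub_mem hx (RT_le R hr)
    rwa [add_sub_cancel_left] at this
  have h0 := Submodule.disjoint_def.mp (disjoint_highDeg (k := k) (V := V) (by norm_num : 2 < 3)) s this hs
  rwa [h0, add_zero]

end LowDegree
end QuadAlg

namespace QuadAlg

open TensorProduct

/-! ### Reading off coefficients in products of linearly disjoint subspaces -/

section Contraction

variable {k T : Type u} [Field k] [Ring T] [Algebra k T] {M N : Submodule k T}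

lemma contrR_mul (H : M.LinearDisjoint N) (φ : Module.Dual k N) (m : M) (n : N)
    (h : (m : T) * n ∈ M * N) : contrR H φ ⟨m * n, h⟩ = φ n • m := by
  simp [contrR, mulMap_symm_mul]

lemma contrR_sum (H : M.LinearDisjoint N) (φ : Module.Dual k N) {ι : Type*} (s : Finset ι)
    (m : ι → M) (n : ι → N) (h : ∑ i ∈ s, (m i : T) * n i ∈ M * N) :
    contrR H φ ⟨∑ i ∈ s, (m i : T) * n i, h⟩ = ∑ i ∈ s, φ (n i) • m i := by
  have e : (⟨∑ i ∈ s, (m i : T) * n i, h⟩ : ↥(M * N)) =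
      ∑ i ∈ s, ⟨(m i : T) * n i, Submodule.mul_mem_mul (m i).2 (n i).2⟩ :=
    Subtype.ext (by simp)
  rw [e, map_sum]
  exact Finset.sum_congr rfl fun i _ => contrR_mul H φ _ _ _

/-- Coefficients with respect to linearly independent right factors can be read off. -/
lemma coeff_mem {P : Submodule k T} (H : M.LinearDisjoint N) {J : Type*} {e : J → T}
    (he : LinearIndependent k e) (heN : ∀ j, e j ∈ N) (q : J →₀ T) (hq : ∀ j, q j ∈ M)
    (hP : P ≤ M) (h : (q.sum fun j x => x * e j) ∈ P * N) (j : J) : q j ∈ P := by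
  classical
  let e' : J → N := fun j => ⟨e j, heN j⟩
  have he' : LinearIndependent k e' := LinearIndependent.of_comp N.subtype he
  -- A functional dual to `e j` among the `e i`, from an extension of the family to a basis of `N`.
  -- Contraction along it isolates the coefficient `q j`.
  obtain ⟨φ, hφ⟩ : ∃ φ : Module.Dual k N, ∀ i, φ (e' i) = if i = j then 1 else 0 := by
    let b := Module.Basis.extend he'.linearIndepOn_id
    let j' := (⟨e' j, he'.linearIndepOn_id.subset_extend _ ⟨j, rfl⟩⟩ :
      he'.linearIndepOn_id.extend (Set.subset_univ _))
    refine ⟨b.coord j', fun i => ?_⟩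
    have hi : e' i = b ⟨e' i, he'.linearIndepOn_id.subset_extend _ ⟨i, rfl⟩⟩ := by
      simp [b]
    rw [hi, Module.Basis.coord_apply, Module.Basis.repr_self, Finsupp.single_apply]
    simp only [j', Subtype.mk.injEq, he'.injective.eq_iff]
  have h1 : (q.sum fun j x => x * e j) ∈ M * N := mul_le_mul' hP le_rfl h
  have h2 := contrR_mem H φ hP h h1
  have h3 : contrR H φ ⟨_, h1⟩ = ∑ i ∈ q.support, φ (e' i) • (⟨q i, hq i⟩ : M) :=
    contrR_sum H φ q.support (fun i => ⟨q i, hq i⟩) e' h1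
  rw [h3] at h2
  simp only [hφ, ite_smul, one_smul, zero_smul, Finset.sum_ite_eq'] at h2
  split_ifs at h2 with hj
  · exact h2
  · rw [Finsupp.notMem_support_iff.mp hj]; exact zero_mem _

end Contraction

/-! ### The generators of a linear resolution are the spaces `R_a` -/

section Resolution

variable {k V : Type u} [Field k] [AddCommGroup V] [Module k V]

/-- A linear free resolution of the trivial module over `TV/(R)`, with a free module of rank one
in degree zero. -/
structure LinRes (R : Submodule k (V ⊗[k] V)) where
  idx : ℕ → Type u
  [uniq : Unique (idx 0)]
  d : ∀ n, (idx (n + 1) →₀ Alg R) →ₗ[Alg R] (idx n →₀ Alg R)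
  d_mem : ∀ n i j, d n (Finsupp.single i 1) j ∈ gr R 1
  exact_zero : Function.Exact (d 0) fun y => aug R (y default)
  exact_succ : ∀ n, Function.Exact (d (n + 1)) (d n)

/-- Only the indexing changes: the term `A` becomes the free module on one point and the other terms
move up by one, so that all differentials have the same shape and induction on the degree is
uniform. -/
lemma IsKoszul.exists_linRes {R : Submodule k (V ⊗[k] V)} (h : IsKoszul R) :
    Nonempty (LinRes R) := by
  obtain ⟨I, p, D, hp, hD, e0, e1, e2⟩ := h
  let J : ℕ → Type u := fun n => Nat.casesOn n PUnit I
  let q : (I 0 →₀ Alg R) →ₗ[Alg R] (PUnit.{u + 1} →₀ Alg R) :=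
    Finsupp.lsingle PUnit.unit ∘ₗ p
  have hq : ∀ x, q x = Finsupp.single PUnit.unit (p x) := fun x => rfl
  refine ⟨{ idx := J, uniq := inferInstanceAs (Unique PUnit.{u + 1}), d := fun n => match n with
            | 0 => q
            | n + 1 => D n
            d_mem := ?_, exact_zero := ?_, exact_succ := ?_ }⟩
  · rintro (_ | n) i j
    · change q _ j ∈ _
      rw [hq]; obtain rfl : j = PUnit.unit := rfl
      rw [Finsupp.single_eq_same]; exact hp i
    · exact hD n i j
  · intro (y : PUnit.{u + 1} →₀ Alg R)
    refine (e0 (y PUnit.unit)).trans ⟨fun ⟨x, hx⟩ => ⟨x, ?_⟩, fun ⟨x, hx⟩ => ⟨x, ?_⟩⟩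
    · change q x = y
      rw [hq, hx]; ext; simp
    · have hx : q x = y := hx
      rw [← hx, hq]; simp
  · rintro (_ | n) y
    · refine Iff.trans ?_ (e1 y)
      change q y = 0 ↔ _
      rw [hq]; simp
    · exact e2 n y

namespace LinRes

variable {R : Submodule k (V ⊗[k] V)} (P : LinRes R)

attribute [instance] LinRes.uniq

/-- The matrix of a differential, as a map `k^(J_{n+1}) → V^(J_n)`. -/
noncomputable def mat (n : ℕ) : (P.idx (n + 1) →₀ k) →ₗ[k] (P.idx n →₀ V) :=
  Finsupp.linearCombination k fun i =>
    Finsupp.mapRange.linearMap (linPart R) (P.d n (Finsupp.single i 1))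

lemma gen_mat_single (n : ℕ) (i : P.idx (n + 1)) (j : P.idx n) :
    gen R (P.mat n (Finsupp.single i 1) j) = P.d n (Finsupp.single i 1) j := by
  simp [mat, gen_linPart R (P.d_mem n i j)]

/-- Base change of the coefficients of a vector from `k` to `TV/(R)`. -/
noncomputable def const (n : ℕ) : (P.idx n →₀ k) →ₗ[k] (P.idx n →₀ Alg R) :=
  Finsupp.mapRange.linearMap (Algebra.linearMap k (Alg R))

/-- Vectors with coefficients in `V`, viewed as vectors with coefficients in `TV/(R)`. -/
noncomputable def lin (n : ℕ) : (P.idx n →₀ V) →ₗ[k] (P.idx n →₀ Alg R) :=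
  Finsupp.mapRange.linearMap (gen R)

lemma d_const (n : ℕ) (x : P.idx (n + 1) →₀ k) : P.d n (P.const (n + 1) x) = P.lin n (P.mat n x) := by
  have : (P.d n).restrictScalars k ∘ₗ P.const (n + 1) = P.lin n ∘ₗ P.mat n := by
    refine Finsupp.lhom_ext' fun i => LinearMap.ext_ring (Finsupp.ext fun j => ?_)
    simp only [LinearMap.comp_apply, LinearMap.restrictScalars_apply, const, lin,
      Finsupp.lsingle_apply, Finsupp.mapRange.linearMap_apply, Finsupp.mapRange_single,
      Finsupp.mapRange_apply, gen_mat_single, Algebra.linearMap_apply, map_one]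
  exact LinearMap.congr_fun this x

/-- The values of the differentials in lowest degree. -/
lemma d_apply (n : ℕ) (y : P.idx (n + 1) →₀ Alg R) (j : P.idx n) :
    P.d n y j = y.sum fun i a => a * gen R (P.mat n (Finsupp.single i 1) j) := by
  conv_lhs => rw [← Finsupp.sum_single y]
  rw [Finsupp.sum, map_sum, Finsupp.finsetSum_apply]
  refine Finset.sum_congr rfl fun i _ => ?_
  have h : (Finsupp.single i (y i) : P.idx (n + 1) →₀ Alg R) = y i • Finsupp.single i 1 := by simp
  rw [h, map_smul, Finsupp.smul_apply, ← gen_mat_single, smul_eq_mul]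

/-- This is the minimality of the resolution: the matrix entries lie in `V`, which the augmentation
kills. -/
lemma aug_d (n : ℕ) (y : P.idx (n + 1) →₀ Alg R) (j : P.idx n) : aug R (P.d n y j) = 0 := by
  rw [d_apply, Finsupp.sum, map_sum]
  exact Finset.sum_eq_zero fun i _ => by rw [map_mul, aug_gen, mul_zero]

/-- The matrix entries already have degree one, so only the constant terms of the coefficients
contribute to the linear part of a boundary. -/
lemma linPart_d (n : ℕ) (y : P.idx (n + 1) →₀ Alg R) :
    Finsupp.mapRange.linearMap (linPart R) (P.d n y) =
      P.mat n (Finsupp.mapRange.linearMap (aug R).toLinearMap y) := by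
  ext j
  rw [Finsupp.mapRange.linearMap_apply, Finsupp.mapRange_apply, d_apply, Finsupp.sum, map_sum]
  have h : P.mat n (Finsupp.mapRange.linearMap (aug R).toLinearMap y) =
      ∑ i ∈ y.support, aug R (y i) • P.mat n (Finsupp.single i 1) := by
    conv_lhs => rw [← Finsupp.sum_single y, Finsupp.sum, map_sum, map_sum]
    refine Finset.sum_congr rfl fun i _ => ?_
    rw [← map_smul]; congr 1
    simp
  rw [h, Finsupp.finsetSum_apply]
  refine Finset.sum_congr rfl fun i _ => ?_
  rw [linPart_mul, aug_gen, linPart_gen, zero_smul, add_zero, Finsupp.smul_apply]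

/-- The constant vector `x` is a cycle, hence a boundary by exactness, and boundaries have no
constant term. -/
lemma const_eq_zero_of_exact {n : ℕ} (x : P.idx (n + 1) →₀ k) (h : P.mat n x = 0) : x = 0 := by
  have h1 : P.d n (P.const (n + 1) x) = 0 := by rw [d_const, h, map_zero]
  obtain ⟨y, hy⟩ := (P.exact_succ n _).mp h1
  ext i
  have h2 := P.aug_d (n + 1) y i
  rw [hy] at h2
  simpa [const] using h2

lemma mat_injective (n : ℕ) : Function.Injective (P.mat n) :=
  (injective_iff_map_eq_zero _).mpr fun x h => P.const_eq_zero_of_exact x h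

lemma linPart_lin (n : ℕ) (x : P.idx n →₀ V) :
    Finsupp.mapRange.linearMap (linPart R) (P.lin n x) = x := by
  ext j; simp [lin]

lemma mat_zero_surjective : Function.Surjective (P.mat 0) := by
  intro x
  obtain ⟨y, hy⟩ := (P.exact_zero (P.lin 0 x)).mp (by simp [lin])
  exact ⟨_, (P.linPart_d 0 y).symm.trans (by rw [hy, linPart_lin])⟩

/-- This is exactness in the lowest degree: a linear cycle is the boundary of some `y`, and
comparing linear parts shows that `y` may be replaced by its constant part. -/
lemma mem_range_mat (n : ℕ) (x : P.idx (n + 1) →₀ V) :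
    x ∈ LinearMap.range (P.mat (n + 1)) ↔ P.d n (P.lin (n + 1) x) = 0 := by
  constructor
  · rintro ⟨y, rfl⟩
    rw [← d_const]
    exact (P.exact_succ n _).mpr ⟨_, rfl⟩
  · intro h
    obtain ⟨y, hy⟩ := (P.exact_succ n _).mp h
    exact ⟨_, (P.linPart_d _ y).symm.trans (by rw [hy, linPart_lin])⟩

/-- The map `∑ v_j e_j ↦ ∑ v_j f(e_j)` to the tensor algebra. -/
noncomputable def ext (n : ℕ) (f : (P.idx n →₀ k) →ₗ[k] TensorAlgebra k V) :
    (P.idx n →₀ V) →ₗ[k] TensorAlgebra k V :=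
  Finsupp.lsum k fun j => LinearMap.mulRight k (f (Finsupp.single j 1)) ∘ₗ TensorAlgebra.ι k

/-- The identification of `k^(J_n)` with a subspace of the tensor algebra. -/
noncomputable def toTensor : ∀ n, (P.idx n →₀ k) →ₗ[k] TensorAlgebra k V
  | 0 => Finsupp.linearCombination k fun _ => 1
  | n + 1 => P.ext n (toTensor n) ∘ₗ P.mat n

lemma ext_apply (n : ℕ) (f : (P.idx n →₀ k) →ₗ[k] TensorAlgebra k V) (x : P.idx n →₀ V) :
    P.ext n f x = x.sum fun j v => TensorAlgebra.ι k v * f (Finsupp.single j 1) := by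
  rw [ext, Finsupp.lsum_apply]; rfl

lemma ext_mem (n : ℕ) (f : (P.idx n →₀ k) →ₗ[k] TensorAlgebra k V) (x : P.idx n →₀ V) :
    P.ext n f x ∈ V1 k V * LinearMap.range f := by
  rw [ext_apply]
  exact Submodule.sum_mem _ fun j _ => Submodule.mul_mem_mul (mem_V1 _) ⟨_, rfl⟩

lemma range_ext (n : ℕ) (f : (P.idx n →₀ k) →ₗ[k] TensorAlgebra k V) :
    LinearMap.range (P.ext n f) = V1 k V * LinearMap.range f := by
  refine le_antisymm (by rintro _ ⟨x, rfl⟩; exact P.ext_mem n f x) ?_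
  rw [Submodule.mul_le]
  rintro _ ⟨v, rfl⟩ _ ⟨y, rfl⟩
  refine ⟨y.sum fun j c => Finsupp.single j (c • v), ?_⟩
  conv_rhs => rw [← Finsupp.sum_single y]
  simp only [Finsupp.sum, map_sum, Finset.mul_sum]
  refine Finset.sum_congr rfl fun j _ => ?_
  rw [ext_apply, Finsupp.sum_single_index (by simp), map_smul, smul_mul_assoc, ← mul_smul_comm,
    ← map_smul, Finsupp.smul_single, smul_eq_mul, mul_one]

lemma linearIndependent_single {n : ℕ} {f : (P.idx n →₀ k) →ₗ[k] TensorAlgebra k V}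
    (hf : Function.Injective f) : LinearIndependent k fun j => f (Finsupp.single j 1) := by
  have h := (Finsupp.basisSingleOne (R := k) (ι := P.idx n)).linearIndependent.map' f
    (LinearMap.ker_eq_bot.mpr hf)
  simpa [Function.comp_def] using h

lemma ext_injective {n : ℕ} {f : (P.idx n →₀ k) →ₗ[k] TensorAlgebra k V}
    (hf : Function.Injective f) (hr : LinearMap.range f ≤ V1 k V ^ n) :
    Function.Injective (P.ext n f) := by
  refine (injective_iff_map_eq_zero _).mpr fun x hx => Finsupp.ext fun j => ?_
  have h := coeff_mem (P := ⊥) (linearDisjoint_V1 1 n) (P.linearIndependent_single hf)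
    (fun j => hr ⟨_, rfl⟩) (Finsupp.mapRange.linearMap (TensorAlgebra.ι k) x)
    (fun j => by simpa using mem_V1 (x j)) bot_le (by
      rw [Finsupp.mapRange.linearMap_apply, Finsupp.sum_mapRange_index (by simp), ← ext_apply, hx]
      exact zero_mem _) j
  simpa using h

/-- The conditions that define `R_{n+2}` split according to the place of `R`. With `R` in the first
two places the condition is `R V^n`; with `R` further right all conditions concern the last `n + 1`
factors and together say `V R_{n+1}`. -/
lemma Rsub_add_two (n : ℕ) :
    Rsub R (n + 2) = V1 k V * Rsub R (n + 1) ⊓ RT R * V1 k V ^ n := by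
  refine le_antisymm (le_inf ?_ ?_) (le_inf ?_ ?_)
  · have := Rsub_add_le R 1 (n + 1)
    rwa [Rsub_one, show 1 + (n + 1) = n + 2 by ring] at this
  · refine inf_le_right.trans (iInf_le_of_le 0 (iInf_le_of_le n (iInf_le_of_le (by ring) ?_)))
    rw [pow_zero, one_mul]
  · refine inf_le_left.trans ((mul_le_mul' le_rfl (Rsub_le R _)).trans ?_)
    rw [← pow_succ']
  · refine le_iInf fun i => le_iInf fun j => le_iInf fun h => ?_
    rcases i with _ | i
    · obtain rfl : j = n := by omega
      rw [pow_zero, one_mul]; exact inf_le_right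
    · refine inf_le_left.trans ?_
      rw [pow_succ', mul_assoc, mul_assoc]
      refine mul_le_mul' le_rfl (inf_le_right.trans (iInf_le_of_le i (iInf_le_of_le j
        (iInf_le_of_le (by omega) ?_))))
      rw [mul_assoc]

/-- Applying the matrix twice inside the tensor algebra gives coefficients in `V^2` in front of
linearly independent tensors of degree `n`. The classes of these coefficients in the quadratic
algebra are the entries of the boundary of `x`. Since degree two has no relations besides `R`, the
boundary vanishes exactly when all coefficients lie in `R`, that is, when the tensor lies in `R
V^n`. -/
lemma mem_range_mat_iff (n : ℕ) (hi : Function.Injective (P.toTensor n))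
    (hr : LinearMap.range (P.toTensor n) ≤ V1 k V ^ n) (x : P.idx (n + 1) →₀ V) :
    x ∈ LinearMap.range (P.mat (n + 1)) ↔
      P.ext (n + 1) (P.toTensor (n + 1)) x ∈ RT R * V1 k V ^ n := by
  classical
  -- The entries of the boundary of `x`, with the products of elements of `V` formed in the tensor
  -- algebra instead of its quotient.
  let q : P.idx n →₀ TensorAlgebra k V := x.sum fun i v =>
    Finsupp.mapRange.linearMap (LinearMap.mulLeft k (TensorAlgebra.ι k v) ∘ₗ TensorAlgebra.ι k)
      (P.mat n (Finsupp.single i 1))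
  have hq : ∀ j, q j = x.sum fun i v =>
      TensorAlgebra.ι k v * TensorAlgebra.ι k (P.mat n (Finsupp.single i 1) j) := by
    intro j
    simp only [q, Finsupp.sum, Finsupp.finsetSum_apply]
    exact Finset.sum_congr rfl fun i _ => by simp
  have hq2 : ∀ j, q j ∈ V1 k V ^ 2 := fun j => by
    rw [hq, pow_two]
    exact Submodule.sum_mem _ fun i _ => Submodule.mul_mem_mul (mem_V1 _) (mem_V1 _)
  have hd : ∀ j, P.d n (P.lin (n + 1) x) j = quot R (q j) := by
    intro j
    rw [d_apply, hq, Finsupp.sum, lin, Finsupp.mapRange.linearMap_apply]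
    have : (Finsupp.mapRange (gen R) (map_zero _) x).sum
        (fun i a => a * gen R (P.mat n (Finsupp.single i 1) j)) = x.sum fun i v =>
        gen R v * gen R (P.mat n (Finsupp.single i 1) j) :=
      Finsupp.sum_mapRange_index (by simp)
    refine this.trans ?_
    simp only [Finsupp.sum, map_sum]
    exact Finset.sum_congr rfl fun i _ => by rw [map_mul]; rfl
  have he : P.ext (n + 1) (P.toTensor (n + 1)) x =
      q.sum fun j y => y * P.toTensor n (Finsupp.single j 1) := by
    have h1 : q.sum (fun j y => y * P.toTensor n (Finsupp.single j 1)) =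
        Finsupp.lsum k (fun j => LinearMap.mulRight k (P.toTensor n (Finsupp.single j 1))) q := by
      rw [Finsupp.lsum_apply]; rfl
    rw [h1, ext_apply]
    simp only [q, Finsupp.sum, map_sum]
    refine Finset.sum_congr rfl fun i _ => ?_
    rw [toTensor, LinearMap.comp_apply, ext_apply, Finsupp.lsum_apply,
      Finsupp.mapRange.linearMap_apply, Finsupp.sum_mapRange_index (by simp), Finsupp.sum,
      Finset.mul_sum, Finsupp.sum]
    exact Finset.sum_congr rfl fun j _ => by simp [mul_assoc]
  rw [mem_range_mat, he]
  constructor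
  · intro h
    refine Submodule.sum_mem _ fun j _ => Submodule.mul_mem_mul
      (mem_RT_of_quot_eq_zero R (hq2 j) ?_) (hr ⟨_, rfl⟩)
    rw [← hd, h]; rfl
  · intro h
    ext j
    rw [hd]
    exact quot_eq_zero_of_mem R (coeff_mem (linearDisjoint_V1 2 n)
      (P.linearIndependent_single hi) (fun j => hr ⟨_, rfl⟩) q hq2 (RT_le R) h j)

/-- In the inductive step, vectors over `V` correspond to `V R_{n+1}`, and those in the range of the
next matrix are the ones whose tensor lies in `R V^n`. This is the recursion `Rsub_add_two`. The
criterion for the range looks two degrees down, hence the two-step induction. -/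
lemma toTensor_spec (n : ℕ) : Function.Injective (P.toTensor n) ∧
    LinearMap.range (P.toTensor n) = Rsub R n := by
  induction n using Nat.twoStepInduction with
  | zero =>
    have hz : ∀ x, P.toTensor 0 x = algebraMap k _ (x default) := fun x => by
      have hx : x = Finsupp.single default (x default) := by
        refine Finsupp.ext fun j => ?_; rw [Subsingleton.elim j default]; simp
      rw [toTensor]
      conv_lhs => rw [hx]
      rw [Finsupp.linearCombination_single, Algebra.algebraMap_eq_smul_one]
    refine ⟨fun x y h => ?_, ?_⟩
    · rw [hz, hz] at h
      refine Finsupp.ext fun j => ?_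
      rw [Subsingleton.elim j default]
      exact (TensorAlgebra.algebraMap_leftInverse V).injective h
    · rw [Rsub_zero]
      ext t
      rw [Submodule.mem_one]
      exact ⟨fun ⟨x, hx⟩ => ⟨_, (hz x).symm.trans hx⟩,
        fun ⟨c, hc⟩ => ⟨Finsupp.single default c, by rw [hz]; simpa using hc⟩⟩
  | one =>
    have hz : P.toTensor 0 (Finsupp.single default 1) = 1 := by simp [toTensor]
    have he : ∀ x, P.ext 0 (P.toTensor 0) x = TensorAlgebra.ι k (x default) := fun x => by
      have hx : x = Finsupp.single default (x default) := by
        refine Finsupp.ext fun j => ?_; rw [Subsingleton.elim j default]; simp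
      rw [ext_apply]
      conv_lhs => rw [hx]
      rw [Finsupp.sum_single_index (by simp), hz, mul_one]
    have h1 : Function.Injective (P.ext 0 (P.toTensor 0)) := fun x y h => by
      rw [he, he, TensorAlgebra.ι_inj] at h
      refine Finsupp.ext fun j => ?_; rw [Subsingleton.elim j default, h]
    refine ⟨h1.comp (P.mat_injective 0), ?_⟩
    rw [toTensor, LinearMap.range_comp, LinearMap.range_eq_top.mpr P.mat_zero_surjective,
      Submodule.map_top, Rsub_one]
    ext t
    exact ⟨fun ⟨x, hx⟩ => ⟨_, (he x).symm.trans hx⟩,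
      fun ⟨v, hv⟩ => ⟨Finsupp.single default v, by rw [he]; simpa using hv⟩⟩
  | more n ih0 ih1 =>
    have hr1 : LinearMap.range (P.toTensor (n + 1)) ≤ V1 k V ^ (n + 1) :=
      ih1.2.le.trans (Rsub_le R _)
    have hx := P.ext_injective ih1.1 hr1
    refine ⟨hx.comp (P.mat_injective (n + 1)), ?_⟩
    rw [Rsub_add_two, ← ih1.2, ← range_ext]
    have hm := P.mem_range_mat_iff n ih0.1 (ih0.2.le.trans (Rsub_le R _))
    ext t
    constructor
    · rintro ⟨y, rfl⟩
      exact ⟨⟨_, rfl⟩, (hm _).mp ⟨y, rfl⟩⟩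
    · rintro ⟨⟨x, rfl⟩, h⟩
      obtain ⟨y, hy⟩ := (hm x).mpr h
      exact ⟨y, by rw [← hy]; rfl⟩

lemma toTensor_injective (n : ℕ) : Function.Injective (P.toTensor n) := (P.toTensor_spec n).1

lemma range_toTensor (n : ℕ) : LinearMap.range (P.toTensor n) = Rsub R n := (P.toTensor_spec n).2

end LinRes

end Resolution
end QuadAlg

namespace QuadAlg

open TensorProduct

/-! ### Ext groups computed from the linear resolution -/

namespace LinRes

variable {k V : Type u} [Field k] [AddCommGroup V] [Module k V] {R : Submodule k (V ⊗[k] V)}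
  (P : LinRes R)

/-- The terms of the resolution, as objects of the category of modules. -/
noncomputable abbrev obj (n : ℕ) : ModuleCat.{u} (Alg R) := ModuleCat.of _ (P.idx n →₀ Alg R)

/-- The complex of free modules underlying the resolution. -/
noncomputable def complex : ChainComplex (ModuleCat.{u} (Alg R)) ℕ :=
  ChainComplex.of P.obj (fun n => ModuleCat.ofHom (P.d n)) fun n =>
    ModuleCat.hom_ext (LinearMap.ext fun _ => (P.exact_succ n).apply_apply_eq_zero _)

lemma complex_d (n : ℕ) : P.complex.d (n + 1) n = ModuleCat.ofHom (P.d n) := by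
  unfold complex
  exact ChainComplex.of_d P.obj (fun n => ModuleCat.ofHom (P.d n)) n

/-- The augmentation of the resolution. -/
noncomputable def augmentation : P.obj 0 ⟶ trivialModule R :=
  ModuleCat.ofHom (X := P.idx 0 →₀ Alg R) (Y := (trivialModule R : Type u))
    { toFun := fun (y : P.idx 0 →₀ Alg R) => aug R (y default)
      map_add' := fun _ _ => map_add (aug R) _ _
      map_smul' := fun _ _ => map_mul (aug R) _ _ }

lemma augmentation_apply (y : P.idx 0 →₀ Alg R) :
    P.augmentation.hom y = aug R (y default) := rfl

lemma augmentation_surjective : Function.Surjective P.augmentation.hom := fun (c : k) =>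
  ⟨(Finsupp.single default (algebraMap k (Alg R) c) : P.idx 0 →₀ Alg R), by
    rw [augmentation_apply, Finsupp.single_eq_same, AlgHom.commutes]; rfl⟩

lemma complex_d_comp_augmentation : P.complex.d 1 0 ≫ P.augmentation = 0 := by
  rw [complex_d]
  exact ModuleCat.hom_ext (LinearMap.ext fun x => P.exact_zero.apply_apply_eq_zero x)

lemma exact_augmentation :
    (ShortComplex.mk _ _ P.complex_d_comp_augmentation).Exact ∧ Epi P.augmentation := by
  refine ⟨?_, (ModuleCat.epi_iff_surjective _).mpr P.augmentation_surjective⟩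
  rw [ShortComplex.moduleCat_exact_iff]
  intro x hx
  obtain ⟨y, hy⟩ := (P.exact_zero x).mp hx
  exact ⟨y, (congrArg (fun t => t.hom y) (P.complex_d 0)).trans hy⟩

/-- The projective resolution given by a linear free resolution. -/
noncomputable def projRes : ProjectiveResolution (trivialModule R) where
  complex := P.complex
  projective n := inferInstanceAs (Projective (P.obj n))
  π := (ChainComplex.toSingle₀Equiv _ _).symm ⟨P.augmentation, P.complex_d_comp_augmentation⟩
  quasiIso := ⟨fun n => by
    cases n with
    | zero =>
      -- In degree zero the condition says that the augmented complex is exact at the first free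
      -- module and that the augmentation is surjective.
      rw [ChainComplex.quasiIsoAt₀_iff, ShortComplex.quasiIso_iff_of_zeros']
      · refine (ShortComplex.exact_and_epi_g_iff_of_iso ?_).2 P.exact_augmentation
        exact ShortComplex.isoMk (Iso.refl _) (Iso.refl _) (Iso.refl _)
          ((Category.id_comp _).trans (Category.comp_id _).symm)
          ((Category.id_comp _).trans (Category.comp_id _).symm)
      all_goals rfl
    | succ n =>
      rw [quasiIsoAt_iff_exactAt']
      · rw [HomologicalComplex.exactAt_iff' _ (n + 1 + 1) (n + 1) n (by simp) (by simp),
          ShortComplex.moduleCat_exact_iff]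
        intro x hx
        have hx' : P.d n x = 0 := (congrArg (fun t => t.hom x) (P.complex_d n)).symm.trans hx
        obtain ⟨y, hy⟩ := (P.exact_succ n x).mp hx'
        exact ⟨y, (congrArg (fun t => t.hom y) (P.complex_d (n + 1))).trans hy⟩
      · apply ChainComplex.exactAt_succ_single_obj⟩

lemma hom_eq_zero_of_aug (n : ℕ) (g : P.obj n ⟶ trivialModule R) (y : P.idx n →₀ Alg R)
    (hy : ∀ j, aug R (y j) = 0) : g.hom y = 0 := by
  have h : y = y.sum fun j a => a • Finsupp.single j (1 : Alg R) := by
    conv_lhs => rw [← Finsupp.sum_single y]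
    exact Finset.sum_congr rfl fun j _ => by simp
  rw [h, Finsupp.sum, map_sum]
  refine Finset.sum_eq_zero fun j _ => ?_
  rw [map_smul]
  exact (congrArg (fun c : k => c * (show k from g.hom (Finsupp.single j 1))) (hy j)).trans
    (zero_mul (M₀ := k) _)

/-- The map of left modules with prescribed values on the basis. -/
noncomputable def coeffHom (n : ℕ) (f : P.idx n → Alg R) :
    P.obj n ⟶ ModuleCat.of (Alg R) (Alg R) :=
  ModuleCat.ofHom (Finsupp.linearCombination (Alg R) f)

lemma coeffHom_apply (n : ℕ) (f : P.idx n → Alg R) (y : P.idx n →₀ Alg R) :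
    (P.coeffHom n f).hom y = y.sum fun j a => a * f j :=
  Finsupp.linearCombination_apply _ _

lemma coeffHom_single (n : ℕ) (f : P.idx n → Alg R) (j : P.idx n) :
    (P.coeffHom n f).hom (Finsupp.single j 1) = f j := by
  rw [coeffHom_apply, Finsupp.sum_single_index (by simp), one_mul]

/-- Coboundaries with values in `A` have entries in the augmentation ideal, because the
differentials do. Hence a constant cochain is a coboundary only if it is zero; all the information
drawn from `Ext(k, A)` rests on this. -/
lemma aug_hom_d (n : ℕ) (g : P.obj n ⟶ ModuleCat.of (Alg R) (Alg R))
    (y : P.idx (n + 1) →₀ Alg R) : aug R (g.hom (P.d n y)) = 0 := by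
  have h : P.d n y = (P.d n y).sum fun j a => a • Finsupp.single j (1 : Alg R) := by
    conv_lhs => rw [← Finsupp.sum_single (P.d n y)]
    exact Finset.sum_congr rfl fun j _ => by simp
  rw [h, Finsupp.sum, map_sum, map_sum]
  refine Finset.sum_eq_zero fun j _ => ?_
  rw [map_smul, smul_eq_mul, map_mul, aug_d, zero_mul]

lemma projRes_d (n : ℕ) : P.projRes.complex.d (n + 1) n = ModuleCat.ofHom (P.d n) := P.complex_d n

lemma projRes_d_comp_eq_zero_iff {n : ℕ} {Y : ModuleCat.{u} (Alg R)} (f : P.obj n ⟶ Y) :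
    P.projRes.complex.d (n + 1) n ≫ f = 0 ↔
      ∀ i, f.hom (P.d n (Finsupp.single i 1)) = 0 := by
  rw [projRes_d]
  constructor
  · intro h i
    exact congrArg (fun t => t.hom (Finsupp.single i 1)) h
  · intro h
    refine ModuleCat.hom_ext (Finsupp.lhom_ext' fun i => LinearMap.ext_ring ?_)
    exact h i

lemma extMk_congr {n : ℕ} {Y : ModuleCat.{u} (Alg R)} {f g : P.obj n ⟶ Y} (h : f = g)
    (hf : P.projRes.complex.d (n + 1) n ≫ f = 0) (hg : P.projRes.complex.d (n + 1) n ≫ g = 0) :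
    P.projRes.extMk f (n + 1) rfl hf = P.projRes.extMk g (n + 1) rfl hg := by
  subst h; rfl

/-- A cocycle of positive degree with trivial class is a coboundary. -/
lemma exists_of_extMk_eq_zero {n : ℕ} {Y : ModuleCat.{u} (Alg R)} (f : P.obj (n + 1) ⟶ Y)
    (hf : P.projRes.complex.d (n + 2) (n + 1) ≫ f = 0)
    (h : P.projRes.extMk f (n + 2) rfl hf = 0) :
    ∃ g : P.obj n ⟶ Y, ∀ y, g.hom (P.d n y) = f.hom y := by
  obtain ⟨g, hg⟩ := (P.projRes.extMk_eq_zero_iff f (n + 2) rfl hf n rfl).mp h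
  refine ⟨g, fun y => ?_⟩
  rw [projRes_d] at hg
  exact congrArg (fun t => t.hom y) hg

/-- By minimality the differentials of `Hom(P, k)` are zero. A basis element would give a coordinate
functional that is a cocycle without being a coboundary, hence a nonzero class in `Ext(k, k)`. -/
lemma isEmpty_idx {n : ℕ} (h : Subsingleton (Abelian.Ext (trivialModule R) (trivialModule R) (n + 1))) :
    IsEmpty (P.idx (n + 1)) := by
  refine ⟨fun i => ?_⟩
  let f : P.obj (n + 1) ⟶ trivialModule R :=
    ModuleCat.ofHom (X := P.idx (n + 1) →₀ Alg R) (Y := (trivialModule R : Type u))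
      { toFun := fun (y : P.idx (n + 1) →₀ Alg R) => aug R (y i)
        map_add' := fun _ _ => map_add (aug R) _ _
        map_smul' := fun _ _ => map_mul (aug R) _ _ }
  have hf : P.projRes.complex.d (n + 2) (n + 1) ≫ f = 0 :=
    (P.projRes_d_comp_eq_zero_iff f).mpr fun j => P.aug_d _ _ _
  obtain ⟨g, hg⟩ := P.exists_of_extMk_eq_zero f hf (Subsingleton.elim _ _)
  have h1 := hg (Finsupp.single i 1)
  rw [P.hom_eq_zero_of_aug n g _ (P.aug_d _ _)] at h1
  have h2 : f.hom (Finsupp.single i 1) = (show (trivialModule R : Type u) from (1 : k)) := by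
    change aug R ((Finsupp.single i 1 : P.idx (n + 1) →₀ Alg R) i) = 1
    rw [Finsupp.single_eq_same, map_one]
  exact zero_ne_one (α := k) (h1.trans h2)

/-- There are no coboundaries in degree zero, so this case is separate: a cocycle factors through
the augmentation, and the resulting map out of the trivial module is an element of `Ext^0`. -/
lemma eq_zero_of_hom_subsingleton {Y : ModuleCat.{u} (Alg R)}
    (h : Subsingleton (Abelian.Ext (trivialModule R) Y 0)) (f : P.obj 0 ⟶ Y)
    (hf : P.projRes.complex.d 1 0 ≫ f = 0) : f = 0 := by
  obtain ⟨h1, h2⟩ := P.exact_augmentation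
  have : Epi (ShortComplex.mk _ _ P.complex_d_comp_augmentation).g := h2
  have h3 := h1.g_desc f hf
  have h4 : h1.desc f hf = 0 := Abelian.Ext.addEquiv₀.symm.injective (Subsingleton.elim _ _)
  exact h3.symm.trans ((congrArg _ h4).trans Limits.comp_zero)

/-- A functional on `k^(J_n)`, with values in `TV/(R)`. -/
noncomputable abbrev constHom (n : ℕ) (f : P.idx n → k) :
    P.obj n ⟶ ModuleCat.of (Alg R) (Alg R) :=
  P.coeffHom n fun j => algebraMap k (Alg R) (f j)

lemma constHom_d_single (n : ℕ) (f : P.idx n → k) (i : P.idx (n + 1)) :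
    (P.constHom n f).hom (P.d n (Finsupp.single i 1)) =
      gen R ((P.mat n (Finsupp.single i 1)).sum fun j v => f j • v) := by
  have h : P.d n (Finsupp.single i 1) = P.lin n (P.mat n (Finsupp.single i 1)) := by
    rw [← d_const]; congr 1; simp [const]
  rw [h, coeffHom_apply, lin, Finsupp.mapRange.linearMap_apply,
    Finsupp.sum_mapRange_index (by simp)]
  simp only [Finsupp.sum, map_sum]
  refine Finset.sum_congr rfl fun j _ => ?_
  rw [map_smul, ← Algebra.commutes, ← Algebra.smul_def]

/-- The hypothesis `hf` makes the constant cochain a cocycle, so the vanishing of `Ext^n` makes it a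
coboundary (or zero, for `n = 0`). Its entries then have augmentation zero, while the augmentation
of a constant is the constant itself. -/
lemma eq_zero_of_constHom_cocycle {n : ℕ} (f : P.idx n → k)
    (h : Subsingleton (Abelian.Ext (trivialModule R) (ModuleCat.of (Alg R) (Alg R)) n))
    (hf : ∀ i, ((P.mat n (Finsupp.single i 1)).sum fun j v => f j • v) = 0) (j : P.idx n) :
    f j = 0 := by
  have hc : P.projRes.complex.d (n + 1) n ≫ P.constHom n f = 0 :=
    (P.projRes_d_comp_eq_zero_iff _).mpr fun i => by rw [constHom_d_single, hf, map_zero]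
  have h1 := P.coeffHom_single n (fun j => algebraMap k (Alg R) (f j)) j
  have h2 : aug R (algebraMap k (Alg R) (f j)) = f j := AlgHom.commutes _ _
  rw [← h2, ← h1]
  cases n with
  | zero =>
    have h3 : P.constHom 0 f = 0 := P.eq_zero_of_hom_subsingleton h _ hc
    exact (congrArg (fun t => aug R (t.hom (Finsupp.single j 1))) h3).trans (map_zero _)
  | succ n =>
    obtain ⟨g, hg⟩ := P.exists_of_extMk_eq_zero _ hc (Subsingleton.elim _ _)
    rw [← hg]
    exact P.aug_hom_d n g _

/-- The resolution stops at `n`, so every cochain of degree `n` is a cocycle. Constant cochains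
embed in `Ext^n(k, A)`, because none but zero is a coboundary, so the rank is at most one; rank zero
would make `Ext^n(k, A)` vanish. -/
lemma finrank_top {n : ℕ} (hn : IsEmpty (P.idx (n + 1)))
    (e : Abelian.Ext (trivialModule R) (ModuleCat.of (Alg R) (Alg R)) n ≃+ k)
    (he : ∀ x a, e (x.comp (Abelian.Ext.mk₀ (rightMul R a)) (add_zero n)) = e x * aug R a) :
    Module.finrank k (P.idx n →₀ k) = 1 := by
  have hc : ∀ f : P.obj n ⟶ ModuleCat.of (Alg R) (Alg R),
      P.projRes.complex.d (n + 1) n ≫ f = 0 :=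
    fun f => (P.projRes_d_comp_eq_zero_iff f).mpr fun i => (hn.false i).elim
  have hne : Nonempty (P.idx n) := by
    by_contra hne
    rw [not_nonempty_iff] at hne
    obtain ⟨x, hx⟩ := e.surjective 1
    obtain ⟨f, hf, rfl⟩ := P.projRes.extMk_surjective x (n + 1) rfl
    have h0 : f = 0 := ModuleCat.hom_ext (Finsupp.lhom_ext' fun i => (hne.false i).elim)
    subst h0
    rw [ProjectiveResolution.extMk_zero, map_zero] at hx
    exact zero_ne_one hx
  cases n with
  | zero => rw [Module.finrank_finsupp_self, Fintype.card_unique]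
  | succ n =>
    have hs : ∀ (f : P.idx (n + 1) →₀ k) i, (P.constHom (n + 1) f).hom (Finsupp.single i 1) =
        algebraMap k (Alg R) (f i) := fun f i => P.coeffHom_single _ _ i
    let κ : (P.idx (n + 1) →₀ k) →ₗ[k] k :=
      { toFun := fun f => e (P.projRes.extMk (P.constHom (n + 1) f) (n + 2) rfl (hc _))
        map_add' := fun f g => by
          refine Eq.trans (congrArg e ?_) (map_add e _ _)
          refine Eq.trans (P.extMk_congr ?_ _ _) (P.projRes.add_extMk (P.constHom (n + 1) f)
            (P.constHom (n + 1) g) (n + 2) rfl (hc _) (hc _)).symm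
          refine ModuleCat.hom_ext (Finsupp.lhom_ext' fun i => LinearMap.ext_ring ?_)
          exact (hs _ i).trans ((map_add (algebraMap k (Alg R)) _ _).trans
            (congrArg₂ (· + ·) (hs f i).symm (hs g i).symm))
        -- The isomorphism `e` is only additive, but it respects the right action of `A`. Scaling a
        -- cochain by `c` is composition with right multiplication by `c`, on which `e` is known.
        map_smul' := fun c f => by
          rw [RingHom.id_apply, smul_eq_mul, mul_comm c]
          have h2 : aug R (algebraMap k (Alg R) c) = c := AlgHom.commutes _ _
          conv_rhs => rw [← h2]
          rw [← he]
          refine congrArg e (Eq.trans (P.extMk_congr ?_ _ _) (P.projRes.extMk_comp_mk₀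
            (P.constHom (n + 1) f) (n + 2) rfl (hc _) (rightMul R (algebraMap k (Alg R) c))).symm)
          refine ModuleCat.hom_ext (Finsupp.lhom_ext' fun i => LinearMap.ext_ring ?_)
          refine (hs _ i).trans ((map_mul (algebraMap k (Alg R)) c (f i)).trans ?_)
          exact (Algebra.commutes _ _).trans (congrArg (· * _) (hs f i).symm) }
    have hκ : Function.Injective κ := (injective_iff_map_eq_zero κ).mpr fun f hf => by
      have h1 := e.map_eq_zero_iff.mp hf
      obtain ⟨g, hg⟩ := P.exists_of_extMk_eq_zero _ _ h1
      ext j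
      have h3 := P.aug_hom_d n g (Finsupp.single j 1)
      rw [hg, coeffHom_single] at h3
      exact (AlgHom.commutes (aug R) (f j)).symm.trans h3
    have := FiniteDimensional.of_injective κ hκ
    have h1 := LinearMap.finrank_le_finrank_of_injective hκ
    rw [Module.finrank_self] at h1
    have h2 : 0 < Module.finrank k (P.idx (n + 1) →₀ k) := Module.finrank_pos
    omega

end LinRes

/-! ### Regularity expressed through the spaces `R_a` -/

section Frobenius

variable {k V : Type u} [Field k] [AddCommGroup V] [Module k V]

/-- The consequences of regularity for the spaces `R_a` on which the construction of the fiber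
functor rests: `R_{d+1} = 0`, `dim R_d = 1`, and no proper subspace `Q ⊂ R_i` satisfies
`R_{i+1} ⊆ V ⊗ Q` if `i < d`. -/
structure IsFrobenius (R : Submodule k (V ⊗[k] V)) (d : ℕ) : Prop where
  eq_bot : Rsub R (d + 1) = ⊥
  finrank_eq_one : Module.finrank k (Rsub R d) = 1
  eq_zero : ∀ i < d, ∀ φ : Module.Dual k ↥(Rsub R i),
    (∀ (x : TensorAlgebra k V) (_ : x ∈ Rsub R (i + 1)) (h : x ∈ V1 k V * Rsub R i),
      contrR (linearDisjoint (pow_one (V1 k V)).ge (Rsub_le R i)) φ ⟨x, h⟩ = 0) → φ = 0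

/-- Each clause is a fact about `Ext` carried through the identification of the generators in degree
`n` with `R_n`. The first comes from `Ext^{d+1}(k, k) = 0`, the second from `Ext^d(k, A) ≅ k`, the
third from `Ext^i(k, A) = 0` for `i < d`. -/
lemma isFrobenius {R : Submodule k (V ⊗[k] V)} {d : ℕ} (hK : IsKoszul R)
    (hAS : IsASRegular R d) : IsFrobenius R d := by
  obtain ⟨P⟩ := hK.exists_linRes
  have hpd := hAS.projectiveDimension_le (trivialModule R)
  have hd : IsEmpty (P.idx (d + 1)) :=
    P.isEmpty_idx (HasProjectiveDimensionLT.subsingleton (trivialModule R) (d + 1) (d + 1) le_rfl _)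
  have E : ∀ n, (P.idx n →₀ k) ≃ₗ[k] Rsub R n := fun n =>
    LinearEquiv.ofInjective _ (P.toTensor_injective n) ≪≫ₗ
      LinearEquiv.ofEq _ _ (P.range_toTensor n)
  refine ⟨?_, ?_, fun i hi φ h => ?_⟩
  · rw [← P.range_toTensor, LinearMap.range_eq_bot]
    exact Finsupp.lhom_ext' fun i => (hd.false i).elim
  · obtain ⟨e, he⟩ := hAS.ext_top
    rw [← (E d).finrank_eq, P.finrank_top hd e he]
  · have hmem : ∀ n y, P.toTensor n y ∈ Rsub R n := fun n y => by
      rw [← P.range_toTensor]; exact ⟨y, rfl⟩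
    let u : P.idx i → Rsub R i := fun j => ⟨P.toTensor i (Finsupp.single j 1), hmem _ _⟩
    -- The values of `φ` on the basis form a constant cochain. Its coboundary at a generator `l` is
    -- the contraction along `φ` of the element of `R_{i+1} ⊆ V R_i` that corresponds to `l`, so `h`
    -- makes it a cocycle.
    have h0 := P.eq_zero_of_constHom_cocycle (fun j => φ (u j)) (hAS.ext_eq_zero i hi.ne)
      fun l => by
        have h1 := hmem (i + 1) (Finsupp.single l 1)
        have h2 : P.toTensor (i + 1) (Finsupp.single l 1) =
            ∑ j ∈ (P.mat i (Finsupp.single l 1)).support,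
              ((⟨_, mem_V1 (P.mat i (Finsupp.single l 1) j)⟩ : V1 k V) : TensorAlgebra k V) * u j :=
          P.ext_apply i _ _
        have h3 : P.toTensor (i + 1) (Finsupp.single l 1) ∈ V1 k V * Rsub R i := by
          have := Rsub_add_le R 1 i
          rw [Rsub_one, add_comm] at this
          exact this h1
        have h4 := h _ h1 h3
        have h5 := congrArg Subtype.val ((contrR_sum (linearDisjoint (pow_one (V1 k V)).ge
          (Rsub_le R i)) φ _ (fun j => ⟨_, mem_V1 (P.mat i (Finsupp.single l 1) j)⟩) u
          (h2 ▸ h3)).symm.trans ((congrArg _ (Subtype.ext h2.symm)).trans h4))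
        apply (TensorAlgebra.ι_leftInverse (R := k) (M := V)).injective
        rw [map_zero, Finsupp.sum, map_sum]
        rw [Submodule.coe_sum] at h5
        refine Eq.trans (Finset.sum_congr rfl fun j _ => ?_) h5
        simp
    ext ⟨x, hx⟩
    have hx' := hx
    rw [← P.range_toTensor] at hx'
    obtain ⟨y, rfl⟩ := hx'
    have h6 : φ ∘ₗ (P.toTensor i).codRestrict (Rsub R i) (hmem i) = 0 :=
      Finsupp.lhom_ext' fun j => LinearMap.ext_ring (h0 j)
    exact LinearMap.congr_fun h6 y

end Frobenius
end QuadAlg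

namespace QuadAlg

open TensorProduct

/-! ### Disjointness from the whole tensor algebra -/

section TopDisjoint

variable {k V : Type u} [Field k] [AddCommGroup V] [Module k V]

noncomputable instance : GradedAlgebra fun n : ℕ => V1 k V ^ n :=
  inferInstanceAs (GradedAlgebra
    fun n : ℕ => LinearMap.range (TensorAlgebra.ι k : V →ₗ[k] TensorAlgebra k V) ^ n)

/-- The homogeneous component of degree `n` of an element of the tensor algebra. -/
noncomputable def comp (n : ℕ) : TensorAlgebra k V →ₗ[k] ↥(V1 k V ^ n) :=
  DFinsupp.lapply n ∘ₗ
    (DirectSum.decomposeLinearEquiv fun n : ℕ => V1 k V ^ n).toLinearMap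

lemma eq_zero_of_comp {x : TensorAlgebra k V} (h : ∀ n, comp n x = 0) : x = 0 := by
  have : DirectSum.decompose (fun n : ℕ => V1 k V ^ n) x = 0 := DFinsupp.ext h
  exact (DirectSum.decompose _).injective (this.trans (DirectSum.decompose_zero _).symm)

lemma comp_mul_right {m n : ℕ} (x : TensorAlgebra k V) {y : TensorAlgebra k V}
    (hy : y ∈ V1 k V ^ n) : (comp (m + n) (x * y) : TensorAlgebra k V) = comp m x * y :=
  DirectSum.coe_decompose_mul_add_of_right_mem (fun n : ℕ => V1 k V ^ n) hy

lemma comp_mul_left {m n : ℕ} {x : TensorAlgebra k V} (y : TensorAlgebra k V)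
    (hx : x ∈ V1 k V ^ m) : (comp (m + n) (x * y) : TensorAlgebra k V) = x * comp n y :=
  DirectSum.coe_decompose_mul_add_of_left_mem (fun n : ℕ => V1 k V ^ n) hx

/-- Since the right factors are homogeneous of degree `n`, a relation among products can be tested
on homogeneous components of the left factors, where disjointness of `V^m` and `V^n` applies. This
permits contractions with domain the entire tensor algebra, without tracking subspaces in the types.
-/
lemma linearDisjoint_top_V1 (n : ℕ) :
    (⊤ : Submodule k (TensorAlgebra k V)).LinearDisjoint (V1 k V ^ n) := by
  let b := Module.Basis.ofVectorSpace k ↥(V1 k V ^ n)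
  refine Submodule.LinearDisjoint.of_basis_right' _ _ b
    ((injective_iff_map_eq_zero _).mpr fun f hf => Finsupp.ext fun i => Subtype.ext
      (eq_zero_of_comp fun m => ?_))
  have h1 : (V1 k V ^ (m + n)).subtype ∘ₗ comp (m + n) ∘ₗ Submodule.mulRightMap ⊤ b =
      Submodule.mulRightMap (V1 k V ^ m) b ∘ₗ
        Finsupp.mapRange.linearMap (comp m ∘ₗ Submodule.subtype ⊤) :=
    Finsupp.lhom_ext fun i x => by
      simp [Submodule.mulRightMap_apply_single, comp_mul_right]
  have h2 := LinearMap.congr_fun h1 f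
  simp only [LinearMap.comp_apply, hf, map_zero] at h2
  have h3 := LinearMap.ker_eq_bot'.mp
    ((linearDisjoint_V1 m n).linearIndependent_right_of_flat b.linearIndependent) _ h2.symm
  simpa using DFunLike.congr_fun h3 i

lemma linearDisjoint_V1_top (n : ℕ) :
    (V1 k V ^ n).LinearDisjoint (⊤ : Submodule k (TensorAlgebra k V)) := by
  let b := Module.Basis.ofVectorSpace k ↥(V1 k V ^ n)
  refine Submodule.LinearDisjoint.of_basis_left' _ _ b
    ((injective_iff_map_eq_zero _).mpr fun f hf => Finsupp.ext fun i => Subtype.ext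
      (eq_zero_of_comp fun m => ?_))
  have h1 : (V1 k V ^ (n + m)).subtype ∘ₗ comp (n + m) ∘ₗ Submodule.mulLeftMap ⊤ b =
      Submodule.mulLeftMap (V1 k V ^ m) b ∘ₗ
        Finsupp.mapRange.linearMap (comp m ∘ₗ Submodule.subtype ⊤) :=
    Finsupp.lhom_ext fun i x => by
      simp [Submodule.mulLeftMap_apply_single, comp_mul_left]
  have h2 := LinearMap.congr_fun h1 f
  simp only [LinearMap.comp_apply, hf, map_zero] at h2
  have h3 := LinearMap.ker_eq_bot'.mp
    ((linearDisjoint_V1 n m).linearIndependent_left_of_flat b.linearIndependent) _ h2.symm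
  simpa using DFunLike.congr_fun h3 i

end TopDisjoint

/-! ### Contractions on the whole tensor algebra -/

section Contraction

variable {k V : Type u} [Field k] [AddCommGroup V] [Module k V]

/-- A bilinear map on a pair of linearly disjoint subspaces is induced by a linear map on the whole
algebra. -/
lemma exists_extend_mul {T W : Type*} [Ring T] [Algebra k T] [AddCommGroup W] [Module k W]
    {M N : Submodule k T} (H : M.LinearDisjoint N) (f : M →ₗ[k] N →ₗ[k] W) :
    ∃ G : T →ₗ[k] W, ∀ (m : M) (n : N), G (m * n) = f m n := by
  obtain ⟨G, hG⟩ := (TensorProduct.lift f ∘ₗ H.mulMap.symm.toLinearMap).exists_extend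
  refine ⟨G, fun m n => ?_⟩
  have h1 := LinearMap.congr_fun hG (H.mulMap (m ⊗ₜ n))
  simpa using h1

/-- The linear map on the whole algebra obtained by extending a bilinear map on a pair of linearly
disjoint subspaces. -/
noncomputable def extMul {T W : Type*} [Ring T] [Algebra k T] [AddCommGroup W] [Module k W]
    {M N : Submodule k T} (H : M.LinearDisjoint N) (f : M →ₗ[k] N →ₗ[k] W) : T →ₗ[k] W :=
  (exists_extend_mul H f).choose

lemma extMul_mul {T W : Type*} [Ring T] [Algebra k T] [AddCommGroup W] [Module k W]
    {M N : Submodule k T} (H : M.LinearDisjoint N) (f : M →ₗ[k] N →ₗ[k] W) (m : M) (n : N) :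
    extMul H f (m * n) = f m n :=
  (exists_extend_mul H f).choose_spec m n

variable (R : Submodule k (V ⊗[k] V))

lemma linearDisjoint_top_Rsub (b : ℕ) :
    (⊤ : Submodule k (TensorAlgebra k V)).LinearDisjoint (Rsub R b) :=
  (linearDisjoint_top_V1 b).of_le_of_flat_left le_rfl (Rsub_le R b)

lemma linearDisjoint_Rsub_top (b : ℕ) :
    (Rsub R b).LinearDisjoint (⊤ : Submodule k (TensorAlgebra k V)) :=
  (linearDisjoint_V1_top b).of_le_of_flat_left (Rsub_le R b) le_rfl

/-- Contraction from the right along a functional on `R_b`, extended to the whole tensor algebra: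
it sends `a x` to `φ(x) a` for `x ∈ R_b`. -/
noncomputable def rc (b : ℕ) :
    TensorAlgebra k V →ₗ[k] Module.Dual k (Rsub R b) →ₗ[k] TensorAlgebra k V :=
  extMul (linearDisjoint_top_Rsub R b) (LinearMap.mk₂ k
    (fun a x => (Module.Dual.eval k (Rsub R b) x).smulRight (a : TensorAlgebra k V))
    (fun a b x => by ext; simp)
    (fun c a x => by ext φ; exact smul_comm (φ x) c (a : TensorAlgebra k V))
    (fun a x y => by ext; simp [add_smul]) (fun c a x => by ext; simp [mul_smul]))

/-- Contraction from the left along a functional on `R_b`, extended to the whole tensor algebra: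
it sends `x a` to `φ(x) a` for `x ∈ R_b`. -/
noncomputable def lc (b : ℕ) :
    TensorAlgebra k V →ₗ[k] Module.Dual k (Rsub R b) →ₗ[k] TensorAlgebra k V :=
  extMul (linearDisjoint_Rsub_top R b) (LinearMap.mk₂ k
    (fun x a => (Module.Dual.eval k (Rsub R b) x).smulRight (a : TensorAlgebra k V))
    (fun x y a => by ext; simp [add_smul]) (fun c x a => by ext; simp [mul_smul])
    (fun x a b => by ext; simp)
    (fun c x a => by ext φ; exact smul_comm (φ x) c (a : TensorAlgebra k V)))

variable {R} {b : ℕ}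

lemma rc_mul (a : TensorAlgebra k V) (x : Rsub R b) (φ : Module.Dual k (Rsub R b)) :
    rc R b (a * x) φ = φ x • a :=
  LinearMap.congr_fun (extMul_mul (linearDisjoint_top_Rsub R b) _ ⟨a, Submodule.mem_top⟩ x) φ

lemma lc_mul (x : Rsub R b) (a : TensorAlgebra k V) (φ : Module.Dual k (Rsub R b)) :
    lc R b (x * a) φ = φ x • a :=
  LinearMap.congr_fun (extMul_mul (linearDisjoint_Rsub_top R b) _ x ⟨a, Submodule.mem_top⟩) φ

lemma rc_coe (x : Rsub R b) (φ : Module.Dual k (Rsub R b)) :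
    rc R b x φ = algebraMap k _ (φ x) := by
  rw [← one_mul (x : TensorAlgebra k V), rc_mul, Algebra.algebraMap_eq_smul_one]

lemma lc_coe (x : Rsub R b) (φ : Module.Dual k (Rsub R b)) :
    lc R b x φ = algebraMap k _ (φ x) := by
  rw [← mul_one (x : TensorAlgebra k V), lc_mul, Algebra.algebraMap_eq_smul_one]

lemma rc_mem {P : Submodule k (TensorAlgebra k V)} {y : TensorAlgebra k V} (hy : y ∈ P * Rsub R b)
    (φ : Module.Dual k (Rsub R b)) : rc R b y φ ∈ P := by
  induction hy using Submodule.mul_induction_on' with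
  | mem_mul_mem m hm n hn => rw [rc_mul m ⟨n, hn⟩]; exact P.smul_mem _ hm
  | add x _ y _ hx hy => rw [map_add]; exact add_mem hx hy

lemma lc_mem {P : Submodule k (TensorAlgebra k V)} {y : TensorAlgebra k V} (hy : y ∈ Rsub R b * P)
    (φ : Module.Dual k (Rsub R b)) : lc R b y φ ∈ P := by
  induction hy using Submodule.mul_induction_on' with
  | mem_mul_mem m hm n hn => rw [lc_mul ⟨m, hm⟩]; exact P.smul_mem _ hn
  | add x _ y _ hx hy => rw [map_add]; exact add_mem hx hy

/-- A right contraction does not see factors on the left. The hypothesis on `y` cannot be dropped: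
outside `T R_b` the map `rc` is an arbitrary linear extension. -/
lemma rc_mul_left {P : Submodule k (TensorAlgebra k V)} {y : TensorAlgebra k V}
    (hy : y ∈ P * Rsub R b) (a : TensorAlgebra k V) (φ : Module.Dual k (Rsub R b)) :
    rc R b (a * y) φ = a * rc R b y φ := by
  induction hy using Submodule.mul_induction_on' with
  | mem_mul_mem m hm n hn => rw [← mul_assoc, rc_mul _ ⟨n, hn⟩, rc_mul _ ⟨n, hn⟩, mul_smul_comm]
  | add x _ y _ hx hy => simp only [mul_add, map_add, LinearMap.add_apply, hx, hy]

lemma lc_mul_right {P : Submodule k (TensorAlgebra k V)} {y : TensorAlgebra k V}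
    (hy : y ∈ Rsub R b * P) (a : TensorAlgebra k V) (φ : Module.Dual k (Rsub R b)) :
    lc R b (y * a) φ = lc R b y φ * a := by
  induction hy using Submodule.mul_induction_on' with
  | mem_mul_mem m hm n hn => rw [mul_assoc, lc_mul ⟨m, hm⟩, lc_mul ⟨m, hm⟩, smul_mul_assoc]
  | add x _ y _ hx hy => simp only [add_mul, map_add, LinearMap.add_apply, hx, hy]

/-- On a product `x p z` both orders give `φ(x) ψ(z) p`. This commutation is the source of the
associativity of the pairing below and of its two descriptions. -/
lemma lc_rc_comm {a : ℕ} {P : Submodule k (TensorAlgebra k V)} {y : TensorAlgebra k V}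
    (hy : y ∈ Rsub R a * (P * Rsub R b)) (φ : Module.Dual k (Rsub R a))
    (ψ : Module.Dual k (Rsub R b)) :
    lc R a (rc R b y ψ) φ = rc R b (lc R a y φ) ψ := by
  induction hy using Submodule.mul_induction_on' with
  | mem_mul_mem m hm n hn =>
    rw [rc_mul_left hn, lc_mul ⟨m, hm⟩, lc_mul ⟨m, hm⟩, map_smul, LinearMap.smul_apply]
  | add x _ y _ hx hy => simp only [map_add, LinearMap.add_apply, hx, hy]

lemma contrR_eq_rc {M : Submodule k (TensorAlgebra k V)} (H : M.LinearDisjoint (Rsub R b))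
    {y : TensorAlgebra k V} (hy : y ∈ M * Rsub R b) (φ : Module.Dual k (Rsub R b)) :
    (contrR H φ ⟨y, hy⟩ : TensorAlgebra k V) = rc R b y φ := by
  have h : ∀ z : ↥(M * Rsub R b), (contrR H φ z : TensorAlgebra k V) = rc R b z φ := by
    intro z
    obtain ⟨z, rfl⟩ := H.mulMap.surjective z
    induction z using TensorProduct.induction_on with
    | zero => simp only [map_zero, Submodule.coe_zero, LinearMap.zero_apply]
    | add x y hx hy => simp only [map_add, Submodule.coe_add, LinearMap.add_apply, hx, hy]
    | tmul m n =>
      rw [Submodule.LinearDisjoint.val_mulMap_tmul, rc_mul]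
      simp [contrR]
  exact h ⟨y, hy⟩

variable [FiniteDimensional k V]

instance Rsub_finite (b : ℕ) : Module.Finite k (Rsub R b) := by
  have h1 : (V1 k V).FG := by
    rw [V1, LinearMap.range_eq_map]
    exact (Module.Finite.fg_top).map _
  have h2 : Module.Finite k ↥(V1 k V ^ b) := Module.Finite.iff_fg.mpr (h1.pow b)
  exact Submodule.finiteDimensional_of_le (Rsub_le R b)

end Contraction

/-! ### Perfect pairings from a generator of `R_d` -/

section Pairing

variable {k V : Type u} [Field k] [AddCommGroup V] [Module k V] {R : Submodule k (V ⊗[k] V)}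
  {d : ℕ} (hF : IsFrobenius R d) {t : TensorAlgebra k V} (ht : t ∈ Rsub R d) (ht0 : t ≠ 0)

-- Downward induction on `b`. For `b = d` the space is the line through `t`. Otherwise contraction
-- along `φ` maps `R_{b+1}` to `V`; composed with any functional on `V` it gives a functional on
-- `R_{b+1}` along which `t` contracts to zero, since the iterated contraction already vanishes at
-- its first stage. By induction that functional is zero, so `φ` annihilates `R_{b+1}` under
-- contraction, and the Frobenius condition in degree `b < d` gives `φ = 0`.
include hF ht ht0 in
lemma rc_top_injective {a b : ℕ} (hab : a + b = d) (φ : Module.Dual k (Rsub R b))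
    (h : rc R b t φ = 0) : φ = 0 := by
  induction a generalizing b with
  | zero =>
    obtain rfl : b = d := by omega
    rw [rc_coe ⟨t, ht⟩] at h
    have h0 : φ ⟨t, ht⟩ = 0 := (TensorAlgebra.algebraMap_leftInverse V).injective
      (h.trans (map_zero _).symm)
    ext x
    obtain ⟨c, rfl⟩ := exists_smul_eq_of_finrank_eq_one hF.finrank_eq_one
      (x := ⟨t, ht⟩) (fun e => ht0 (congrArg Subtype.val e)) x
    rw [map_smul, h0, smul_zero, LinearMap.zero_apply]
  | succ a ih =>
    have key : ∀ x ∈ Rsub R (b + 1), x ∈ V1 k V * Rsub R b := fun x hx => by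
      have := Rsub_add_le R 1 b
      rw [Rsub_one, add_comm] at this
      exact this hx
    refine hF.eq_zero b (by omega) φ fun x hx hx' => Subtype.ext ?_
    rw [contrR_eq_rc]
    have hm : ∀ y : Rsub R (b + 1), rc R b y φ ∈ Rsub R 1 := fun y => by
      rw [Rsub_one]; exact rc_mem (key _ y.2) φ
    -- Contraction along `φ`, from `R_{b+1} ⊆ V R_b` to `V = R_1`.
    let ψ : Rsub R (b + 1) →ₗ[k] Rsub R 1 :=
      (((rc R b).flip φ) ∘ₗ (Rsub R (b + 1)).subtype).codRestrict (Rsub R 1) hm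
    have h1 : ∀ l : Module.Dual k (Rsub R 1), l ∘ₗ ψ = 0 := by
      intro l
      refine ih (by omega) _ ?_
      have h2 : ∀ s ∈ Rsub R a * Rsub R (b + 1),
          rc R (b + 1) s (l ∘ₗ ψ) = rc R 1 (rc R b s φ) l := by
        intro s hs
        induction hs using Submodule.mul_induction_on' with
        | mem_mul_mem m hm' n hn =>
          rw [rc_mul m ⟨n, hn⟩, rc_mul_left (key n hn)]
          exact (rc_mul m (ψ ⟨n, hn⟩) l).symm
        | add x _ y _ hx hy => simp only [map_add, LinearMap.add_apply, hx, hy]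
      rw [h2 t (Rsub_add_le R a (b + 1) (by rwa [show a + (b + 1) = d by omega])), h, map_zero,
        LinearMap.zero_apply]
    have h3 : ψ ⟨x, hx⟩ = 0 := (Module.forall_dual_apply_eq_zero_iff k _).mp fun l =>
      LinearMap.congr_fun (h1 l) ⟨x, hx⟩
    exact congrArg Subtype.val h3

lemma mem_mul_of_add {a b : ℕ} (hab : a + b = d) {x : TensorAlgebra k V} (hx : x ∈ Rsub R d) :
    x ∈ Rsub R a * Rsub R b := by
  subst hab; exact Rsub_add_le R a b hx

/-- The contraction `R_b^* → R_a` of an element of `R_d`, for `a + b = d`. -/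
noncomputable def rcTop (ht : t ∈ Rsub R d) (a b : ℕ) (hab : a + b = d) :
    Module.Dual k (Rsub R b) →ₗ[k] Rsub R a :=
  (rc R b t).codRestrict (Rsub R a) fun φ => rc_mem (mem_mul_of_add hab ht) φ

/-- The contraction `R_a^* → R_b` of an element of `R_d`, for `a + b = d`. -/
noncomputable def lcTop (ht : t ∈ Rsub R d) (a b : ℕ) (hab : a + b = d) :
    Module.Dual k (Rsub R a) →ₗ[k] Rsub R b :=
  (lc R a t).codRestrict (Rsub R b) fun φ => lc_mem (mem_mul_of_add hab ht) φ

/-- Both sides contract `t ∈ R_a R_b` to a scalar, in the two possible orders. So the left and right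
contractions are transposes of each other, and bijectivity passes from one to the other. -/
lemma dual_rcTop {a b : ℕ} (hab : a + b = d) (φ : Module.Dual k (Rsub R a))
    (ψ : Module.Dual k (Rsub R b)) : φ (rcTop ht a b hab ψ) = ψ (lcTop ht a b hab φ) := by
  have h := lc_rc_comm (P := 1) (b := b) (y := t) (by
    rw [one_mul]; exact mem_mul_of_add hab ht) φ ψ
  have h1 := lc_coe (rcTop ht a b hab ψ) φ
  have h2 := rc_coe (lcTop ht a b hab φ) ψ
  exact (TensorAlgebra.algebraMap_leftInverse V).injective (h1.symm.trans (h.trans h2))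

variable [FiniteDimensional k V]

include hF ht0

/-- Injectivity holds for `(a, b)` and for `(b, a)`, which gives both inequalities between `dim R_a`
and `dim R_b`; an injective map between spaces of equal dimension is bijective. -/
lemma rcTop_bijective {a b : ℕ} (hab : a + b = d) : Function.Bijective (rcTop ht a b hab) := by
  have hinj : ∀ (a b : ℕ) (hab : a + b = d), Function.Injective (rcTop ht a b hab) :=
    fun a b hab => (injective_iff_map_eq_zero _).mpr fun φ h =>
      rc_top_injective hF ht ht0 hab φ (congrArg Subtype.val h)
  have h1 := LinearMap.finrank_le_finrank_of_injective (hinj a b hab)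
  have h2 := LinearMap.finrank_le_finrank_of_injective (hinj b a (by omega))
  rw [Subspace.dual_finrank_eq] at h1 h2
  exact ⟨hinj a b hab, (LinearMap.injective_iff_surjective_of_finrank_eq_finrank
    (by rw [Subspace.dual_finrank_eq]; omega)).mp (hinj a b hab)⟩

/-- A functional with zero left contraction vanishes on all right contractions, which fill `R_a`; a
dimension count does the rest. -/
lemma lcTop_bijective {a b : ℕ} (hab : a + b = d) : Function.Bijective (lcTop ht a b hab) := by
  have hinj : Function.Injective (lcTop ht a b hab) := (injective_iff_map_eq_zero _).mpr
    fun φ h => LinearMap.ext fun x => by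
      obtain ⟨ψ, rfl⟩ := (rcTop_bijective hF ht ht0 hab).2 x
      rw [dual_rcTop, h, map_zero, LinearMap.zero_apply]
  have h1 := (LinearEquiv.ofBijective _ (rcTop_bijective hF ht ht0 hab)).finrank_eq
  rw [Subspace.dual_finrank_eq] at h1
  exact ⟨hinj, (LinearMap.injective_iff_surjective_of_finrank_eq_finrank
    (by rw [Subspace.dual_finrank_eq]; omega)).mp hinj⟩

end Pairing
end QuadAlg

namespace FiberFunctor

open TensorProduct

/-! ### Slices and products in `B ⊗ W` -/

section Coaction

variable {k : Type u} [Field k] {B W W' W'' : Type*} [Ring B] [Algebra k B]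
  [AddCommGroup W] [Module k W] [AddCommGroup W'] [Module k W'] [AddCommGroup W''] [Module k W'']

/-- Slicing an element of `B ⊗ W` with a functional on `W`. -/
noncomputable def slice (B : Type*) [Ring B] [Algebra k B] (ξ : Module.Dual k W) :
    B ⊗[k] W →ₗ[k] B :=
  (TensorProduct.rid k B).toLinearMap ∘ₗ ξ.lTensor B

@[simp] lemma slice_tmul (ξ : Module.Dual k W) (b : B) (w : W) :
    slice B ξ (b ⊗ₜ w) = ξ w • b := by simp [slice]

lemma slice_lTensor (ξ : Module.Dual k W') (f : W →ₗ[k] W') (z : B ⊗[k] W) :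
    slice B ξ (f.lTensor B z) = slice B (ξ ∘ₗ f) z := by
  simp [slice, LinearMap.lTensor_comp]

lemma slice_add (ξ ξ' : Module.Dual k W) (z : B ⊗[k] W) :
    slice B (ξ + ξ') z = slice B ξ z + slice B ξ' z := by
  simp [slice, LinearMap.lTensor_add]

lemma slice_smul (c : k) (ξ : Module.Dual k W) (z : B ⊗[k] W) :
    slice B (c • ξ) z = c • slice B ξ z := by
  simp [slice, LinearMap.lTensor_smul]

lemma sum_slice_tmul {ι : Type*} [Fintype ι] (b : Module.Basis ι k W) (z : B ⊗[k] W) :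
    ∑ i, slice B (b.coord i) z ⊗ₜ[k] b i = z := by
  induction z using TensorProduct.induction_on with
  | zero => simp
  | add x y hx hy =>
    simp only [map_add, add_tmul, Finset.sum_add_distrib, hx, hy]
  | tmul c w =>
    simp only [slice_tmul, smul_tmul, ← tmul_sum, Module.Basis.coord_apply, b.sum_repr]

lemma slice_ext [FiniteDimensional k W] {z z' : B ⊗[k] W}
    (h : ∀ ξ : Module.Dual k W, slice B ξ z = slice B ξ z') : z = z' := by
  rw [← sum_slice_tmul (Module.finBasis k W) z, ← sum_slice_tmul (Module.finBasis k W) z']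
  simp only [h]

/-- The product `(b ⊗ w)(c ⊗ w') = bc ⊗ μ(w ⊗ w')`. -/
noncomputable def mulCo (B : Type*) [Ring B] [Algebra k B] (μ : W ⊗[k] W' →ₗ[k] W'') :
    B ⊗[k] W →ₗ[k] B ⊗[k] W' →ₗ[k] B ⊗[k] W'' :=
  TensorProduct.curry (TensorProduct.map (LinearMap.mul' k B) μ ∘ₗ
    (TensorProduct.tensorTensorTensorComm k B W B W').toLinearMap)

@[simp] lemma mulCo_tmul (μ : W ⊗[k] W' →ₗ[k] W'') (b c : B) (w : W) (w' : W') :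
    mulCo B μ (b ⊗ₜ w) (c ⊗ₜ w') = (b * c) ⊗ₜ μ (w ⊗ₜ w') := by
  simp [mulCo]

end Coaction

lemma mapL_comp {k : Type u} [Field k] {C : Type w} [Category.{v} C] (F : C ⥤ FGModuleCat.{u} k)
    {X Y Z : C} (f : X ⟶ Y) (g : Y ⟶ Z) : mapL F (f ≫ g) = mapL F g ∘ₗ mapL F f := by
  simp [mapL]

/-! ### Monoidal natural transformations into `B ⊗ G`, and the universal coaction of the coend -/

section Monoidal

variable {k : Type u} [Field k] {C : Type w} [Category.{v} C] [MonoidalCategory C]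
  (F G : C ⥤ FGModuleCat.{u} k) [F.Monoidal] [G.Monoidal] (B : Type*) [Ring B] [Algebra k B]

/-- The tensor product of two maps `FX → B ⊗ GX` and `FY → B ⊗ GY`, through the product of
`B`. -/
noncomputable def conv {X Y : C} (ρ : F.obj X →ₗ[k] B ⊗[k] G.obj X)
    (σ : F.obj Y →ₗ[k] B ⊗[k] G.obj Y) : F.obj (X ⊗ Y) →ₗ[k] B ⊗[k] G.obj (X ⊗ Y) :=
  TensorProduct.lift ((mulCo B (muL G X Y).toLinearMap).compl₁₂ ρ σ) ∘ₗ
    (muL F X Y).symm.toLinearMap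

variable {F G B}

@[simp] lemma conv_muL {X Y : C} (ρ : F.obj X →ₗ[k] B ⊗[k] G.obj X)
    (σ : F.obj Y →ₗ[k] B ⊗[k] G.obj Y) (v : F.obj X) (w : F.obj Y) :
    conv F G B ρ σ (muL F X Y (v ⊗ₜ w)) = mulCo B (muL G X Y).toLinearMap (ρ v) (σ w) := by
  simp [conv]

lemma slice_tens {X Y : C} (ξ : Module.Dual k (G.obj X)) (ζ : Module.Dual k (G.obj Y))
    (x : B ⊗[k] G.obj X) (y : B ⊗[k] G.obj Y) :
    slice B (tens G ξ ζ) (mulCo B (muL G X Y).toLinearMap x y) = slice B ξ x * slice B ζ y := by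
  induction x using TensorProduct.induction_on with
  | zero => simp
  | add x x' hx hx' => simp only [map_add, LinearMap.add_apply, add_mul, hx, hx']
  | tmul b v =>
  induction y using TensorProduct.induction_on with
  | zero => simp
  | add y y' hy hy' => simp only [map_add, mul_add, hy, hy']
  | tmul c w =>
    rw [mulCo_tmul, slice_tmul, slice_tmul, slice_tmul, LinearEquiv.coe_coe, tens_muL]
    rw [smul_mul_smul_comm]

lemma lTensor_mulCo {X Y X' Y' : C} (f : X ⟶ Y) (g : X' ⟶ Y') (x : B ⊗[k] G.obj X)
    (y : B ⊗[k] G.obj X') :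
    (mapL G (f ⊗ₘ g)).lTensor B (mulCo B (muL G X X').toLinearMap x y) =
      mulCo B (muL G Y Y').toLinearMap ((mapL G f).lTensor B x) ((mapL G g).lTensor B y) := by
  induction x using TensorProduct.induction_on with
  | zero => simp
  | add x x' hx hx' => simp only [map_add, LinearMap.add_apply, hx, hx']
  | tmul b v =>
  induction y using TensorProduct.induction_on with
  | zero => simp
  | add y y' hy hy' => simp only [map_add, hy, hy']
  | tmul c w =>
    rw [mulCo_tmul, LinearMap.lTensor_tmul, LinearMap.lTensor_tmul, LinearMap.lTensor_tmul,
      mulCo_tmul, LinearEquiv.coe_coe, LinearEquiv.coe_coe, mapL_muL]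

lemma lTensor_associator {X Y Z : C} (x : B ⊗[k] G.obj X) (y : B ⊗[k] G.obj Y)
    (z : B ⊗[k] G.obj Z) :
    (mapL G (α_ X Y Z).hom).lTensor B (mulCo B (muL G (X ⊗ Y) Z).toLinearMap
        (mulCo B (muL G X Y).toLinearMap x y) z) =
      mulCo B (muL G X (Y ⊗ Z)).toLinearMap x (mulCo B (muL G Y Z).toLinearMap y z) := by
  induction x using TensorProduct.induction_on with
  | zero => simp
  | add x x' hx hx' => simp only [map_add, LinearMap.add_apply, hx, hx']
  | tmul b v =>
  induction y using TensorProduct.induction_on with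
  | zero => simp
  | add y y' hy hy' => simp only [map_add, LinearMap.add_apply, hy, hy']
  | tmul c w =>
  induction z using TensorProduct.induction_on with
  | zero => simp
  | add y y' hy hy' => simp only [map_add, hy, hy']
  | tmul e s =>
    simp only [mulCo_tmul, LinearMap.lTensor_tmul, LinearEquiv.coe_coe, mapL_associator, mul_assoc]

lemma lTensor_leftUnitor {X : C} (x : B ⊗[k] G.obj X) :
    (mapL G (λ_ X).hom).lTensor B (mulCo B (muL G (𝟙_ C) X).toLinearMap (1 ⊗ₜ epsL G 1) x) =
      x := by
  induction x using TensorProduct.induction_on with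
  | zero => simp
  | add x x' hx hx' => simp only [map_add, hx, hx']
  | tmul b v =>
    simp only [mulCo_tmul, LinearMap.lTensor_tmul, LinearEquiv.coe_coe, mapL_leftUnitor, one_mul]

lemma lTensor_rightUnitor {X : C} (x : B ⊗[k] G.obj X) :
    (mapL G (ρ_ X).hom).lTensor B (mulCo B (muL G X (𝟙_ C)).toLinearMap x (1 ⊗ₜ epsL G 1)) =
      x := by
  induction x using TensorProduct.induction_on with
  | zero => simp
  | add x x' hx hx' => simp only [map_add, LinearMap.add_apply, hx, hx']
  | tmul b v =>
    simp only [mulCo_tmul, LinearMap.lTensor_tmul, LinearEquiv.coe_coe, mapL_rightUnitor, mul_one]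

variable (F G B) in
/-- The map `F1 → B ⊗ G1` which sends `1` to `1 ⊗ 1`. -/
noncomputable def unitCo : F.obj (𝟙_ C) →ₗ[k] B ⊗[k] G.obj (𝟙_ C) :=
  TensorProduct.mk k B _ 1 ∘ₗ (epsL G).toLinearMap ∘ₗ (epsL F).symm.toLinearMap

@[simp] lemma unitCo_epsL : unitCo F G B (epsL F 1) = 1 ⊗ₜ epsL G 1 := by simp [unitCo]

lemma unit_hom_ext {W : Type*} [AddCommGroup W] [Module k W] {f g : F.obj (𝟙_ C) →ₗ[k] W}
    (h : f (epsL F 1) = g (epsL F 1)) : f = g := by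
  have : f ∘ₗ (epsL F).toLinearMap = g ∘ₗ (epsL F).toLinearMap := LinearMap.ext_ring h
  ext t
  obtain ⟨t, rfl⟩ := (epsL F).surjective t
  exact LinearMap.congr_fun this t

variable (F G B) in
/-- A monoidal natural transformation from `F` to `B ⊗ G`. -/
structure Coaction where
  app (X : C) : F.obj X →ₗ[k] B ⊗[k] G.obj X
  nat {X Y : C} (f : X ⟶ Y) : (mapL G f).lTensor B ∘ₗ app X = app Y ∘ₗ mapL F f
  one : app (𝟙_ C) = unitCo F G B
  mul (X Y : C) : app (X ⊗ Y) = conv F G B (app X) (app Y)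

namespace Coaction

open Coend

lemma nat_apply (ρ : Coaction F G B) {X Y : C} (f : X ⟶ Y) (v : F.obj X) :
    (mapL G f).lTensor B (ρ.app X v) = ρ.app Y (mapL F f v) := LinearMap.congr_fun (ρ.nat f) v

variable (ρ : Coaction F F B)

/-- The matrix coefficients of a coaction. -/
noncomputable def sliceL (X : C) : Module.Dual k (F.obj X) →ₗ[k] F.obj X →ₗ[k] B :=
  LinearMap.mk₂ k (fun ξ v => slice B ξ (ρ.app X v))
    (fun ξ ξ' v => slice_add _ _ _) (fun c ξ v => slice_smul _ _ _)
    (fun ξ v v' => by simp only [map_add]) (fun c ξ v => by simp only [map_smul])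

lemma isNatural_sliceL : IsNatural ρ.sliceL := fun X Y f ξ v => by
  simp only [sliceL, LinearMap.mk₂_apply]
  rw [← slice_lTensor, ρ.nat_apply]

/-- The linear map from the coend given by a coaction. -/
noncomputable def toLin : Coend F →ₗ[k] B := desc ρ.sliceL ρ.isNatural_sliceL

lemma toLin_coef (X : C) (ξ : Module.Dual k (F.obj X)) (v : F.obj X) :
    ρ.toLin (coef F X ξ v) = slice B ξ (ρ.app X v) := by
  rw [toLin, desc_coef, sliceL, LinearMap.mk₂_apply]

/-- The algebra morphism from the coend given by a coaction. -/
noncomputable def toAlgHom : Coend F →ₐ[k] B :=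
  AlgHom.ofLinearMap ρ.toLin
    (by
      rw [one_def, toLin_coef, ρ.one, unitCo_epsL, slice_tmul]
      simp)
    (fun a b => by
      induction a using induction_on with
      | zero => simp
      | add a a' h h' => simp only [add_mul, map_add, h, h']
      | coef X ξ x =>
      induction b using induction_on with
      | zero => simp
      | add b b' h h' => simp only [mul_add, map_add, h, h']
      | coef Y ζ y =>
        rw [coef_mul_coef, toLin_coef, toLin_coef, toLin_coef, ρ.mul, conv_muL, slice_tens])

lemma toAlgHom_coef (X : C) (ξ : Module.Dual k (F.obj X)) (v : F.obj X) :
    ρ.toAlgHom (coef F X ξ v) = slice B ξ (ρ.app X v) := ρ.toLin_coef X ξ v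

end Coaction

namespace Coend

variable (F) in
/-- The universal coaction `v ↦ ∑ i, c_{e^i,v} ⊗ e_i`. -/
noncomputable def coact (X : C) : F.obj X →ₗ[k] Coend F ⊗[k] F.obj X :=
  ∑ i, (TensorProduct.mk k _ _).flip (bas X i) ∘ₗ coefL F X ((bas X).coord i)

lemma slice_coact (X : C) (ξ : Module.Dual k (F.obj X)) (v : F.obj X) :
    slice (Coend F) ξ (coact F X v) = coef F X ξ v := by
  have hξ : ξ = ∑ i, ξ (bas X i) • (bas X).coord i := (bas X).ext fun i => by simp
  conv_rhs => rw [hξ, coef_sum_left]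
  simp only [coef_smul_left]
  simp [coact, LinearMap.sum_apply, coefL]

variable (F) in
/-- The universal coaction is monoidal and natural. -/
noncomputable def coaction : Coaction F F (Coend F) where
  app := coact F
  nat f := LinearMap.ext fun v => slice_ext fun ξ => by
    rw [LinearMap.comp_apply, LinearMap.comp_apply, slice_lTensor, slice_coact, slice_coact,
      coef_comp]
  one := unit_hom_ext <| slice_ext fun ξ => by
    rw [slice_coact, unitCo_epsL, slice_tmul, one_def]
    have h : ξ = ξ (epsL F 1) • (epsL F).symm.toLinearMap := unit_hom_ext (by simp)
    conv_lhs => rw [h, coef_smul_left]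
  mul X Y := dual_ext fun v w => by
    rw [conv_muL]
    let b := ((bas X).tensorProduct (bas Y)).map (muL F X Y)
    rw [← sum_slice_tmul b (coact F (X ⊗ Y) _), ← sum_slice_tmul b (mulCo _ _ _ _)]
    refine Finset.sum_congr rfl fun ⟨i, j⟩ _ => ?_
    have h : b.coord (i, j) = tens F ((bas X).coord i) ((bas Y).coord j) :=
      dual_ext fun v w => by simp [b, mul_comm]
    rw [h, slice_coact, slice_tens, slice_coact, slice_coact, coef_mul_coef]

end Coend

end Monoidal

/-! ### Coactions on a category given by generators and relations -/

section Presented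

variable {k : Type u} [Field k] {S : Type} [Monoid S] {P : StrictPres S}
  (F G : P.Cat ⥤ FGModuleCat.{u} k) [F.Monoidal] [G.Monoidal] (B : Type*) [Ring B] [Algebra k B]

/-- An object together with a linear map `FX → B ⊗ GX`. These form a monoid. -/
structure ObjCoaction where
  of : S
  app : F.obj ⟨of⟩ →ₗ[k] B ⊗[k] G.obj ⟨of⟩

namespace ObjCoaction

variable {F G B}

-- The two linear maps live over objects that are only provably equal. Comparing them through the
-- images of `eqToHom` instead of casts keeps the comparison within reach of the coherence of `F`
-- and `G`.
omit [F.Monoidal] [G.Monoidal] in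
lemma ext_of {m n : ObjCoaction F G B} (h : m.of = n.of)
    (h' : ∀ v, (mapL G (eqToHom (congrArg StrictPres.Cat.mk h))).lTensor B (m.app v) =
      n.app (mapL F (eqToHom (congrArg StrictPres.Cat.mk h)) v)) : m = n := by
  obtain ⟨x, ρ⟩ := m
  obtain ⟨y, σ⟩ := n
  dsimp only at h
  subst h
  congr
  ext v
  simpa [mapL_id] using h' v

noncomputable instance : Mul (ObjCoaction F G B) :=
  ⟨fun m n => ⟨m.of * n.of, conv F G B (X := ⟨m.of⟩) (Y := ⟨n.of⟩) m.app n.app⟩⟩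

noncomputable instance : One (ObjCoaction F G B) := ⟨⟨1, unitCo F G B⟩⟩

/-- The associators and unitors of a presented category are the morphisms `eqToHom`, so the monoid
laws reduce to the coherence of `F` and `G`. The gain is that a coaction can be prescribed through
the universal property of the monoid of objects, as a homomorphism to this monoid. -/
noncomputable instance : Monoid (ObjCoaction F G B) where
  mul_assoc a b c := by
    refine ext_of (mul_assoc a.of b.of c.of) fun v => ?_
    refine LinearMap.congr_fun (f := (mapL G (α_ (⟨a.of⟩ : P.Cat) ⟨b.of⟩ ⟨c.of⟩).hom).lTensor B ∘ₗ
        conv F G B (conv F G B a.app b.app) c.app)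
      (g := conv F G B a.app (conv F G B b.app c.app) ∘ₗ
        mapL F (α_ (⟨a.of⟩ : P.Cat) ⟨b.of⟩ ⟨c.of⟩).hom) ?_ v
    refine dual_ext fun t z => ?_
    obtain ⟨t, rfl⟩ := (muL F _ _).surjective t
    induction t using TensorProduct.induction_on with
    | zero => simp only [map_zero, zero_tmul]
    | add t t' h h' => simp only [map_add, add_tmul, h, h']
    | tmul x y =>
      rw [LinearMap.comp_apply, LinearMap.comp_apply, mapL_associator, conv_muL, conv_muL,
        conv_muL, conv_muL, lTensor_associator]
  one_mul a := by
    refine ext_of (one_mul a.of) fun v => ?_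
    refine LinearMap.congr_fun (f := (mapL G (λ_ (⟨a.of⟩ : P.Cat)).hom).lTensor B ∘ₗ
        conv F G B (unitCo F G B) a.app)
      (g := a.app ∘ₗ mapL F (λ_ (⟨a.of⟩ : P.Cat)).hom) ?_ v
    refine dual_ext fun t x => ?_
    obtain ⟨t, rfl⟩ := (epsL F).surjective t
    have e : epsL F t = t • epsL F 1 := by rw [← map_smul, smul_eq_mul, mul_one]
    rw [e, ← smul_tmul', map_smul, map_smul, map_smul, LinearMap.comp_apply, LinearMap.comp_apply,
      mapL_leftUnitor, conv_muL, unitCo_epsL, lTensor_leftUnitor]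
  mul_one a := by
    refine ext_of (mul_one a.of) fun v => ?_
    refine LinearMap.congr_fun (f := (mapL G (ρ_ (⟨a.of⟩ : P.Cat)).hom).lTensor B ∘ₗ
        conv F G B a.app (unitCo F G B))
      (g := a.app ∘ₗ mapL F (ρ_ (⟨a.of⟩ : P.Cat)).hom) ?_ v
    refine dual_ext fun x t => ?_
    obtain ⟨t, rfl⟩ := (epsL F).surjective t
    have e : epsL F t = t • epsL F 1 := by rw [← map_smul, smul_eq_mul, mul_one]
    rw [e, tmul_smul, map_smul, map_smul, map_smul, LinearMap.comp_apply, LinearMap.comp_apply,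
      mapL_rightUnitor, conv_muL, unitCo_epsL, lTensor_rightUnitor]

lemma mul_mk {x y : S} (ρ : F.obj ⟨x⟩ →ₗ[k] B ⊗[k] G.obj ⟨x⟩)
    (σ : F.obj ⟨y⟩ →ₗ[k] B ⊗[k] G.obj ⟨y⟩) :
    (⟨x, ρ⟩ : ObjCoaction F G B) * ⟨y, σ⟩ =
      ⟨x * y, conv F G B (X := ⟨x⟩) (Y := ⟨y⟩) ρ σ⟩ := rfl

omit [F.Monoidal] [G.Monoidal] in
lemma app_inj {x : S} {ρ σ : F.obj ⟨x⟩ →ₗ[k] B ⊗[k] G.obj ⟨x⟩}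
    (h : (⟨x, ρ⟩ : ObjCoaction F G B) = ⟨x, σ⟩) : ρ = σ := eq_of_heq (ObjCoaction.mk.inj h).2

lemma one_mk : (1 : ObjCoaction F G B) = ⟨1, unitCo F G B⟩ := rfl

/-- The projection to objects. -/
noncomputable def proj : ObjCoaction F G B →* S where
  toFun := of
  map_one' := rfl
  map_mul' _ _ := rfl

end ObjCoaction

namespace Coaction

variable {F G B}

open StrictPres

/-- Compatibility passes to composites, and to tensor products because the family is multiplicative.
Every morphism is represented by a formal one built from generators in these two ways and from
identities. -/
lemma nat_of_gen (app : ∀ X : P.Cat, F.obj X →ₗ[k] B ⊗[k] G.obj X)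
    (mul : ∀ X Y, app (X ⊗ Y) = conv F G B (app X) (app Y))
    (nat : ∀ {x y : S} (g : P.gen x y),
      (mapL G (P.homMk (.gen g))).lTensor B ∘ₗ app ⟨x⟩ = app ⟨y⟩ ∘ₗ mapL F (P.homMk (.gen g)))
    {X Y : P.Cat} (f : X ⟶ Y) : (mapL G f).lTensor B ∘ₗ app X = app Y ∘ₗ mapL F f := by
  obtain ⟨f, rfl⟩ := P.homMk_surjective f
  obtain ⟨x⟩ := X
  obtain ⟨y⟩ := Y
  dsimp only at f
  induction f with
  | gen g => exact nat g
  | ident x =>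
    have h : P.homMk (.ident x) = 𝟙 (⟨x⟩ : P.Cat) := rfl
    rw [h, mapL_id, mapL_id, LinearMap.lTensor_id, LinearMap.id_comp, LinearMap.comp_id]
  | comp f g hf hg =>
    have h := UpPlus.homMk_comp P f g
    rw [h, mapL_comp, mapL_comp, LinearMap.lTensor_comp, LinearMap.comp_assoc, hf, ← LinearMap.comp_assoc, hg,
      LinearMap.comp_assoc]
  | tensor f g hf hg =>
    rw [UpPlus.homMk_tensor]
    refine dual_ext (F := F) (X := ⟨_⟩) (Y := ⟨_⟩) fun v w => ?_
    rw [LinearMap.comp_apply, LinearMap.comp_apply, mapL_muL]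
    erw [mul, mul]
    rw [conv_muL, conv_muL, lTensor_mulCo]
    have hf' := LinearMap.congr_fun hf v
    have hg' := LinearMap.congr_fun hg w
    rw [LinearMap.comp_apply, LinearMap.comp_apply] at hf' hg'
    rw [hf', hg']

/-- A multiplicative family of maps `FX → B ⊗ GX` which is natural for the generating morphisms is
a coaction. -/
theorem exists_of_monoidHom (s : S →* ObjCoaction F G B) (hs : ∀ x, (s x).of = x)
    (nat : ∀ (app : ∀ x : S, F.obj ⟨x⟩ →ₗ[k] B ⊗[k] G.obj ⟨x⟩), (∀ x, s x = ⟨x, app x⟩) →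
      app 1 = unitCo F G B →
      (∀ x y, app (x * y) = conv F G B (X := ⟨x⟩) (Y := ⟨y⟩) (app x) (app y)) →
      ∀ {x y : S} (g : P.gen x y),
      (mapL G (P.homMk (.gen g))).lTensor B ∘ₗ app x = app y ∘ₗ mapL F (P.homMk (.gen g))) :
    ∃ ρ : Coaction F G B, ∀ x, s x = ⟨x, ρ.app ⟨x⟩⟩ := by
  have h : ∀ x, ∃ ρ, s x = ⟨x, ρ⟩ := fun x => by
    have := hs x
    generalize s x = m at this ⊢
    subst this
    exact ⟨m.app, rfl⟩
  choose app happ using h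
  have mul : ∀ x y, app (x * y) = conv F G B (X := ⟨x⟩) (Y := ⟨y⟩) (app x) (app y) := fun x y => by
    have := map_mul s x y
    rw [happ, happ, happ, ObjCoaction.mul_mk] at this
    exact ObjCoaction.app_inj this
  have one : app 1 = unitCo F G B := by
    have := map_one s
    rw [happ, ObjCoaction.one_mk] at this
    exact ObjCoaction.app_inj this
  exact ⟨{ app := fun X => app X.of
           nat := fun f => nat_of_gen (fun X => app X.of) (fun X Y => mul X.of Y.of)
            (nat app happ one mul) f
           one := one
           mul := fun X Y => mul X.of Y.of }, happ⟩

end Coaction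

end Presented

end FiberFunctor

/-! ### The universal property of `Λ` -/

namespace Lambda

variable {d : ℕ} {N : Type*} [Monoid N] (f : Letter d → N) (g : N)
  (hmul : FreeMonoid.lift f (LambdaPlus.r d d) * g = 1)
  (hmul' : g * FreeMonoid.lift f (LambdaPlus.r d d) = 1)

/-- The universal property of `Λ`. -/
def lift : Lambda d →* N :=
  PresentedMonoid.lift (Sum.elim f fun _ : Unit => g) fun a b h => by
    have hf : (FreeMonoid.lift (Sum.elim f fun _ : Unit => g)).comp (FreeMonoid.map Sum.inl) =
        FreeMonoid.lift f := FreeMonoid.hom_eq fun a => by simp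
    have hf' : ∀ w, FreeMonoid.lift (Sum.elim f fun _ : Unit => g) (FreeMonoid.map Sum.inl w) =
        FreeMonoid.lift f w := fun w => DFunLike.congr_fun hf w
    cases h with
    | mul_inv => rw [map_mul, hf', FreeMonoid.lift_eval_of, map_one]; exact hmul
    | inv_mul => rw [map_mul, hf', FreeMonoid.lift_eval_of, map_one]; exact hmul'

lemma lift_incl (w : LambdaPlus d) : lift f g hmul hmul' (incl d w) = FreeMonoid.lift f w := by
  have hf : (lift f g hmul hmul').comp (incl d) = FreeMonoid.lift f := FreeMonoid.hom_eq fun a => by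
    rw [FreeMonoid.lift_eval_of]; rfl
  exact DFunLike.congr_fun hf w

lemma hom_ext {φ ψ : Lambda d →* N} (h : ∀ a : Letter d, φ (r d a) = ψ (r d a))
    (h' : φ (rInv d) = ψ (rInv d)) : φ = ψ := by
  refine PresentedMonoid.ext (LambdaRel d) ?_
  rintro (a | a)
  · have := h a
    rw [r, LambdaPlus.r, dif_pos a.2] at this
    exact this
  · exact h'

end Lambda

lemma LambdaPlus.r_coe {d : ℕ} (a : Letter d) : r d a = FreeMonoid.of a := dif_pos a.2

namespace QuadAlg

open TensorProduct

/-! ### Trivialising the line `R_d`, and the pairing behind `θ` -/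

section TopForm

variable {k V : Type u} [Field k] [AddCommGroup V] [Module k V]

/-- A generator of the line `R_d`, which satisfies the conditions of a Frobenius pairing. -/
structure TopForm (R : Submodule k (V ⊗[k] V)) (d : ℕ) where
  t : TensorAlgebra k V
  mem : t ∈ Rsub R d
  ne : t ≠ 0
  eq_one : d = 0 → t = 1
  frob : IsFrobenius R d

/-- For positive `d` any nonzero element of the line will do. For `d = 0` the object `r_d` is the
unit, so the generator has to be `1` for the trivialisation to be compatible with units. -/
lemma IsFrobenius.nonempty_topForm {R : Submodule k (V ⊗[k] V)} {d : ℕ} (h : IsFrobenius R d) :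
    Nonempty (TopForm R d) := by
  obtain rfl | hd := Nat.eq_zero_or_pos d
  · exact ⟨1, by rw [Rsub_zero]; exact Submodule.one_le.mp le_rfl, one_ne_zero, fun _ => rfl, h⟩
  · have := Module.nontrivial_of_finrank_pos (R := k) (M := Rsub R d)
      (by rw [h.finrank_eq_one]; exact one_pos)
    obtain ⟨t, ht⟩ := exists_ne (0 : Rsub R d)
    exact ⟨t, t.2, fun e => ht (Subtype.ext e), by omega, h⟩

namespace TopForm

variable {R : Submodule k (V ⊗[k] V)} {d : ℕ} (τ : TopForm R d)

lemma exists_smul {x : TensorAlgebra k V} (hx : x ∈ Rsub R d) : ∃ c : k, c • τ.t = x := by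
  obtain ⟨c, hc⟩ := exists_smul_eq_of_finrank_eq_one τ.frob.finrank_eq_one (x := ⟨τ.t, τ.mem⟩)
    (fun e => τ.ne (congrArg Subtype.val e)) ⟨x, hx⟩
  exact ⟨c, congrArg Subtype.val hc⟩

lemma exists_coord : ∃ f : TensorAlgebra k V →ₗ[k] k, f τ.t = 1 := by
  obtain ⟨f, hf⟩ := Module.Projective.exists_dual_ne_zero k τ.ne
  exact ⟨(f τ.t)⁻¹ • f, by simp [hf]⟩

/-- A functional on the tensor algebra with value one on the generator of `R_d`. -/
noncomputable def coord : TensorAlgebra k V →ₗ[k] k := τ.exists_coord.choose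

lemma coord_t : τ.coord τ.t = 1 := τ.exists_coord.choose_spec

/-- The subspace which represents `r_a` after trivialisation of `R_d`. -/
noncomputable def W (_ : TopForm R d) (a : ℕ) : Submodule k (TensorAlgebra k V) :=
  if a = d then 1 else Rsub R a

/-- The isomorphism `W_a → R_a`, as an endomorphism of the tensor algebra. -/
noncomputable def J (a : ℕ) : TensorAlgebra k V →ₗ[k] TensorAlgebra k V :=
  if a = d then LinearMap.mulRight k τ.t else LinearMap.id

/-- The isomorphism `R_a → W_a`, as an endomorphism of the tensor algebra. -/
noncomputable def Jinv (a : ℕ) : TensorAlgebra k V →ₗ[k] TensorAlgebra k V :=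
  if a = d then Algebra.linearMap k _ ∘ₗ τ.coord else LinearMap.id

lemma J_mem {a : ℕ} {x : TensorAlgebra k V} (hx : x ∈ τ.W a) : τ.J a x ∈ Rsub R a := by
  unfold W J at *
  split_ifs at * with h
  · subst h
    obtain ⟨c, rfl⟩ := Submodule.mem_one.mp hx
    rw [LinearMap.mulRight_apply, ← Algebra.smul_def]
    exact Submodule.smul_mem _ c τ.mem
  · exact hx

lemma Jinv_mem {a : ℕ} {x : TensorAlgebra k V} (hx : x ∈ Rsub R a) : τ.Jinv a x ∈ τ.W a := by
  unfold W Jinv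
  split_ifs with h
  · exact Submodule.mem_one.mpr ⟨τ.coord x, rfl⟩
  · exact hx

lemma Jinv_J {a : ℕ} {x : TensorAlgebra k V} (hx : x ∈ τ.W a) : τ.Jinv a (τ.J a x) = x := by
  unfold W J Jinv at *
  split_ifs at * with h
  · obtain ⟨c, rfl⟩ := Submodule.mem_one.mp hx
    simp [τ.coord_t, Algebra.algebraMap_eq_smul_one]
  · rfl

lemma J_Jinv {a : ℕ} {x : TensorAlgebra k V} (hx : x ∈ Rsub R a) : τ.J a (τ.Jinv a x) = x := by
  unfold J Jinv
  split_ifs with h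
  · subst h
    obtain ⟨c, rfl⟩ := τ.exists_smul hx
    simp [τ.coord_t]
  · rfl

lemma exists_Jinv {a : ℕ} {x : TensorAlgebra k V} (hx : x ∈ τ.W a) :
    ∃ u ∈ Rsub R a, τ.Jinv a u = x := ⟨τ.J a x, τ.J_mem hx, τ.Jinv_J hx⟩

lemma Jinv_top : τ.Jinv d τ.t = 1 := by simp [Jinv, τ.coord_t]

lemma Jinv_zero_one : τ.Jinv 0 1 = 1 := by
  obtain rfl | hd := eq_or_ne 0 d
  · have h := τ.Jinv_top
    rwa [τ.eq_one rfl] at h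
  · simp [Jinv, hd]

lemma W_zero : τ.W 0 = 1 := by
  unfold W; split_ifs <;> simp [Rsub_zero]

lemma W_top : τ.W d = 1 := by simp [W]

lemma W_le (a : ℕ) : ∃ n, τ.W a ≤ V1 k V ^ n := by
  unfold W
  split_ifs
  · exact ⟨0, by rw [pow_zero]⟩
  · exact ⟨a, Rsub_le R a⟩

section Pairing

variable [FiniteDimensional k V]

/-- The functional on `R_{d-b}` dual to an element of `R_b`: contraction of the generator of `R_d`
from the right gives back the element. -/
noncomputable def rdual (b : ℕ) (hb : b ≤ d) :
    Rsub R b →ₗ[k] Module.Dual k (Rsub R (d - b)) :=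
  (LinearEquiv.ofBijective _ (rcTop_bijective τ.frob τ.mem τ.ne
    (show b + (d - b) = d by omega))).symm.toLinearMap

/-- The functional on `R_{d-a}` dual to an element of `R_a`: contraction of the generator of `R_d`
from the left gives back the element. -/
noncomputable def ldual (a : ℕ) (ha : a ≤ d) :
    Rsub R a →ₗ[k] Module.Dual k (Rsub R (d - a)) :=
  (LinearEquiv.ofBijective _ (lcTop_bijective τ.frob τ.mem τ.ne
    (show (d - a) + a = d by omega))).symm.toLinearMap

lemma rc_rdual {b : ℕ} (hb : b ≤ d) (y : Rsub R b) :
    rc R (d - b) τ.t (τ.rdual b hb y) = y :=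
  congrArg Subtype.val (LinearEquiv.apply_symm_apply (LinearEquiv.ofBijective _
    (rcTop_bijective τ.frob τ.mem τ.ne (show b + (d - b) = d by omega))) y)

lemma lc_ldual {a : ℕ} (ha : a ≤ d) (u : Rsub R a) :
    lc R (d - a) τ.t (τ.ldual a ha u) = u :=
  congrArg Subtype.val (LinearEquiv.apply_symm_apply (LinearEquiv.ofBijective _
    (lcTop_bijective τ.frob τ.mem τ.ne (show (d - a) + a = d by omega))) u)

/-- The pairing `R_a × R_b → R_{a+b-d}`, contracting the first argument along the functional dual
to the second. -/
noncomputable def pair (b : ℕ) (hb : b ≤ d) :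
    TensorAlgebra k V →ₗ[k] Rsub R b →ₗ[k] TensorAlgebra k V :=
  (rc R (d - b)).compl₂ (τ.rdual b hb)

omit [FiniteDimensional k V] in
lemma mem_mul_of_eq {a b c : ℕ} (h : a + b = c) {x : TensorAlgebra k V} (hx : x ∈ Rsub R c) :
    x ∈ Rsub R a * Rsub R b := by
  subst h; exact Rsub_add_le R a b hx

/-- Both `u` and `y` are contractions of `t`, the first from the left and the second from the right.
Contracting `t` at both ends gives one side or the other according to the order, and the order is
immaterial. -/
lemma pair_eq {a b : ℕ} (ha : a ≤ d) (hb : b ≤ d) (hab : d ≤ a + b) (u : Rsub R a)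
    (y : Rsub R b) : τ.pair b hb u y = lc R (d - a) y (τ.ldual a ha u) := by
  have h := lc_rc_comm (P := Rsub R (a + b - d)) (y := τ.t)
    (mul_le_mul_right (Rsub_add_le R (a + b - d) (d - b)) (Rsub R (d - a))
      (mem_mul_of_eq (by omega) τ.mem)) (τ.ldual a ha u) (τ.rdual b hb y)
  rw [rc_rdual, lc_ldual] at h
  exact h.symm

lemma pair_mem {a b c : ℕ} (h : a + b = c + d) (hb : b ≤ d) {u : TensorAlgebra k V}
    (hu : u ∈ Rsub R a) (y : Rsub R b) : τ.pair b hb u y ∈ Rsub R c :=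
  rc_mem (mem_mul_of_eq (by omega) hu) _

lemma pair_t_left {b : ℕ} (hb : b ≤ d) (y : Rsub R b) : τ.pair b hb τ.t y = y :=
  τ.rc_rdual hb y

lemma pair_t_right {a : ℕ} (ha : a ≤ d) (u : Rsub R a) :
    τ.pair d le_rfl u ⟨τ.t, τ.mem⟩ = u := by
  rw [τ.pair_eq ha le_rfl (by omega)]
  exact τ.lc_ldual ha u

/-- Write the products with `u` as left contractions and those with `w` as right contractions. Both
sides become `v` contracted on the left by the functional of `u` and on the right by that of `w`. -/
lemma pair_pair {a b c ab bc : ℕ} (h₁ : a + b = ab + d) (h₂ : b + c = bc + d) (h₃ : d ≤ ab + c)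
    (ha : a ≤ d) (hb : b ≤ d) (hc : c ≤ d) (hbc : bc ≤ d) (u : Rsub R a) (v : Rsub R b)
    (w : Rsub R c) :
    τ.pair c hc (τ.pair b hb u v) w =
      τ.pair bc hbc u ⟨τ.pair c hc v w, τ.pair_mem h₂ hc v.2 w⟩ := by
  rw [τ.pair_eq ha hb (by omega), τ.pair_eq ha hbc (by omega)]
  have h := lc_rc_comm (a := d - a) (b := d - c) (P := Rsub R (ab + c - d)) (y := v)
    (mul_le_mul_right (Rsub_add_le R (ab + c - d) (d - c)) (Rsub R (d - a))
      (mem_mul_of_eq (by omega) v.2)) (τ.ldual a ha u) (τ.rdual c hc w)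
  exact h.symm

lemma pair_mul_left {b c : ℕ} (hc : c ≤ d) (hbc : d ≤ b + c) (u : TensorAlgebra k V)
    {v : TensorAlgebra k V} (hv : v ∈ Rsub R b) (w : Rsub R c) :
    τ.pair c hc (u * v) w = u * τ.pair c hc v w :=
  rc_mul_left (P := Rsub R (b + c - d)) (mem_mul_of_eq (by omega) hv) u _

lemma lc_mul_ldual {a b : ℕ} (ha : a ≤ d) (hab : d ≤ a + b) (u : Rsub R a)
    {v : TensorAlgebra k V} (hv : v ∈ Rsub R b) (w : TensorAlgebra k V) :
    lc R (d - a) (v * w) (τ.ldual a ha u) = lc R (d - a) v (τ.ldual a ha u) * w :=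
  lc_mul_right (P := Rsub R (a + b - d)) (mem_mul_of_eq (by omega) hv) w _

end Pairing

/-- The values of the trivialised functor on objects. -/
noncomputable def word : Lambda d →* Submodule k (TensorAlgebra k V) :=
  Lambda.lift (fun a => τ.W a.1) 1
    (by
      unfold LambdaPlus.r
      split_ifs with h
      · rw [FreeMonoid.lift_eval_of, τ.W_top, mul_one]
      · rw [map_one, mul_one])
    (by
      unfold LambdaPlus.r
      split_ifs with h
      · rw [FreeMonoid.lift_eval_of, τ.W_top, mul_one]
      · rw [map_one, mul_one])

lemma word_rInv : τ.word (Lambda.rInv d) = 1 := rfl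

lemma word_r {a : ℕ} (ha : a ≤ d) : τ.word (Lambda.r d a) = τ.W a := by
  rw [word, Lambda.r, Lambda.lift_incl]
  unfold LambdaPlus.r
  split_ifs with h
  · rw [FreeMonoid.lift_eval_of]
  · obtain rfl : a = 0 := by omega
    rw [map_one, W_zero]

lemma exists_word_le (w : Lambda d) : ∃ n, τ.word w ≤ V1 k V ^ n := by
  induction w using PresentedMonoid.inductionOn with | _ w
  induction w with
  | one => exact ⟨0, by rw [map_one, map_one, pow_zero]⟩
  | of a =>
    obtain a | a := a
    · exact τ.W_le a.1
    · exact ⟨0, le_of_eq (pow_zero _).symm⟩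
  | mul x y hx hy =>
    obtain ⟨m, hm⟩ := hx
    obtain ⟨n, hn⟩ := hy
    exact ⟨m + n, by rw [map_mul, map_mul, pow_add]; exact mul_le_mul' hm hn⟩

lemma word_linearDisjoint (x y : Lambda d) : (τ.word x).LinearDisjoint (τ.word y) := by
  obtain ⟨m, hm⟩ := τ.exists_word_le x
  obtain ⟨n, hn⟩ := τ.exists_word_le y
  exact linearDisjoint hm hn

instance word_finite [FiniteDimensional k V] (w : Lambda d) :
    Module.Finite k (τ.word w) := by
  obtain ⟨n, hn⟩ := τ.exists_word_le w
  have h1 : (V1 k V).FG := by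
    rw [V1, LinearMap.range_eq_map]
    exact (Module.Finite.fg_top).map _
  have h2 : Module.Finite k ↥(V1 k V ^ n) := Module.Finite.iff_fg.mpr (h1.pow n)
  exact Submodule.finiteDimensional_of_le hn

end TopForm
end TopForm
end QuadAlg

namespace QuadAlg

open TensorProduct

/-! ### Tensor products of maps inside one algebra -/

section Tmap

variable {k T : Type u} [Field k] [Ring T] [Algebra k T] {P Q : Submodule k T}

/-- The tensor product of two linear endomorphisms, restricted to the product of two linearly
disjoint subspaces and extended arbitrarily. -/
noncomputable def tmap (H : P.LinearDisjoint Q) (f g : T →ₗ[k] T) : T →ₗ[k] T :=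
  extMul H ((LinearMap.mul k T).compl₁₂ (f ∘ₗ P.subtype) (g ∘ₗ Q.subtype))

lemma tmap_mul (H : P.LinearDisjoint Q) (f g : T →ₗ[k] T) {m n : T} (hm : m ∈ P) (hn : n ∈ Q) :
    tmap H f g (m * n) = f m * g n := extMul_mul H _ ⟨m, hm⟩ ⟨n, hn⟩

lemma eqOn_mul {W : Type*} [AddCommGroup W] [Module k W] {f g : T →ₗ[k] W}
    (h : ∀ m ∈ P, ∀ n ∈ Q, f (m * n) = g (m * n)) {x : T} (hx : x ∈ P * Q) : f x = g x := by
  induction hx using Submodule.mul_induction_on' with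
  | mem_mul_mem m hm n hn => exact h m hm n hn
  | add x _ y _ hx hy => rw [map_add, map_add, hx, hy]

lemma tmap_mem (H : P.LinearDisjoint Q) {f g : T →ₗ[k] T} {P' Q' : Submodule k T}
    (hf : ∀ m ∈ P, f m ∈ P') (hg : ∀ n ∈ Q, g n ∈ Q') {x : T} (hx : x ∈ P * Q) :
    tmap H f g x ∈ P' * Q' := by
  induction hx using Submodule.mul_induction_on' with
  | mem_mul_mem m hm n hn =>
    rw [tmap_mul H f g hm hn]
    exact Submodule.mul_mem_mul (hf m hm) (hg n hn)
  | add x _ y _ hx hy => rw [map_add]; exact add_mem hx hy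

end Tmap

/-! ### Construction of a functor on `U` -/

section Functor

variable {k V : Type u} [Field k] [AddCommGroup V] [Module k V] [FiniteDimensional k V]
  {R : Submodule k (V ⊗[k] V)} {d : ℕ} (τ : TopForm R d)

namespace TopForm

omit [FiniteDimensional k V] in
lemma linearDisjoint_Rsub (a b : ℕ) : (Rsub R a).LinearDisjoint (Rsub R b) :=
  linearDisjoint (Rsub_le R a) (Rsub_le R b)

omit [FiniteDimensional k V] in
lemma linearDisjoint_W (a b : ℕ) : (τ.W a).LinearDisjoint (τ.W b) := by
  obtain ⟨m, hm⟩ := τ.W_le a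
  obtain ⟨n, hn⟩ := τ.W_le b
  exact linearDisjoint hm hn

/-- The isomorphism `R_a R_b → W_a W_b`. -/
noncomputable def Jinv₂ (a b : ℕ) : TensorAlgebra k V →ₗ[k] TensorAlgebra k V :=
  tmap (linearDisjoint_Rsub (R := R) a b) (τ.Jinv a) (τ.Jinv b)

omit [FiniteDimensional k V] in
lemma Jinv₂_mul {a b : ℕ} {u v : TensorAlgebra k V} (hu : u ∈ Rsub R a) (hv : v ∈ Rsub R b) :
    τ.Jinv₂ a b (u * v) = τ.Jinv a u * τ.Jinv b v := tmap_mul _ _ _ hu hv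

/-- The map `W_b → R_b`. -/
noncomputable def JW (b : ℕ) : τ.W b →ₗ[k] Rsub R b := (τ.J b).restrict fun _ h => τ.J_mem h

/-- The map `W_a W_b → W_c` induced by the pairing, for `c = a + b - d`. -/
noncomputable def pairW (a b c : ℕ) (hb : b ≤ d) : TensorAlgebra k V →ₗ[k] TensorAlgebra k V :=
  τ.Jinv c ∘ₗ extMul (τ.linearDisjoint_W a b)
    ((τ.pair b hb).compl₁₂ (τ.J a ∘ₗ (τ.W a).subtype) (τ.JW b))

lemma pairW_mul {a b c : ℕ} (hb : b ≤ d) {u : TensorAlgebra k V} (hu : u ∈ Rsub R a)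
    (v : Rsub R b) :
    τ.pairW a b c hb (τ.Jinv a u * τ.Jinv b v) = τ.Jinv c (τ.pair b hb u v) := by
  have h := extMul_mul (τ.linearDisjoint_W a b)
    ((τ.pair b hb).compl₁₂ (τ.J a ∘ₗ (τ.W a).subtype) (τ.JW b))
    ⟨_, τ.Jinv_mem hu⟩ ⟨_, τ.Jinv_mem v.2⟩
  have h1 : τ.JW b ⟨_, τ.Jinv_mem v.2⟩ = v := Subtype.ext (τ.J_Jinv v.2)
  rw [LinearMap.compl₁₂_apply, h1] at h
  simp only [LinearMap.comp_apply, Submodule.subtype_apply, τ.J_Jinv hu] at h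
  rw [pairW, LinearMap.comp_apply, h]

open StrictPres

/-- The value of the trivialised functor on a formal morphism, as an endomorphism of the tensor
algebra. -/
noncomputable def ev : {x y : Lambda d} → PreHom (UPres d).gen x y →
    (TensorAlgebra k V →ₗ[k] TensorAlgebra k V)
  | _, _, .gen (.phi a b c _ _) => τ.Jinv₂ a b ∘ₗ τ.J c
  | _, _, .gen (.theta a b c _ _ hb) => τ.pairW a b c hb
  | _, _, .ident _ => LinearMap.id
  | _, _, .comp f g => ev g ∘ₗ ev f
  | _, _, .tensor (x := x) (x' := x') f g => tmap (τ.word_linearDisjoint x x') (ev f) (ev g)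

omit [FiniteDimensional k V] in
lemma word_theta {a b : ℕ} (ha : a ≤ d) (hb : b ≤ d) :
    τ.word (Lambda.r d a * Lambda.rInv d * Lambda.r d b) = τ.W a * τ.W b := by
  rw [map_mul, map_mul, word_rInv, mul_one, τ.word_r ha, τ.word_r hb]

lemma ev_mem {x y : Lambda d} (f : PreHom (UPres d).gen x y) {v : TensorAlgebra k V}
    (hv : v ∈ τ.word x) : τ.ev f v ∈ τ.word y := by
  induction f generalizing v with
  | gen g =>
    cases g with
    | phi a b c h hc =>
      rw [τ.word_r hc] at hv
      rw [map_mul, τ.word_r (by omega), τ.word_r (by omega)]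
      exact tmap_mem _ (fun _ h => τ.Jinv_mem h) (fun _ h => τ.Jinv_mem h)
        (mem_mul_of_eq h (τ.J_mem hv))
    | theta a b c h ha hb =>
      rw [τ.word_theta ha hb] at hv
      rw [τ.word_r (by omega)]
      induction hv using Submodule.mul_induction_on' with
      | mem_mul_mem m hm n hn =>
        obtain ⟨u, hu, rfl⟩ := τ.exists_Jinv hm
        obtain ⟨v, hv, rfl⟩ := τ.exists_Jinv hn
        have := τ.pairW_mul (c := c) hb hu ⟨v, hv⟩
        refine (congrArg (· ∈ τ.W c) this).mpr ?_
        exact τ.Jinv_mem (τ.pair_mem h hb hu ⟨v, hv⟩)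
      | add x _ y _ hx hy => rw [map_add]; exact add_mem hx hy
  | ident x => exact hv
  | comp f g hf hg => exact hg (hf hv)
  | tensor f g hf hg =>
    rw [map_mul] at hv ⊢
    exact tmap_mem _ (fun _ h => hf h) (fun _ h => hg h) hv

/-- All values of the functor are subspaces of one algebra and all morphisms are evaluated as
endomorphisms of that algebra, so an identity between equal objects acts as the literal identity.
This removes all coherence from the verification of the relations. -/
lemma ev_eqTo {x y : Lambda d} (h : x = y) (v : TensorAlgebra k V) :
    τ.ev (PreHom.eqTo (U.Gen d) h) v = v := by
  subst h; rfl

lemma ev_comp {x y z : Lambda d} (f : PreHom (UPres d).gen x y) (g : PreHom (UPres d).gen y z)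
    (v : TensorAlgebra k V) : τ.ev (f.comp g) v = τ.ev g (τ.ev f v) := rfl

lemma ev_ident (x : Lambda d) (v : TensorAlgebra k V) :
    τ.ev (.ident x : PreHom (UPres d).gen x x) v = v := rfl

lemma ev_tensor {x y x' y' : Lambda d} (f : PreHom (UPres d).gen x y)
    (g : PreHom (UPres d).gen x' y') {m n : TensorAlgebra k V} (hm : m ∈ τ.word x)
    (hn : n ∈ τ.word x') : τ.ev (f.tensor g) (m * n) = τ.ev f m * τ.ev g n :=
  tmap_mul _ _ _ hm hn

lemma ev_phi {a b c : ℕ} (h : a + b = c) (hc : c ≤ d) {u : TensorAlgebra k V}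
    (hu : u ∈ Rsub R c) : τ.ev (U.phi a b c h hc) (τ.Jinv c u) = τ.Jinv₂ a b u :=
  congrArg (τ.Jinv₂ a b) (τ.J_Jinv hu)

lemma ev_theta {a b c : ℕ} (h : a + b = c + d) (ha : a ≤ d) (hb : b ≤ d) {u v : TensorAlgebra k V}
    (hu : u ∈ Rsub R a) (hv : v ∈ Rsub R b) :
    τ.ev (U.theta a b c h ha hb) (τ.Jinv a u * τ.Jinv b v) =
      τ.Jinv c (τ.pair b hb u ⟨v, hv⟩) := τ.pairW_mul hb hu ⟨v, hv⟩

omit [FiniteDimensional k V] in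
lemma Jinv_mem_word {a : ℕ} (ha : a ≤ d) {u : TensorAlgebra k V} (hu : u ∈ Rsub R a) :
    τ.Jinv a u ∈ τ.word (Lambda.r d a) := by
  rw [τ.word_r ha]; exact τ.Jinv_mem hu

omit [FiniteDimensional k V] in
lemma mem_word_rInv_mul {x : Lambda d} {u : TensorAlgebra k V} (hu : u ∈ τ.word x) :
    u ∈ τ.word (Lambda.rInv d * x) := by
  rwa [map_mul, word_rInv, one_mul]

omit [FiniteDimensional k V] in
lemma mem_word_mul_rInv {x : Lambda d} {u : TensorAlgebra k V} (hu : u ∈ τ.word x) :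
    u ∈ τ.word (x * Lambda.rInv d) := by
  rwa [map_mul, word_rInv, mul_one]

omit [FiniteDimensional k V] in
lemma mul_mem_word {x y : Lambda d} {u v : TensorAlgebra k V} (hu : u ∈ τ.word x)
    (hv : v ∈ τ.word y) : u * v ∈ τ.word (x * y) := by
  rw [map_mul]; exact Submodule.mul_mem_mul hu hv

/-- Before trivialisation both sides are the inclusion of `R_abc` in `R_a R_b R_c`; afterwards both
are the map that applies `Jinv` in each of the three factors, and this is checked on products. -/
lemma ev_phi_phi {a b c ab bc abc : ℕ} (h₁ : a + b = ab) (h₂ : b + c = bc) (h₃ : ab + c = abc)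
    (h₄ : a + bc = abc) (hd : abc ≤ d) {x : TensorAlgebra k V}
    (hx : x ∈ τ.word (Lambda.r d abc)) :
    τ.ev ((U.phi a b ab h₁ (by omega)).tensor (.ident (Lambda.r d c)))
        (τ.ev (U.phi ab c abc h₃ hd) x) =
      τ.ev ((PreHom.ident (Lambda.r d a)).tensor (U.phi b c bc h₂ (by omega)))
        (τ.ev (U.phi a bc abc h₄ hd) x) := by
  rw [τ.word_r hd] at hx
  obtain ⟨u, hu, rfl⟩ := τ.exists_Jinv hx
  rw [τ.ev_phi _ _ hu, τ.ev_phi _ _ hu]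
  have hab := linearDisjoint (Rsub_le R a) (Rsub_le R b)
  have hle : Rsub R ab ≤ Rsub R a * Rsub R b := h₁ ▸ Rsub_add_le R a b
  have hle' : Rsub R bc ≤ Rsub R b * Rsub R c := h₂ ▸ Rsub_add_le R b c
  have Hl : (Rsub R a * Rsub R b).LinearDisjoint (Rsub R c) :=
    linearDisjoint (m := a + b) (by rw [pow_add]; exact mul_le_mul' (Rsub_le R a) (Rsub_le R b))
      (Rsub_le R c)
  have Hr : (Rsub R a).LinearDisjoint (Rsub R b * Rsub R c) :=
    linearDisjoint (n := b + c) (Rsub_le R a)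
      (by rw [pow_add]; exact mul_le_mul' (Rsub_le R b) (Rsub_le R c))
  have e1 : τ.ev ((U.phi a b ab h₁ (by omega)).tensor (.ident (Lambda.r d c)))
      (τ.Jinv₂ ab c u) = tmap Hl (τ.Jinv₂ a b) (τ.Jinv c) u := by
    refine eqOn_mul (f := τ.ev ((U.phi a b ab h₁ (by omega)).tensor (.ident (Lambda.r d c))) ∘ₗ
      τ.Jinv₂ ab c) (fun m hm n hn => ?_) (mem_mul_of_eq h₃ hu)
    rw [LinearMap.comp_apply, τ.Jinv₂_mul hm hn, tmap_mul Hl _ _ (hle hm) hn,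
      τ.ev_tensor _ _ (τ.Jinv_mem_word (by omega) hm) (τ.Jinv_mem_word (by omega) hn),
      τ.ev_phi _ _ hm, ev_ident]
  have e2 : τ.ev ((PreHom.ident (Lambda.r d a)).tensor (U.phi b c bc h₂ (by omega)))
      (τ.Jinv₂ a bc u) = tmap Hr (τ.Jinv a) (τ.Jinv₂ b c) u := by
    refine eqOn_mul (f := τ.ev ((PreHom.ident (Lambda.r d a)).tensor
      (U.phi b c bc h₂ (by omega))) ∘ₗ τ.Jinv₂ a bc) (fun m hm n hn => ?_) (mem_mul_of_eq h₄ hu)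
    rw [LinearMap.comp_apply, τ.Jinv₂_mul hm hn, tmap_mul Hr _ _ hm (hle' hn),
      τ.ev_tensor _ _ (τ.Jinv_mem_word (by omega) hm) (τ.Jinv_mem_word (by omega) hn),
      τ.ev_phi _ _ hn, ev_ident]
  rw [e1, e2]
  refine eqOn_mul (fun m hm n hn => ?_) (mul_le_mul_left hle (Rsub R c) (mem_mul_of_eq h₃ hu))
  refine eqOn_mul (f := tmap Hl (τ.Jinv₂ a b) (τ.Jinv c) ∘ₗ LinearMap.mulRight k n)
    (g := tmap Hr (τ.Jinv a) (τ.Jinv₂ b c) ∘ₗ LinearMap.mulRight k n)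
    (fun u hu v hv => ?_) hm
  simp only [LinearMap.comp_apply, LinearMap.mulRight_apply]
  rw [tmap_mul Hl _ _ (Submodule.mul_mem_mul hu hv) hn, mul_assoc,
    tmap_mul Hr _ _ hu (Submodule.mul_mem_mul hv hn), τ.Jinv₂_mul hu hv, τ.Jinv₂_mul hv hn,
    mul_assoc]

/-- Pairing with `w` is a right contraction, which in `R_a R_b` only touches the second factor, so
it commutes with splitting off the first. -/
lemma ev_phi_theta {a b c ab bc abc : ℕ} (h₁ : a + b = ab) (h₂ : b + c = bc + d)
    (h₃ : ab + c = abc + d) (h₄ : a + bc = abc) (hab : ab ≤ d) (hc : c ≤ d)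
    {u w : TensorAlgebra k V} (hu : u ∈ Rsub R ab) (hw : w ∈ Rsub R c) :
    τ.ev ((PreHom.ident (Lambda.r d a)).tensor (U.theta b c bc h₂ (by omega) hc))
        (τ.ev ((U.phi a b ab h₁ hab).tensor (.ident (Lambda.rInv d * Lambda.r d c)))
          (τ.Jinv ab u * τ.Jinv c w)) =
      τ.ev (U.phi a bc abc h₄ (by omega))
        (τ.ev (U.theta ab c abc h₃ hab hc) (τ.Jinv ab u * τ.Jinv c w)) := by
  rw [τ.ev_tensor _ _ (τ.Jinv_mem_word hab hu)
    (τ.mem_word_rInv_mul (τ.Jinv_mem_word hc hw)), τ.ev_phi _ _ hu, ev_ident,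
    τ.ev_theta _ _ _ hu hw, τ.ev_phi _ _ (τ.pair_mem h₃ hc hu ⟨w, hw⟩)]
  refine eqOn_mul (f := τ.ev ((PreHom.ident (Lambda.r d a)).tensor
      (U.theta b c bc h₂ (by omega) hc)) ∘ₗ LinearMap.mulRight k (τ.Jinv c w) ∘ₗ τ.Jinv₂ a b)
    (g := τ.Jinv₂ a bc ∘ₗ (τ.pair c hc).flip ⟨w, hw⟩)
    (fun m hm n hn => ?_) (mem_mul_of_eq h₁ hu)
  simp only [LinearMap.comp_apply, LinearMap.mulRight_apply, LinearMap.flip_apply]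
  rw [τ.pair_mul_left hc (by omega) m hn, τ.Jinv₂_mul hm hn,
    τ.Jinv₂_mul hm (τ.pair_mem h₂ hc hn ⟨w, hw⟩), mul_assoc (τ.Jinv a m),
    τ.ev_tensor _ _ (τ.Jinv_mem_word (by omega) hm)
      (τ.mul_mem_word (τ.mem_word_mul_rInv (τ.Jinv_mem_word (by omega) hn))
        (τ.Jinv_mem_word hc hw)), ev_ident, τ.ev_theta _ _ _ hn hw]

/-- This is the mirror image of `ev_phi_theta`, through the description of the pairing by left
contraction in `pair_eq`: the last factor of `R_b R_c` is not touched. -/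
lemma ev_theta_phi {a b c ab bc abc : ℕ} (h₁ : a + b = ab + d) (h₂ : b + c = bc)
    (h₃ : ab + c = abc) (h₄ : a + bc = abc + d) (ha : a ≤ d) (hbc : bc ≤ d)
    {u w : TensorAlgebra k V} (hu : u ∈ Rsub R a) (hw : w ∈ Rsub R bc) :
    τ.ev ((U.theta a b ab h₁ ha (by omega)).tensor (.ident (Lambda.r d c)))
        (τ.ev ((PreHom.ident (Lambda.r d a * Lambda.rInv d)).tensor (U.phi b c bc h₂ hbc))
          (τ.Jinv a u * τ.Jinv bc w)) =
      τ.ev (U.phi ab c abc h₃ (by omega))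
        (τ.ev (U.theta a bc abc h₄ ha hbc) (τ.Jinv a u * τ.Jinv bc w)) := by
  have hb : b ≤ d := by omega
  rw [τ.ev_tensor _ _ (τ.mem_word_mul_rInv (τ.Jinv_mem_word ha hu)) (τ.Jinv_mem_word hbc hw),
    τ.ev_phi _ _ hw, ev_ident, τ.ev_theta _ _ _ hu hw,
    τ.ev_phi _ _ (τ.pair_mem h₄ hbc hu ⟨w, hw⟩), τ.pair_eq ha hbc (by omega) ⟨u, hu⟩]
  refine eqOn_mul (f := τ.ev ((U.theta a b ab h₁ ha (by omega)).tensor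
      (.ident (Lambda.r d c))) ∘ₗ LinearMap.mulLeft k (τ.Jinv a u) ∘ₗ τ.Jinv₂ b c)
    (g := τ.Jinv₂ ab c ∘ₗ (lc R (d - a)).flip (τ.ldual a ha ⟨u, hu⟩))
    (fun m hm n hn => ?_) (mem_mul_of_eq h₂ hw)
  simp only [LinearMap.comp_apply, LinearMap.mulLeft_apply, LinearMap.flip_apply]
  rw [τ.lc_mul_ldual ha (by omega) _ hm, τ.Jinv₂_mul hm hn,
    ← τ.pair_eq ha hb (by omega) ⟨u, hu⟩ ⟨m, hm⟩,
    τ.Jinv₂_mul (τ.pair_mem h₁ hb hu ⟨m, hm⟩) hn, ← mul_assoc (τ.Jinv a u),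
    τ.ev_tensor _ _ (τ.mul_mem_word (τ.mem_word_mul_rInv (τ.Jinv_mem_word ha hu))
        (τ.Jinv_mem_word hb hm)) (τ.Jinv_mem_word (by omega) hn), ev_ident,
    τ.ev_theta _ _ _ hu hm]

lemma ev_theta_theta {a b c ab bc abc : ℕ} (h₁ : a + b = ab + d) (h₂ : b + c = bc + d)
    (h₃ : ab + c = abc + d) (h₄ : a + bc = abc + d) (ha : a ≤ d) (hb : b ≤ d) (hc : c ≤ d)
    {u v w : TensorAlgebra k V} (hu : u ∈ Rsub R a) (hv : v ∈ Rsub R b) (hw : w ∈ Rsub R c) :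
    τ.ev (U.theta ab c abc h₃ (by omega) hc)
        (τ.ev ((U.theta a b ab h₁ ha hb).tensor (.ident (Lambda.rInv d * Lambda.r d c)))
          (τ.Jinv a u * τ.Jinv b v * τ.Jinv c w)) =
      τ.ev (U.theta a bc abc h₄ ha (by omega))
        (τ.ev ((PreHom.ident (Lambda.r d a * Lambda.rInv d)).tensor (U.theta b c bc h₂ hb hc))
          (τ.Jinv a u * τ.Jinv b v * τ.Jinv c w)) := by
  have hu' := τ.mem_word_mul_rInv (τ.Jinv_mem_word ha hu)
  rw [τ.ev_tensor _ _ (τ.mul_mem_word hu' (τ.Jinv_mem_word hb hv))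
      (τ.mem_word_rInv_mul (τ.Jinv_mem_word hc hw)), mul_assoc (τ.Jinv a u),
    τ.ev_tensor _ _ hu' (τ.mul_mem_word (τ.mem_word_mul_rInv (τ.Jinv_mem_word hb hv))
        (τ.Jinv_mem_word hc hw)), ev_ident, ev_ident, τ.ev_theta _ _ _ hu hv,
    τ.ev_theta _ _ _ hv hw, τ.ev_theta _ _ _ (τ.pair_mem h₁ hb hu ⟨v, hv⟩) hw,
    τ.ev_theta _ _ _ hu (τ.pair_mem h₂ hc hv ⟨w, hw⟩),
    τ.pair_pair h₁ h₂ (by omega) ha hb hc (by omega) ⟨u, hu⟩ ⟨v, hv⟩ ⟨w, hw⟩]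

omit [FiniteDimensional k V] in
lemma eqOn_word_theta {W : Type*} [AddCommGroup W] [Module k W] {a b : ℕ} (ha : a ≤ d) (hb : b ≤ d)
    {f g : TensorAlgebra k V →ₗ[k] W}
    (h : ∀ u ∈ Rsub R a, ∀ v ∈ Rsub R b,
      f (τ.Jinv a u * τ.Jinv b v) = g (τ.Jinv a u * τ.Jinv b v)) {x : TensorAlgebra k V}
    (hx : x ∈ τ.word (Lambda.r d a * Lambda.rInv d * Lambda.r d b)) : f x = g x := by
  rw [τ.word_theta ha hb] at hx
  refine eqOn_mul (fun m hm n hn => ?_) hx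
  obtain ⟨u, hu, rfl⟩ := τ.exists_Jinv hm
  obtain ⟨v, hv, rfl⟩ := τ.exists_Jinv hn
  exact h u hu v hv

lemma ev_rel {x y : Lambda d} {f g : PreHom (UPres d).gen x y} (h : (UPres d).rel f g)
    {v : TensorAlgebra k V} (hv : v ∈ τ.word x) : τ.ev f v = τ.ev g v := by
  cases h with
  | phi_zero_left a ha =>
    rw [τ.word_r ha] at hv
    obtain ⟨u, hu, rfl⟩ := τ.exists_Jinv hv
    have h1 : (1 : TensorAlgebra k V) ∈ Rsub R 0 := by
      rw [Rsub_zero]; exact Submodule.one_le.mp le_rfl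
    have h2 := τ.Jinv₂_mul h1 hu
    rw [one_mul, Jinv_zero_one, one_mul] at h2
    rw [ev_eqTo, τ.ev_phi _ _ hu, h2]
  | phi_zero_right a ha =>
    rw [τ.word_r ha] at hv
    obtain ⟨u, hu, rfl⟩ := τ.exists_Jinv hv
    have h1 : (1 : TensorAlgebra k V) ∈ Rsub R 0 := by
      rw [Rsub_zero]; exact Submodule.one_le.mp le_rfl
    have h2 := τ.Jinv₂_mul hu h1
    rw [mul_one, Jinv_zero_one, mul_one] at h2
    rw [ev_eqTo, τ.ev_phi _ _ hu, h2]
  -- `R_d` is spanned by `t`, which trivialises to `1` and pairs as the identity.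
  | theta_top_left a ha =>
    rw [ev_eqTo]
    refine τ.eqOn_word_theta le_rfl ha (g := LinearMap.id) (fun u hu v hv => ?_) hv
    obtain ⟨c, rfl⟩ := τ.exists_smul hu
    rw [τ.ev_theta _ _ _ hu hv, map_smul, LinearMap.smul_apply, τ.pair_t_left ha ⟨v, hv⟩,
      map_smul, map_smul, Jinv_top, LinearMap.id_apply, smul_mul_assoc, one_mul]
  | theta_top_right a ha =>
    rw [ev_eqTo]
    refine τ.eqOn_word_theta ha le_rfl (g := LinearMap.id) (fun u hu v hv => ?_) hv
    obtain ⟨c, rfl⟩ := τ.exists_smul hv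
    have h1 : (⟨c • τ.t, hv⟩ : Rsub R d) = c • ⟨τ.t, τ.mem⟩ := rfl
    rw [τ.ev_theta _ _ _ hu hv, h1, map_smul, τ.pair_t_right ha ⟨u, hu⟩,
      map_smul, map_smul, Jinv_top, LinearMap.id_apply, mul_smul_comm, mul_one]
  | phi_phi a b c ab bc abc h₁ h₂ h₃ h₄ hd =>
    simp only [ev_comp, ev_eqTo]
    exact τ.ev_phi_phi h₁ h₂ h₃ h₄ hd hv
  | theta_theta a b c ab bc abc h₁ h₂ h₃ h₄ ha hb hc =>
    simp only [ev_comp, ev_eqTo]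
    have hab : ab ≤ d := by omega
    have hbc : bc ≤ d := by omega
    rw [map_mul, map_mul _ (Lambda.rInv d), word_rInv, one_mul, τ.word_r hc] at hv
    refine eqOn_mul (f := τ.ev (U.theta ab c abc h₃ hab hc) ∘ₗ
        τ.ev ((U.theta a b ab h₁ ha hb).tensor (.ident (Lambda.rInv d * Lambda.r d c))))
      (g := τ.ev (U.theta a bc abc h₄ ha hbc) ∘ₗ
        τ.ev ((PreHom.ident (Lambda.r d a * Lambda.rInv d)).tensor (U.theta b c bc h₂ hb hc)))
      (fun m hm n hn => ?_) hv
    obtain ⟨w, hw, rfl⟩ := τ.exists_Jinv hn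
    exact τ.eqOn_word_theta ha hb (f := (τ.ev (U.theta ab c abc h₃ hab hc) ∘ₗ
        τ.ev ((U.theta a b ab h₁ ha hb).tensor (.ident (Lambda.rInv d * Lambda.r d c)))) ∘ₗ
          LinearMap.mulRight k (τ.Jinv c w))
      (g := (τ.ev (U.theta a bc abc h₄ ha hbc) ∘ₗ
        τ.ev ((PreHom.ident (Lambda.r d a * Lambda.rInv d)).tensor (U.theta b c bc h₂ hb hc))) ∘ₗ
          LinearMap.mulRight k (τ.Jinv c w))
      (fun u hu v hv => τ.ev_theta_theta h₁ h₂ h₃ h₄ ha hb hc hu hv hw) hm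
  | phi_theta a b c ab bc abc h₁ h₂ h₃ h₄ hab hc =>
    simp only [ev_comp, ev_eqTo]
    have hb : b ≤ d := by omega
    have habc : abc ≤ d := by omega
    exact τ.eqOn_word_theta hab hc
      (f := τ.ev ((PreHom.ident (Lambda.r d a)).tensor (U.theta b c bc h₂ hb hc)) ∘ₗ
        τ.ev ((U.phi a b ab h₁ hab).tensor (.ident (Lambda.rInv d * Lambda.r d c))))
      (g := τ.ev (U.phi a bc abc h₄ habc) ∘ₗ τ.ev (U.theta ab c abc h₃ hab hc))
      (fun u hu w hw => τ.ev_phi_theta h₁ h₂ h₃ h₄ hab hc hu hw) hv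
  | theta_phi a b c ab bc abc h₁ h₂ h₃ h₄ ha hbc =>
    simp only [ev_comp, ev_eqTo]
    have hb : b ≤ d := by omega
    have habc : abc ≤ d := by omega
    exact τ.eqOn_word_theta ha hbc
      (f := τ.ev ((U.theta a b ab h₁ ha hb).tensor (.ident (Lambda.r d c))) ∘ₗ
        τ.ev ((PreHom.ident (Lambda.r d a * Lambda.rInv d)).tensor (U.phi b c bc h₂ hbc)))
      (g := τ.ev (U.phi ab c abc h₃ habc) ∘ₗ τ.ev (U.theta a bc abc h₄ ha hbc))
      (fun u hu w hw => τ.ev_theta_phi h₁ h₂ h₃ h₄ ha hbc hu hw) hv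

/-- The value of the trivialised functor on an object. -/
noncomputable abbrev wordObj (w : Lambda d) : FGModuleCat.{u} k := FGModuleCat.of k (τ.word w)

lemma wordObj_eqToHom {w w' : Lambda d} (h : w = w') (x : τ.word w) :
    (((eqToHom (congrArg τ.wordObj h)).hom.hom x : τ.word w') : TensorAlgebra k V) = x := by
  subst h; rfl

omit [FiniteDimensional k V] in
lemma algebraMap_mem_word_one (c : k) : algebraMap k (TensorAlgebra k V) c ∈ τ.word 1 := by
  rw [map_one]; exact Submodule.mem_one.mpr ⟨c, rfl⟩

/-- The unit isomorphism of the trivialised functor. -/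
noncomputable def unitEquiv : k ≃ₗ[k] τ.word 1 :=
  LinearEquiv.ofBijective
    ((Algebra.linearMap k (TensorAlgebra k V)).codRestrict (τ.word 1) τ.algebraMap_mem_word_one)
    ⟨fun a b h => (TensorAlgebra.algebraMap_leftInverse V).injective (congrArg Subtype.val h), by
      rintro ⟨x, hx⟩
      have hx' := hx
      rw [map_one] at hx'
      obtain ⟨c, rfl⟩ := Submodule.mem_one.mp hx'
      exact ⟨c, rfl⟩⟩

/-- The tensor isomorphisms of the trivialised functor. -/
noncomputable def mulEquiv (x y : Lambda d) : (τ.word x ⊗[k] τ.word y) ≃ₗ[k] τ.word (x * y) :=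
  (τ.word_linearDisjoint x y).mulMap ≪≫ₗ LinearEquiv.ofEq _ _ (map_mul τ.word x y).symm

/-- The values of the trivialised functor on generators. -/
noncomputable def liftData : (UPres d).LiftData (FGModuleCat.{u} k) where
  obj := τ.wordObj
  ε := τ.unitEquiv.toFGModuleCatIso
  μ x y := (τ.mulEquiv x y).toFGModuleCatIso
  assoc x y z := by
    refine FGModuleCat.hom_ext (TensorProduct.ext_threefold fun a b c => Subtype.ext ?_)
    refine (τ.wordObj_eqToHom (mul_assoc x y z) _).trans ?_
    exact mul_assoc (a : TensorAlgebra k V) b c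
  left_unit x := by
    refine FGModuleCat.hom_ext (TensorProduct.ext' fun a b => Subtype.ext ?_)
    refine (τ.wordObj_eqToHom (one_mul x) _).trans ?_
    exact (Algebra.smul_def a (b : TensorAlgebra k V)).symm
  right_unit x := by
    refine FGModuleCat.hom_ext (TensorProduct.ext' fun b a => Subtype.ext ?_)
    refine (τ.wordObj_eqToHom (mul_one x) _).trans ?_
    exact (Algebra.commutes a (b : TensorAlgebra k V)).symm.trans
      (Algebra.smul_def a (b : TensorAlgebra k V)).symm
  map g := FGModuleCat.ofHom ((τ.ev (.gen g)).restrict fun _ h => τ.ev_mem (.gen g) h)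

lemma mulEquiv_map_apply {x y x' y' : Lambda d} (p : PreHom (UPres d).gen x y)
    (q : PreHom (UPres d).gen x' y') (f : τ.word x →ₗ[k] τ.word y) (g : τ.word x' →ₗ[k] τ.word y')
    (hf : ∀ v, (f v : TensorAlgebra k V) = τ.ev p v)
    (hg : ∀ v, (g v : TensorAlgebra k V) = τ.ev q v) (v : τ.word (x * x')) :
    (τ.mulEquiv y y' (TensorProduct.map f g ((τ.mulEquiv x x').symm v)) : TensorAlgebra k V) =
      τ.ev (p.tensor q) v := by
  obtain ⟨t, rfl⟩ := (τ.mulEquiv x x').surjective v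
  rw [LinearEquiv.symm_apply_apply]
  induction t using TensorProduct.induction_on with
  | zero => simp
  | add s t hs ht =>
    rw [map_add, map_add, map_add, Submodule.coe_add, Submodule.coe_add, map_add, hs, ht]
  | tmul a b =>
    have h (z w : Lambda d) (a : τ.word z) (b : τ.word w) :
        (τ.mulEquiv z w (a ⊗ₜ b) : TensorAlgebra k V) = a * b := rfl
    rw [TensorProduct.map_tmul, h, h, τ.ev_tensor p q a.2 b.2, hf, hg]

lemma eval_apply {x y : Lambda d} (f : PreHom (UPres d).gen x y) (v : τ.word x) :
    Subtype.val (p := (· ∈ τ.word y)) ((τ.liftData.eval f).hom.hom v) = τ.ev f v := by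
  induction f with
  | gen g => rfl
  | ident x => rfl
  | comp f g hf hg =>
    exact (hg ((τ.liftData.eval f).hom.hom v)).trans (congrArg (τ.ev g) (hf v))
  | tensor f g hf hg => exact τ.mulEquiv_map_apply f g _ _ hf hg v

lemma liftData_respects : τ.liftData.Respects := fun _ _ f g h =>
  FGModuleCat.hom_ext (LinearMap.ext fun v => Subtype.ext
    ((τ.eval_apply f v).trans ((τ.ev_rel h v.2).trans (τ.eval_apply g v).symm)))

/-- A monoidal functor on `U` which extends `M⁺`, obtained by trivialising `R_d`. -/
noncomputable def functor : U d ⥤ FGModuleCat.{u} k := τ.liftData.lift τ.liftData_respects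

noncomputable instance : τ.functor.Monoidal :=
  inferInstanceAs (τ.liftData.lift τ.liftData_respects).Monoidal

end TopForm

end Functor
end QuadAlg

namespace FiberFunctor

open TensorProduct

/-! ### Monoidal isomorphisms as coactions of the ground field -/

section

variable {k : Type u} [Field k] {C : Type w} [Category.{v} C] [MonoidalCategory C]
  {F G : C ⥤ FGModuleCat.{u} k} [F.Monoidal] [G.Monoidal]

/-- The scalar-valued part of a map into `k ⊗ W`. -/
noncomputable def Coaction.lin (ρ : Coaction F G k) (X : C) : F.obj X →ₗ[k] G.obj X :=
  (TensorProduct.lid k (G.obj X)).toLinearMap ∘ₗ ρ.app X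

lemma lid_mulCo {X Y : C} (x : k ⊗[k] G.obj X) (y : k ⊗[k] G.obj Y) :
    TensorProduct.lid k _ (mulCo k (muL G X Y).toLinearMap x y) =
      muL G X Y (TensorProduct.lid k _ x ⊗ₜ TensorProduct.lid k _ y) := by
  induction x using TensorProduct.induction_on with
  | zero => simp
  | add x x' hx hx' => simp only [map_add, LinearMap.add_apply, add_tmul, hx, hx']
  | tmul b v =>
  induction y using TensorProduct.induction_on with
  | zero => simp
  | add y y' hy hy' => simp only [map_add, tmul_add, hy, hy']
  | tmul c w =>
    simp only [mulCo_tmul, TensorProduct.lid_tmul, LinearEquiv.coe_coe, smul_tmul_smul, map_smul]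

lemma Coaction.lin_mul (ρ : Coaction F G k) (X Y : C) (x : F.obj X) (y : F.obj Y) :
    ρ.lin (X ⊗ Y) (muL F X Y (x ⊗ₜ y)) = muL G X Y (ρ.lin X x ⊗ₜ ρ.lin Y y) := by
  simp only [lin, LinearMap.comp_apply, ρ.mul, conv_muL, LinearEquiv.coe_coe, lid_mulCo]

lemma Coaction.lin_nat (ρ : Coaction F G k) {X Y : C} (f : X ⟶ Y) (x : F.obj X) :
    mapL G f (ρ.lin X x) = ρ.lin Y (mapL F f x) := by
  have h := congrArg (TensorProduct.lid k _) (ρ.nat_apply f x)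
  have h2 : ∀ z : k ⊗[k] G.obj X, TensorProduct.lid k _ ((mapL G f).lTensor k z) =
      mapL G f (TensorProduct.lid k _ z) := by
    intro z
    induction z using TensorProduct.induction_on with
    | zero => simp
    | add y y' hy hy' => simp only [map_add, hy, hy']
    | tmul c w => simp
  rw [h2] at h
  exact h

lemma Coaction.lin_bijective_mul (ρ : Coaction F G k) {X Y : C}
    (hX : Function.Bijective (ρ.lin X)) (hY : Function.Bijective (ρ.lin Y)) :
    Function.Bijective (ρ.lin (X ⊗ Y)) := by
  have h : ρ.lin (X ⊗ Y) = ((muL F X Y).symm ≪≫ₗ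
      TensorProduct.congr (LinearEquiv.ofBijective _ hX) (LinearEquiv.ofBijective _ hY) ≪≫ₗ
        muL G X Y).toLinearMap := dual_ext fun v w => by simp [ρ.lin_mul]
  rw [h]
  exact LinearEquiv.bijective _

lemma Coaction.lin_one (ρ : Coaction F G k) : ρ.lin (𝟙_ C) (epsL F 1) = epsL G 1 := by
  simp [lin, ρ.one]

lemma Coaction.lin_bijective_one (ρ : Coaction F G k) : Function.Bijective (ρ.lin (𝟙_ C)) := by
  have h : ρ.lin (𝟙_ C) = ((epsL F).symm ≪≫ₗ epsL G).toLinearMap := unit_hom_ext (by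
    simp [ρ.lin_one])
  rw [h]
  exact LinearEquiv.bijective _

/-- A monoidal isomorphism, from a family of linear isomorphisms. -/
lemma Coaction.exists_iso (ρ : Coaction F G k) (h : ∀ X, Function.Bijective (ρ.lin X)) :
    ∃ e : F ≅ G, NatTrans.IsMonoidal e.hom := by
  refine ⟨NatIso.ofComponents (fun X => (LinearEquiv.ofBijective (ρ.lin X) (h X)).toFGModuleCatIso)
    fun {X Y} f => FGModuleCat.hom_ext (LinearMap.ext fun x => (ρ.lin_nat f x).symm), ?_⟩
  constructor
  · refine FGModuleCat.hom_ext (LinearMap.ext_ring ?_)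
    exact ρ.lin_one
  · intro X Y
    refine FGModuleCat.hom_ext (TensorProduct.ext' fun x y => ?_)
    exact ρ.lin_mul X Y x y

end

end FiberFunctor

namespace QuadAlg

open TensorProduct FiberFunctor

/-! ### Elements of the values of `M⁺` as tensors -/

section Elements

variable {k V : Type u} [Field k] [AddCommGroup V] [Module k V] [FiniteDimensional k V]
  (R : Submodule k (V ⊗[k] V)) {d : ℕ}

/-- An element of `M⁺(x)`, given by an element of the tensor algebra. -/
noncomputable def elt (x : LambdaPlus d) (u : TensorAlgebra k V) (hu : u ∈ word R d x) :
    (MPlus R d).obj ⟨x⟩ := (⟨u, hu⟩ : word R d x)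

variable {R}

lemma exists_elt {x : LambdaPlus d} (v : (MPlus R d).obj ⟨x⟩) : ∃ u hu, v = elt R x u hu :=
  ⟨_, Subtype.prop (p := (· ∈ word R d x)) v, rfl⟩

lemma elt_add {x : LambdaPlus d} {u v : TensorAlgebra k V} (hu : u ∈ word R d x)
    (hv : v ∈ word R d x) : elt R x (u + v) (add_mem hu hv) = elt R x u hu + elt R x v hv := rfl

omit [FiniteDimensional k V] in
lemma word_mul_mem {x y : LambdaPlus d} {u v : TensorAlgebra k V} (hu : u ∈ word R d x)
    (hv : v ∈ word R d y) : u * v ∈ word R d (x * y) := by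
  rw [map_mul]; exact Submodule.mul_mem_mul hu hv

lemma muL_elt {x y : LambdaPlus d} {u v : TensorAlgebra k V} (hu : u ∈ word R d x)
    (hv : v ∈ word R d y) : muL (MPlus R d) ⟨x⟩ ⟨y⟩ (elt R x u hu ⊗ₜ elt R y v hv) =
      elt R (x * y) (u * v) (word_mul_mem hu hv) := rfl

omit [FiniteDimensional k V] in
lemma one_mem_word : (1 : TensorAlgebra k V) ∈ word R d 1 := by
  rw [map_one]; exact Submodule.one_le.mp le_rfl

lemma epsL_elt : epsL (MPlus R d) 1 = elt R 1 1 one_mem_word :=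
  Subtype.ext (map_one (algebraMap k (TensorAlgebra k V)))

lemma exists_mapL_elt {x y : LambdaPlus d} (f : (⟨x⟩ : UpPlus d) ⟶ ⟨y⟩) {u : TensorAlgebra k V}
    (hu : u ∈ word R d x) : ∃ hu', mapL (MPlus R d) f (elt R x u hu) = elt R y u hu' := by
  obtain ⟨f, rfl⟩ := (UpPlusPres d).homMk_surjective f
  have h := eval_apply R d f ⟨u, hu⟩
  refine ⟨?_, Subtype.ext h⟩
  have h2 := Subtype.prop (p := (· ∈ word R d y)) (((liftData R d).eval f).hom.hom (⟨u, hu⟩ : word R d x))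
  rwa [h] at h2

end Elements

/-! ### The trivialised functor extends `M⁺` -/

section Extension

variable {k V : Type u} [Field k] [AddCommGroup V] [Module k V] [FiniteDimensional k V]
  {R : Submodule k (V ⊗[k] V)} {d : ℕ} (τ : TopForm R d)

namespace TopForm

open StrictPres

lemma functor_eqToHom {X Y : U d} (h : X = Y) (v : τ.word X.of) :
    (Subtype.val (p := (· ∈ τ.word Y.of)) (mapL τ.functor (eqToHom h) v)) = v := by
  subst h; simp only [eqToHom_refl, mapL_id]; rfl

/-- The restriction of the trivialised functor to `U↑⁺`. -/
noncomputable abbrev restr : UpPlus d ⥤ FGModuleCat.{u} k := UpPlus.toU d ⋙ τ.functor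

omit [FiniteDimensional k V] in
lemma J_mem_word {a : ℕ} (ha : a ≤ d) {x : TensorAlgebra k V}
    (hx : x ∈ τ.word (Lambda.r d a)) : τ.J a x ∈ QuadAlg.word R d (LambdaPlus.r d a) := by
  rw [τ.word_r ha] at hx
  rw [QuadAlg.word_r R ha]
  exact τ.J_mem hx

/-- An element of the value on `x` of the trivialised functor, given by an element of the tensor
algebra. -/
noncomputable def elt (x : LambdaPlus d) (u : TensorAlgebra k V)
    (hu : u ∈ τ.word (Lambda.incl d x)) : τ.restr.obj ⟨x⟩ := (⟨u, hu⟩ : τ.word (Lambda.incl d x))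

lemma exists_elt {x : LambdaPlus d} (v : τ.restr.obj ⟨x⟩) : ∃ u hu, v = τ.elt x u hu :=
  ⟨_, Subtype.prop (p := (· ∈ τ.word (Lambda.incl d x))) v, rfl⟩

lemma elt_add {x : LambdaPlus d} {u v : TensorAlgebra k V} (hu : u ∈ τ.word (Lambda.incl d x))
    (hv : v ∈ τ.word (Lambda.incl d x)) :
    τ.elt x (u + v) (add_mem hu hv) = τ.elt x u hu + τ.elt x v hv := rfl

lemma elt_congr {x : LambdaPlus d} {u v : TensorAlgebra k V} (h : u = v)
    (hu : u ∈ τ.word (Lambda.incl d x)) (hv : v ∈ τ.word (Lambda.incl d x)) :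
    τ.elt x u hu = τ.elt x v hv := by subst h; rfl

omit [FiniteDimensional k V] in
lemma mul_mem_word_incl {x y : LambdaPlus d} {u v : TensorAlgebra k V}
    (hu : u ∈ τ.word (Lambda.incl d x)) (hv : v ∈ τ.word (Lambda.incl d y)) :
    u * v ∈ τ.word (Lambda.incl d (x * y)) := by
  rw [map_mul]; exact τ.mul_mem_word hu hv

lemma muL_elt {x y : LambdaPlus d} {u v : TensorAlgebra k V} (hu : u ∈ τ.word (Lambda.incl d x))
    (hv : v ∈ τ.word (Lambda.incl d y)) : muL τ.restr ⟨x⟩ ⟨y⟩ (τ.elt x u hu ⊗ₜ τ.elt y v hv) =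
      τ.elt (x * y) (u * v) (τ.mul_mem_word_incl hu hv) :=
  Subtype.ext (τ.functor_eqToHom (congrArg Cat.mk (map_mul (Lambda.incl d) x y).symm)
    (muL τ.functor ⟨Lambda.incl d x⟩ ⟨Lambda.incl d y⟩
      ((⟨u, hu⟩ : τ.word (Lambda.incl d x)) ⊗ₜ (⟨v, hv⟩ : τ.word (Lambda.incl d y)))))

omit [FiniteDimensional k V] in
lemma one_mem_word_incl : (1 : TensorAlgebra k V) ∈ τ.word (Lambda.incl d 1) := by
  rw [map_one, map_one]; exact Submodule.one_le.mp le_rfl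

lemma epsL_elt : epsL τ.restr 1 = τ.elt 1 1 τ.one_mem_word_incl :=
  Subtype.ext ((τ.functor_eqToHom (congrArg Cat.mk (map_one (Lambda.incl d)).symm)
    (epsL τ.functor 1)).trans (map_one (algebraMap k (TensorAlgebra k V))))

lemma mapL_phi_elt {a b c : ℕ} (h : a + b = c) (hc : c ≤ d) {u : TensorAlgebra k V}
    (hu : u ∈ τ.word (Lambda.r d c))
    (hu' : τ.ev (U.phi a b c h hc) u ∈
      τ.word (Lambda.incl d (LambdaPlus.r d a * LambdaPlus.r d b))) :
    mapL τ.restr ((UpPlusPres d).homMk (UpPlus.phi a b c h hc)) (τ.elt (LambdaPlus.r d c) u hu) =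
      τ.elt _ (τ.ev (U.phi a b c h hc) u) hu' := by
  have h1 : mapL τ.restr ((UpPlusPres d).homMk (UpPlus.phi a b c h hc)) =
      mapL τ.functor (eqToHom (congrArg Cat.mk (map_mul (Lambda.incl d) (LambdaPlus.r d a)
        (LambdaPlus.r d b)).symm)) ∘ₗ
        mapL τ.functor ((UPres d).homMk (U.phi a b c h hc)) :=
    mapL_comp τ.functor ((UPres d).homMk (U.phi a b c h hc)) (eqToHom (congrArg Cat.mk
      (map_mul (Lambda.incl d) (LambdaPlus.r d a) (LambdaPlus.r d b)).symm))
  rw [h1]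
  exact Subtype.ext ((τ.functor_eqToHom (congrArg Cat.mk (map_mul (Lambda.incl d) _ _).symm)
    (mapL τ.functor ((UPres d).homMk (U.phi a b c h hc)) (⟨u, hu⟩ : τ.word (Lambda.r d c)))).trans
    (τ.eval_apply (U.phi a b c h hc) ⟨u, hu⟩))

/-- The isomorphism `W_a → R_a`, as a linear map between values of functors. -/
noncomputable def JL (a : Letter d) :
    τ.restr.obj ⟨LambdaPlus.r d a⟩ →ₗ[k] k ⊗[k] (MPlus R d).obj ⟨LambdaPlus.r d a⟩ :=
  (TensorProduct.lid k _).symm.toLinearMap ∘ₗ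
    (τ.J a.1).restrict (p := τ.word (Lambda.r d a)) (q := QuadAlg.word R d (LambdaPlus.r d a))
      fun _ h => τ.J_mem_word a.2.2 h

/-- The isomorphisms `W_a → R_a`, extended to words. -/
noncomputable def trivHom : LambdaPlus d →* ObjCoaction τ.restr (MPlus R d) k :=
  FreeMonoid.lift fun a => ⟨LambdaPlus.r d a, τ.JL a⟩

lemma trivHom_of (x : LambdaPlus d) : (τ.trivHom x).of = x := by
  have : ObjCoaction.proj.comp τ.trivHom = MonoidHom.id _ := FreeMonoid.hom_eq fun a => by
    rw [MonoidHom.comp_apply, trivHom, FreeMonoid.lift_eval_of]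
    exact LambdaPlus.r_coe a
  exact DFunLike.congr_fun this x

section

variable {app : ∀ x : LambdaPlus d,
    τ.restr.obj ⟨x⟩ →ₗ[k] k ⊗[k] (MPlus R d).obj ⟨x⟩} (happ : ∀ x, τ.trivHom x = ⟨x, app x⟩)
  (one : app 1 = unitCo τ.restr (MPlus R d) k)
  (mul : ∀ x y, app (x * y) = conv τ.restr (MPlus R d) k (X := ⟨x⟩) (Y := ⟨y⟩) (app x) (app y))

include happ in
lemma app_letter (a : Letter d) : app (LambdaPlus.r d a) = τ.JL a := by
  have h := happ (LambdaPlus.r d a)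
  have h2 : τ.trivHom (LambdaPlus.r d a) = ⟨LambdaPlus.r d a, τ.JL a⟩ := by
    conv_lhs => rw [LambdaPlus.r_coe, trivHom, FreeMonoid.lift_eval_of]
  rw [h2] at h
  exact (ObjCoaction.app_inj h).symm

-- For `a ≥ 1` this is the definition on letters. For `a = 0` the object `r_0` is the empty word, so
-- the value comes from the unit condition and from the normalisation `Jinv_zero_one`.
include happ one in
lemma app_r {a : ℕ} (ha : a ≤ d) {u : TensorAlgebra k V} (hu : u ∈ Rsub R a)
    (hu' : u ∈ QuadAlg.word R d (LambdaPlus.r d a)) :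
    app (LambdaPlus.r d a) (τ.elt _ (τ.Jinv a u) (τ.Jinv_mem_word ha hu)) =
      1 ⊗ₜ QuadAlg.elt R _ u hu' := by
  obtain rfl | h0 := Nat.eq_zero_or_pos a
  · have key : ∀ (x : LambdaPlus d) (_ : x = 1) (v w : TensorAlgebra k V) (hv hw),
        v = w → app x (τ.elt x v hv) = 1 ⊗ₜ QuadAlg.elt R x w hw := by
      rintro x rfl v w hv hw rfl
      have hw' : v ∈ (1 : Submodule k (TensorAlgebra k V)) :=
        (map_one (QuadAlg.word R d)).le hw
      obtain ⟨c, rfl⟩ := Submodule.mem_one.mp hw'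
      have h1 : τ.elt 1 _ hv = c • epsL τ.restr 1 := by
        rw [epsL_elt]
        exact Subtype.ext (Algebra.algebraMap_eq_smul_one c)
      have h2 : QuadAlg.elt R 1 _ hw = c • epsL (MPlus R d) 1 := by
        rw [QuadAlg.epsL_elt]
        exact Subtype.ext (Algebra.algebraMap_eq_smul_one c)
      rw [h1, h2, tmul_smul, map_smul, one, unitCo_epsL]
    refine key _ (LambdaPlus.r_zero d) _ _ _ _ ?_
    rw [Rsub_zero] at hu
    obtain ⟨c, hc⟩ := Submodule.mem_one.mp hu
    rw [← hc, Algebra.algebraMap_eq_smul_one, map_smul, Jinv_zero_one]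
  · rw [τ.app_letter happ ⟨a, h0, ha⟩]
    refine congrArg (1 ⊗ₜ[k] ·) (Subtype.ext ?_)
    exact τ.J_Jinv hu

-- The trivialised `φ` is the inclusion conjugated by the trivialisations. By multiplicativity `app`
-- undoes `Jinv` in both factors of `R_a R_b`, and what remains is the inclusion used by `M⁺`.
include happ one mul in
lemma app_phi {a b c : ℕ} (h : a + b = c) (hc : c ≤ d) :
    (mapL (MPlus R d) ((UpPlusPres d).homMk (UpPlus.phi a b c h hc))).lTensor k ∘ₗ
        app (LambdaPlus.r d c) =
      app (LambdaPlus.r d a * LambdaPlus.r d b) ∘ₗ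
        mapL τ.restr ((UpPlusPres d).homMk (UpPlus.phi a b c h hc)) := by
  have ha : a ≤ d := by omega
  have hb : b ≤ d := by omega
  have key : ∀ y (hy : y ∈ Rsub R a * Rsub R b), ∃ h1 h2,
      app (LambdaPlus.r d a * LambdaPlus.r d b) (τ.elt _ (τ.Jinv₂ a b y) h1) =
        1 ⊗ₜ QuadAlg.elt R _ y h2 := by
    intro y hy
    induction hy using Submodule.mul_induction_on' with
    | mem_mul_mem m hm n hn =>
      have hm' : m ∈ QuadAlg.word R d (LambdaPlus.r d a) := by rwa [QuadAlg.word_r R ha]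
      have hn' : n ∈ QuadAlg.word R d (LambdaPlus.r d b) := by rwa [QuadAlg.word_r R hb]
      have h3 := τ.mul_mem_word_incl (τ.Jinv_mem_word ha hm) (τ.Jinv_mem_word hb hn)
      refine ⟨by rw [τ.Jinv₂_mul hm hn]; exact h3, QuadAlg.word_mul_mem hm' hn', ?_⟩
      rw [τ.elt_congr (τ.Jinv₂_mul hm hn) _ h3,
        ← τ.muL_elt (τ.Jinv_mem_word ha hm) (τ.Jinv_mem_word hb hn), mul]
      refine (conv_muL _ _ _ _).trans ?_
      rw [τ.app_r happ one ha hm hm', τ.app_r happ one hb hn hn', mulCo_tmul, one_mul,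
        LinearEquiv.coe_coe, QuadAlg.muL_elt]
    | add x _ y _ hx hy =>
      obtain ⟨h1, h2, hx⟩ := hx
      obtain ⟨h3, h4, hy⟩ := hy
      refine ⟨by rw [map_add]; exact add_mem h1 h3, add_mem h2 h4, ?_⟩
      rw [QuadAlg.elt_add h2 h4, tmul_add, ← hx, ← hy]
      refine Eq.trans ?_ (map_add (app _) _ _)
      rw [← elt_add]
      exact congrArg (app _) (τ.elt_congr (map_add _ _ _) _ _)
  refine LinearMap.ext fun v => ?_
  obtain ⟨v, hv, rfl⟩ := τ.exists_elt v
  have hv' : v ∈ τ.W c := by rw [← τ.word_r hc]; exact hv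
  obtain ⟨u, hu, rfl⟩ := τ.exists_Jinv hv'
  obtain ⟨h1, h2, h3⟩ := key u (mem_mul_of_eq h hu)
  have hu' : u ∈ QuadAlg.word R d (LambdaPlus.r d c) := by rwa [QuadAlg.word_r R hc]
  have h4 := τ.ev_phi h hc hu
  obtain ⟨h5, h6⟩ := exists_mapL_elt ((UpPlusPres d).homMk (UpPlus.phi a b c h hc)) hu'
  rw [LinearMap.comp_apply, LinearMap.comp_apply, τ.app_r happ one hc hu hu',
    LinearMap.lTensor_tmul, h6, τ.mapL_phi_elt h hc hv (h4 ▸ h1), τ.elt_congr h4 _ h1, h3]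

end

/-- The isomorphisms `W_a → R_a` on letters extend to the free monoid `Λ⁺`. Naturality has to be
checked on the generators `φ` only, and bijectivity passes from letters to words through tensor
products. -/
theorem extends_functor : Extends R d τ.functor := by
  obtain ⟨ρ, hρ⟩ := Coaction.exists_of_monoidHom τ.trivHom τ.trivHom_of (by
    rintro app happ one mul x y ⟨a, b, c, h, hc⟩
    exact τ.app_phi happ one mul h hc)
  refine ρ.exists_iso fun X => ?_
  obtain ⟨x⟩ := X
  induction x using FreeMonoid.inductionOn with
  | one => exact ρ.lin_bijective_one
  | of a =>
    rw [← LambdaPlus.r_coe]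
    have h1 := τ.app_letter hρ a
    have h2 : ∀ v, ρ.lin ⟨LambdaPlus.r d a⟩ v =
        (τ.J a.1).restrict (p := τ.word (Lambda.r d a))
          (q := QuadAlg.word R d (LambdaPlus.r d a)) (fun _ h => τ.J_mem_word a.2.2 h) v := by
      intro v
      rw [Coaction.lin, LinearMap.comp_apply, h1]
      exact LinearEquiv.apply_symm_apply _ _
    refine ⟨fun v w h => ?_, fun u => ?_⟩
    · have h' := congrArg Subtype.val ((h2 v).symm.trans (h.trans (h2 w)))
      have e : ∀ v : τ.word (Lambda.r d a), τ.Jinv a (τ.J a v) = v := fun v =>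
        τ.Jinv_J (by rw [← τ.word_r a.2.2]; exact v.2)
      exact Subtype.ext ((e v).symm.trans ((congrArg (τ.Jinv a) h').trans (e w)))
    · have hu : Subtype.val (p := (· ∈ QuadAlg.word R d (LambdaPlus.r d a))) u ∈ Rsub R a := by
        rw [← QuadAlg.word_r R a.2.2]; exact u.2
      exact ⟨(⟨_, τ.Jinv_mem_word a.2.2 hu⟩ : τ.word (Lambda.r d a)),
        (h2 _).trans (Subtype.ext (τ.J_Jinv hu))⟩
  | mul x y hx hy => exact ρ.lin_bijective_mul hx hy

end TopForm

end Extension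
end QuadAlg

namespace QuadAlg

open TensorProduct FiberFunctor

/-! ### Subspaces preserved by a coaction -/

section Preserves

variable {k : Type u} [Field k] {B T : Type*} [Ring B] [Algebra k B] [Ring T] [Algebra k T]

/-- Slicing an element of `B ⊗ W` with a functional on `B`. -/
noncomputable def lslice {W : Type*} [AddCommGroup W] [Module k W] (β : Module.Dual k B) :
    B ⊗[k] W →ₗ[k] W :=
  (TensorProduct.lid k W).toLinearMap ∘ₗ β.rTensor W

@[simp] lemma lslice_tmul {W : Type*} [AddCommGroup W] [Module k W] (β : Module.Dual k B) (b : B)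
    (w : W) : lslice β (b ⊗ₜ[k] w) = β b • w := by simp [lslice]

lemma lslice_lTensor {W W' : Type*} [AddCommGroup W] [Module k W] [AddCommGroup W'] [Module k W']
    (β : Module.Dual k B) (f : W →ₗ[k] W') (z : B ⊗[k] W) :
    lslice β (f.lTensor B z) = f (lslice β z) := by
  induction z using TensorProduct.induction_on with
  | zero => simp
  | add x y hx hy => simp only [map_add, hx, hy]
  | tmul b w => simp

/-- Expanding in a basis of `B`, an element lies in `B ⊗ P` as soon as its slices along the
coordinate functionals lie in `P`. In this form stability under arbitrary intersections is
immediate, as needed for the `R_a`. -/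
lemma mem_range_lTensor_iff {W : Type*} [AddCommGroup W] [Module k W] {P : Submodule k W}
    {z : B ⊗[k] W} : z ∈ LinearMap.range (P.subtype.lTensor B) ↔
      ∀ β : Module.Dual k B, lslice β z ∈ P := by
  classical
  constructor
  · rintro ⟨z, rfl⟩ β
    rw [lslice_lTensor]
    exact Subtype.prop _
  · intro h
    let b := Module.Basis.ofVectorSpace k B
    obtain ⟨f, rfl⟩ := (TensorProduct.equivFinsuppOfBasisLeft b).symm.surjective z
    rw [TensorProduct.equivFinsuppOfBasisLeft_symm_apply, Finsupp.sum]
    refine Submodule.sum_mem _ fun i hi => ?_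
    have := h (b.coord i)
    rw [TensorProduct.equivFinsuppOfBasisLeft_symm_apply, Finsupp.sum, map_sum,
      Finset.sum_eq_single i] at this
    · exact ⟨b i ⊗ₜ ⟨f i, by simpa using this⟩, rfl⟩
    · intro j _ hj
      simp [hj]
    · intro hi'
      exact absurd hi hi'

/-- The condition `Φ(P) ⊆ B ⊗ P`. -/
def Preserves (Φ : T →ₐ[k] B ⊗[k] T) (P : Submodule k T) : Prop :=
  ∀ u ∈ P, Φ u ∈ LinearMap.range (P.subtype.lTensor B)

namespace Preserves

variable {Φ : T →ₐ[k] B ⊗[k] T} {P Q : Submodule k T}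

lemma one : Preserves Φ 1 := fun u hu => by
  obtain ⟨c, rfl⟩ := Submodule.mem_one.mp hu
  rw [AlgHom.map_algebraMap, Algebra.TensorProduct.algebraMap_apply,
    Algebra.algebraMap_eq_smul_one, smul_tmul, ← Algebra.algebraMap_eq_smul_one]
  exact ⟨1 ⊗ₜ ⟨_, hu⟩, rfl⟩

lemma mul (hP : Preserves Φ P) (hQ : Preserves Φ Q) : Preserves Φ (P * Q) := fun u hu => by
  have key : ∀ (z : B ⊗[k] P) (w : B ⊗[k] Q), P.subtype.lTensor B z * Q.subtype.lTensor B w ∈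
      LinearMap.range ((P * Q).subtype.lTensor B) := by
    intro z w
    induction z using TensorProduct.induction_on with
    | zero => simp
    | add x y hx hy => rw [map_add, add_mul]; exact add_mem hx hy
    | tmul b p =>
    induction w using TensorProduct.induction_on with
    | zero => simp
    | add x y hx hy => rw [map_add, mul_add]; exact add_mem hx hy
    | tmul c q => exact ⟨(b * c) ⊗ₜ ⟨p * q, Submodule.mul_mem_mul p.2 q.2⟩, by simp⟩
  induction hu using Submodule.mul_induction_on' with
  | add x _ y _ hx hy => rw [map_add]; exact add_mem hx hy
  | mem_mul_mem m hm n hn =>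
    obtain ⟨z, hz⟩ := hP m hm
    obtain ⟨w, hw⟩ := hQ n hn
    rw [map_mul, ← hz, ← hw]
    exact key z w

lemma pow (hP : Preserves Φ P) (n : ℕ) : Preserves Φ (P ^ n) := by
  induction n with
  | zero => rw [pow_zero]; exact one
  | succ n ih => rw [pow_succ]; exact ih.mul hP

lemma inf (hP : Preserves Φ P) (hQ : Preserves Φ Q) : Preserves Φ (P ⊓ Q) := fun u hu =>
  mem_range_lTensor_iff.mpr fun β =>
    ⟨mem_range_lTensor_iff.mp (hP u hu.1) β, mem_range_lTensor_iff.mp (hQ u hu.2) β⟩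

lemma iInf {ι : Sort*} {P : ι → Submodule k T} (h : ∀ i, Preserves Φ (P i)) :
    Preserves Φ (⨅ i, P i) := fun u hu =>
  mem_range_lTensor_iff.mpr fun β => (Submodule.mem_iInf _).mpr fun i =>
    mem_range_lTensor_iff.mp (h i u ((Submodule.mem_iInf _).mp hu i)) β

end Preserves

end Preserves

/-! ### Uniqueness of the universal coacting bialgebra -/

section UEnd

variable {k V : Type u} [Field k] [AddCommGroup V] [Module k V] {R : Submodule k (V ⊗[k] V)}

lemma algHom_ext {B : Type*} [Ring B] [Algebra k B] {f g : Alg R →ₐ[k] B}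
    (h : ∀ v, f (gen R v) = g (gen R v)) : f = g :=
  RingQuot.ringQuot_ext' k _ _ (TensorAlgebra.hom_ext (LinearMap.ext h))

lemma IsGraded.map {B B' : Type u} [Ring B] [Algebra k B] [Ring B'] [Algebra k B']
    {f : Alg R →ₐ[k] B ⊗[k] Alg R} (hf : IsGraded R f) (g : B →ₐ[k] B') :
    IsGraded R ((Algebra.TensorProduct.map g (AlgHom.id k (Alg R))).comp f) := fun n a ha => by
  obtain ⟨z, hz⟩ := hf n a ha
  refine ⟨g.toLinearMap.rTensor _ z, ?_⟩
  rw [AlgHom.comp_apply, ← hz]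
  exact LinearMap.congr_fun (LinearMap.lTensor_comp_rTensor _ _ _ |>.trans
    (LinearMap.rTensor_comp_lTensor _ _ _).symm) z

variable {E E' : Type u} [Ring E] [Bialgebra k E] [Ring E'] [Bialgebra k E']
  {δ : Alg R →ₐ[k] E ⊗[k] Alg R} {δ' : Alg R →ₐ[k] E' ⊗[k] Alg R}

namespace IsUEnd

lemma hom_ext (h : IsUEnd R E δ) {B : Type u} [Ring B] [Algebra k B] {g g' : E →ₐ[k] B}
    (hg : (Algebra.TensorProduct.map g (AlgHom.id k (Alg R))).comp δ =
      (Algebra.TensorProduct.map g' (AlgHom.id k (Alg R))).comp δ) : g = g' :=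
  (h.universal B _ (h.graded.map g')).unique hg rfl

/-- Universality gives an algebra morphism `g` that carries `δ` to `δ'`. Compatibility with the
coalgebra structures follows from universality again: the two candidates for the counit both turn
`δ` into `a ↦ 1 ⊗ a`, and the two candidates for the comultiplication both turn it into the twice
iterated coaction `δ'`. -/
lemma exists_bialgHom (h : IsUEnd R E δ) (h' : IsUEnd R E' δ') :
    ∃ Φ : E →ₐc[k] E', (Algebra.TensorProduct.map (Φ : E →ₐ[k] E') (AlgHom.id k (Alg R))).comp δ =
      δ' := by
  obtain ⟨g, hg, -⟩ := h.universal E' δ' h'.graded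
  have hg' : ∀ a, g.toLinearMap.rTensor (Alg R) (δ a) = δ' a := fun a => DFunLike.congr_fun hg a
  refine ⟨BialgHom.ofAlgHom g (h.hom_ext ?_) (h.hom_ext ?_), hg⟩
  · refine AlgHom.ext fun a => ?_
    refine Eq.trans ?_ (h.counit a).symm
    refine Eq.trans ?_ (h'.counit a)
    rw [← hg' a, ← LinearMap.comp_apply, ← LinearMap.rTensor_comp]
    rfl
  · refine AlgHom.ext fun a => (TensorProduct.assoc k E' E' (Alg R)).injective ?_
    have h1 := congrArg (TensorProduct.map g.toLinearMap (g.toLinearMap.rTensor (Alg R)))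
      (h.coassoc a)
    have h2 := h'.coassoc a
    have h3 : ∀ z : (E ⊗[k] E) ⊗[k] Alg R, TensorProduct.map g.toLinearMap
        (g.toLinearMap.rTensor (Alg R)) (TensorProduct.assoc k E E (Alg R) z) =
      TensorProduct.assoc k E' E' (Alg R)
        ((TensorProduct.map g.toLinearMap g.toLinearMap).rTensor (Alg R) z) := fun z =>
      LinearMap.congr_fun (TensorProduct.ext_threefold
        (g := TensorProduct.map g.toLinearMap (g.toLinearMap.rTensor (Alg R)) ∘ₗ
          (TensorProduct.assoc k E E (Alg R)).toLinearMap)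
        (h := (TensorProduct.assoc k E' E' (Alg R)).toLinearMap ∘ₗ
          (TensorProduct.map g.toLinearMap g.toLinearMap).rTensor (Alg R)) fun x y z => rfl) z
    rw [h3] at h1
    have h4 : ∀ z : E ⊗[k] Alg R, TensorProduct.map g.toLinearMap
        (g.toLinearMap.rTensor (Alg R)) (δ.toLinearMap.lTensor E z) =
      δ'.toLinearMap.lTensor E' (g.toLinearMap.rTensor (Alg R) z) := fun z =>
      LinearMap.congr_fun (TensorProduct.ext'
        (g := TensorProduct.map g.toLinearMap (g.toLinearMap.rTensor (Alg R)) ∘ₗ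
          δ.toLinearMap.lTensor E)
        (h := δ'.toLinearMap.lTensor E' ∘ₗ g.toLinearMap.rTensor (Alg R)) fun x a => by
          simpa using congrArg (g x ⊗ₜ[k] ·) (hg' a)) z
    rw [h4, hg', ← h2, ← hg', EmbeddingLike.apply_eq_iff_eq] at h1
    rw [EmbeddingLike.apply_eq_iff_eq]
    have h5 : ∀ z : E ⊗[k] Alg R, Algebra.TensorProduct.map
        ((Algebra.TensorProduct.map g g).comp (Bialgebra.comulAlgHom k E)) (AlgHom.id k (Alg R)) z =
      (TensorProduct.map g.toLinearMap g.toLinearMap).rTensor (Alg R)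
        ((Coalgebra.comul (R := k) (A := E)).rTensor (Alg R) z) := fun z =>
      LinearMap.congr_fun (LinearMap.rTensor_comp (Alg R)
        (TensorProduct.map g.toLinearMap g.toLinearMap) (Coalgebra.comul (R := k) (A := E))) z
    have h6 : ∀ z : E ⊗[k] Alg R, Algebra.TensorProduct.map
        ((Bialgebra.comulAlgHom k E').comp g) (AlgHom.id k (Alg R)) z =
      (Coalgebra.comul (R := k) (A := E')).rTensor (Alg R) (g.toLinearMap.rTensor (Alg R) z) :=
      fun z => LinearMap.congr_fun (LinearMap.rTensor_comp (Alg R)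
        (Coalgebra.comul (R := k) (A := E')) g.toLinearMap) z
    exact (h5 _).trans (h1.trans (h6 _).symm)

/-- The universal coacting bialgebra is unique up to isomorphism. -/
theorem exists_bialgEquiv (h : IsUEnd R E δ) (h' : IsUEnd R E' δ') :
    Nonempty (E ≃ₐc[k] E') := by
  obtain ⟨Φ, hΦ⟩ := h.exists_bialgHom h'
  obtain ⟨Ψ, hΨ⟩ := h'.exists_bialgHom h
  have key : ∀ {E E' : Type u} [Ring E] [Bialgebra k E] [Ring E'] [Bialgebra k E']
      {δ : Alg R →ₐ[k] E ⊗[k] Alg R} {δ' : Alg R →ₐ[k] E' ⊗[k] Alg R} (_ : IsUEnd R E δ)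
      (Φ : E →ₐc[k] E') (Ψ : E' →ₐc[k] E)
      (_ : (Algebra.TensorProduct.map (Φ : E →ₐ[k] E') (AlgHom.id k (Alg R))).comp δ = δ')
      (_ : (Algebra.TensorProduct.map (Ψ : E' →ₐ[k] E) (AlgHom.id k (Alg R))).comp δ' = δ),
      Ψ.comp Φ = BialgHom.id k E := by
    intro E E' _ _ _ _ δ δ' h Φ Ψ hΦ hΨ
    have h1 : ((Ψ : E' →ₐ[k] E).comp (Φ : E →ₐ[k] E')) = AlgHom.id k E := h.hom_ext <| by
      rw [Algebra.TensorProduct.map_id, AlgHom.id_comp]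
      conv_rhs => rw [← hΨ, ← hΦ, ← AlgHom.comp_assoc, ← Algebra.TensorProduct.map_comp]
      rfl
    exact BialgHom.ext fun x => DFunLike.congr_fun h1 x
  exact ⟨BialgEquiv.ofBialgHom Φ Ψ (key h' Ψ Φ hΨ hΦ) (key h Φ Ψ hΦ hΨ)⟩

end IsUEnd

end UEnd

end QuadAlg

namespace FiberFunctor

open TensorProduct

/-! ### Coactions and algebra morphisms out of the coend -/

section

variable {k : Type u} [Field k] {C : Type w} [Category.{v} C] [MonoidalCategory C]
  {F G : C ⥤ FGModuleCat.{u} k} [F.Monoidal] [G.Monoidal] {B B' : Type*} [Ring B] [Algebra k B]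
  [Ring B'] [Algebra k B']

lemma rTensor_mulCo (g : B →ₐ[k] B') {W W' W'' : Type*} [AddCommGroup W] [Module k W]
    [AddCommGroup W'] [Module k W'] [AddCommGroup W''] [Module k W''] (μ : W ⊗[k] W' →ₗ[k] W'')
    (x : B ⊗[k] W) (y : B ⊗[k] W') :
    g.toLinearMap.rTensor W'' (mulCo B μ x y) =
      mulCo B' μ (g.toLinearMap.rTensor W x) (g.toLinearMap.rTensor W' y) := by
  induction x using TensorProduct.induction_on with
  | zero => simp
  | add x x' hx hx' => simp only [map_add, LinearMap.add_apply, hx, hx']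
  | tmul b v =>
  induction y using TensorProduct.induction_on with
  | zero => simp
  | add y y' hy hy' => simp only [map_add, hy, hy']
  | tmul c w => simp

lemma slice_rTensor {W : Type*} [AddCommGroup W] [Module k W] (g : B →ₗ[k] B')
    (ξ : Module.Dual k W) (z : B ⊗[k] W) :
    slice B' ξ (g.rTensor W z) = g (slice B ξ z) := by
  induction z using TensorProduct.induction_on with
  | zero => simp
  | add x x' hx hx' => simp only [map_add, hx, hx']
  | tmul b v => simp

/-- Change of algebra for a coaction. -/
noncomputable def Coaction.map (g : B →ₐ[k] B') (ρ : Coaction F G B) : Coaction F G B' where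
  app X := g.toLinearMap.rTensor _ ∘ₗ ρ.app X
  nat {X Y} f := LinearMap.ext fun v => by
    simp only [LinearMap.comp_apply]
    rw [← ρ.nat_apply]
    exact LinearMap.congr_fun ((LinearMap.lTensor_comp_rTensor _ _ _).trans
      (LinearMap.rTensor_comp_lTensor _ _ _).symm) _
  one := unit_hom_ext (by simp [ρ.one])
  mul X Y := dual_ext fun v w => by
    rw [LinearMap.comp_apply, ρ.mul, conv_muL, conv_muL, rTensor_mulCo]
    rfl

lemma Coaction.map_app (g : B →ₐ[k] B') (ρ : Coaction F G B) (X : C) (v : F.obj X) :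
    (ρ.map g).app X v = g.toLinearMap.rTensor _ (ρ.app X v) := rfl

lemma Coaction.rTensor_coact (ρ : Coaction F F B) (X : C) (v : F.obj X) :
    ρ.toAlgHom.toLinearMap.rTensor _ (Coend.coact F X v) = ρ.app X v := slice_ext fun ξ => by
  rw [slice_rTensor, Coend.slice_coact, AlgHom.toLinearMap_apply, ρ.toAlgHom_coef]

namespace Coend

/-- Algebra morphisms from the coend are determined by the coactions they induce. -/
lemma algHom_ext {g g' : Coend F →ₐ[k] B}
    (h : ∀ X v, g.toLinearMap.rTensor _ (coact F X v) = g'.toLinearMap.rTensor _ (coact F X v)) :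
    g = g' := AlgHom.ext fun t => by
  induction t using induction_on with
  | zero => simp
  | add a a' h h' => simp only [map_add, h, h']
  | coef X ξ x =>
    rw [← slice_coact, ← AlgHom.toLinearMap_apply g, ← slice_rTensor, h, slice_rTensor,
      AlgHom.toLinearMap_apply]

lemma coact_apply (X : C) (v : F.obj X) :
    coact F X v = ∑ i, coef F X ((bas X).coord i) v ⊗ₜ bas X i := by
  simp [coact, LinearMap.sum_apply, coefL]

lemma assoc_comul_coact (X : C) (v : F.obj X) :
    TensorProduct.assoc k _ _ _ ((Coalgebra.comul (R := k) (A := Coend F)).rTensor _ (coact F X v)) =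
      (coact F X).lTensor _ (coact F X v) := by
  have h : ∀ ξ, Coalgebra.comul (R := k) (coef F X ξ v) =
      ∑ i, coef F X ((bas X).coord i) v ⊗ₜ[k] coef F X ξ (bas X i) := fun ξ =>
    comulL_coef (bas X) ξ v
  simp only [coact_apply, map_sum, LinearMap.rTensor_tmul, LinearMap.lTensor_tmul, h,
    sum_tmul, TensorProduct.assoc_tmul, tmul_sum]
  rw [Finset.sum_comm]

lemma counit_coact (X : C) (v : F.obj X) :
    (Coalgebra.counit (R := k) (A := Coend F)).rTensor _ (coact F X v) = 1 ⊗ₜ v := by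
  have h : ∀ ξ, Coalgebra.counit (R := k) (coef F X ξ v) = ξ v := fun ξ => counitL_coef X ξ v
  simp only [coact_apply, map_sum, LinearMap.rTensor_tmul, h]
  have h2 : ∀ i, (bas X).coord i v ⊗ₜ[k] bas X i = 1 ⊗ₜ ((bas X).coord i v • bas X i) := fun i => by
    rw [tmul_smul, smul_tmul', smul_eq_mul, mul_one]
  rw [Finset.sum_congr rfl fun i _ => h2 i, ← tmul_sum]
  simp only [Module.Basis.coord_apply, (bas X).sum_repr]

end Coend

end

end FiberFunctor

namespace QuadAlg

open TensorProduct FiberFunctor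

/-! ### Coactions on `M⁺` as restrictions of endomorphisms of the tensor algebra -/

section

variable {k V : Type u} [Field k] [AddCommGroup V] [Module k V] [FiniteDimensional k V]
  (R : Submodule k (V ⊗[k] V)) {d : ℕ}

/-- The inclusion of `M⁺(x)` in the tensor algebra. -/
noncomputable def valL (x : LambdaPlus d) : (MPlus R d).obj ⟨x⟩ →ₗ[k] TensorAlgebra k V :=
  (word R d x).subtype

variable {R}

@[simp] lemma valL_elt {x : LambdaPlus d} {u : TensorAlgebra k V} (hu : u ∈ word R d x) :
    valL R x (elt R x u hu) = u := rfl

lemma valL_injective (x : LambdaPlus d) : Function.Injective (valL R x) :=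
  Subtype.val_injective

lemma valL_mapL {x y : LambdaPlus d} (f : (⟨x⟩ : UpPlus d) ⟶ ⟨y⟩) (v : (MPlus R d).obj ⟨x⟩) :
    valL R y (mapL (MPlus R d) f v) = valL R x v := by
  obtain ⟨u, hu, rfl⟩ := exists_elt v
  obtain ⟨hu', h⟩ := exists_mapL_elt f hu
  rw [h, valL_elt, valL_elt]

lemma valL_muL (x y : LambdaPlus d) (v : (MPlus R d).obj ⟨x⟩) (w : (MPlus R d).obj ⟨y⟩) :
    valL R (x * y) (muL (MPlus R d) ⟨x⟩ ⟨y⟩ (v ⊗ₜ w)) = valL R x v * valL R y w := rfl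

variable {B : Type*} [Ring B] [Algebra k B]

lemma lTensor_valL_mulCo {x y : LambdaPlus d} (z : B ⊗[k] (MPlus R d).obj ⟨x⟩)
    (w : B ⊗[k] (MPlus R d).obj ⟨y⟩) :
    (valL R (x * y)).lTensor B (mulCo B (muL (MPlus R d) ⟨x⟩ ⟨y⟩).toLinearMap z w) =
      (valL R x).lTensor B z * (valL R y).lTensor B w := by
  induction z using TensorProduct.induction_on with
  | zero => simp
  | add x x' hx hx' => simp only [map_add, LinearMap.add_apply, add_mul, hx, hx']
  | tmul b v =>
  induction w using TensorProduct.induction_on with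
  | zero => simp
  | add y y' hy hy' => simp only [map_add, mul_add, hy, hy']
  | tmul c w =>
    rw [mulCo_tmul, LinearMap.lTensor_tmul, LinearMap.lTensor_tmul, LinearMap.lTensor_tmul,
      LinearEquiv.coe_coe, valL_muL, Algebra.TensorProduct.tmul_mul_tmul]

lemma lTensor_valL_injective (x : LambdaPlus d) :
    Function.Injective ((valL R x).lTensor B) :=
  Module.Flat.lTensor_preserves_injective_linearMap _ (valL_injective x)

/-- On `M⁺(x)` the coaction `ρ` is the restriction of `Φ`. -/
def Agrees (ρ : Coaction (MPlus R d) (MPlus R d) B)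
    (Φ : TensorAlgebra k V →ₐ[k] B ⊗[k] TensorAlgebra k V) (x : LambdaPlus d) : Prop :=
  ∀ v, (valL R x).lTensor B (ρ.app ⟨x⟩ v) = Φ (valL R x v)

namespace Agrees

variable {ρ : Coaction (MPlus R d) (MPlus R d) B}
  {Φ : TensorAlgebra k V →ₐ[k] B ⊗[k] TensorAlgebra k V}

lemma one : Agrees ρ Φ 1 := by
  have h : (valL R 1).lTensor B ∘ₗ ρ.app ⟨1⟩ = Φ.toLinearMap ∘ₗ valL R 1 := by
    refine unit_hom_ext ?_
    rw [LinearMap.comp_apply, LinearMap.comp_apply]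
    refine (congrArg _ (LinearMap.congr_fun ρ.one _)).trans ?_
    rw [unitCo_epsL, epsL_elt]
    refine (LinearMap.lTensor_tmul ..).trans ?_
    rw [valL_elt]
    exact (map_one Φ).symm
  exact fun v => LinearMap.congr_fun h v

lemma mul {x y : LambdaPlus d} (hx : Agrees ρ Φ x) (hy : Agrees ρ Φ y) : Agrees ρ Φ (x * y) := by
  have h : (valL R (x * y)).lTensor B ∘ₗ ρ.app ⟨x * y⟩ = Φ.toLinearMap ∘ₗ valL R (x * y) := by
    refine dual_ext (X := (⟨x⟩ : UpPlus d)) (Y := ⟨y⟩) fun v w => ?_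
    rw [LinearMap.comp_apply, LinearMap.comp_apply]
    refine (congrArg _ (LinearMap.congr_fun (ρ.mul ⟨x⟩ ⟨y⟩) _)).trans ?_
    rw [conv_muL, lTensor_valL_mulCo, hx, hy, valL_muL]
    exact (map_mul Φ _ _).symm
  exact fun v => LinearMap.congr_fun h v

/-- Morphisms of `U↑⁺` act on `M⁺` as inclusions of subspaces of the tensor algebra, so agreement on
a larger space restricts to a smaller one. -/
lemma of_hom {x y : LambdaPlus d} (f : (⟨x⟩ : UpPlus d) ⟶ ⟨y⟩) (hy : Agrees ρ Φ y) :
    Agrees ρ Φ x := fun v => by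
  have h : valL R x = valL R y ∘ₗ mapL (MPlus R d) f := LinearMap.ext fun v => (valL_mapL f v).symm
  rw [← valL_mapL f, ← hy, ← ρ.nat_apply, h, LinearMap.lTensor_comp, LinearMap.comp_apply]

/-- The morphism `φ_{a,1}` places `R_{a+1}` inside `R_a R_1`, so everything is determined on `R_1 =
V`. When `d = 0` there are no letters, and the unit condition suffices. -/
lemma of_r_one (h : 1 ≤ d → Agrees ρ Φ (LambdaPlus.r d 1)) (x : LambdaPlus d) :
    Agrees ρ Φ x := by
  have hr : ∀ a ≤ d, Agrees ρ Φ (LambdaPlus.r d a) := fun a => by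
    induction a with
    | zero => intro _; rw [LambdaPlus.r_zero]; exact one
    | succ a ih =>
      intro ha
      exact of_hom ((UpPlusPres d).homMk (UpPlus.phi a 1 (a + 1) rfl ha))
        ((ih (by omega)).mul (h (by omega)))
  induction x using FreeMonoid.inductionOn with
  | one => exact one
  | of a => rw [← LambdaPlus.r_coe]; exact hr a a.2.2
  | mul x y hx hy => exact hx.mul hy

/-- A morphism which preserves the subspaces `M⁺(x)` restricts to a coaction. -/
lemma exists_coaction (h : ∀ x, Preserves Φ (word R d x)) :
    ∃ ρ : Coaction (MPlus R d) (MPlus R d) B, ∀ x, Agrees ρ Φ x := by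
  have h1 : ∀ x : LambdaPlus d, ∃ ρ : (MPlus R d).obj ⟨x⟩ →ₗ[k] B ⊗[k] (MPlus R d).obj ⟨x⟩,
      ∀ v, (valL R x).lTensor B (ρ v) = Φ (valL R x v) := fun x => by
    -- By flatness `B ⊗ M⁺(x)` embeds in the tensor product of `B` with the tensor algebra, and the
    -- hypothesis says that `Φ` lands in the image. The conditions on a coaction are then checked
    -- after this embedding, where they are properties of the algebra map `Φ`.
    let e := LinearEquiv.ofInjective _ (lTensor_valL_injective (R := R) (B := B) x)
    refine ⟨e.symm.toLinearMap ∘ₗ (Φ.toLinearMap ∘ₗ valL R x).codRestrict _ fun v =>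
      h x _ (Subtype.prop (p := (· ∈ word R d x)) v), fun v => ?_⟩
    exact congrArg Subtype.val (e.apply_symm_apply _)
  choose app happ using h1
  refine ⟨{ app := fun X => app X.of
            nat := fun {X Y} f => LinearMap.ext fun v => lTensor_valL_injective Y.of ?_
            one := unit_hom_ext <| lTensor_valL_injective 1 ?_
            mul := fun X Y => dual_ext fun v w => lTensor_valL_injective (X.of * Y.of) ?_ }, happ⟩
  · rw [LinearMap.comp_apply, LinearMap.comp_apply, ← LinearMap.comp_apply (LinearMap.lTensor _ _),
      ← LinearMap.lTensor_comp]
    have h2 : valL R Y.of ∘ₗ mapL (MPlus R d) f = valL R X.of :=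
      LinearMap.ext fun v => valL_mapL f v
    rw [h2, happ]
    refine Eq.trans ?_ (happ Y.of _).symm
    exact congrArg Φ (valL_mapL f v).symm
  · refine (happ 1 _).trans ?_
    rw [unitCo_epsL, epsL_elt, valL_elt, map_one]
    rfl
  · refine (happ (X.of * Y.of) _).trans ?_
    rw [conv_muL]
    refine Eq.trans ?_ (lTensor_valL_mulCo _ _).symm
    rw [happ, happ, ← map_mul]
    rfl

lemma app_eq {σ : Coaction (MPlus R d) (MPlus R d) B} {x : LambdaPlus d} (hρ : Agrees ρ Φ x)
    (hσ : Agrees σ Φ x) : ρ.app ⟨x⟩ = σ.app ⟨x⟩ :=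
  LinearMap.ext fun v => lTensor_valL_injective x ((hρ v).trans (hσ v).symm)

end Agrees

-- For `d = 0` there is no letter `r_1`, but then `V = R_1 = R_{d+1}` is zero.
omit [FiniteDimensional k V] in
lemma IsFrobenius.V1_le (h : IsFrobenius R d) : V1 k V ≤ word R d (LambdaPlus.r d 1) := by
  obtain rfl | hd := Nat.eq_zero_or_pos d
  · rw [← Rsub_one R, h.eq_bot]; exact bot_le
  · rw [word_r R hd, Rsub_one]

-- When `d ≤ 1` there is no letter `r_2` to carry `R`; the vanishing of `R_{d+1}` then forces `R` to
-- vanish as well.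
omit [FiniteDimensional k V] in
lemma IsFrobenius.RT_le (h : IsFrobenius R d) :
    RT R = ⊥ ∨ 2 ≤ d ∧ RT R = word R d (LambdaPlus.r d 2) := by
  obtain hd | hd := Nat.lt_or_ge 1 d
  · exact .inr ⟨hd, by rw [word_r R hd, Rsub_two]⟩
  · left
    interval_cases d
    · have h1 := h.eq_bot
      rw [zero_add, Rsub_one] at h1
      have h2 := QuadAlg.RT_le R
      rwa [h1, pow_two, Submodule.bot_mul, le_bot_iff] at h2
    · rw [← Rsub_two]; exact h.eq_bot

end

end QuadAlg

namespace QuadAlg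

open TensorProduct FiberFunctor

/-! ### Passing between the tensor algebra and its quadratic quotient -/

section Descent

variable {k V : Type u} [Field k] [AddCommGroup V] [Module k V]
  {R : Submodule k (V ⊗[k] V)} {d : ℕ} {B : Type*} [Ring B] [Algebra k B]
  {Φ : TensorAlgebra k V →ₐ[k] B ⊗[k] TensorAlgebra k V}

lemma assoc_rTensor_lTensor {E W W' : Type*} [AddCommGroup E] [Module k E] [AddCommGroup W]
    [Module k W] [AddCommGroup W'] [Module k W'] (c : E →ₗ[k] E ⊗[k] E) (g : W →ₗ[k] W')
    (z : E ⊗[k] W) : TensorProduct.assoc k E E W' (c.rTensor W' (g.lTensor E z)) =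
      (g.lTensor E).lTensor E (TensorProduct.assoc k E E W (c.rTensor W z)) := by
  induction z using TensorProduct.induction_on with
  | zero => simp
  | add x y hx hy => simp only [map_add, hx, hy]
  | tmul b w =>
    simp only [LinearMap.lTensor_tmul, LinearMap.rTensor_tmul]
    generalize c b = t
    induction t using TensorProduct.induction_on with
    | zero => simp
    | add x y hx hy => simp only [add_tmul, map_add, hx, hy]
    | tmul b c => simp

lemma Preserves.bot {T : Type*} [Ring T] [Algebra k T] {Φ : T →ₐ[k] B ⊗[k] T} :
    Preserves Φ ⊥ := fun u hu => by
  rw [(Submodule.mem_bot k).mp hu, map_zero]; exact zero_mem _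

lemma exists_descend (h : Preserves Φ (RT R)) : ∃ f : Alg R →ₐ[k] B ⊗[k] Alg R,
    ∀ x, f (quot R x) = (quot R).toLinearMap.lTensor B (Φ x) := by
  refine ⟨RingQuot.liftAlgHom k ⟨(Algebra.TensorProduct.map (AlgHom.id k B) (quot R)).comp Φ,
    fun s t hst => ?_⟩, fun x => RingQuot.liftAlgHom_mkAlgHom_apply k _ _ x⟩
  obtain ⟨hs, rfl⟩ := hst
  obtain ⟨z, hz⟩ := h s hs
  rw [map_zero, AlgHom.comp_apply, ← hz]
  refine (LinearMap.congr_fun (LinearMap.lTensor_comp B (quot R).toLinearMap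
    (RT R).subtype) z).symm.trans ?_
  have h0 : (quot R).toLinearMap ∘ₗ (RT R).subtype = 0 :=
    LinearMap.ext fun u => quot_eq_zero_of_mem R u.2
  rw [h0, LinearMap.lTensor_zero, LinearMap.zero_apply]

lemma Preserves.isGraded {B : Type u} [Ring B] [Algebra k B]
    {Φ : TensorAlgebra k V →ₐ[k] B ⊗[k] TensorAlgebra k V} (h : Preserves Φ (V1 k V))
    {f : Alg R →ₐ[k] B ⊗[k] Alg R}
    (hf : ∀ x, f (quot R x) = (quot R).toLinearMap.lTensor B (Φ x)) : IsGraded R f := by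
  have h1 : Preserves f (LinearMap.range (gen R)) := by
    rintro _ ⟨v, rfl⟩
    refine mem_range_lTensor_iff.mpr fun β => ?_
    rw [gen_apply, hf, lslice_lTensor]
    obtain ⟨w, hw⟩ := mem_range_lTensor_iff.mp (h _ (mem_V1 v)) β
    exact ⟨w, congrArg (quot R) hw⟩
  exact fun n => h1.pow n

/-- In degree one a graded map sends `V` to `B ⊗ V`, and this extends freely to the tensor algebra.
The lift covers `f` because the two agree on generators. -/
lemma IsGraded.exists_lift {B : Type u} [Ring B] [Algebra k B] {f : Alg R →ₐ[k] B ⊗[k] Alg R}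
    (hf : IsGraded R f) : ∃ Φ : TensorAlgebra k V →ₐ[k] B ⊗[k] TensorAlgebra k V,
      Preserves Φ (V1 k V) ∧ ∀ x, f (quot R x) = (quot R).toLinearMap.lTensor B (Φ x) := by
  let Φ := TensorAlgebra.lift k
    ((TensorAlgebra.ι k ∘ₗ linPart R).lTensor B ∘ₗ f.toLinearMap ∘ₗ gen R)
  have hΦ : ∀ v, Φ (TensorAlgebra.ι k v) =
      (TensorAlgebra.ι k ∘ₗ linPart R).lTensor B (f (gen R v)) := fun v => by
    simp [Φ]
  refine ⟨Φ, ?_, ?_⟩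
  · rintro _ ⟨v, rfl⟩
    refine mem_range_lTensor_iff.mpr fun β => ?_
    rw [hΦ, lslice_lTensor]
    exact mem_V1 _
  · have h : f.comp (quot R) = (Algebra.TensorProduct.map (AlgHom.id k B) (quot R)).comp Φ := by
      refine TensorAlgebra.hom_ext (LinearMap.ext fun v => ?_)
      change f (gen R v) = (quot R).toLinearMap.lTensor B (Φ (TensorAlgebra.ι k v))
      obtain ⟨z, hz⟩ := hf 1 (gen R v) (by rw [gr_one]; exact ⟨v, rfl⟩)
      rw [hΦ, ← hz]
      rw [← LinearMap.comp_apply, ← LinearMap.comp_apply,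
        ← LinearMap.lTensor_comp, ← LinearMap.lTensor_comp]
      refine congrArg (fun g => LinearMap.lTensor B g z) (LinearMap.ext fun a => ?_)
      exact (gen_linPart R a.2).symm
    exact fun x => DFunLike.congr_fun h x

/-- A slice of `Φ u` lies in `V^2` and maps to zero in the quadratic algebra, and in degree two only
the elements of `R` do so. -/
lemma Preserves.RT (h : Preserves Φ (V1 k V)) {f : Alg R →ₐ[k] B ⊗[k] Alg R}
    (hf : ∀ x, f (quot R x) = (quot R).toLinearMap.lTensor B (Φ x)) :
    Preserves Φ (QuadAlg.RT R) := fun u hu => mem_range_lTensor_iff.mpr fun β => by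
  refine mem_RT_of_quot_eq_zero R (mem_range_lTensor_iff.mp (h.pow 2 u (RT_le R hu)) β) ?_
  have h1 := lslice_lTensor β (quot R).toLinearMap (Φ u)
  rw [← hf, quot_eq_zero_of_mem R hu, map_zero, map_zero] at h1
  exact h1.symm

/-- The spaces `R_a` are made from `V` and `R` by products and intersections, both of which respect
the condition. -/
lemma Preserves.word (h : Preserves Φ (V1 k V)) (h' : Preserves Φ (QuadAlg.RT R))
    (x : LambdaPlus d) : Preserves Φ (QuadAlg.word R d x) := by
  induction x using FreeMonoid.inductionOn with
  | one => rw [map_one]; exact Preserves.one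
  | of a =>
    rw [← LambdaPlus.r_coe, word_r R a.2.2]
    exact (h.pow _).inf (.iInf fun i => .iInf fun j => .iInf fun _ => ((h.pow i).mul h').mul (h.pow j))
  | mul x y hx hy => rw [map_mul]; exact hx.mul hy

end Descent

/-! ### The coend of `M⁺` is `uend(A)` -/

section Universal

variable {k V : Type u} [Field k] [AddCommGroup V] [Module k V] [FiniteDimensional k V]
  {R : Submodule k (V ⊗[k] V)} {d : ℕ}

lemma Agrees.preserves {B : Type*} [Ring B] [Algebra k B]
    {ρ : Coaction (MPlus R d) (MPlus R d) B}
    {Φ : TensorAlgebra k V →ₐ[k] B ⊗[k] TensorAlgebra k V} {x : LambdaPlus d}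
    (h : Agrees ρ Φ x) : Preserves Φ (word R d x) := fun u hu =>
  ⟨ρ.app ⟨x⟩ (elt R x u hu), h (elt R x u hu)⟩

namespace IsFrobenius

/-- The isomorphism `V → R₁`. -/
noncomputable def iotaL (hF : IsFrobenius R d) : V →ₗ[k] (MPlus R d).obj ⟨LambdaPlus.r d 1⟩ :=
  (TensorAlgebra.ι k).codRestrict (word R d (LambdaPlus.r d 1)) fun v => hF.V1_le (mem_V1 v)

lemma valL_iotaL (hF : IsFrobenius R d) (v : V) :
    valL R _ (hF.iotaL v) = TensorAlgebra.ι k v := rfl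

lemma iotaL_surjective (hF : IsFrobenius R d) (hd : 1 ≤ d) : Function.Surjective hF.iotaL :=
  fun v => by
  obtain ⟨u, hu, rfl⟩ := exists_elt v
  have hu' := hu
  rw [word_r R hd, Rsub_one] at hu'
  obtain ⟨w, rfl⟩ := hu'
  exact ⟨w, rfl⟩

/-- The map from `R₁` to the quadratic algebra. -/
noncomputable def genL (_ : IsFrobenius R d) : (MPlus R d).obj ⟨LambdaPlus.r d 1⟩ →ₗ[k] Alg R :=
  (quot R).toLinearMap ∘ₗ valL R _

lemma genL_iotaL (hF : IsFrobenius R d) (v : V) : hF.genL (hF.iotaL v) = gen R v := rfl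

variable (hF : IsFrobenius R d) {B : Type*} [Ring B] [Algebra k B]

/-- The endomorphism of the tensor algebra given by a coaction on `R₁`. -/
noncomputable def tensorHom (ρ : Coaction (MPlus R d) (MPlus R d) B) :
    TensorAlgebra k V →ₐ[k] B ⊗[k] TensorAlgebra k V :=
  TensorAlgebra.lift k ((valL R _).lTensor B ∘ₗ ρ.app ⟨LambdaPlus.r d 1⟩ ∘ₗ hF.iotaL)

lemma tensorHom_ι (ρ : Coaction (MPlus R d) (MPlus R d) B) (v : V) :
    hF.tensorHom ρ (TensorAlgebra.ι k v) = (valL R _).lTensor B (ρ.app _ (hF.iotaL v)) := by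
  simp [tensorHom]

lemma agrees_tensorHom (ρ : Coaction (MPlus R d) (MPlus R d) B) (x : LambdaPlus d) :
    Agrees ρ (hF.tensorHom ρ) x := by
  refine Agrees.of_r_one (fun hd v => ?_) x
  obtain ⟨v, rfl⟩ := hF.iotaL_surjective hd v
  rw [valL_iotaL, tensorHom_ι]

lemma preserves_V1 (ρ : Coaction (MPlus R d) (MPlus R d) B) :
    Preserves (hF.tensorHom ρ) (V1 k V) := by
  obtain rfl | hd := Nat.eq_zero_or_pos d
  · rw [← Rsub_one R, hF.eq_bot]; exact Preserves.bot
  · have := (hF.agrees_tensorHom ρ (LambdaPlus.r d 1)).preserves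
    rwa [word_r R hd, Rsub_one] at this

lemma preserves_RT (ρ : Coaction (MPlus R d) (MPlus R d) B) :
    Preserves (hF.tensorHom ρ) (QuadAlg.RT R) := by
  obtain h | ⟨-, h⟩ := hF.RT_le
  · rw [h]; exact Preserves.bot
  · rw [h]; exact (hF.agrees_tensorHom ρ _).preserves

/-- Coactions which agree on `R₁` agree. -/
lemma coaction_ext {ρ σ : Coaction (MPlus R d) (MPlus R d) B}
    (h : ∀ v, ρ.app _ (hF.iotaL v) = σ.app _ (hF.iotaL v)) (X : UpPlus d) :
    ρ.app X = σ.app X := by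
  have h1 : hF.tensorHom ρ = hF.tensorHom σ := TensorAlgebra.hom_ext (LinearMap.ext fun v => by
    simp only [LinearMap.comp_apply, AlgHom.toLinearMap_apply, tensorHom_ι, h])
  exact (hF.agrees_tensorHom ρ X.of).app_eq (h1 ▸ hF.agrees_tensorHom σ X.of)

/-- For positive `d` this is the embedding of `V` in the quadratic algebra. For `d = 0` the source
is the unit object and the map is the inclusion of scalars, split by the augmentation. -/
lemma genL_injective : Function.Injective hF.genL := by
  have h : ∀ v, hF.genL v = 0 → v = 0 := fun v hv => by
    obtain ⟨u, hu, rfl⟩ := exists_elt v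
    obtain rfl | hd := Nat.eq_zero_or_pos d
    · obtain ⟨c, rfl⟩ : ∃ c, algebraMap k _ c = u := by
        have hu' : u ∈ (1 : Submodule k (TensorAlgebra k V)) := (map_one (word R 0)).le hu
        exact Submodule.mem_one.mp hu'
      have h1 : aug R (quot R (algebraMap k _ c)) = 0 := by
        refine (congrArg (aug R) hv).trans (map_zero _)
      rw [aug_quot, AlgHom.commutes] at h1
      have h2 : c = 0 := h1
      subst h2
      exact Subtype.ext (map_zero _)
    · obtain ⟨v, hv'⟩ := hF.iotaL_surjective hd (elt R _ u hu)
      rw [← hv', genL_iotaL] at hv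
      rw [← hv', gen_injective R (hv.trans (map_zero _).symm), map_zero]
  exact (injective_iff_map_eq_zero _).mpr h

/-- A coaction on `M⁺` makes the quadratic algebra a graded comodule algebra. -/
lemma exists_graded {B : Type u} [Ring B] [Algebra k B]
    (ρ : Coaction (MPlus R d) (MPlus R d) B) : ∃ f : Alg R →ₐ[k] B ⊗[k] Alg R, IsGraded R f ∧
      ∀ w, f (hF.genL w) = hF.genL.lTensor B (ρ.app _ w) := by
  obtain ⟨f, hf⟩ := exists_descend (hF.preserves_RT ρ)
  refine ⟨f, (hF.preserves_V1 ρ).isGraded hf, fun w => ?_⟩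
  rw [genL, LinearMap.comp_apply, LinearMap.lTensor_comp, LinearMap.comp_apply,
    hF.agrees_tensorHom ρ _ w]
  exact hf _

/-- A graded comodule algebra structure on the quadratic algebra gives a coaction on `M⁺`. -/
lemma exists_coaction {B : Type u} [Ring B] [Algebra k B] {f : Alg R →ₐ[k] B ⊗[k] Alg R}
    (hf : IsGraded R f) : ∃ ρ : Coaction (MPlus R d) (MPlus R d) B,
      ∀ v, f (gen R v) = hF.genL.lTensor B (ρ.app _ (hF.iotaL v)) := by
  obtain ⟨Φ, h1, h2⟩ := hf.exists_lift
  obtain ⟨ρ, hρ⟩ := Agrees.exists_coaction (Φ := Φ) (fun x => h1.word (d := d) (h1.RT h2) x)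
  refine ⟨ρ, fun v => ?_⟩
  rw [gen_apply, h2, ← hF.valL_iotaL, ← hρ, genL, LinearMap.lTensor_comp, LinearMap.comp_apply]

/-- The coend of `M⁺` is the universal coacting bialgebra. -/
theorem exists_isUEnd (hF : IsFrobenius R d) : ∃ δ : Alg R →ₐ[k] Coend (MPlus R d) ⊗[k] Alg R,
    IsUEnd R (Coend (MPlus R d)) δ := by
  obtain ⟨δ, hδ, hgen⟩ := hF.exists_graded (Coend.coaction (MPlus R d))
  have hmap : ∀ {B : Type u} [Ring B] [Algebra k B] (g : Coend (MPlus R d) →ₐ[k] B) (v : V),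
      (Algebra.TensorProduct.map g (AlgHom.id k (Alg R))) (δ (gen R v)) = hF.genL.lTensor B
        (((Coend.coaction (MPlus R d)).map g).app _ (hF.iotaL v)) := fun g v => by
    rw [← genL_iotaL hF, hgen, Coaction.map_app]
    exact LinearMap.congr_fun ((LinearMap.rTensor_comp_lTensor ..).trans
      (LinearMap.lTensor_comp_rTensor ..).symm) _
  refine ⟨δ, hδ, fun a => ?_, fun a => ?_, fun B _ _ f hf => ?_⟩
  -- Coassociativity, and likewise the counit law, compares algebra morphisms out of the quadratic
  -- algebra, so it may be checked on `V`. There `δ` is the universal coaction on `R_1`, a comodule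
  -- structure.
  · have h : ((Algebra.TensorProduct.assoc k k k _ _ (Alg R)).toAlgHom.comp
        ((Algebra.TensorProduct.map (Bialgebra.comulAlgHom k _) (AlgHom.id k (Alg R))).comp δ)) =
        (Algebra.TensorProduct.map (AlgHom.id k _) δ).comp δ := algHom_ext fun v => by
      change TensorProduct.assoc k _ _ (Alg R)
        ((Coalgebra.comul (R := k) (A := Coend (MPlus R d))).rTensor (Alg R)
          (δ (hF.genL (hF.iotaL v)))) = δ.toLinearMap.lTensor _ (δ (hF.genL (hF.iotaL v)))
      rw [hgen]
      rw [assoc_rTensor_lTensor]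
      refine (congrArg _ (Coend.assoc_comul_coact _ _)).trans ?_
      refine (LinearMap.congr_fun (LinearMap.lTensor_comp _ _ _) _).symm.trans
        (Eq.trans ?_ (LinearMap.congr_fun (LinearMap.lTensor_comp _ _ _) _))
      exact congrArg (fun g => LinearMap.lTensor _ g _) (LinearMap.ext fun w => (hgen w).symm)
    exact DFunLike.congr_fun h a
  · have h : (Algebra.TensorProduct.map (Bialgebra.counitAlgHom k _) (AlgHom.id k (Alg R))).comp δ =
        Algebra.TensorProduct.includeRight := algHom_ext fun v => by
      change (Coalgebra.counit (R := k) (A := Coend (MPlus R d))).rTensor (Alg R)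
          (δ (hF.genL (hF.iotaL v))) = 1 ⊗ₜ hF.genL (hF.iotaL v)
      rw [hgen, ← LinearMap.comp_apply, LinearMap.rTensor_comp_lTensor,
        ← LinearMap.lTensor_comp_rTensor, LinearMap.comp_apply]
      exact (congrArg _ (Coend.counit_coact _ _)).trans (LinearMap.lTensor_tmul ..)
    exact DFunLike.congr_fun h a
  -- A graded coaction restricts to a coaction on `M⁺`, hence gives an algebra morphism from the
  -- coend. For uniqueness, a coaction on `M⁺` is determined by its values on `R_1`, and these can
  -- be read off in the quadratic algebra by `genL_injective`.
  · obtain ⟨ρ, hρ⟩ := hF.exists_coaction hf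
    refine ⟨ρ.toAlgHom, algHom_ext fun v => ?_, fun g hg => ?_⟩
    · rw [AlgHom.comp_apply, hmap, hρ, Coaction.map_app]
      exact congrArg _ (ρ.rTensor_coact _ _)
    · refine Coend.algHom_ext fun X v => ?_
      rw [ρ.rTensor_coact]
      refine LinearMap.congr_fun (hF.coaction_ext (ρ := (Coend.coaction _).map g)
        (σ := ρ) (fun v => ?_) X) v
      refine Module.Flat.lTensor_preserves_injective_linearMap (M := B) _ hF.genL_injective ?_
      rw [← hmap, ← hρ, ← hg, AlgHom.comp_apply]

end IsFrobenius

end Universal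

end QuadAlg

namespace FiberFunctor

open TensorProduct

/-! ### Invertible coactions -/

section CoExt

variable {k : Type*} [Field k] {B W W' : Type*} [Ring B] [Algebra k B] [AddCommGroup W]
  [Module k W] [AddCommGroup W'] [Module k W']

/-- The extension `b ⊗ w ↦ b σ(w)` of a map `σ : W → B ⊗ W'`. -/
noncomputable def coExt (σ : W →ₗ[k] B ⊗[k] W') : B ⊗[k] W →ₗ[k] B ⊗[k] W' :=
  (LinearMap.mul' k B).rTensor W' ∘ₗ (TensorProduct.assoc k B B W').symm.toLinearMap ∘ₗ
    σ.lTensor B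

lemma coExt_tmul (σ : W →ₗ[k] B ⊗[k] W') (b : B) (w : W) :
    coExt σ (b ⊗ₜ w) = (LinearMap.mulLeft k b).rTensor W' (σ w) := by
  simp only [coExt, LinearMap.comp_apply, LinearMap.lTensor_tmul, LinearEquiv.coe_coe]
  generalize σ w = z
  induction z using TensorProduct.induction_on with
  | zero => simp
  | add x y hx hy => simp only [tmul_add, map_add, hx, hy]
  | tmul c w => simp

lemma coExt_rTensor (σ : W →ₗ[k] B ⊗[k] W') (b : B) (z : B ⊗[k] W) :
    coExt σ ((LinearMap.mulLeft k b).rTensor W z) =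
      (LinearMap.mulLeft k b).rTensor W' (coExt σ z) := by
  induction z using TensorProduct.induction_on with
  | zero => simp
  | add x y hx hy => simp only [map_add, hx, hy]
  | tmul c w =>
    rw [LinearMap.rTensor_tmul, coExt_tmul, coExt_tmul, LinearMap.mulLeft_apply,
      LinearMap.mulLeft_mul, LinearMap.rTensor_comp, LinearMap.comp_apply]

lemma coExt_comp_coExt {σ : W →ₗ[k] B ⊗[k] W} {τ : W →ₗ[k] B ⊗[k] W}
    (h : ∀ w, coExt σ (τ w) = 1 ⊗ₜ w) (z : B ⊗[k] W) : coExt σ (coExt τ z) = z := by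
  induction z using TensorProduct.induction_on with
  | zero => simp
  | add x y hx hy => simp only [map_add, hx, hy]
  | tmul b w => rw [coExt_tmul, coExt_rTensor, h]; simp

/-- The extensions `coExt` turn the hypotheses into a right inverse `ι` and a left inverse `τ` of
`σ` under composition. These must coincide, so `ι` is also a left inverse. -/
lemma coExt_right_inv {σ τ ι : W →ₗ[k] B ⊗[k] W} (h : ∀ w, coExt σ (ι w) = 1 ⊗ₜ w)
    (h' : ∀ w, coExt τ (σ w) = 1 ⊗ₜ w) (w : W) : coExt ι (σ w) = 1 ⊗ₜ w := by
  have e : ∀ z, coExt τ z = coExt ι z := fun z => by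
    conv_lhs => rw [← coExt_comp_coExt h z]
    exact coExt_comp_coExt h' _
  rw [← e, h']

lemma lTensor_mulCo_id {W₁ W₂ W₃ : Type*} [AddCommGroup W₁] [Module k W₁] [AddCommGroup W₂]
    [Module k W₂] [AddCommGroup W₃] [Module k W₃] (μ : W₁ ⊗[k] W₂ →ₗ[k] W₃) (x : B ⊗[k] W₁)
    (y : B ⊗[k] W₂) : μ.lTensor B (mulCo B LinearMap.id x y) = mulCo B μ x y := by
  induction x using TensorProduct.induction_on with
  | zero => simp
  | add x x' hx hx' => simp only [map_add, LinearMap.add_apply, hx, hx']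
  | tmul b v =>
  induction y using TensorProduct.induction_on with
  | zero => simp
  | add y y' hy hy' => simp only [map_add, hy, hy']
  | tmul c w => simp

lemma slice_mulLeft (ξ : Module.Dual k W) (b : B) (z : B ⊗[k] W) :
    slice B ξ ((LinearMap.mulLeft k b).rTensor W z) = b * slice B ξ z := by
  induction z using TensorProduct.induction_on with
  | zero => simp
  | add x y hx hy => simp only [map_add, mul_add, hx, hy]
  | tmul c w => simp

lemma coExt_lTensor {W₁ W₂ : Type*} [AddCommGroup W₁] [Module k W₁] [AddCommGroup W₂] [Module k W₂]
    {σ : W →ₗ[k] B ⊗[k] W'} {σ' : W₁ →ₗ[k] B ⊗[k] W₂} {f : W →ₗ[k] W₁} {g : W' →ₗ[k] W₂}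
    (h : g.lTensor B ∘ₗ σ = σ' ∘ₗ f) (z : B ⊗[k] W) :
    coExt σ' (f.lTensor B z) = g.lTensor B (coExt σ z) := by
  induction z using TensorProduct.induction_on with
  | zero => simp
  | add x y hx hy => simp only [map_add, hx, hy]
  | tmul b w =>
    have := LinearMap.congr_fun h w
    rw [LinearMap.comp_apply, LinearMap.comp_apply] at this
    rw [LinearMap.lTensor_tmul, coExt_tmul, coExt_tmul, ← this]
    exact LinearMap.congr_fun ((LinearMap.rTensor_comp_lTensor ..).trans
      (LinearMap.lTensor_comp_rTensor ..).symm) _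

/-! ### Inverses obtained from a pairing and a copairing -/

section Dual

variable {ι : Type*} (s : Finset ι) (z : ι → W') (x : ι → W) (β : W ⊗[k] W' →ₗ[k] k)
  (σ : W →ₗ[k] B ⊗[k] W) (σ' : W' →ₗ[k] B ⊗[k] W')

/-- The candidate `v ↦ ∑ i, β(v, σ'(z_i)) ⊗ x_i` for an inverse of `σ`. -/
noncomputable def dualInv : W →ₗ[k] B ⊗[k] W :=
  ∑ i ∈ s, (TensorProduct.mk k B W).flip (x i) ∘ₗ
    (LinearMap.mk₂ k (fun v u => slice B (TensorProduct.curry β v) u)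
      (fun v v' u => by rw [map_add, slice_add]) (fun c v u => by rw [map_smul, slice_smul])
      (fun v u u' => by rw [map_add]) (fun c v u => by rw [map_smul])).flip (σ' (z i))

lemma dualInv_apply (v : W) :
    dualInv s z x β σ' v = ∑ i ∈ s, slice B (TensorProduct.curry β v) (σ' (z i)) ⊗ₜ x i := by
  simp [dualInv, LinearMap.sum_apply]

variable {s z x β σ σ'}

lemma coExt_dualInv (u : B ⊗[k] W) : coExt (dualInv s z x β σ') u =
    ∑ i ∈ s, slice B β (mulCo B LinearMap.id u (σ' (z i))) ⊗ₜ x i := by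
  induction u using TensorProduct.induction_on with
  | zero => simp
  | add x y hx hy =>
    simp only [map_add, hx, hy, LinearMap.add_apply, add_tmul, Finset.sum_add_distrib]
  | tmul b w =>
    rw [coExt_tmul, dualInv_apply, map_sum]
    refine Finset.sum_congr rfl fun i _ => ?_
    rw [LinearMap.rTensor_tmul, LinearMap.mulLeft_apply]
    congr 1
    generalize σ' (z i) = t
    induction t using TensorProduct.induction_on with
    | zero => simp
    | add x y hx hy => simp only [map_add, mul_add, hx, hy]
    | tmul c w => simp

/-- If the copairing `∑ i, z_i ⊗ x_i` is invariant, then `dualInv` is a right inverse. -/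
lemma coExt_apply_dualInv (h₁ : ∀ v, ∑ i ∈ s, β (v ⊗ₜ z i) • x i = v)
    (hco : ∑ i ∈ s, mulCo B LinearMap.id (σ' (z i)) (σ (x i)) = 1 ⊗ₜ ∑ i ∈ s, z i ⊗ₜ x i)
    (v : W) : coExt σ (dualInv s z x β σ' v) = 1 ⊗ₜ v := by
  -- Pairing the first factor with `v`. Applied to the invariant copairing, it produces `coExt σ` of
  -- the candidate inverse on one side and the expansion of `v` in `h₁` on the other.
  let L : W' ⊗[k] W →ₗ[k] W :=
    (TensorProduct.lid k W).toLinearMap ∘ₗ (TensorProduct.curry β v).rTensor W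
  have hL : ∀ (u : B ⊗[k] W') (t : B ⊗[k] W), L.lTensor B (mulCo B LinearMap.id u t) =
      (LinearMap.mulLeft k (slice B (TensorProduct.curry β v) u)).rTensor W t := fun u t => by
    induction u using TensorProduct.induction_on with
    | zero => simp
    | add x y hx hy =>
      simp only [map_add, LinearMap.add_apply, hx, hy]
      rw [← LinearMap.add_apply, ← LinearMap.rTensor_add]
      congr 2
      ext
      simp [add_mul]
    | tmul b w =>
    induction t using TensorProduct.induction_on with
    | zero => simp
    | add x y hx hy => simp only [map_add, hx, hy]
    | tmul c w =>
      simp only [mulCo_tmul, LinearMap.lTensor_tmul, L, LinearMap.comp_apply, LinearMap.id_apply,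
        LinearMap.rTensor_tmul, LinearEquiv.coe_coe, TensorProduct.lid_tmul, slice_tmul,
        LinearMap.mulLeft_apply, tmul_smul, smul_tmul', smul_mul_assoc]
  have h2 := congrArg (L.lTensor B) hco
  simp only [map_sum, hL] at h2
  rw [dualInv_apply, map_sum]
  simp only [coExt_tmul]
  rw [h2, LinearMap.lTensor_tmul, map_sum]
  conv_rhs => rw [← h₁ v]
  simp [L]

/-- If the pairing `β` is invariant, then `dualInv` is a left inverse. -/
lemma coExt_dualInv_apply (h₁ : ∀ v, ∑ i ∈ s, β (v ⊗ₜ z i) • x i = v)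
    (hev : ∀ v w, slice B β (mulCo B LinearMap.id (σ v) (σ' w)) = β (v ⊗ₜ w) • (1 : B)) (v : W) :
    coExt (dualInv s z x β σ') (σ v) = 1 ⊗ₜ v := by
  rw [coExt_dualInv]
  simp only [hev]
  conv_rhs => rw [← h₁ v]
  simp only [tmul_sum, tmul_smul, smul_tmul']

/-- The pairing `β` is invariant, if `dualInv` is a left inverse. -/
lemma slice_mulCo_of_dualInv (h₂ : ∀ w, ∑ i ∈ s, β (x i ⊗ₜ w) • z i = w) {v : W}
    (h : coExt (dualInv s z x β σ') (σ v) = 1 ⊗ₜ v) (w : W') :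
    slice B β (mulCo B LinearMap.id (σ v) (σ' w)) = β (v ⊗ₜ w) • (1 : B) := by
  rw [coExt_dualInv] at h
  -- Pairing with `w` turns the inverse identity into a sum over the dual family, and the expansion
  -- of `w` in `h₂` collapses this sum.
  have h3 := congrArg (slice B ((TensorProduct.curry β).flip w)) h
  simp only [map_sum, slice_tmul, LinearMap.flip_apply, TensorProduct.curry_apply] at h3
  rw [← h3]
  conv_lhs => rw [← h₂ w]
  simp only [map_sum, map_smul]

end Dual

end CoExt

/-! ### Duals in the source category give an antipode -/

section Hopf

variable {k : Type u} [Field k] {C : Type w} [Category.{v} C] [MonoidalCategory C]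
  {F : C ⥤ FGModuleCat.{u} k} [F.Monoidal]

open Coend

namespace Coend

section

variable {inv : ∀ X, F.obj X →ₗ[k] Coend F ⊗[k] F.obj X}
  (h : ∀ X v, coExt (coact F X) (inv X v) = 1 ⊗ₜ v)
  (h' : ∀ X v, coExt (inv X) (coact F X v) = 1 ⊗ₜ v)

-- The inverse of a natural invertible family is natural: apply the inverse to the naturality square
-- of the universal coaction.
include h h' in
lemma inv_nat {X Y : C} (f : X ⟶ Y) (v : F.obj X) :
    (mapL F f).lTensor _ (inv X v) = inv Y (mapL F f v) := by
  have hn : (mapL F f).lTensor _ ∘ₗ coact F X = coact F Y ∘ₗ mapL F f := (coaction F).nat f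
  have h3 : coExt (coact F Y) ((mapL F f).lTensor _ (inv X v)) =
      coExt (coact F Y) (inv Y (mapL F f v)) := by
    rw [coExt_lTensor hn, h, h, LinearMap.lTensor_tmul]
  have h4 := congrArg (coExt (inv Y)) h3
  rwa [coExt_comp_coExt (h' Y), coExt_comp_coExt (h' Y)] at h4

variable (inv) in
/-- The matrix coefficients of the inverses. -/
noncomputable def antipodeAux (X : C) : Module.Dual k (F.obj X) →ₗ[k] F.obj X →ₗ[k] Coend F :=
  LinearMap.mk₂ k (fun ξ v => slice _ ξ (inv X v))
    (fun ξ ξ' v => slice_add _ _ _) (fun c ξ v => slice_smul _ _ _)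
    (fun ξ v v' => by simp only [map_add]) (fun c ξ v => by simp only [map_smul])

include h h' in
lemma isNatural_antipodeAux : IsNatural (antipodeAux inv) := fun X Y f ξ v => by
  simp only [antipodeAux, LinearMap.mk₂_apply]
  rw [← slice_lTensor, inv_nat h h']

/-- The antipode given by inverses of the universal coactions. -/
noncomputable def antipodeL : Coend F →ₗ[k] Coend F :=
  desc (antipodeAux inv) (isNatural_antipodeAux h h')

lemma antipodeL_coef (X : C) (ξ : Module.Dual k (F.obj X)) (v : F.obj X) :
    antipodeL h h' (coef F X ξ v) = slice _ ξ (inv X v) := by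
  rw [antipodeL, desc_coef, antipodeAux, LinearMap.mk₂_apply]

lemma comul_coef (X : C) (ξ : Module.Dual k (F.obj X)) (v : F.obj X) :
    Coalgebra.comul (R := k) (coef F X ξ v) =
      ∑ i, coef F X ((bas X).coord i) v ⊗ₜ[k] coef F X ξ (bas X i) := comulL_coef (bas X) ξ v

lemma counit_coef (X : C) (ξ : Module.Dual k (F.obj X)) (v : F.obj X) :
    Coalgebra.counit (R := k) (coef F X ξ v) = ξ v := counitL_coef X ξ v

/-- The Hopf algebra structure given by inverses of the universal coactions. -/
noncomputable abbrev hopfAlgebra : HopfAlgebra k (Coend F) :=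
  { Coend.instBialgebra with
    antipode := antipodeL h h'
    mul_antipode_rTensor_comul := by
      refine hom_ext fun X ξ v => ?_
      simp only [LinearMap.comp_apply]
      rw [comul_coef, counit_coef]
      simp only [map_sum, LinearMap.rTensor_tmul, LinearMap.mul'_apply, antipodeL_coef]
      have h1 := congrArg (slice (Coend F) ξ) (h X v)
      rw [← sum_slice_tmul (bas X) (inv X v)] at h1
      simp only [map_sum, coExt_tmul, slice_mulLeft, slice_coact, slice_tmul] at h1
      rw [h1, Algebra.linearMap_apply, Algebra.algebraMap_eq_smul_one]
    mul_antipode_lTensor_comul := by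
      refine hom_ext fun X ξ v => ?_
      simp only [LinearMap.comp_apply]
      rw [comul_coef, counit_coef]
      simp only [map_sum, LinearMap.lTensor_tmul, LinearMap.mul'_apply, antipodeL_coef]
      have h1 := congrArg (slice (Coend F) ξ) (h' X v)
      rw [coact_apply] at h1
      simp only [map_sum, coExt_tmul, slice_mulLeft, slice_tmul] at h1
      rw [h1, Algebra.linearMap_apply, Algebra.algebraMap_eq_smul_one] }

end

end Coend

lemma mapL_whiskerLeft (X : C) {Y Z : C} (g : Y ⟶ Z) (v : F.obj X) (w : F.obj Y) :
    mapL F (X ◁ g) (muL F X Y (v ⊗ₜ w)) = muL F X Z (v ⊗ₜ mapL F g w) := by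
  rw [← id_tensorHom, mapL_muL, mapL_id, LinearMap.id_apply]

lemma mapL_whiskerRight {X Y : C} (g : X ⟶ Y) (Z : C) (v : F.obj X) (w : F.obj Z) :
    mapL F (g ▷ Z) (muL F X Z (v ⊗ₜ w)) = muL F Y Z (mapL F g v ⊗ₜ w) := by
  rw [← tensorHom_id, mapL_muL, mapL_id, LinearMap.id_apply]

lemma mapL_associator_inv {X Y Z : C} (x : F.obj X) (y : F.obj Y) (z : F.obj Z) :
    mapL F (α_ X Y Z).inv (muL F X (Y ⊗ Z) (x ⊗ₜ muL F Y Z (y ⊗ₜ z))) =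
      muL F (X ⊗ Y) Z (muL F X Y (x ⊗ₜ y) ⊗ₜ z) := by
  rw [← mapL_associator, ← LinearMap.comp_apply, ← mapL_comp, Iso.hom_inv_id, mapL_id,
    LinearMap.id_apply]

variable (F) in
/-- The images under `F` of the pairing and copairing of dual objects. -/
lemma exists_dual_family (Z X : C) [ExactPairing Z X] :
    ∃ (s : Finset (F.obj Z × F.obj X)) (β : F.obj X ⊗[k] F.obj Z →ₗ[k] k),
      mapL F (η_ Z X) (epsL F 1) = muL F Z X (∑ i ∈ s, i.1 ⊗ₜ i.2) ∧
      (∀ t, mapL F (ε_ Z X) (muL F X Z t) = β t • epsL F 1) ∧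
      (∀ v, ∑ i ∈ s, β (v ⊗ₜ i.1) • i.2 = v) ∧ (∀ z, ∑ i ∈ s, β (i.2 ⊗ₜ z) • i.1 = z) := by
  classical
  obtain ⟨s, hs⟩ := TensorProduct.exists_finset
    ((muL F Z X).symm (mapL F (η_ Z X) (epsL F 1)))
  have hs' : mapL F (η_ Z X) (epsL F 1) = muL F Z X (∑ i ∈ s, i.1 ⊗ₜ i.2) := by
    rw [← hs, LinearEquiv.apply_symm_apply]
  let β : F.obj X ⊗[k] F.obj Z →ₗ[k] k :=
    (epsL F).symm.toLinearMap ∘ₗ mapL F (ε_ Z X) ∘ₗ (muL F X Z).toLinearMap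
  have hβ : ∀ t, mapL F (ε_ Z X) (muL F X Z t) = β t • epsL F 1 := fun t => by
    rw [← map_smul, smul_eq_mul, mul_one]
    exact ((epsL F).apply_symm_apply _).symm
  refine ⟨s, β, hs', hβ, fun v => ?_, fun z => ?_⟩
  -- The zigzag identity of the dual pair, evaluated on `v ⊗ 1`, is the first dual basis formula;
  -- the other zigzag on `1 ⊗ z` gives the second.
  · have h : X ◁ η_ Z X ≫ (α_ X Z X).inv ≫ ε_ Z X ▷ X ≫ (λ_ X).hom = (ρ_ X).hom := by
      rw [ExactPairing.coevaluation_evaluation_assoc, Iso.inv_hom_id, Category.comp_id]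
    have h1 := congrArg (fun f => mapL F f (muL F X (𝟙_ C) (v ⊗ₜ epsL F 1))) h
    simp only [mapL_rightUnitor, mapL_comp, LinearMap.comp_apply, mapL_whiskerLeft, hs',
      map_sum, tmul_sum, mapL_associator_inv, mapL_whiskerRight, hβ, ← smul_tmul', map_smul,
      mapL_leftUnitor] at h1
    exact h1
  · have h : η_ Z X ▷ Z ≫ (α_ Z X Z).hom ≫ Z ◁ ε_ Z X ≫ (ρ_ Z).hom = (λ_ Z).hom := by
      rw [ExactPairing.evaluation_coevaluation_assoc, Iso.inv_hom_id, Category.comp_id]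
    have h1 := congrArg (fun f => mapL F f (muL F (𝟙_ C) Z (epsL F 1 ⊗ₜ z))) h
    simp only [mapL_leftUnitor, mapL_comp, LinearMap.comp_apply, mapL_whiskerLeft, hs',
      map_sum, sum_tmul, mapL_associator, mapL_whiskerRight, hβ, tmul_smul, map_smul,
      mapL_rightUnitor] at h1
    exact h1

/-- A monoidal natural map into `B ⊗ F` on objects and their duals. -/
lemma sum_mulCo_of_nat {B : Type*} [Ring B] [Algebra k B] {Z X : C} [ExactPairing Z X]
    {s : Finset (F.obj Z × F.obj X)}
    (hs : mapL F (η_ Z X) (epsL F 1) = muL F Z X (∑ i ∈ s, i.1 ⊗ₜ i.2))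
    {σ : F.obj X →ₗ[k] B ⊗[k] F.obj X} {σ' : F.obj Z →ₗ[k] B ⊗[k] F.obj Z}
    (h : (mapL F (η_ Z X)).lTensor B (1 ⊗ₜ epsL F 1) =
      conv F F B σ' σ (mapL F (η_ Z X) (epsL F 1))) :
    ∑ i ∈ s, mulCo B LinearMap.id (σ' i.1) (σ i.2) = 1 ⊗ₜ ∑ i ∈ s, i.1 ⊗ₜ i.2 := by
  have inj : Function.Injective ((muL F Z X).toLinearMap.lTensor B) :=
    Module.Flat.lTensor_preserves_injective_linearMap _ (muL F Z X).injective
  refine inj ?_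
  rw [LinearMap.lTensor_tmul] at h ⊢
  rw [hs] at h
  refine Eq.trans ?_ h.symm
  rw [map_sum, map_sum, map_sum]
  refine Finset.sum_congr rfl fun i _ => ?_
  rw [conv_muL, lTensor_mulCo_id]

lemma slice_pairing {B : Type*} [Ring B] [Algebra k B] {Z X : C} [ExactPairing Z X]
    {β : F.obj X ⊗[k] F.obj Z →ₗ[k] k}
    (hβ : ∀ t, mapL F (ε_ Z X) (muL F X Z t) = β t • epsL F 1) (x : B ⊗[k] F.obj X)
    (y : B ⊗[k] F.obj Z) : slice B β (mulCo B LinearMap.id x y) =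
      slice B (epsL F).symm.toLinearMap
        ((mapL F (ε_ Z X)).lTensor B (mulCo B (muL F X Z).toLinearMap x y)) := by
  rw [← lTensor_mulCo_id (muL F X Z).toLinearMap, slice_lTensor, slice_lTensor]
  refine congrArg (fun f => slice B f _) (LinearMap.ext fun t => ?_)
  simp [hβ]

/-- The coaction on the unit object is trivial, so naturality for coevaluation and evaluation says
that copairing and pairing are invariant. The first fact makes `dualInv` a right inverse, the second
a left inverse. -/
lemma Coaction.exists_inv {B : Type*} [Ring B] [Algebra k B] (ρ : Coaction F F B)
    (Z X : C) [ExactPairing Z X] : ∃ inv : F.obj X →ₗ[k] B ⊗[k] F.obj X,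
      (∀ v, coExt (ρ.app X) (inv v) = 1 ⊗ₜ v) ∧ ∀ v, coExt inv (ρ.app X v) = 1 ⊗ₜ v := by
  obtain ⟨s, β, hs, hβ, h1, h2⟩ := exists_dual_family F Z X
  refine ⟨dualInv s Prod.fst Prod.snd β (ρ.app Z), coExt_apply_dualInv h1 ?_,
    coExt_dualInv_apply h1 fun v w => ?_⟩
  · refine sum_mulCo_of_nat hs ?_
    rw [← unitCo_epsL (F := F), ← ρ.one, ρ.nat_apply, ρ.mul]
  · rw [slice_pairing hβ, ← conv_muL, ← ρ.mul, ρ.nat_apply, hβ, map_smul, map_smul, ρ.one,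
      unitCo_epsL, slice_tmul]
    simp

/-- The coend of a fiber functor on a category with duals is a Hopf algebra. -/
theorem Coend.exists_hopfAlgebra (hd : ∀ X : C, ∃ Z, Nonempty (ExactPairing Z X)) :
    ∃ hopf : HopfAlgebra k (Coend F), hopf.toBialgebra = Coend.instBialgebra := by
  have H : ∀ X, ∃ inv : F.obj X →ₗ[k] Coend F ⊗[k] F.obj X,
      (∀ v, coExt (coact F X) (inv v) = 1 ⊗ₜ v) ∧ ∀ v, coExt inv (coact F X v) = 1 ⊗ₜ v := fun X => by
    obtain ⟨Z, ⟨hZ⟩⟩ := hd X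
    exact (coaction F).exists_inv Z X
  choose inv h h' using H
  exact ⟨hopfAlgebra h h', rfl⟩

end Hopf

end FiberFunctor

namespace Lambda

lemma induction_on {d : ℕ} {p : Lambda d → Prop} (x : Lambda d) (one : p 1)
    (r : ∀ a : Letter d, p (r d a)) (rInv : p (rInv d)) (mul : ∀ x y, p x → p y → p (x * y)) :
    p x := by
  obtain ⟨w, rfl⟩ := PresentedMonoid.surjective_mk x
  induction w using FreeMonoid.inductionOn with
  | one => rw [map_one]; exact one
  | of a =>
    obtain a | a := a
    · have h := r a
      rw [Lambda.r, LambdaPlus.r_coe] at h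
      exact h
    · exact rInv
  | mul x y hx hy => rw [map_mul]; exact mul _ _ hx hy

end Lambda

/-! ### Zigzag identities in a strict monoidal category -/

namespace StrictPres

variable {S : Type} [Monoid S] {P : StrictPres S}

lemma associator_inv_eq (X Y Z : P.Cat) :
    (α_ X Y Z).inv = eqToHom (congrArg Cat.mk (mul_assoc X.of Y.of Z.of)).symm := rfl

lemma leftUnitor_inv_eq (X : P.Cat) :
    (λ_ X).inv = eqToHom (congrArg Cat.mk (one_mul X.of)).symm := rfl

lemma rightUnitor_inv_eq (X : P.Cat) :
    (ρ_ X).inv = eqToHom (congrArg Cat.mk (mul_one X.of)).symm := rfl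

lemma whiskerLeft_whiskerLeft (X Y : P.Cat) {Z W : P.Cat} (f : Z ⟶ W) :
    X ◁ Y ◁ f = eqToHom (congrArg Cat.mk (mul_assoc X.of Y.of Z.of)).symm ≫ (X ⊗ Y) ◁ f ≫
      eqToHom (congrArg Cat.mk (mul_assoc X.of Y.of W.of)) := by
  rw [tensor_whiskerLeft, UpPlus.associator_hom_eq, associator_inv_eq]
  simp

variable {X I B D O : P.Cat} (f : D ⟶ B ⊗ X) (g : (X ⊗ I) ⊗ B ⟶ O)
  (h₁ : 𝟙_ P.Cat = I ⊗ D) (h₂ : I ⊗ (B ⊗ X) = (I ⊗ B) ⊗ X) (h₃ : X ⊗ (I ⊗ B) = (X ⊗ I) ⊗ B)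
  (h₄ : O = 𝟙_ P.Cat)

/-- All structural isomorphisms are identities between equal objects, so the zigzag collapses to the
composite in `h`. For the application, `f` is a `φ`, `g` is a `θ`, `D` is `r_d` and `I` its inverse.
The existential in `h` spares naming the equality of objects. -/
lemma triangle_left {p} (h : ∃ q, (X ⊗ I) ◁ f ≫ eqToHom p ≫ g ▷ X = eqToHom q) :
    X ◁ (eqToHom h₁ ≫ I ◁ f ≫ eqToHom h₂) ≫ (α_ X (I ⊗ B) X).inv ≫
      (eqToHom h₃ ≫ g ≫ eqToHom h₄) ▷ X = (ρ_ X).hom ≫ (λ_ X).inv := by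
  obtain ⟨q, h⟩ := h
  simp only [MonoidalCategory.whiskerLeft_comp, comp_whiskerRight, whiskerLeft_eqToHom,
    eqToHom_whiskerRight, whiskerLeft_whiskerLeft, associator_inv_eq, UpPlus.rightUnitor_hom_eq,
    leftUnitor_inv_eq, Category.assoc, eqToHom_trans, eqToHom_trans_assoc]
  rw [reassoc_of% h]
  simp

lemma triangle_right {p} (h : ∃ q, f ▷ (I ⊗ B) ≫ eqToHom p ≫ B ◁ g = eqToHom q) :
    (eqToHom h₁ ≫ I ◁ f ≫ eqToHom h₂) ▷ (I ⊗ B) ≫ (α_ (I ⊗ B) X (I ⊗ B)).hom ≫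
      (I ⊗ B) ◁ (eqToHom h₃ ≫ g ≫ eqToHom h₄) = (λ_ (I ⊗ B)).hom ≫ (ρ_ (I ⊗ B)).inv := by
  obtain ⟨q, h⟩ := h
  have h5 := congrArg (I ◁ ·) h
  simp only [MonoidalCategory.whiskerLeft_comp, whiskerLeft_eqToHom] at h5
  simp only [MonoidalCategory.whiskerLeft_comp, comp_whiskerRight, whiskerLeft_eqToHom,
    eqToHom_whiskerRight, tensor_whiskerLeft, whisker_assoc, associator_inv_eq,
    UpPlus.associator_hom_eq, rightUnitor_inv_eq, UpPlus.leftUnitor_hom_eq,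
    Category.assoc, eqToHom_trans, eqToHom_trans_assoc]
  rw [reassoc_of% h5]
  simp

end StrictPres

/-! ### Dual objects in `U` -/

namespace U

open StrictPres

variable {d : ℕ}

/-- The morphism `φ_{a,b}` of `U`. -/
abbrev phiHom {a b c : ℕ} (h : a + b = c) (hc : c ≤ d) :
    (⟨Lambda.r d c⟩ : U d) ⟶ (⟨Lambda.r d a⟩ : U d) ⊗ ⟨Lambda.r d b⟩ :=
  (UPres d).homMk (U.phi a b c h hc)

/-- The morphism `θ_{a,b}` of `U`. -/
abbrev thetaHom {a b c : ℕ} (h : a + b = c + d) (ha : a ≤ d) (hb : b ≤ d) :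
    ((⟨Lambda.r d a⟩ : U d) ⊗ ⟨Lambda.rInv d⟩) ⊗ ⟨Lambda.r d b⟩ ⟶ (⟨Lambda.r d c⟩ : U d) :=
  (UPres d).homMk (U.theta a b c h ha hb)

lemma r_zero_eq : (⟨Lambda.r d 0⟩ : U d) = 𝟙_ (U d) := congrArg Cat.mk (Lambda.r_zero d)

lemma phiHom_zero_left {a : ℕ} (ha : a ≤ d) : phiHom (zero_add a) ha =
    eqToHom (congrArg Cat.mk (show Lambda.r d a = Lambda.r d 0 * Lambda.r d a by
      rw [Lambda.r_zero, one_mul])) :=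
  (UpPlus.homMk_eq_of_rel (UPres d) (U.Rel.phi_zero_left a ha)).trans (homMk_eqTo _ _)

lemma phiHom_zero_right {a : ℕ} (ha : a ≤ d) : phiHom (add_zero a) ha =
    eqToHom (congrArg Cat.mk (show Lambda.r d a = Lambda.r d a * Lambda.r d 0 by
      rw [Lambda.r_zero, mul_one])) :=
  (UpPlus.homMk_eq_of_rel (UPres d) (U.Rel.phi_zero_right a ha)).trans (homMk_eqTo _ _)

lemma thetaHom_top_left {a : ℕ} (ha : a ≤ d) : thetaHom (add_comm d a) le_rfl ha =
    eqToHom (congrArg Cat.mk (show Lambda.r d d * Lambda.rInv d * Lambda.r d a = Lambda.r d a by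
      rw [Lambda.r_mul_rInv, one_mul])) :=
  (UpPlus.homMk_eq_of_rel (UPres d) (U.Rel.theta_top_left a ha)).trans (homMk_eqTo _ _)

lemma thetaHom_top_right {a : ℕ} (ha : a ≤ d) : thetaHom rfl ha le_rfl =
    eqToHom (congrArg Cat.mk (show Lambda.r d a * Lambda.rInv d * Lambda.r d d = Lambda.r d a by
      rw [mul_assoc, Lambda.rInv_mul_r, mul_one])) :=
  (UpPlus.homMk_eq_of_rel (UPres d) (U.Rel.theta_top_right a ha)).trans (homMk_eqTo _ _)

lemma thetaHom_phiHom {a b c ab bc abc : ℕ} (h₁ : a + b = ab + d) (h₂ : b + c = bc)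
    (h₃ : ab + c = abc) (h₄ : a + bc = abc + d) (ha : a ≤ d) (hbc : bc ≤ d) :
    ((⟨Lambda.r d a⟩ : U d) ⊗ ⟨Lambda.rInv d⟩) ◁ phiHom h₂ hbc ≫
        eqToHom (congrArg Cat.mk (mul_assoc (Lambda.r d a * Lambda.rInv d) (Lambda.r d b)
          (Lambda.r d c)).symm) ≫ thetaHom h₁ ha (by omega) ▷ ⟨Lambda.r d c⟩ =
      thetaHom h₄ ha hbc ≫ phiHom h₃ (by omega) := by
  have h := UpPlus.homMk_eq_of_rel (UPres d) (U.Rel.theta_phi a b c ab bc abc h₁ h₂ h₃ h₄ ha hbc)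
  have e := homMk_eqTo (UPres d) (mul_assoc (Lambda.r d a * Lambda.rInv d) (Lambda.r d b)
          (Lambda.r d c)).symm
  rw [← e, ← Category.assoc]
  exact h

lemma phiHom_thetaHom {a b c ab bc abc : ℕ} (h₁ : a + b = ab) (h₂ : b + c = bc + d)
    (h₃ : ab + c = abc + d) (h₄ : a + bc = abc) (hab : ab ≤ d) (hc : c ≤ d) :
    phiHom h₁ hab ▷ ((⟨Lambda.rInv d⟩ : U d) ⊗ ⟨Lambda.r d c⟩) ≫
        eqToHom (congrArg Cat.mk (show Lambda.r d a * Lambda.r d b * (Lambda.rInv d * Lambda.r d c) =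
          Lambda.r d a * (Lambda.r d b * Lambda.rInv d * Lambda.r d c) by simp only [mul_assoc])) ≫
        (⟨Lambda.r d a⟩ : U d) ◁ thetaHom h₂ (by omega) hc =
      eqToHom (congrArg Cat.mk (mul_assoc (Lambda.r d ab) (Lambda.rInv d) (Lambda.r d c)).symm) ≫
        thetaHom h₃ hab hc ≫ phiHom h₄ (by omega) := by
  have h := UpPlus.homMk_eq_of_rel (UPres d) (U.Rel.phi_theta a b c ab bc abc h₁ h₂ h₃ h₄ hab hc)
  have e := homMk_eqTo (UPres d) (mul_assoc (Lambda.r d ab) (Lambda.rInv d) (Lambda.r d c))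
  have h0 : Lambda.r d a * Lambda.r d b * (Lambda.rInv d * Lambda.r d c) =
      Lambda.r d a * (Lambda.r d b * Lambda.rInv d * Lambda.r d c) := by simp only [mul_assoc]
  have e' := homMk_eqTo (UPres d) h0
  have h5 : ((eqToHom (congrArg Cat.mk (mul_assoc (Lambda.r d ab) (Lambda.rInv d) (Lambda.r d c))) ≫
      phiHom h₁ hab ▷ ((⟨Lambda.rInv d⟩ : U d) ⊗ ⟨Lambda.r d c⟩)) ≫ eqToHom (congrArg Cat.mk h0)) ≫
        (⟨Lambda.r d a⟩ : U d) ◁ thetaHom h₂ (by omega) hc = thetaHom h₃ hab hc ≫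
          phiHom h₄ (by omega) := by
    rw [← e, ← e']
    exact h
  rw [← h5]
  simp only [Category.assoc, eqToHom_trans_assoc, eqToHom_refl, Category.id_comp]

/-- The pairing of `r_d⁻¹ r_{d-b}` and `r_b`. -/
abbrev exactPairingR {a b : ℕ} (h : a + b = d) :
    ExactPairing ((⟨Lambda.rInv d⟩ : U d) ⊗ ⟨Lambda.r d a⟩) ⟨Lambda.r d b⟩ where
  coevaluation' := eqToHom (congrArg Cat.mk (Lambda.rInv_mul_r d).symm) ≫
    (⟨Lambda.rInv d⟩ : U d) ◁ phiHom h le_rfl ≫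
      eqToHom (congrArg Cat.mk (mul_assoc _ _ _).symm)
  evaluation' := eqToHom (congrArg Cat.mk (mul_assoc _ _ _).symm) ≫
    thetaHom (c := 0) (by omega) (by omega) (by omega) ≫ eqToHom r_zero_eq
  -- The relation `(θ_{b,a} r_b)(r_b r_d⁻¹ φ_{a,b}) = φ_{0,b} θ_{b,d}`, whose right side is an
  -- identity.
  coevaluation_evaluation' := triangle_left _ _ _ _ _ _
    ⟨_, (thetaHom_phiHom (by omega) h (zero_add b) rfl (by omega) le_rfl).trans
      ((congrArg₂ (· ≫ ·) (thetaHom_top_right _) (phiHom_zero_left _)).trans (eqToHom_trans _ _))⟩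
  -- The relation `(r_a θ_{b,a})(φ_{a,b} r_d⁻¹ r_a) = φ_{a,0} θ_{d,a}`, whose right side is an
  -- identity.
  evaluation_coevaluation' := triangle_right _ _ _ _ _ _
    ⟨_, (phiHom_thetaHom h (by omega) (add_comm d a) (add_zero a) le_rfl (by omega)).trans
      ((congrArg (_ ≫ ·) ((congrArg₂ (· ≫ ·) (thetaHom_top_left _) (phiHom_zero_right _)).trans
        (eqToHom_trans _ _))).trans (eqToHom_trans _ _))⟩

/-- The pairing of `r_d` and `r_d⁻¹`. -/
abbrev exactPairingRInv : ExactPairing (⟨Lambda.r d d⟩ : U d) ⟨Lambda.rInv d⟩ where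
  coevaluation' := eqToHom (congrArg Cat.mk (Lambda.r_mul_rInv d).symm)
  evaluation' := eqToHom (congrArg Cat.mk (Lambda.rInv_mul_r d))
  coevaluation_evaluation' := by
    rw [whiskerLeft_eqToHom, eqToHom_whiskerRight, associator_inv_eq, UpPlus.rightUnitor_hom_eq,
      leftUnitor_inv_eq]
    simp only [eqToHom_trans]
  evaluation_coevaluation' := by
    rw [whiskerLeft_eqToHom, eqToHom_whiskerRight, UpPlus.associator_hom_eq,
      UpPlus.leftUnitor_hom_eq, rightUnitor_inv_eq]
    simp only [eqToHom_trans]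

/-- The letters and `r_d⁻¹` have the duals above, and the dual of a product is the product of the
duals in reverse order. -/
lemma exists_exactPairing (X : U d) : ∃ Z, Nonempty (ExactPairing Z X) := by
  obtain ⟨x⟩ := X
  induction x using Lambda.induction_on with
  | one => exact ⟨𝟙_ (U d), ⟨exactPairingUnit⟩⟩
  | r a => exact ⟨_, ⟨exactPairingR (Nat.sub_add_cancel a.2.2)⟩⟩
  | rInv => exact ⟨_, ⟨exactPairingRInv⟩⟩
  | mul x y hx hy =>
    obtain ⟨Z, ⟨hZ⟩⟩ := hx
    obtain ⟨Z', ⟨hZ'⟩⟩ := hy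
    exact ⟨Z' ⊗ Z, ⟨(ExactPairing.tensor : ExactPairing (Z' ⊗ Z) (⟨x⟩ ⊗ ⟨y⟩))⟩⟩

end U

namespace FiberFunctor

open TensorProduct

/-! ### Functoriality of the coend -/

section Functoriality

variable {k : Type u} [Field k] {C : Type*} [Category* C] [MonoidalCategory C] {B : Type*} [Ring B]
  [Algebra k B]

section OfCoef

variable {D : Type*} [Category* D] [MonoidalCategory D] {F : C ⥤ FGModuleCat.{u} k}
  {G : D ⥤ FGModuleCat.{u} k} [F.Monoidal] [G.Monoidal]

open Coend in
/-- A morphism of algebras between coends which sends coefficients to coefficients is a morphism of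
bialgebras. -/
noncomputable def Coend.bialgHomOfCoef (φ : Coend F →ₐ[k] Coend G) (obj : C → D)
    (ι : ∀ X, F.obj X ≃ₗ[k] G.obj (obj X))
    (h : ∀ X ξ v, φ (coef F X ξ v) = coef G (obj X) (ξ ∘ₗ (ι X).symm.toLinearMap) (ι X v)) :
    Coend F →ₐc[k] Coend G :=
  BialgHom.ofAlgHom φ
    (AlgHom.toLinearMap_injective (hom_ext fun X ξ v => by
      refine (congrArg (Coalgebra.counit (R := k)) (h X ξ v)).trans ?_
      refine (counit_coef _ _ _).trans (Eq.trans ?_ (counit_coef X ξ v).symm)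
      simp))
    (AlgHom.toLinearMap_injective (hom_ext fun X ξ v => by
      have h1 := congrArg (TensorProduct.map φ.toLinearMap φ.toLinearMap) (comul_coef X ξ v)
      refine h1.trans (Eq.trans ?_ (congrArg (Coalgebra.comul (R := k)) (h X ξ v)).symm)
      refine Eq.trans ?_ (comulL_coef ((bas X).map (ι X)) _ _).symm
      rw [map_sum]
      refine Finset.sum_congr rfl fun i _ => ?_
      rw [TensorProduct.map_tmul, AlgHom.toLinearMap_apply, AlgHom.toLinearMap_apply, h, h]
      rfl))

end OfCoef

section Comp

variable {D : Type*} [Category* D] [MonoidalCategory D] (L : C ⥤ D) [L.Monoidal]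
  {M : D ⥤ FGModuleCat.{u} k} [M.Monoidal]

lemma epsL_comp : epsL (L ⋙ M) 1 = mapL M (Functor.LaxMonoidal.ε L) (epsL M 1) := rfl

lemma muL_comp (X Y : C) (t : M.obj (L.obj X) ⊗[k] M.obj (L.obj Y)) :
    muL (L ⋙ M) X Y t = mapL M (Functor.LaxMonoidal.μ L X Y) (muL M (L.obj X) (L.obj Y) t) := rfl

/-- Restriction of a coaction along a monoidal functor. -/
noncomputable def Coaction.comp (ρ : Coaction M M B) : Coaction (L ⋙ M) (L ⋙ M) B where
  app X := ρ.app (L.obj X)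
  nat f := ρ.nat (L.map f)
  one := unit_hom_ext (F := L ⋙ M) <| by
    rw [unitCo_epsL, epsL_comp]
    refine (ρ.nat_apply _ _).symm.trans ?_
    rw [ρ.one, unitCo_epsL]
    exact LinearMap.lTensor_tmul ..
  mul X Y := dual_ext (F := L ⋙ M) fun v w => by
    rw [conv_muL, muL_comp]
    refine (ρ.nat_apply _ _).symm.trans ?_
    rw [ρ.mul, conv_muL]
    have h : (muL (L ⋙ M) X Y).toLinearMap =
        mapL M (Functor.LaxMonoidal.μ L X Y) ∘ₗ (muL M (L.obj X) (L.obj Y)).toLinearMap := rfl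
    rw [h, ← lTensor_mulCo_id (_ ∘ₗ _), LinearMap.lTensor_comp, LinearMap.comp_apply,
      lTensor_mulCo_id]

namespace Coend

variable (M) in
lemma toAlgHom_comp_coef (X : C) (ξ : Module.Dual k ((L ⋙ M).obj X)) (v : (L ⋙ M).obj X) :
    ((coaction M).comp L).toAlgHom (coef (L ⋙ M) X ξ v) = coef M (L.obj X) ξ v :=
  (Coaction.toAlgHom_coef _ X ξ v).trans (slice_coact (L.obj X) ξ v)

variable (M) in
/-- The morphism of coends given by restriction along a monoidal functor. -/
noncomputable def restr : Coend (L ⋙ M) →ₐc[k] Coend M :=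
  bialgHomOfCoef ((coaction M).comp L).toAlgHom L.obj (fun _ => LinearEquiv.refl k _)
    (toAlgHom_comp_coef L M)

variable (M) in
lemma restr_coef (X : C) (ξ : Module.Dual k ((L ⋙ M).obj X)) (v : (L ⋙ M).obj X) :
    restr L M (coef (L ⋙ M) X ξ v) = coef M (L.obj X) ξ v := toAlgHom_comp_coef L M X ξ v

end Coend

end Comp

section Iso

variable {F G : C ⥤ FGModuleCat.{u} k} [F.Monoidal] [G.Monoidal] (e : F ≅ G)

/-- A component of a natural isomorphism as a linear map. -/
noncomputable abbrev isoL (X : C) : F.obj X ≃ₗ[k] G.obj X := FGModuleCat.isoToLinearEquiv (e.app X)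

omit [MonoidalCategory C] [F.Monoidal] [G.Monoidal] in
lemma isoL_nat {X Y : C} (f : X ⟶ Y) (v : F.obj X) :
    isoL e Y (mapL F f v) = mapL G f (isoL e X v) :=
  congrArg (fun t => t.hom.hom v) (e.hom.naturality f)

variable [NatTrans.IsMonoidal e.hom]

lemma isoL_epsL : isoL e (𝟙_ C) (epsL F 1) = epsL G 1 :=
  congrArg (fun t => t.hom.hom (1 : k)) (NatTrans.IsMonoidal.unit (τ := e.hom))

lemma isoL_muL {X Y : C} (v : F.obj X) (w : F.obj Y) :
    isoL e (X ⊗ Y) (muL F X Y (v ⊗ₜ w)) = muL G X Y (isoL e X v ⊗ₜ isoL e Y w) :=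
  congrArg (fun t => t.hom.hom (v ⊗ₜ[k] w)) (NatTrans.IsMonoidal.tensor (τ := e.hom) X Y)

/-- Transport of a coaction along a monoidal isomorphism. -/
noncomputable def Coaction.transport (ρ : Coaction G G B) : Coaction F F B where
  app X := (isoL e X).symm.toLinearMap.lTensor B ∘ₗ ρ.app X ∘ₗ (isoL e X).toLinearMap
  nat {X Y} f := LinearMap.ext fun v => by
    simp only [LinearMap.comp_apply, LinearEquiv.coe_coe]
    have hc : mapL F f ∘ₗ (isoL e X).symm.toLinearMap =
        (isoL e Y).symm.toLinearMap ∘ₗ mapL G f := LinearMap.ext fun w => by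
      obtain ⟨w, rfl⟩ := (isoL e X).surjective w
      simp only [LinearMap.comp_apply, LinearEquiv.coe_coe, ← isoL_nat,
        LinearEquiv.symm_apply_apply]
    rw [← LinearMap.comp_apply (LinearMap.lTensor _ _), ← LinearMap.lTensor_comp, hc,
      LinearMap.lTensor_comp, LinearMap.comp_apply, ρ.nat_apply, isoL_nat]
  one := unit_hom_ext <| by
    simp only [LinearMap.comp_apply, LinearEquiv.coe_coe]
    rw [isoL_epsL, ρ.one, unitCo_epsL, unitCo_epsL, LinearMap.lTensor_tmul, LinearEquiv.coe_coe,
      ← isoL_epsL e, LinearEquiv.symm_apply_apply]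
  mul X Y := dual_ext fun v w => by
    simp only [LinearMap.comp_apply, LinearEquiv.coe_coe]
    rw [isoL_muL, ρ.mul, conv_muL, conv_muL]
    simp only [LinearMap.comp_apply, LinearEquiv.coe_coe]
    generalize ρ.app X _ = x
    generalize ρ.app Y _ = y
    induction x using TensorProduct.induction_on with
    | zero => simp
    | add x x' hx hx' => simp only [map_add, LinearMap.add_apply, hx, hx']
    | tmul b v =>
    induction y using TensorProduct.induction_on with
    | zero => simp
    | add y y' hy hy' => simp only [map_add, hy, hy']
    | tmul c w =>
      simp only [mulCo_tmul, LinearMap.lTensor_tmul, LinearEquiv.coe_coe]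
      congr 1
      rw [LinearEquiv.symm_apply_eq, isoL_muL, LinearEquiv.apply_symm_apply,
        LinearEquiv.apply_symm_apply]

namespace Coend

lemma toAlgHom_transport_coef (X : C) (ξ : Module.Dual k (F.obj X)) (v : F.obj X) :
    ((coaction G).transport e).toAlgHom (coef F X ξ v) =
      coef G X (ξ ∘ₗ (isoL e X).symm.toLinearMap) (isoL e X v) := by
  rw [Coaction.toAlgHom_coef]
  refine (slice_lTensor _ _ _).trans ?_
  exact slice_coact _ _ _

/-- The morphism of coends given by a monoidal isomorphism. -/
noncomputable def isoHom : Coend F →ₐc[k] Coend G :=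
  bialgHomOfCoef ((coaction G).transport e).toAlgHom id (isoL e) (toAlgHom_transport_coef e)

lemma isoHom_coef (X : C) (ξ : Module.Dual k (F.obj X)) (v : F.obj X) :
    isoHom e (coef F X ξ v) = coef G X (ξ ∘ₗ (isoL e X).symm.toLinearMap) (isoL e X v) :=
  toAlgHom_transport_coef e X ξ v

lemma isoHom_symm_isoHom (e' : G ≅ F) [NatTrans.IsMonoidal e'.hom]
    (h : ∀ X v, isoL e' X (isoL e X v) = v) (t : Coend F) : isoHom e' (isoHom e t) = t := by
  induction t using induction_on with
  | zero => simp
  | add a a' h h' => simp only [map_add, h, h']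
  | coef X ξ x =>
    rw [isoHom_coef, isoHom_coef, h]
    congr 1
    refine LinearMap.ext fun v => ?_
    simp only [LinearMap.comp_apply, LinearEquiv.coe_coe]
    congr 1
    rw [LinearEquiv.symm_apply_eq, LinearEquiv.symm_apply_eq]
    obtain ⟨v, rfl⟩ := (isoL e' X).surjective v
    obtain ⟨v, rfl⟩ := (isoL e X).surjective v
    rw [h, h]

/-- The isomorphism of coends given by a monoidal isomorphism. -/
noncomputable def isoEquiv : Coend F ≃ₐc[k] Coend G :=
  haveI : NatTrans.IsMonoidal e.symm.hom := inferInstanceAs (NatTrans.IsMonoidal e.inv)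
  BialgEquiv.ofBialgHom (isoHom e) (isoHom e.symm)
    (BialgHom.ext fun t => isoHom_symm_isoHom e.symm e
      (fun X v => congrArg (fun t => t.hom.hom v) (e.inv_hom_id_app X)) t)
    (BialgHom.ext fun t => isoHom_symm_isoHom e e.symm
      (fun X v => congrArg (fun t => t.hom.hom v) (e.hom_inv_id_app X)) t)

end Coend

end Iso

end Functoriality

end FiberFunctor

/-- Inverses in a monoid are unique, so the value on `r_d` forces the value on `r_d⁻¹`. This is the
uniqueness half of the envelope property, at the level of objects. -/
lemma Lambda.hom_ext_incl {d : ℕ} {N : Type*} [Monoid N] {φ ψ : Lambda d →* N}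
    (h : ∀ x, φ (incl d x) = ψ (incl d x)) : φ = ψ := by
  refine Lambda.hom_ext (fun a => h _) ?_
  have h1 : φ (rInv d) * φ (r d d) = 1 := by rw [← map_mul, rInv_mul_r, map_one]
  have h2 : ψ (r d d) * ψ (rInv d) = 1 := by rw [← map_mul, r_mul_rInv, map_one]
  rw [← mul_one (φ (rInv d)), ← h2, ← mul_assoc, ← (show φ (r d d) = ψ (r d d) from h _), h1, one_mul]

namespace FiberFunctor

open TensorProduct

/-! ### Colinear morphisms -/

section Colinear

variable {k : Type u} [Field k] {C : Type*} [Category* C] {F : C ⥤ FGModuleCat.{u} k} {B : Type*}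
  [Ring B] [Algebra k B]

/-- The morphism `f` is compatible with the maps `app`. -/
def Colinear (app : ∀ X, F.obj X →ₗ[k] B ⊗[k] F.obj X) {X Y : C} (f : X ⟶ Y) : Prop :=
  (mapL F f).lTensor B ∘ₗ app X = app Y ∘ₗ mapL F f

namespace Colinear

variable {app : ∀ X, F.obj X →ₗ[k] B ⊗[k] F.obj X} {X Y Z : C}

lemma apply {f : X ⟶ Y} (hf : Colinear app f) (v : F.obj X) :
    (mapL F f).lTensor B (app X v) = app Y (mapL F f v) := LinearMap.congr_fun hf v

lemma comp {f : X ⟶ Y} {g : Y ⟶ Z} (hf : Colinear app f) (hg : Colinear app g) :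
    Colinear app (f ≫ g) := by
  rw [Colinear, mapL_comp, LinearMap.lTensor_comp, LinearMap.comp_assoc, hf,
    ← LinearMap.comp_assoc, hg, LinearMap.comp_assoc]

variable (app) in
lemma eqToHom (h : X = Y) : Colinear app (eqToHom h) := by
  subst h
  simp only [Colinear, eqToHom_refl, mapL_id, LinearMap.lTensor_id, LinearMap.id_comp,
    LinearMap.comp_id]

lemma of_comp_eqToHom {f : X ⟶ Y} {h : Y = Z} (hf : Colinear app (f ≫ CategoryTheory.eqToHom h)) :
    Colinear app f := by
  subst h
  rwa [eqToHom_refl, Category.comp_id] at hf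

lemma of_eqToHom_comp {f : Y ⟶ Z} {h : X = Y} (hf : Colinear app (CategoryTheory.eqToHom h ≫ f)) :
    Colinear app f := by
  subst h
  rwa [eqToHom_refl, Category.id_comp] at hf

section

variable [MonoidalCategory C] [F.Monoidal]
  (one : app (𝟙_ C) = unitCo F F B) (mul : ∀ X Y, app (X ⊗ Y) = conv F F B (app X) (app Y))

include mul in
lemma whiskerLeft (X : C) {f : Y ⟶ Z} (hf : Colinear app f) : Colinear app (X ◁ f) :=
  dual_ext fun v w => by
    rw [LinearMap.comp_apply, LinearMap.comp_apply, mapL_whiskerLeft, mul, mul, conv_muL, conv_muL,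
      ← id_tensorHom, lTensor_mulCo, mapL_id, LinearMap.lTensor_id, LinearMap.id_apply, hf.apply]

include mul in
lemma whiskerRight {f : X ⟶ Y} (hf : Colinear app f) (Z : C) : Colinear app (f ▷ Z) :=
  dual_ext fun v w => by
    rw [LinearMap.comp_apply, LinearMap.comp_apply, mapL_whiskerRight, mul, mul, conv_muL, conv_muL,
      ← tensorHom_id, lTensor_mulCo, mapL_id, LinearMap.lTensor_id, LinearMap.id_apply, hf.apply]

include one mul in
/-- If the copairing of two dual objects is invariant, and one of the coactions is invertible, then
the pairing is invariant. -/
lemma evaluation {Z X : C} [ExactPairing Z X] (hη : Colinear app (η_ Z X))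
    {τ : F.obj X →ₗ[k] B ⊗[k] F.obj X} (hτ : ∀ v, coExt τ (app X v) = 1 ⊗ₜ v) :
    Colinear app (ε_ Z X) := by
  obtain ⟨s, β, hs, hβ, h1, h2⟩ := exists_dual_family F Z X
  -- Invariance of the copairing alone makes `dualInv` a right inverse of the coaction. As a left
  -- inverse `τ` exists, it is two-sided, and a left inverse of this shape forces the pairing to be
  -- invariant.
  have h3 := coExt_apply_dualInv (σ := app X) (σ' := app Z) h1 (sum_mulCo_of_nat hs (by
    have := hη.apply (epsL F 1)
    rwa [one, unitCo_epsL, mul] at this))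
  have h4 := coExt_right_inv h3 hτ
  have h5 := fun v w => slice_mulCo_of_dualInv (σ' := app Z) h2 (h4 v) w
  refine dual_ext fun v w => slice_ext fun ξ => ?_
  have hξ : ξ = ξ (epsL F 1) • (epsL F).symm.toLinearMap := unit_hom_ext (by simp)
  rw [LinearMap.comp_apply, LinearMap.comp_apply, hβ, one, mul, conv_muL, hξ, slice_smul,
    slice_smul, ← slice_pairing hβ, h5, map_smul, unitCo_epsL, map_smul, slice_tmul]
  simp

end

end Colinear

end Colinear

/-! ### Coactions of a Hopf algebra -/

section Antipode

variable {k : Type u} [Field k] {C : Type w} [Category.{v} C] [MonoidalCategory C]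
  {F : C ⥤ FGModuleCat.{u} k} [F.Monoidal] {K : Type*} [Ring K] [HopfAlgebra k K]
  (f : Coend F →ₐc[k] K)

open Coend

/-- The coaction given by a morphism of bialgebras. -/
noncomputable abbrev coactionOf : Coaction F F K := (coaction F).map (f : Coend F →ₐ[k] K)

lemma slice_coactionOf (X : C) (ξ : Module.Dual k (F.obj X)) (v : F.obj X) :
    slice K ξ ((coactionOf f).app X v) = f (coef F X ξ v) := by
  rw [Coaction.map_app, slice_rTensor]
  exact congrArg f (slice_coact _ _ _)

/-- The inverse of a coaction of a Hopf algebra. -/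
noncomputable def coactionInv (X : C) : F.obj X →ₗ[k] K ⊗[k] F.obj X :=
  (HopfAlgebra.antipode k).rTensor _ ∘ₗ (coactionOf f).app X

lemma slice_coactionInv (X : C) (ξ : Module.Dual k (F.obj X)) (v : F.obj X) :
    slice K ξ (coactionInv f X v) = HopfAlgebra.antipode k (f (coef F X ξ v)) := by
  rw [coactionInv, LinearMap.comp_apply, slice_rTensor, slice_coactionOf]

lemma comul_map_coef (X : C) (ξ : Module.Dual k (F.obj X)) (v : F.obj X) :
    Coalgebra.comul (R := k) (f (coef F X ξ v)) =
      ∑ i, f (coef F X ((bas X).coord i) v) ⊗ₜ[k] f (coef F X ξ (bas X i)) := by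
  rw [← CoalgHomClass.map_comp_comul_apply, comul_coef, map_sum]
  rfl

lemma counit_map_coef (X : C) (ξ : Module.Dual k (F.obj X)) (v : F.obj X) :
    Coalgebra.counit (R := k) (f (coef F X ξ v)) = ξ v := by
  rw [CoalgHomClass.counit_comp_apply, counit_coef]

/-- Slice by slice this is one of the two antipode axioms of `K`, applied to the image of a
coefficient; `coExt_coactionOf` is the other one. -/
lemma coExt_coactionInv (X : C) (v : F.obj X) :
    coExt (coactionInv f X) ((coactionOf f).app X v) = 1 ⊗ₜ v := slice_ext fun ξ => by
  rw [← sum_slice_tmul (bas X) ((coactionOf f).app X v)]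
  simp only [map_sum, coExt_tmul, slice_mulLeft, slice_coactionInv, slice_coactionOf, slice_tmul]
  have h := LinearMap.congr_fun (HopfAlgebra.mul_antipode_lTensor_comul (R := k) (A := K))
    (f (coef F X ξ v))
  simp only [LinearMap.comp_apply, comul_map_coef, counit_map_coef, map_sum,
    LinearMap.lTensor_tmul, LinearMap.mul'_apply] at h
  rw [h, Algebra.linearMap_apply, Algebra.algebraMap_eq_smul_one]

lemma coExt_coactionOf (X : C) (v : F.obj X) :
    coExt ((coactionOf f).app X) (coactionInv f X v) = 1 ⊗ₜ v := slice_ext fun ξ => by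
  rw [← sum_slice_tmul (bas X) (coactionInv f X v)]
  simp only [map_sum, coExt_tmul, slice_mulLeft, slice_coactionInv, slice_coactionOf, slice_tmul]
  have h := LinearMap.congr_fun (HopfAlgebra.mul_antipode_rTensor_comul (R := k) (A := K))
    (f (coef F X ξ v))
  simp only [LinearMap.comp_apply, comul_map_coef, counit_map_coef, map_sum,
    LinearMap.rTensor_tmul, LinearMap.mul'_apply] at h
  rw [h, Algebra.linearMap_apply, Algebra.algebraMap_eq_smul_one]

/-- A coaction on a line is given by an invertible element. -/
lemma exists_unit_of_finrank_eq_one {X : C} (hX : Module.finrank k (F.obj X) = 1) :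
    ∃ g : Kˣ, ∀ v, (coactionOf f).app X v = (g : K) ⊗ₜ v := by
  obtain ⟨v₀, hv₀, hv⟩ := finrank_eq_one_iff'.mp hX
  have hspan : ∀ v, ∃ c : k, c • v₀ = v := hv
  -- Any linear map from a line `L` to `K ⊗ L` has the form `v ↦ g ⊗ v`. The elements obtained from
  -- the coaction and from its inverse are inverse to each other.
  have key : ∀ σ : F.obj X →ₗ[k] K ⊗[k] F.obj X, ∃ g : K, ∀ v, σ v = g ⊗ₜ v := fun σ => by
    have h0 : ∀ z : K ⊗[k] F.obj X, ∃ g : K, z = g ⊗ₜ v₀ := fun z => by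
      induction z using TensorProduct.induction_on with
      | zero => exact ⟨0, by simp⟩
      | add x y hx hy =>
        obtain ⟨a, rfl⟩ := hx
        obtain ⟨b, rfl⟩ := hy
        exact ⟨a + b, (add_tmul _ _ _).symm⟩
      | tmul b w =>
        obtain ⟨c, rfl⟩ := hspan w
        exact ⟨c • b, by rw [smul_tmul]⟩
    obtain ⟨g, hg⟩ := h0 (σ v₀)
    refine ⟨g, fun v => ?_⟩
    obtain ⟨c, rfl⟩ := hspan v
    rw [map_smul, hg, tmul_smul]
  obtain ⟨ξ, hξ⟩ : ∃ ξ : Module.Dual k (F.obj X), ξ v₀ = 1 := by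
    obtain ⟨ξ, hξ⟩ := Module.Projective.exists_dual_ne_zero k hv₀
    exact ⟨(ξ v₀)⁻¹ • ξ, by simp [hξ]⟩
  obtain ⟨g, hg⟩ := key ((coactionOf f).app X)
  obtain ⟨g', hg'⟩ := key (coactionInv f X)
  have e1 := congrArg (slice K ξ) (coExt_coactionInv f X v₀)
  have e2 := congrArg (slice K ξ) (coExt_coactionOf f X v₀)
  rw [hg, coExt_tmul, hg', slice_mulLeft, slice_tmul, slice_tmul, hξ, one_smul, one_smul] at e1
  rw [hg', coExt_tmul, hg, slice_mulLeft, slice_tmul, slice_tmul, hξ, one_smul, one_smul] at e2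
  exact ⟨⟨g, g', e1, e2⟩, hg⟩

end Antipode

end FiberFunctor

namespace FiberFunctor

open TensorProduct StrictPres

/-! ### Scalar coactions on objects -/

section Presented

variable {k : Type u} [Field k] {S : Type} [Monoid S] {P : StrictPres S}
  {F G : P.Cat ⥤ FGModuleCat.{u} k} [F.Monoidal] [G.Monoidal] {B : Type*} [Ring B] [Algebra k B]

/-- A coaction as a morphism of monoids. -/
noncomputable def Coaction.toMonoidHom (ρ : Coaction F G B) : S →* ObjCoaction F G B where
  toFun x := ⟨x, ρ.app ⟨x⟩⟩
  map_one' := congrArg (ObjCoaction.mk 1) ρ.one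
  map_mul' x y := congrArg (ObjCoaction.mk (x * y)) (ρ.mul ⟨x⟩ ⟨y⟩)

namespace ObjCoaction

variable (F) in
/-- The coaction `v ↦ b ⊗ v` on an object. -/
noncomputable def scalar (x : S) (b : B) : ObjCoaction F F B := ⟨x, TensorProduct.mk k B _ b⟩

lemma scalar_mul_scalar (x y : S) (b c : B) :
    scalar F x b * scalar F y c = scalar F (x * y) (b * c) := by
  refine congrArg (ObjCoaction.mk (x * y)) (dual_ext (F := F) (X := (⟨x⟩ : P.Cat)) (Y := (⟨y⟩ : P.Cat))
    fun v w => ?_)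
  exact (conv_muL (F := F) (G := F) (TensorProduct.mk k B _ b) (TensorProduct.mk k B _ c) v w).trans
    (mulCo_tmul _ _ _ _ _)

lemma scalar_one {x : S} (h : x = 1) : scalar F x (1 : B) = 1 := by
  subst h
  refine congrArg (ObjCoaction.mk 1) (unit_hom_ext ?_)
  rw [unitCo_epsL]
  rfl

end ObjCoaction

omit [F.Monoidal] in
lemma mapL_eqToHom_symm {X Y : P.Cat} (h : X = Y) (v : F.obj X) :
    mapL F (eqToHom h.symm) (mapL F (eqToHom h) v) = v := by
  subst h; simp [mapL_id]

end Presented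

/-! ### The Hopf envelope: extending coactions from `U↑⁺` to `U` -/

section Restriction

variable {k : Type u} [Field k] {d : ℕ} {M : U d ⥤ FGModuleCat.{u} k} [M.Monoidal] {B : Type*}
  [Ring B] [Algebra k B]

/-- A coaction on the restriction to `U↑⁺`, as a morphism to the monoid of coactions on objects
of `U`. -/
noncomputable def restrHom (ρ : Coaction (UpPlus.toU d ⋙ M) (UpPlus.toU d ⋙ M) B) :
    LambdaPlus d →* ObjCoaction M M B where
  toFun x := ⟨Lambda.incl d x, ρ.app ⟨x⟩⟩
  map_one' := by
    -- The unit of the restricted functor is that of `M` transported along the equality of the image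
    -- of the empty word with `1`. The multiplicative case below has the same shape.
    refine ObjCoaction.ext_of (map_one (Lambda.incl d)) fun v => ?_
    refine LinearMap.congr_fun (f := (mapL M (eqToHom (congrArg Cat.mk
      (map_one (Lambda.incl d))))).lTensor B ∘ₗ ρ.app (𝟙_ (UpPlus d)))
      (g := unitCo M M B ∘ₗ mapL M (eqToHom (congrArg Cat.mk (map_one (Lambda.incl d)))))
      (unit_hom_ext (F := UpPlus.toU d ⋙ M) ?_) v
    have h : epsL (UpPlus.toU d ⋙ M) 1 =
      mapL M (eqToHom (congrArg Cat.mk (map_one (Lambda.incl d))).symm) (epsL M 1) := rfl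
    have h2 := mapL_eqToHom_symm (F := M) (congrArg Cat.mk (map_one (Lambda.incl d))).symm
      (epsL M 1)
    have h3 : ρ.app (𝟙_ (UpPlus d)) (epsL (UpPlus.toU d ⋙ M) 1) =
        1 ⊗ₜ epsL (UpPlus.toU d ⋙ M) 1 := by rw [ρ.one, unitCo_epsL]
    refine (congrArg ((mapL M (eqToHom (congrArg Cat.mk
      (map_one (Lambda.incl d))))).lTensor B) h3).trans ?_
    refine ((LinearMap.lTensor_tmul ..).trans (congrArg (1 ⊗ₜ[k] ·) h2)).trans ?_
    exact (unitCo_epsL (F := M) (G := M)).symm.trans (congrArg (unitCo M M B) h2.symm)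
  map_mul' x y := by
    refine ObjCoaction.ext_of (map_mul (Lambda.incl d) x y) fun v => ?_
    refine LinearMap.congr_fun (f := (mapL M (eqToHom (congrArg Cat.mk
      (map_mul (Lambda.incl d) x y)))).lTensor B ∘ₗ ρ.app ((⟨x⟩ : UpPlus d) ⊗ ⟨y⟩))
      (g := conv M M B (X := ⟨Lambda.incl d x⟩) (Y := ⟨Lambda.incl d y⟩) (ρ.app ⟨x⟩) (ρ.app ⟨y⟩) ∘ₗ
        mapL M (eqToHom (congrArg Cat.mk (map_mul (Lambda.incl d) x y))))
      (dual_ext (F := UpPlus.toU d ⋙ M) fun v w => ?_) v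
    have h : ∀ t, muL (UpPlus.toU d ⋙ M) ⟨x⟩ ⟨y⟩ t =
      mapL M (eqToHom (congrArg Cat.mk (map_mul (Lambda.incl d) x y)).symm)
        (muL M ⟨Lambda.incl d x⟩ ⟨Lambda.incl d y⟩ t) := fun t => rfl
    have h2 : mapL M (eqToHom (congrArg Cat.mk (map_mul (Lambda.incl d) x y))) ∘ₗ
        (muL (UpPlus.toU d ⋙ M) ⟨x⟩ ⟨y⟩).toLinearMap =
        (muL M ⟨Lambda.incl d x⟩ ⟨Lambda.incl d y⟩).toLinearMap := LinearMap.ext fun t =>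
      mapL_eqToHom_symm (F := M) (congrArg Cat.mk (map_mul (Lambda.incl d) x y)).symm _
    have h3 := LinearMap.congr_fun h2 (v ⊗ₜ w)
    have h4 : ρ.app ((⟨x⟩ : UpPlus d) ⊗ ⟨y⟩) (muL (UpPlus.toU d ⋙ M) ⟨x⟩ ⟨y⟩ (v ⊗ₜ w)) =
        mulCo B (muL (UpPlus.toU d ⋙ M) ⟨x⟩ ⟨y⟩).toLinearMap (ρ.app ⟨x⟩ v) (ρ.app ⟨y⟩ w) := by
      rw [ρ.mul, conv_muL]
    refine (congrArg ((mapL M (eqToHom (congrArg Cat.mk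
      (map_mul (Lambda.incl d) x y)))).lTensor B) h4).trans ?_
    refine Eq.trans ?_ (congrArg (conv M M B (X := ⟨Lambda.incl d x⟩) (Y := ⟨Lambda.incl d y⟩)
      (ρ.app ⟨x⟩) (ρ.app ⟨y⟩)) h3.symm)
    refine Eq.trans ?_ (conv_muL (F := M) (G := M) _ _ _ _).symm
    refine (congrArg _ (lTensor_mulCo_id _ _ _).symm).trans ?_
    refine (LinearMap.congr_fun (LinearMap.lTensor_comp _ _ _) _).symm.trans ?_
    exact (congrArg (fun q => LinearMap.lTensor B q _) h2).trans (lTensor_mulCo_id _ _ _)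

/-- Morphisms from the coend over `U` are determined by their restriction to `U↑⁺`. -/
lemma algHom_ext_restr {g g' : Coend M →ₐ[k] B}
    (h : ∀ t, g (Coend.restr (UpPlus.toU d) M t) = g' (Coend.restr (UpPlus.toU d) M t)) :
    g = g' := by
  -- An algebra morphism is a coaction, and the underlying homomorphism from `Λ` is determined by
  -- its values on `Λ⁺`.
  have h1 : ((Coend.coaction M).map g).toMonoidHom = ((Coend.coaction M).map g').toMonoidHom :=
    Lambda.hom_ext_incl fun x => congrArg (ObjCoaction.mk _) <| LinearMap.ext fun v =>
      slice_ext fun ξ => by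
        rw [Coaction.map_app, Coaction.map_app, slice_rTensor, slice_rTensor]
        refine (congrArg g (Coend.slice_coact _ _ _)).trans
          (Eq.trans ?_ (congrArg g' (Coend.slice_coact _ _ _)).symm)
        have e := Coend.restr_coef (UpPlus.toU d) M ⟨x⟩ ξ v
        exact (congrArg g e.symm).trans ((h _).trans (congrArg g' e))
  exact Coend.algHom_ext fun X v =>
    LinearMap.congr_fun (ObjCoaction.app_inj (DFunLike.congr_fun h1 X.of)) v

-- Since `r_d` is invertible, `M(r_d) ⊗ M(r_d⁻¹) ≅ k`, and a product of natural numbers equal to one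
-- has both factors one.
variable (M) in
lemma finrank_top : Module.finrank k (M.obj ⟨Lambda.r d d⟩) = 1 := by
  have e : M.obj ⟨Lambda.r d d⟩ ⊗[k] M.obj ⟨Lambda.rInv d⟩ ≃ₗ[k] k :=
    muL M ⟨Lambda.r d d⟩ ⟨Lambda.rInv d⟩ ≪≫ₗ
      FGModuleCat.isoToLinearEquiv (M.mapIso (eqToIso (congrArg Cat.mk (Lambda.r_mul_rInv d)))) ≪≫ₗ
        (epsL M).symm
  have h := e.finrank_eq
  rw [Module.finrank_tensorProduct, Module.finrank_self] at h
  exact Nat.eq_one_of_mul_eq_one_right h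

section Envelope

variable {K : Type*} [Ring K] [HopfAlgebra k K] (f : Coend (UpPlus.toU d ⋙ M) →ₐc[k] K)

/-- A morphism from the coend over `U↑⁺` to a Hopf algebra gives a coaction over `U`. -/
lemma exists_coaction_extension : ∃ ρ : Coaction M M K,
    ∀ x : LambdaPlus d, ρ.app ⟨Lambda.incl d x⟩ = (coactionOf f).app ⟨x⟩ := by
  -- The Hopf algebra coacts on the line `M(r_d)` through a unit `g`. Letting `r_d⁻¹` carry `g⁻¹`
  -- inverts the coaction on `r_d` in the monoid of coactions on objects, so the universal property
  -- of `Λ` applies.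
  obtain ⟨g, hg⟩ := exists_unit_of_finrank_eq_one f (X := ⟨LambdaPlus.r d d⟩) (finrank_top M)
  have hlift : ∀ x, FreeMonoid.lift (fun a => restrHom (coactionOf f) (FreeMonoid.of a)) x =
      restrHom (coactionOf f) x := fun x =>
    DFunLike.congr_fun (FreeMonoid.hom_eq fun a => by rw [FreeMonoid.lift_eval_of] :
      FreeMonoid.lift (fun a => restrHom (coactionOf f) (FreeMonoid.of a)) =
        restrHom (coactionOf f)) x
  have htop : restrHom (coactionOf f) (LambdaPlus.r d d) =
      ObjCoaction.scalar M (Lambda.r d d) (g : K) :=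
    congrArg (ObjCoaction.mk (Lambda.r d d)) (LinearMap.ext hg)
  let s : Lambda d →* ObjCoaction M M K :=
    Lambda.lift (fun a => restrHom (coactionOf f) (FreeMonoid.of a))
      (ObjCoaction.scalar M (Lambda.rInv d) ((g⁻¹ : Kˣ) : K))
      (by rw [hlift, htop, ObjCoaction.scalar_mul_scalar, Units.mul_inv,
        ObjCoaction.scalar_one (Lambda.r_mul_rInv d)])
      (by rw [hlift, htop, ObjCoaction.scalar_mul_scalar, Units.inv_mul,
        ObjCoaction.scalar_one (Lambda.rInv_mul_r d)])
  have hs : ∀ x, s (Lambda.incl d x) = ⟨Lambda.incl d x, (coactionOf f).app ⟨x⟩⟩ := fun x =>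
    (Lambda.lift_incl _ _ _ _ x).trans (hlift x)
  have hproj : ∀ x, (s x).of = x := fun x => by
    have : ObjCoaction.proj.comp s = MonoidHom.id _ :=
      Lambda.hom_ext_incl fun x => congrArg ObjCoaction.of (hs x)
    exact DFunLike.congr_fun this x
  obtain ⟨ρ, hρ⟩ := Coaction.exists_of_monoidHom s hproj (by
    intro app happ one mul x y γ
    have happ' : ∀ x, app (Lambda.incl d x) = (coactionOf f).app ⟨x⟩ := fun x =>
      ObjCoaction.app_inj ((happ _).symm.trans (hs x))
    let app' : ∀ X : U d, M.obj X →ₗ[k] K ⊗[k] M.obj X := fun X => app X.of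
    have mul' : ∀ X Y, app' (X ⊗ Y) = conv M M K (app' X) (app' Y) := fun X Y => mul _ _
    have hphi : ∀ {a b c : ℕ} (h : a + b = c) (hc : c ≤ d), Colinear app' (U.phiHom h hc) := by
      intro a b c h hc
      have h1 : Colinear (F := M) app' (U.phiHom h hc ≫ eqToHom (congrArg Cat.mk
          (map_mul (Lambda.incl d) (LambdaPlus.r d a) (LambdaPlus.r d b)).symm)) := by
        have h2 := (coactionOf f).nat ((UpPlusPres d).homMk (UpPlus.phi a b c h hc))
        rw [← happ', ← happ'] at h2
        exact h2
      exact h1.of_comp_eqToHom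
    -- When `a + b = d`, the morphism `θ_{b,a}` is the pairing of `r_b` with its dual. The copairing
    -- consists of `φ_{a,b}` and identities, hence is colinear, and the antipode of `K` inverts the
    -- coaction on `r_b`; so the pairing is colinear too.
    have hev : ∀ {a b : ℕ} (h : a + b = d), Colinear app'
        (U.thetaHom (d := d) (a := b) (b := a) (c := 0) (by omega) (by omega) (by omega)) := by
      intro a b h
      let _ := U.exactPairingR h
      have hη : Colinear app' (η_ ((⟨Lambda.rInv d⟩ : U d) ⊗ ⟨Lambda.r d a⟩) ⟨Lambda.r d b⟩) :=
        (Colinear.eqToHom app' _).comp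
          (((hphi h le_rfl).whiskerLeft mul' _).comp (Colinear.eqToHom app' _))
      have hε := hη.evaluation one mul' (τ := coactionInv f ⟨LambdaPlus.r d b⟩) (fun v => by
        refine Eq.trans ?_ (coExt_coactionInv f ⟨LambdaPlus.r d b⟩ v)
        exact congrArg _ (LinearMap.congr_fun (happ' (LambdaPlus.r d b)) v))
      have h3 : Colinear app' (eqToHom _ ≫ U.thetaHom (d := d) (a := b) (b := a) (c := 0)
        (by omega) (by omega) (by omega) ≫ eqToHom U.r_zero_eq) := hε
      exact h3.of_eqToHom_comp.of_comp_eqToHom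
    obtain ⟨a, b, c, h, hc⟩ | ⟨a, b, c, h, ha, hb⟩ := γ
    · exact hphi h hc
    -- Since `b = (d - a) + c`, a general `θ_{a,b}`, followed by the identity `φ_{0,c}`, equals
    -- `(θ_{a,d-a} r_c)(r_a r_d⁻¹ φ_{d-a,c})`, a composite of colinear morphisms.
    · have h4 := U.thetaHom_phiHom (d := d) (a := a) (b := d - a) (c := c) (ab := 0) (bc := b)
        (abc := c) (by omega) (by omega) (by omega) h ha hb
      have h5 : Colinear app' (U.thetaHom h ha hb ≫ U.phiHom (zero_add c) (by omega)) := by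
        rw [← h4]
        exact ((hphi _ _).whiskerLeft mul' _).comp
          ((Colinear.eqToHom app' _).comp ((hev (by omega)).whiskerRight mul' _))
      rw [U.phiHom_zero_left] at h5
      exact h5.of_comp_eqToHom)
  exact ⟨ρ, fun x => ObjCoaction.app_inj ((hρ _).symm.trans (hs x))⟩

/-- The coend over `U` is the Hopf envelope of the coend over `U↑⁺`. -/
theorem existsUnique_extension :
    ∃! g : Coend M →ₐc[k] K, g.comp (Coend.restr (UpPlus.toU d) M) = f := by
  obtain ⟨ρ, hρ⟩ := exists_coaction_extension f
  have hcoef : ∀ t, ρ.toAlgHom (Coend.restr (UpPlus.toU d) M t) = f t := fun t => by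
    induction t using Coend.induction_on with
    | zero => simp
    | add a b ha hb => simp only [map_add, ha, hb]
    | coef X ξ v =>
      rw [Coend.restr_coef, ρ.toAlgHom_coef, ← slice_coactionOf]
      exact congrArg _ (LinearMap.congr_fun (hρ X.of) v)
  -- Compatibility with counit and comultiplication may be tested after restriction to the coend
  -- over `U↑⁺`, where the morphism becomes `f`.
  refine ⟨BialgHom.ofAlgHom ρ.toAlgHom (algHom_ext_restr fun t => ?_)
    (algHom_ext_restr fun t => ?_), BialgHom.ext hcoef, fun g hg => ?_⟩
  · refine (congrArg (Coalgebra.counit (R := k)) (hcoef t)).trans ?_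
    exact (CoalgHomClass.counit_comp_apply f t).trans
      (CoalgHomClass.counit_comp_apply (Coend.restr (UpPlus.toU d) M) t).symm
  · refine (congrArg (TensorProduct.map ρ.toAlgHom.toLinearMap ρ.toAlgHom.toLinearMap)
      (CoalgHomClass.map_comp_comul_apply (Coend.restr (UpPlus.toU d) M) t).symm).trans ?_
    refine Eq.trans ?_ ((CoalgHomClass.map_comp_comul_apply f t).trans
      (congrArg (Coalgebra.comul (R := k)) (hcoef t).symm))
    refine (LinearMap.congr_fun (TensorProduct.map_comp _ _ _ _) _).symm.trans ?_
    have h : ρ.toAlgHom.toLinearMap ∘ₗ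
        (Coend.restr (UpPlus.toU d) M : Coend (UpPlus.toU d ⋙ M) →ₗ[k] Coend M) =
        (f : Coend (UpPlus.toU d ⋙ M) →ₗ[k] K) := LinearMap.ext hcoef
    exact congrArg (fun q => TensorProduct.map q q (Coalgebra.comul (R := k) t)) h
  · have h : (g : Coend M →ₐ[k] K) = ρ.toAlgHom := algHom_ext_restr fun t =>
      (DFunLike.congr_fun hg t).trans (hcoef t).symm
    exact BialgHom.ext fun t => DFunLike.congr_fun h t

end Envelope

end Restriction

end FiberFunctor

open scoped TensorProduct

/-! ### Bialgebra morphisms and antipodes -/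

section HopfAlgebra

variable {k : Type*} [Field k]

/-- A morphism of bialgebras between Hopf algebras preserves the antipode. -/
lemma BialgHom.map_antipode {H K : Type*} [Ring H] [HopfAlgebra k H] [Ring K] [HopfAlgebra k K]
    (f : H →ₐc[k] K) (x : H) :
    f (HopfAlgebra.antipode k x) = HopfAlgebra.antipode k (f x) := by
  -- In the convolution algebra of linear maps `H → K`, composing `f` with the antipode of `H` gives
  -- a left inverse of `f`, and with that of `K` a right inverse; the two therefore agree.
  open WithConv LinearMap in
  have h1 : toConv ((f : H →ₐ[k] K).toLinearMap ∘ₗ HopfAlgebra.antipode k) *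
      toConv (f : H →ₐ[k] K).toLinearMap = 1 := by
    have := algHom_comp_convMul_distrib (f : H →ₐ[k] K) (toConv (HopfAlgebra.antipode k))
      (toConv (LinearMap.id : H →ₗ[k] H))
    rw [antipode_mul_id] at this
    refine (WithConv.ofConv_injective this.symm).trans ?_
    ext y; simp
  have h2 : toConv (f : H →ₐ[k] K).toLinearMap *
      toConv (HopfAlgebra.antipode k ∘ₗ (f : H →ₐ[k] K).toLinearMap) = 1 := by
    have := convMul_comp_coalgHom_distrib (toConv (LinearMap.id : K →ₗ[k] K))
      (toConv (HopfAlgebra.antipode k)) (f : H →ₗc[k] K)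
    rw [id_mul_antipode] at this
    refine (WithConv.ofConv_injective this.symm).trans ?_
    ext y; simp
  exact LinearMap.congr_fun (congrArg WithConv.ofConv (left_inv_eq_right_inv h1 h2)) x

end HopfAlgebra

namespace QuadAlg

open FiberFunctor

/-! ### Uniqueness of Hopf envelopes -/

section Envelope

variable {k : Type u} [Field k] {E H : Type u} [Ring E] [Bialgebra k E] [Ring H] [HopfAlgebra k H]
  {i : E →ₐc[k] H}

lemma IsHopfEnvelope.hom_ext (hi : IsHopfEnvelope i) {K : Type u} [Ring K] [HopfAlgebra k K]
    {g g' : H →ₐc[k] K} (h : g.comp i = g'.comp i) : g = g' :=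
  (hi K (g'.comp i)).unique h rfl

/-- Two Hopf envelopes of a bialgebra are isomorphic. -/
lemma IsHopfEnvelope.exists_bialgEquiv (hi : IsHopfEnvelope i) {H' : Type u} [Ring H']
    [HopfAlgebra k H'] {i' : E →ₐc[k] H'} (hi' : IsHopfEnvelope i') :
    Nonempty (H ≃ₐc[k] H') := by
  obtain ⟨f, hf, -⟩ := hi H' i'
  obtain ⟨g, hg, -⟩ := hi' H i
  refine ⟨BialgEquiv.ofBialgHom f g (hi'.hom_ext ?_) (hi.hom_ext ?_)⟩
  · rw [BialgHom.comp_assoc, hg, hf, BialgHom.id_comp]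
  · rw [BialgHom.comp_assoc, hf, hg, BialgHom.id_comp]

/-- A Hopf envelope and a bialgebra with the same universal property that has an antipode are
isomorphic as Hopf algebras. -/
lemma IsHopfEnvelope.exists_bialgEquiv_of_toBialgebra_eq (hi : IsHopfEnvelope i) {C : Type u}
    [Ring C] [inst : Bialgebra k C] (hopf : HopfAlgebra k C) (hh : hopf.toBialgebra = inst)
    (j : E →ₐc[k] C)
    (hj : ∀ (K : Type u) [Ring K] [HopfAlgebra k K] (f : E →ₐc[k] K),
      ∃! g : C →ₐc[k] K, g.comp j = f) :
    ∃ Φ : H ≃ₐc[k] C, ∀ x, Φ (HopfAlgebra.antipode k x) = hopf.antipode (Φ x) := by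
  -- With the two bialgebra structures identified, `C` is itself a Hopf envelope of `E`, and
  -- uniqueness of envelopes applies.
  subst hh
  obtain ⟨Φ⟩ := hi.exists_bialgEquiv (i' := j) hj
  exact ⟨Φ, fun x => BialgHom.map_antipode (Φ : H →ₐc[k] C) x⟩

end Envelope

/-! ### The coend of an extension as `uaut(A)` -/

section Main

variable {k V : Type u} [Field k] [AddCommGroup V] [Module k V] [FiniteDimensional k V]
  {R : Submodule k (V ⊗[k] V)} {d : ℕ}

/-- If `M` extends `M⁺`, then `coend M` is the Hopf envelope of any algebra isomorphic to
`coend M⁺`. -/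
lemma Extends.exists_hopfEnvelope {M : U d ⥤ FGModuleCat.{u} k} [M.Monoidal] (hM : Extends R d M)
    {E : Type u} [Ring E] [Bialgebra k E] (e : E ≃ₐc[k] Coend (MPlus R d)) :
    ∃ j : E →ₐc[k] Coend M, ∀ (K : Type u) [Ring K] [HopfAlgebra k K] (f : E →ₐc[k] K),
      ∃! g : Coend M →ₐc[k] K, g.comp j = f := by
  obtain ⟨e', he'⟩ := hM
  let e₂ : E ≃ₐc[k] Coend (UpPlus.toU d ⋙ M) := e.trans (Coend.isoEquiv e').symm
  have h1 (x) : e₂.symm (e₂ x) = x := e₂.symm_apply_apply x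
  have h2 (x) : e₂ (e₂.symm x) = x := e₂.apply_symm_apply x
  refine ⟨(Coend.restr (UpPlus.toU d) M).comp (e₂ : E →ₐc[k] _), fun K _ _ f => ?_⟩
  obtain ⟨g, hg, hu⟩ := existsUnique_extension
    (f.comp (e₂.symm : Coend (UpPlus.toU d ⋙ M) →ₐc[k] E))
  refine ⟨g, BialgHom.ext fun x => ?_, fun g' hg' => hu g' (BialgHom.ext fun x => ?_)⟩
  · exact (DFunLike.congr_fun hg (e₂ x)).trans (congrArg f (h1 x))
  · refine Eq.trans ?_ (DFunLike.congr_fun hg' (e₂.symm x))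
    exact congrArg (fun y => g' (Coend.restr (UpPlus.toU d) M y)) (h2 x).symm

omit [FiniteDimensional k V] in
/-- The envelope of the universal coacting bialgebra, given as a bialgebra that has an antipode. -/
lemma IsUEnd.isUAut {E : Type u} [Ring E] [Bialgebra k E] {δ : Alg R →ₐ[k] E ⊗[k] Alg R}
    (hδ : IsUEnd R E δ) {C : Type u} [Ring C] [inst : Bialgebra k C] (hopf : HopfAlgebra k C)
    (hh : hopf.toBialgebra = inst) (j : E →ₐc[k] C)
    (hj : ∀ (K : Type u) [Ring K] [HopfAlgebra k K] (f : E →ₐc[k] K),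
      ∃! g : C →ₐc[k] K, g.comp j = f) : IsUAut R C := by
  subst hh
  exact ⟨E, _, _, δ, j, hδ, hj⟩

end Main

end QuadAlg


theorem theorem5p1 {k : Type u} [Field k] [IsAlgClosed k] {V : Type u} [AddCommGroup V]
    [Module k V] [FiniteDimensional k V] (R : Submodule k (V ⊗[k] V)) (d : ℕ)
    (hK : IsKoszul R) (hAS : IsASRegular R d) :
    (∃ (E : Type u) (_ : Ring E) (_ : Bialgebra k E) (δ : Alg R →ₐ[k] E ⊗[k] Alg R),
      IsUEnd R E δ) ∧
    (∀ (E : Type u) [Ring E] [Bialgebra k E] (δ : Alg R →ₐ[k] E ⊗[k] Alg R),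
      IsUEnd R E δ → Nonempty (E ≃ₐc[k] Coend (MPlus R d))) ∧
    (∃ (M : U d ⥤ FGModuleCat.{u} k) (_ : M.Monoidal), Extends R d M) ∧
    (∃ (H : Type u) (_ : Ring H) (_ : HopfAlgebra k H), IsUAut R H) ∧
    (∀ (M : U d ⥤ FGModuleCat.{u} k) [M.Monoidal], Extends R d M →
      ∀ (H : Type u) [Ring H] [HopfAlgebra k H], IsUAut R H →
        ∃ hopf : HopfAlgebra k (Coend M), hopf.toBialgebra = Coend.instBialgebra ∧
          ∃ Φ : H ≃ₐc[k] Coend M,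
            ∀ x, Φ (HopfAlgebra.antipode k x) = hopf.antipode (Φ x)) := by
  have hF := isFrobenius hK hAS
  obtain ⟨τ⟩ := hF.nonempty_topForm
  obtain ⟨δ, hδ⟩ := hF.exists_isUEnd
  refine ⟨⟨_, _, _, δ, hδ⟩, fun E _ _ δ' hδ' => hδ'.exists_bialgEquiv hδ,
    ⟨τ.functor, inferInstance, τ.extends_functor⟩, ?_, ?_⟩
  · obtain ⟨hopf, hh⟩ := Coend.exists_hopfAlgebra (F := τ.functor) U.exists_exactPairing
    obtain ⟨j, hj⟩ := τ.extends_functor.exists_hopfEnvelope (BialgEquiv.refl k (Coend (MPlus R d)))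
    exact ⟨_, _, hopf, hδ.isUAut hopf hh j hj⟩
  -- The algebra `H` is the envelope of some model `E` of `uend(A)`. Identifying `E` with the coend
  -- of `M⁺` turns the coend of `M` into an envelope of the same `E`.
  · intro M _ hM H _ _ ⟨E, _, _, δ', i, hδ', hi⟩
    obtain ⟨hopf, hh⟩ := Coend.exists_hopfAlgebra (F := M) U.exists_exactPairing
    obtain ⟨e⟩ := hδ'.exists_bialgEquiv hδ
    obtain ⟨j, hj⟩ := hM.exists_hopfEnvelope e
    exact ⟨hopf, hh, hi.exists_bialgEquiv_of_toBialgebra_eq hopf hh j hj⟩
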